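/- Let $(M^{2n},g_0,J_+,J_-)$ be a compact generalized Kähler manifold with $[J_+,J_-]=0$: $J_\pm$ are integrable complex structures compatible with the Riemannian metric $g_0$, and the forms $g_0(J_\pm\cdot,\cdot)$, denoted $\omega_0$ for the sign $+$ and $\omega_-$ for the sign $-$, satisfy $d^c_+\omega_0=-d^c_-\omega_-$ and $dd^c_+\omega_0=-dd^c_-\omega_-=0$. All manifolds, metrics, functions and families are smooth, and $\partial,\bar\partial$, $(1,1)$-forms and Hermitian metrics refer to the complex structure $J_+$. Let $\Pi=J_+J_-$ and $TM=T_+M\oplus T_-M$ with $T_\pm M=\ker(\Pi\mp I)$; these are holomorphic subbundles of the tangent bundle of $(M,J_+)$. For a $(1,1)$-form $\eta$ let $\pi_\pm\eta$ be its component in $\Lambda^{1,0}_\pm\wedge\Lambda^{0,1}_\pm$, where $\Lambda_\pm=(T_\pm M)^*$, and put $\delta_\pm\delta_\pm^c u=\pi_\pm(\sqrt{-1}\,\partial\bar\partial u)$ for a function $u$. For a Hermitian metric $h$ on a holomorphic subbundle of $TM$ let $\rho(h)=-\sqrt{-1}\,\partial\bar\partial\log\det h$ be its first Chern form, computed in local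 holomorphic frames. For a Hermitian metric $g$ on $(M,J_+)$ with Kähler form $\omega=g(J_+\cdot,\cdot)$ let $$P(\omega)=-\partial\partial^*_\omega\omega-\bar\partial\bar\partial^*_\omega\omega-\sqrt{-1}\,\partial\bar\partial\log\det g .$$ A solution of pluriclosed flow on $[0,T)$, $0<T\le\infty$, with initial condition $\omega_0$ is a family $\omega_t$, $t\in[0,T)$, smooth on $M\times[0,T)$, of Kähler forms of pluriclosed ($\partial\bar\partial\omega_t=0$) Hermitian metrics on $(M,J_+)$, with $\frac{\partial}{\partial t}\omega_t=-P(\omega_t)$ and with value $\omega_0$ at $t=0$. Let $h_\pm$ be Hermitian metrics on $T_\pm M$, put $\rho^{\pm}=\pi_\pm\rho$ and $$P(h_\pm)=\rho^+(h_+)-\rho^+(h_-)-\rho^-(h_+)+\rho^-(h_-),$$ and for a function $f=f_t$ on $M\times[0,T)$ let $$\omega^f_t=\omega_0-tP(h_\pm)+(\delta_+\delta_+^c-\delta_-\delta_-^c)f_t .$$ Suppose that $f$ is smooth on $M\times[0,T)$, that $\omega^f_t$ is positive for all $t\in[0,T)$, so that it is the Kähler form of a metric $g^f_t$ with restrictions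 $g^f_\pm$ to $T_\pm M$, and that $$\frac{\partial f}{\partial t}=\log\frac{\det g^f_+\,\det h_-}{\det h_+\,\det g^f_-},\qquad f(0)=0 .$$ Then $\omega^f_t$ is a solution of pluriclosed flow on $[0,T)$ with initial condition $\omega_0$, and it is the unique one: if $\omega'_t$ is a solution of pluriclosed flow on $[0,T')$, $0<T'\le\infty$, with initial condition $\omega_0$, then $\omega'_t=\omega^f_t$ for all $t\in[0,\min(T,T'))$. -/

import Mathlib

open scoped Manifold ContDiff Topology

noncomputable section

namespace GenKahler

/-- The real model space of a manifold of real dimension `2 n`. -/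
abbrev Model (n : ℕ) : Type := EuclideanSpace ℝ (Fin (2 * n))

/-- The `i`-th standard coordinate vector of the model space. -/
def stdVec {n : ℕ} (i : Fin (2 * n)) : Model n := EuclideanSpace.single i 1

variable {n : ℕ} {M : Type*} [TopologicalSpace M] [ChartedSpace (Model n) M]

/-! ### Tensor fields and differential forms -/

/-- The tangent space of `M` at `x` (as a real vector space). -/
abbrev TS (n : ℕ) {M : Type*} [TopologicalSpace M] [ChartedSpace (Model n) M] (x : M) : Type :=
  TangentSpace 𝓘(ℝ, Model n) x

variable (n M) in
/-- Fields of endomorphisms of the tangent bundle. -/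
abbrev EndField : Type _ := ∀ x : M, TS n x →L[ℝ] TS n x

variable (n M) in
/-- Fields of bilinear forms on the tangent spaces. -/
abbrev BilinField : Type _ := ∀ x : M, TS n x →L[ℝ] TS n x →L[ℝ] ℝ

variable (n M) in
/-- Real differential forms of degree `k`, with no regularity imposed. -/
abbrev Form (k : ℕ) : Type _ := ∀ x : M, TS n x [⋀^Fin k]→L[ℝ] ℝ

/-- The differential at `y` of the inverse of the chart at `x₀`. -/
def chartInvDeriv (x₀ : M) (y : Model n) :
    Model n →L[ℝ] TS n ((chartAt (Model n) x₀).symm y) :=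
  mfderiv 𝓘(ℝ, Model n) 𝓘(ℝ, Model n) (chartAt (Model n) x₀).symm y

/-- The differential at `x` of the chart at `x`. -/
def chartDeriv (x : M) : TS n x →L[ℝ] Model n :=
  mfderiv 𝓘(ℝ, Model n) 𝓘(ℝ, Model n) (chartAt (Model n) x) x

/-- The coordinate expression of a form in the chart at `x₀` (its pullback by the inverse of
the chart). -/
def inChart {k : ℕ} (α : Form n M k) (x₀ : M) (y : Model n) : Model n [⋀^Fin k]→L[ℝ] ℝ :=
  (α ((chartAt (Model n) x₀).symm y)).compContinuousLinearMap (chartInvDeriv x₀ y)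

/-- The exterior derivative on a manifold, computed at `x` in the chart at `x`. -/
def extD {k : ℕ} (α : Form n M k) : Form n M (k + 1) := fun x =>
  (extDeriv (inChart α x) (chartAt (Model n) x x)).compContinuousLinearMap (chartDeriv x)

/-- The differential of a function, as a linear form on the tangent space. -/
def dFun (u : M → ℝ) (x : M) : TS n x →L[ℝ] ℝ :=
  mfderiv 𝓘(ℝ, Model n) 𝓘(ℝ, ℝ) u x

/-- A family of forms `α t` is smooth in space and time jointly, for `t ∈ S`. -/
def SmoothFamilyOn {k : ℕ} (S : Set ℝ) (α : ℝ → Form n M k) : Prop :=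
  ∀ x₀ : M, ContDiffOn ℝ ∞ (fun p : ℝ × Model n => inChart (α p.1) x₀ p.2)
    (S ×ˢ (chartAt (Model n) x₀).target)

/-! ### Complex structures -/

/-- The differential at `x` of a complex coordinate map `φ`. -/
def coordDeriv (φ : OpenPartialHomeomorph M (EuclideanSpace ℂ (Fin n))) (x : M) :
    TS n x →L[ℝ] EuclideanSpace ℂ (Fin n) :=
  mfderiv 𝓘(ℝ, Model n) 𝓘(ℝ, EuclideanSpace ℂ (Fin n)) φ x

/-- `φ` is a holomorphic coordinate chart for `J`: a diffeomorphism of an open set of `M`, of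
class `C^∞`, onto an open set of `ℂ^n`, whose differential turns `J` into multiplication
by `i`. -/
structure IsHoloChart (J : EndField n M)
    (φ : OpenPartialHomeomorph M (EuclideanSpace ℂ (Fin n))) : Prop where
  smooth : ContMDiffOn 𝓘(ℝ, Model n) 𝓘(ℝ, EuclideanSpace ℂ (Fin n)) ∞ φ φ.source
  smooth_symm : ContMDiffOn 𝓘(ℝ, EuclideanSpace ℂ (Fin n)) 𝓘(ℝ, Model n) ∞ φ.symm φ.target
  map_J : ∀ x ∈ φ.source, ∀ v : TS n x,
    coordDeriv φ x (J x v) = Complex.I • coordDeriv φ x v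

/-- `J` is an integrable complex structure: `M` is covered by holomorphic charts for `J`.
(This entails `J ^ 2 = -1` and the smoothness of `J`.) -/
def IsComplexStructure (J : EndField n M) : Prop :=
  ∀ x : M, ∃ φ : OpenPartialHomeomorph M (EuclideanSpace ℂ (Fin n)),
    x ∈ φ.source ∧ IsHoloChart J φ

/-- `d^c u = i (∂̄ - ∂) u = - du ∘ J` for a function `u`. -/
def dcFun (J : EndField n M) (u : M → ℝ) : Form n M 1 := fun x =>
  ContinuousAlternatingMap.ofSubsingleton ℝ (TS n x) ℝ (0 : Fin 1) (-((dFun u x).comp (J x)))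

/-- `i ∂∂̄ u = (1 / 2) d d^c u` for a function `u`. -/
def iddbar (J : EndField n M) (u : M → ℝ) : Form n M 2 := fun x =>
  (1 / 2 : ℝ) • extD (dcFun J u) x

/-- `d^c η = i (∂̄ - ∂) η = - (d η)(J ·, J ·, J ·)` for a form `η` of type `(1,1)`. -/
def dcForm (J : EndField n M) (η : Form n M 2) : Form n M 3 := fun x =>
  -(extD η x).compContinuousLinearMap (J x)

/-- The `(1,1)` part of a real 2-form. -/
def part11 (J : EndField n M) (β : Form n M 2) : Form n M 2 := fun x =>
  (1 / 2 : ℝ) • (β x + (β x).compContinuousLinearMap (J x))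

/-! ### Metrics and Kähler forms -/

/-- The bilinear form `g(X, Y) = ω₁(X, J Y)`; it is the metric with Kähler form
`ω₁ = g(J ·, ·)`. -/
def metricOf (J : EndField n M) (ω₁ : Form n M 2) (x : M) (X Y : TS n x) : ℝ :=
  ω₁ x ![X, J x Y]

/-- `ω₁` is the Kähler form `g(J ·, ·)` of `g` and `J`. -/
def IsKahlerForm (g : BilinField n M) (J : EndField n M) (ω₁ : Form n M 2) : Prop :=
  ∀ (x : M) (X Y : TS n x), ω₁ x ![X, Y] = g x (J x X) Y

/-- `ω₁` is (pointwise) the Kähler form of a `J`-Hermitian metric: it is of type `(1,1)` and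
positive. -/
def IsHermitianForm (J : EndField n M) (ω₁ : Form n M 2) : Prop :=
  (∀ (x : M) (X Y : TS n x), ω₁ x ![J x X, J x Y] = ω₁ x ![X, Y]) ∧
    ∀ (x : M) (X : TS n x), X ≠ 0 → 0 < metricOf J ω₁ x X X

/-- `h` is a smooth Hermitian metric on the `J`-invariant subbundle `D` of the tangent bundle:
the restriction of `h` to `D` is symmetric, positive definite and `J`-invariant.
(The values of `h` outside `D` are immaterial.) -/
structure IsHermitianMetricOn (J : EndField n M) [IsManifold 𝓘(ℝ, Model n) ∞ M]
    (D : ∀ x : M, Submodule ℝ (TS n x)) (h : BilinField n M) : Prop where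
  smooth : ContMDiff 𝓘(ℝ, Model n)
    (𝓘(ℝ, Model n).prod 𝓘(ℝ, Model n →L[ℝ] Model n →L[ℝ] ℝ)) ∞
    (fun x : M => Bundle.TotalSpace.mk' (Model n →L[ℝ] Model n →L[ℝ] ℝ)
      (E := fun x : M => TS n x →L[ℝ] TS n x →L[ℝ] ℝ) x (h x))
  symm : ∀ x, ∀ X ∈ D x, ∀ Y ∈ D x, h x X Y = h x Y X
  pos : ∀ x, ∀ X ∈ D x, X ≠ 0 → 0 < h x X X
  map_J : ∀ x, ∀ X ∈ D x, ∀ Y ∈ D x, h x (J x X) (J x Y) = h x X Y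

/-! ### Determinants and first Chern forms -/

/-- `Z` is a basis of `D ⊆ T_x M` over `ℂ`, where `i` acts by `J`. -/
def IsComplexBasis (J : EndField n M) (x : M) (D : Submodule ℝ (TS n x)) {k : ℕ}
    (Z : Fin k → TS n x) : Prop :=
  (∀ a, Z a ∈ D) ∧ (∀ a, J x (Z a) ∈ D) ∧
    ∀ v ∈ D, ∃! c : Fin k → ℂ, v = ∑ a, ((c a).re • Z a + (c a).im • J x (Z a))

/-- The determinant `det (h_{a b̄})`, where `h_{a b̄} = h(∂_a, ∂̄_b)` for the vectors
`∂_a = (Z_a - i J Z_a) / 2` of type `(1,0)` and the complex bilinear extension of a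
`J`-invariant symmetric form `h`; explicitly `h_{a b̄} = (h(Z_a, Z_b) - i h(J Z_a, Z_b)) / 2`.
For a Hermitian metric the determinant is real. -/
def hermDet (J : EndField n M) (x : M) (h : TS n x → TS n x → ℝ) {k : ℕ}
    (Z : Fin k → TS n x) : ℝ :=
  (Matrix.det (Matrix.of fun a b : Fin k =>
    (((h (Z a) (Z b) : ℝ) : ℂ) - Complex.I * ((h (J x (Z a)) (Z b) : ℝ) : ℂ)) / 2)).re

/-- `Z` is a holomorphic frame, over the open set `U`, of the subbundle `D` of the holomorphic
tangent bundle of `(M, J)`: its members are vector fields in `D` that are holomorphic in every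
holomorphic chart, and they form a complex basis of `D` at every point of `U`. -/
structure IsHoloFrame (J : EndField n M) (D : ∀ x : M, Submodule ℝ (TS n x)) (U : Set M) {k : ℕ}
    (Z : Fin k → ∀ x : M, TS n x) : Prop where
  isOpen : IsOpen U
  basis : ∀ x ∈ U, IsComplexBasis J x (D x) (fun a => Z a x)
  holo : ∀ φ : OpenPartialHomeomorph M (EuclideanSpace ℂ (Fin n)), IsHoloChart J φ →
    ∀ a, DifferentiableOn ℂ
      (fun w : EuclideanSpace ℂ (Fin n) => coordDeriv φ (φ.symm w) (Z a (φ.symm w)))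
      (φ.target ∩ φ.symm ⁻¹' U)

open Classical in
/-- The first Chern form `ρ(h) = - i ∂∂̄ log det h` of the Hermitian metric `h` on the holomorphic
subbundle `D`, where `det h` is computed in a holomorphic frame of `D` near the given point. (The
result does not depend on the frame; the value is `0` where `D` has no holomorphic frame.) -/
def chernForm (J : EndField n M) (D : ∀ x : M, Submodule ℝ (TS n x))
    (h : ∀ x : M, TS n x → TS n x → ℝ) : Form n M 2 := fun x =>
  if H : ∃ (k : ℕ) (Z : Fin k → ∀ y : M, TS n y) (U : Set M), x ∈ U ∧ IsHoloFrame J D U Z then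
    -iddbar J (fun y => Real.log (hermDet J y (h y) (fun a => H.choose_spec.choose a y))) x
  else 0

/-! ### The codifferential -/

/-- The matrix of a field of bilinear forms in the coordinates given by the chart at `x₀`. -/
def gram (g : ∀ x : M, TS n x → TS n x → ℝ) (x₀ : M) (y : Model n) :
    Matrix (Fin (2 * n)) (Fin (2 * n)) ℝ :=
  Matrix.of fun i j => g ((chartAt (Model n) x₀).symm y)
    (chartInvDeriv x₀ y (stdVec i)) (chartInvDeriv x₀ y (stdVec j))

/-- The components `β^{ij} = g^{ia} g^{jb} β_{ab}` of a 2-form `β` in the chart at `x₀`. -/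
def raised (g : ∀ x : M, TS n x → TS n x → ℝ) (β : Form n M 2) (x₀ : M) (y : Model n) :
    Matrix (Fin (2 * n)) (Fin (2 * n)) ℝ :=
  (gram g x₀ y)⁻¹ * (Matrix.of fun a b => inChart β x₀ y ![stdVec a, stdVec b]) *
    ((gram g x₀ y)⁻¹).transpose

/-- The codifferential (formal `L²` adjoint of `d`) of a 2-form for the Riemannian metric `g`:
`(d^* β)_k = - g_{kj} (det g)^{-1/2} ∂_i ((det g)^{1/2} β^{ij})`, computed at `x` in the chart
at `x`. -/
def codiff (g : ∀ x : M, TS n x → TS n x → ℝ) (β : Form n M 2) : Form n M 1 := fun x =>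
  let y₀ : Model n := chartAt (Model n) x x
  let c : Fin (2 * n) → ℝ := fun k =>
    -∑ j, gram g x y₀ k j * (√(gram g x y₀).det)⁻¹ *
      ∑ i, fderiv ℝ (fun y => √(gram g x y).det * raised g β x y i j) y₀ (stdVec i)
  ContinuousAlternatingMap.ofSubsingleton ℝ (TS n x) ℝ (0 : Fin 1)
    (∑ k, c k • (EuclideanSpace.proj k : Model n →L[ℝ] ℝ).comp (chartDeriv x))

/-! ### Pluriclosed flow -/

/-- `P(ω) = - ∂∂^*ω - ∂̄∂̄^*ω - i ∂∂̄ log det g` for a Hermitian metric `g` with Kähler form `ω = ω₁`.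
For a real form `ω` of type `(1,1)` the forms `∂̄^*ω` and `∂^*ω` are the parts of `d^*ω` of type
`(1,0)` and `(0,1)`, so that `∂∂^*ω + ∂̄∂̄^*ω` is the `(1,1)` part of `d d^*ω`; the last term of
`P` is the first Chern form of `(TM, J, g)`. -/
def pluriP (J : EndField n M) (ω₁ : Form n M 2) : Form n M 2 := fun x =>
  -part11 J (extD (codiff (metricOf J ω₁) ω₁)) x + chernForm J (fun _ => ⊤) (metricOf J ω₁) x

/-- The time interval `[0, T)`, with `T ≤ ∞`. -/
def timeInterval (T : EReal) : Set ℝ := {t | 0 ≤ t ∧ (t : EReal) < T}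

/-- `ω₁` is a smooth solution on `[0, T)` of the pluriclosed flow `∂ω/∂t = - P(ω)` on `(M, J)`,
with initial condition `ω₀`: a smooth family of pluriclosed Hermitian metrics
(`d d^c ω = 2 i ∂∂̄ ω = 0`) that satisfies the equation. -/
structure IsPluriclosedFlow (J : EndField n M) (ω₀ : Form n M 2) (T : EReal)
    (ω₁ : ℝ → Form n M 2) : Prop where
  smooth : SmoothFamilyOn (timeInterval T) ω₁
  hermitian : ∀ t ∈ timeInterval T, IsHermitianForm J (ω₁ t)
  pluriclosed : ∀ t ∈ timeInterval T, extD (dcForm J (ω₁ t)) = 0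
  flow : ∀ t ∈ timeInterval T, ∀ (x : M) (X Y : TS n x),
    HasDerivWithinAt (fun s => ω₁ s x ![X, Y]) (-(pluriP J (ω₁ t) x ![X, Y])) (timeInterval T) t
  initial : ω₁ 0 = ω₀

/-! ### Generalized Kähler structures with commuting complex structures -/

/-- `(g, J₊, J₋)` is a generalized Kähler structure; `ωp`, `ωm` are its two Kähler forms
`g(J_± ·, ·)`. The metric is a smooth Riemannian metric compatible with the two integrable complex
structures, with `d^c_+ ω_+ = - d^c_- ω_-` and `d d^c_+ ω_+ = - d d^c_- ω_- = 0`. -/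
structure IsGeneralizedKahler [IsManifold 𝓘(ℝ, Model n) ∞ M]
    (g : Bundle.ContMDiffRiemannianMetric 𝓘(ℝ, Model n) ∞ (Model n) (fun x : M => TS n x))
    (Jp Jm : EndField n M) (ωp ωm : Form n M 2) : Prop where
  complex_p : IsComplexStructure Jp
  complex_m : IsComplexStructure Jm
  compat_p : ∀ (x : M) (X Y : TS n x), g.inner x (Jp x X) (Jp x Y) = g.inner x X Y
  compat_m : ∀ (x : M) (X Y : TS n x), g.inner x (Jm x X) (Jm x Y) = g.inner x X Y
  kahler_p : IsKahlerForm g.inner Jp ωp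
  kahler_m : IsKahlerForm g.inner Jm ωm
  dc_eq : dcForm Jp ωp = -dcForm Jm ωm
  ddc_p : extD (dcForm Jp ωp) = 0
  ddc_m : extD (dcForm Jm ωm) = 0

/-- `Π = J₊ J₋`. -/
def prodJ (Jp Jm : EndField n M) : EndField n M := fun x => (Jp x).comp (Jm x)

/-- `T₊ M = ker (Π - 1)`. -/
def Tplus (Jp Jm : EndField n M) (x : M) : Submodule ℝ (TS n x) :=
  LinearMap.ker (prodJ Jp Jm x - ContinuousLinearMap.id ℝ (TS n x)).toLinearMap

/-- `T₋ M = ker (Π + 1)`. -/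
def Tminus (Jp Jm : EndField n M) (x : M) : Submodule ℝ (TS n x) :=
  LinearMap.ker (prodJ Jp Jm x + ContinuousLinearMap.id ℝ (TS n x)).toLinearMap

/-- The projection `π₊` of a form of type `(1,1)` for `J₊` to `Λ^{1,0}_+ ∧ Λ^{0,1}_+`: composition
with the projection `(1 + Π) / 2` of `TM = T₊ ⊕ T₋` onto `T₊`. -/
def piPlus (Jp Jm : EndField n M) (η : Form n M 2) : Form n M 2 := fun x =>
  (η x).compContinuousLinearMap
    ((1 / 2 : ℝ) • (ContinuousLinearMap.id ℝ (TS n x) + prodJ Jp Jm x))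

/-- The projection `π₋` of a form of type `(1,1)` for `J₊` to `Λ^{1,0}_- ∧ Λ^{0,1}_-`: composition
with the projection `(1 - Π) / 2` of `TM = T₊ ⊕ T₋` onto `T₋`. -/
def piMinus (Jp Jm : EndField n M) (η : Form n M 2) : Form n M 2 := fun x =>
  (η x).compContinuousLinearMap
    ((1 / 2 : ℝ) • (ContinuousLinearMap.id ℝ (TS n x) - prodJ Jp Jm x))

/-- `(δ₊ δ₊^c - δ₋ δ₋^c) u`, where `δ_± δ_±^c = π_± i ∂∂̄` (for the complex structure `J₊`). -/
def boxForm (Jp Jm : EndField n M) (u : M → ℝ) : Form n M 2 := fun x =>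
  piPlus Jp Jm (iddbar Jp u) x - piMinus Jp Jm (iddbar Jp u) x

/-- `P(h_±) = ρ⁺(h₊) - ρ⁺(h₋) - ρ⁻(h₊) + ρ⁻(h₋)`, where `ρ(h_±)` is the first Chern form of
`(T_± M, J₊, h_±)` and `ρ^±` is its component `π_± ρ`. -/
def backgroundP (Jp Jm : EndField n M) (hp hm : BilinField n M) : Form n M 2 :=
  let ρp : Form n M 2 := chernForm Jp (Tplus Jp Jm) (fun x X Y => hp x X Y)
  let ρm : Form n M 2 := chernForm Jp (Tminus Jp Jm) (fun x X Y => hm x X Y)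
  fun x => piPlus Jp Jm ρp x - piPlus Jp Jm ρm x - piMinus Jp Jm ρp x + piMinus Jp Jm ρm x

/-- `ω^f_t = ω₀ - t P(h_±) + (δ₊ δ₊^c - δ₋ δ₋^c) f_t`. -/
def omegaF (Jp Jm : EndField n M) (hp hm : BilinField n M) (ω₀ : Form n M 2)
    (f : ℝ → M → ℝ) (t : ℝ) : Form n M 2 := fun x =>
  ω₀ x - t • backgroundP Jp Jm hp hm x + boxForm Jp Jm (f t) x

/-- `f` is a smooth solution on `M × [0, T)` of the scalar flow
`∂f/∂t = log ((det g^f₊ det h₋) / (det h₊ det g^f₋))`, `f(0) = 0`. It is part of the notion of a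
solution that `ω^f_t` is positive, hence is the Kähler form of a metric `g^f_t`; the determinants
of the induced Hermitian metrics on `T_±` are computed in complex bases of `T_± M` at the given
point (the quotient does not depend on the bases). -/
structure IsScalarFlow (Jp Jm : EndField n M) (hp hm : BilinField n M) (ω₀ : Form n M 2)
    (T : EReal) (f : ℝ → M → ℝ) : Prop where
  smooth : ContMDiffOn (𝓘(ℝ, ℝ).prod 𝓘(ℝ, Model n)) 𝓘(ℝ, ℝ) ∞
    (fun p : ℝ × M => f p.1 p.2) (timeInterval T ×ˢ Set.univ)
  positive : ∀ t ∈ timeInterval T, ∀ (x : M) (X : TS n x), X ≠ 0 →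
    0 < metricOf Jp (omegaF Jp Jm hp hm ω₀ f t) x X X
  flow : ∀ t ∈ timeInterval T, ∀ (x : M) (k l : ℕ) (Z : Fin k → TS n x) (W : Fin l → TS n x),
    IsComplexBasis Jp x (Tplus Jp Jm x) Z → IsComplexBasis Jp x (Tminus Jp Jm x) W →
    HasDerivWithinAt (fun s => f s x)
      (Real.log
        ((hermDet Jp x (metricOf Jp (omegaF Jp Jm hp hm ω₀ f t) x) Z *
            hermDet Jp x (fun X Y => hm x X Y) W) /
          (hermDet Jp x (fun X Y => hp x X Y) Z *
            hermDet Jp x (metricOf Jp (omegaF Jp Jm hp hm ω₀ f t) x) W)))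
      (timeInterval T) t
  initial : ∀ x, f 0 x = 0

end GenKahler

end

set_option linter.unusedSectionVars false

noncomputable section

namespace GenKahler

/-! ### Forms on a vector space -/

section Flat

variable {E : Type*} [NormedAddCommGroup E] [NormedSpace ℝ E]
  {F : Type*} [NormedAddCommGroup F] [NormedSpace ℝ F]

/-- A linear form regarded as an alternating form of degree one. -/
abbrev oneForm (a : E →L[ℝ] ℝ) : E [⋀^Fin 1]→L[ℝ] ℝ :=
  ContinuousAlternatingMap.ofSubsingleton ℝ E ℝ (0 : Fin 1) a

theorem exists_form_reconstruction [FiniteDimensional ℝ E] (k : ℕ) :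
    ∃ (ι : Type) (_ : Fintype ι) (v : ι → Fin k → E) (R : (ι → ℝ) →L[ℝ] E [⋀^Fin k]→L[ℝ] ℝ),
      ∀ α : E [⋀^Fin k]→L[ℝ] ℝ, R (fun i => α (v i)) = α := by
  let b := Module.finBasis ℝ E
  let v : (Fin k → Fin (Module.finrank ℝ E)) → Fin k → E := fun s j => b (s j)
  let L : (E [⋀^Fin k]→L[ℝ] ℝ) →ₗ[ℝ] ((Fin k → Fin (Module.finrank ℝ E)) → ℝ) :=
    { toFun := fun α s => α (v s)
      map_add' := fun _ _ => rfl
      map_smul' := fun _ _ => rfl }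
  have hL : LinearMap.ker L = ⊥ := by
    rw [LinearMap.ker_eq_bot]
    intro α β h
    apply ContinuousAlternatingMap.toAlternatingMap_injective
    refine b.ext_alternating fun s _ => ?_
    exact congrFun h s
  obtain ⟨R, hR⟩ := L.exists_leftInverse_of_injective hL
  exact ⟨_, inferInstance, v, LinearMap.toContinuousLinearMap R,
    fun α => LinearMap.congr_fun hR α⟩

theorem contDiffWithinAt_form [FiniteDimensional ℝ E] {k : ℕ} {m : WithTop ℕ∞}
    {α : F → E [⋀^Fin k]→L[ℝ] ℝ} {s : Set F} {w : F}
    (h : ∀ v, ContDiffWithinAt ℝ m (fun w => α w v) s w) : ContDiffWithinAt ℝ m α s w := by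
  obtain ⟨ι, _, v, R, hR⟩ := exists_form_reconstruction (E := E) k
  have h1 : ContDiffWithinAt ℝ m (fun w => R (fun i => α w (v i))) s w :=
    R.contDiff.contDiffAt.comp_contDiffWithinAt _ (contDiffWithinAt_pi.2 fun i => h (v i))
  simpa only [hR] using h1

theorem ContDiffWithinAt.form_apply {k : ℕ} {m : WithTop ℕ∞}
    {α : F → E [⋀^Fin k]→L[ℝ] ℝ} {s : Set F} {w : F}
    (h : ContDiffWithinAt ℝ m α s w) (v : Fin k → E) :
    ContDiffWithinAt ℝ m (fun w => α w v) s w :=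
  (ContinuousAlternatingMap.apply ℝ E ℝ v).contDiff.contDiffAt.comp_contDiffWithinAt w h

theorem contDiffWithinAt_form_iff [FiniteDimensional ℝ E] {k : ℕ} {m : WithTop ℕ∞}
    {α : F → E [⋀^Fin k]→L[ℝ] ℝ} {s : Set F} {w : F} :
    ContDiffWithinAt ℝ m α s w ↔ ∀ v, ContDiffWithinAt ℝ m (fun w => α w v) s w :=
  ⟨fun h v => ContDiffWithinAt.form_apply h v, contDiffWithinAt_form⟩

theorem contDiffAt_form_iff [FiniteDimensional ℝ E] {k : ℕ} {m : WithTop ℕ∞}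
    {α : F → E [⋀^Fin k]→L[ℝ] ℝ} {w : F} :
    ContDiffAt ℝ m α w ↔ ∀ v, ContDiffAt ℝ m (fun w => α w v) w := by
  simp only [← contDiffWithinAt_univ, contDiffWithinAt_form_iff]

theorem contDiffOn_form_iff [FiniteDimensional ℝ E] {k : ℕ} {m : WithTop ℕ∞}
    {α : F → E [⋀^Fin k]→L[ℝ] ℝ} {s : Set F} :
    ContDiffOn ℝ m α s ↔ ∀ v, ContDiffOn ℝ m (fun w => α w v) s :=
  ⟨fun h v w hw => ContDiffWithinAt.form_apply (h w hw) v,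
    fun h w hw => contDiffWithinAt_form fun v => h v w hw⟩

theorem differentiableAt_oneForm {a : E → E →L[ℝ] ℝ} {w : E} (h : DifferentiableAt ℝ a w) :
    DifferentiableAt ℝ (fun w => oneForm (a w)) w :=
  (ContinuousAlternatingMap.ofSubsingletonLIE (𝕜 := ℝ) (E := E) (F := ℝ) (0 : Fin 1)).toContinuousLinearEquiv
    |>.differentiableAt.comp w h

theorem extDeriv_oneForm_apply {a : E → E →L[ℝ] ℝ} {w : E} (h : DifferentiableAt ℝ a w)
    (X Y : E) :
    extDeriv (fun w => oneForm (a w)) w ![X, Y] = fderiv ℝ a w X Y - fderiv ℝ a w Y X := by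
  rw [extDeriv_apply (differentiableAt_oneForm h)]
  have h1 : ∀ Z : E, fderiv ℝ (fun y => a y Z) w = (fderiv ℝ a w).flip Z := fun Z => by
    ext V
    rw [fderiv_clm_apply h (differentiableAt_const Z)]
    simp
  simp [Fin.sum_univ_two, Fin.removeNth, h1, sub_eq_add_neg]

theorem extDeriv_two_apply {Ω : E → E [⋀^Fin 2]→L[ℝ] ℝ} {w : E} (h : DifferentiableAt ℝ Ω w)
    (X Y Z : E) :
    extDeriv Ω w ![X, Y, Z] = fderiv ℝ (fun y => Ω y ![Y, Z]) w X
      - fderiv ℝ (fun y => Ω y ![X, Z]) w Y + fderiv ℝ (fun y => Ω y ![X, Y]) w Z := by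
  rw [extDeriv_apply h]
  have e0 : ((0 : Fin 3).removeNth ![X, Y, Z]) = ![Y, Z] := by
    ext i; fin_cases i <;> rfl
  have e1 : ((1 : Fin 3).removeNth ![X, Y, Z]) = ![X, Z] := by
    ext i; fin_cases i <;> rfl
  have e2 : ((2 : Fin 3).removeNth ![X, Y, Z]) = ![X, Y] := by
    ext i; fin_cases i <;> rfl
  simp [Fin.sum_univ_three, e0, e1, e2, sub_eq_add_neg]

theorem extDeriv_three_apply {Ω : E → E [⋀^Fin 3]→L[ℝ] ℝ} {w : E} (h : DifferentiableAt ℝ Ω w)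
    (X Y Z W : E) :
    extDeriv Ω w ![X, Y, Z, W] = fderiv ℝ (fun y => Ω y ![Y, Z, W]) w X
      - fderiv ℝ (fun y => Ω y ![X, Z, W]) w Y + fderiv ℝ (fun y => Ω y ![X, Y, W]) w Z
      - fderiv ℝ (fun y => Ω y ![X, Y, Z]) w W := by
  rw [extDeriv_apply h]
  have e0 : ((0 : Fin 4).removeNth ![X, Y, Z, W]) = ![Y, Z, W] := by
    ext i; fin_cases i <;> rfl
  have e1 : ((1 : Fin 4).removeNth ![X, Y, Z, W]) = ![X, Z, W] := by
    ext i; fin_cases i <;> rfl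
  have e2 : ((2 : Fin 4).removeNth ![X, Y, Z, W]) = ![X, Y, W] := by
    ext i; fin_cases i <;> rfl
  have e3 : ((3 : Fin 4).removeNth ![X, Y, Z, W]) = ![X, Y, Z] := by
    ext i; fin_cases i <;> rfl
  rw [Fin.sum_univ_four, e0, e1, e2, e3]
  simp [sub_eq_add_neg]

theorem two_form_ext {α β : E [⋀^Fin 2]→L[ℝ] ℝ} (h : ∀ X Y, α ![X, Y] = β ![X, Y]) : α = β := by
  ext v
  have : v = ![v 0, v 1] := by ext i; fin_cases i <;> rfl
  rw [this, h]

theorem form_comp_two {E' : Type*} [AddCommGroup E'] [Module ℝ E'] [TopologicalSpace E']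
    {E'' : Type*} [AddCommGroup E''] [Module ℝ E''] [TopologicalSpace E'']
    (α : E'' [⋀^Fin 2]→L[ℝ] ℝ) (A : E' →L[ℝ] E'') (X Y : E') :
    α.compContinuousLinearMap A ![X, Y] = α ![A X, A Y] := by
  rw [ContinuousAlternatingMap.compContinuousLinearMap_apply]
  congr 1; ext i; fin_cases i <;> rfl

theorem form_comp_three {E' : Type*} [AddCommGroup E'] [Module ℝ E'] [TopologicalSpace E']
    {E'' : Type*} [AddCommGroup E''] [Module ℝ E''] [TopologicalSpace E'']
    (α : E'' [⋀^Fin 3]→L[ℝ] ℝ) (A : E' →L[ℝ] E'') (X Y Z : E') :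
    α.compContinuousLinearMap A ![X, Y, Z] = α ![A X, A Y, A Z] := by
  rw [ContinuousAlternatingMap.compContinuousLinearMap_apply]
  congr 1; ext i; fin_cases i <;> rfl

theorem form_swap (α : E [⋀^Fin 2]→L[ℝ] ℝ) (X Y : E) : α ![X, Y] = -α ![Y, X] := by
  have h := α.toAlternatingMap.map_swap ![Y, X] (i := 0) (j := 1) (by decide)
  have e : (![Y, X] ∘ Equiv.swap (0 : Fin 2) 1) = ![X, Y] := by
    ext i; fin_cases i <;> simp
  rw [e] at h
  exact h

/-- The bilinear form of an alternating form of degree two, as a continuous linear map. -/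
def toBil (E : Type*) [NormedAddCommGroup E] [NormedSpace ℝ E] :
    (E [⋀^Fin 2]→L[ℝ] ℝ) →L[ℝ] (E →L[ℝ] E →L[ℝ] ℝ) :=
  ((ContinuousLinearMap.compL ℝ E (E [×1]→L[ℝ] ℝ) (E →L[ℝ] ℝ))
      (continuousMultilinearCurryFin1 ℝ E ℝ).toContinuousLinearEquiv.toContinuousLinearMap) ∘L
    ((continuousMultilinearCurryLeftEquiv ℝ (fun _ : Fin 2 => E)
      ℝ).toContinuousLinearEquiv.toContinuousLinearMap ∘L
      ContinuousAlternatingMap.toContinuousMultilinearMapCLM ℝ)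

@[simp] theorem toBil_apply (α : E [⋀^Fin 2]→L[ℝ] ℝ) (X Y : E) :
    toBil E α X Y = α ![X, Y] := by
  simp only [toBil, ContinuousLinearMap.comp_apply, ContinuousLinearMap.compL_apply]
  show α _ = α _
  congr 1
  ext i; fin_cases i <;> rfl

/-! ### Traces -/

/-- The trace of continuous endomorphisms, as a continuous linear form. -/
def trL (E : Type*) [NormedAddCommGroup E] [NormedSpace ℝ E] [FiniteDimensional ℝ E] :
    (E →L[ℝ] E) →L[ℝ] ℝ :=
  LinearMap.toContinuousLinearMap
    (LinearMap.trace ℝ E ∘ₗ ContinuousLinearMap.coeLM ℝ)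

variable [FiniteDimensional ℝ E] [FiniteDimensional ℝ F]

theorem trL_apply (A : E →L[ℝ] E) : trL E A = LinearMap.trace ℝ E A.toLinearMap := rfl

theorem trL_comm (A : E →L[ℝ] F) (B : F →L[ℝ] E) : trL E (B ∘L A) = trL F (A ∘L B) :=
  LinearMap.trace_comp_comm' A.toLinearMap B.toLinearMap

theorem trL_basis {ι : Type*} [Fintype ι] (b : Module.Basis ι ℝ E) (A : E →L[ℝ] E) :
    trL E A = ∑ i, b.repr (A (b i)) i := by
  classical
  rw [trL_apply, LinearMap.trace_eq_matrix_trace ℝ b]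
  simp [Matrix.trace, LinearMap.toMatrix_apply]

end Flat

end GenKahler

end

noncomputable section

namespace GenKahler

theorem two_le_infty : (2 : WithTop ℕ∞) ≤ ∞ := by
  exact WithTop.coe_le_coe.2 (le_top : (2 : ℕ∞) ≤ ⊤)

theorem ContDiffWithinAt.form_apply_vec {E F : Type*} [NormedAddCommGroup E] [NormedSpace ℝ E]
    [FiniteDimensional ℝ E] [NormedAddCommGroup F] [NormedSpace ℝ F]
    {k : ℕ} {m : WithTop ℕ∞} {α : F → E [⋀^Fin k]→L[ℝ] ℝ} {u : F → Fin k → E} {s : Set F} {w : F}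
    (h : ContDiffWithinAt ℝ m α s w) (hu : ContDiffWithinAt ℝ m u s w) :
    ContDiffWithinAt ℝ m (fun w => α w (u w)) s w := by
  classical
  obtain ⟨ι, _, v, R, hR⟩ := exists_form_reconstruction (E := E) k
  have h1 : ∀ (α : E [⋀^Fin k]→L[ℝ] ℝ) (x : Fin k → E),
      α x = ∑ i, α (v i) * R (Pi.single i 1) x := fun α x => by
    conv_lhs => rw [← hR α, ← Finset.univ_sum_single (fun i => α (v i)), map_sum]
    rw [ContinuousAlternatingMap.sum_apply]
    refine Finset.sum_congr rfl fun i _ => ?_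
    have : (Pi.single i (α (v i)) : ι → ℝ) = α (v i) • Pi.single i 1 := by
      rw [← Pi.single_smul]; simp
    rw [this, map_smul]; rfl
  have h2 : (fun w => α w (u w)) = fun w => ∑ i, α w (v i) * R (Pi.single i 1) (u w) :=
    funext fun w => h1 _ _
  rw [h2]
  refine ContDiffWithinAt.sum fun i _ => (ContDiffWithinAt.form_apply h (v i)).mul ?_
  exact ((R (Pi.single i 1)).toContinuousMultilinearMap.contDiff).contDiffAt.comp_contDiffWithinAt
    w hu

variable {n : ℕ} {M : Type*} [TopologicalSpace M] [ChartedSpace (Model n) M]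

/-! ### Smooth charts with values in a normed space -/

section Charts

variable {E : Type*} [NormedAddCommGroup E] [NormedSpace ℝ E]
  {E₁ : Type*} [NormedAddCommGroup E₁] [NormedSpace ℝ E₁]
  {E₂ : Type*} [NormedAddCommGroup E₂] [NormedSpace ℝ E₂]

/-- A smooth coordinate chart with values in a normed space. -/
structure IsSmoothChart (φ : OpenPartialHomeomorph M E) : Prop where
  smooth : ContMDiffOn 𝓘(ℝ, Model n) 𝓘(ℝ, E) ∞ φ φ.source
  smooth_symm : ContMDiffOn 𝓘(ℝ, E) 𝓘(ℝ, Model n) ∞ φ.symm φ.target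

theorem IsHoloChart.isSmoothChart {J : EndField n M}
    {φ : OpenPartialHomeomorph M (EuclideanSpace ℂ (Fin n))} (h : IsHoloChart J φ) :
    IsSmoothChart (n := n) φ := ⟨h.smooth, h.smooth_symm⟩

theorem isSmoothChart_chartAt [IsManifold 𝓘(ℝ, Model n) ∞ M] (x : M) :
    IsSmoothChart (n := n) (chartAt (Model n) x) := ⟨contMDiffOn_chart, contMDiffOn_chart_symm⟩

/-- The differential of a chart. -/
def dChart (φ : OpenPartialHomeomorph M E) (x : M) : TS n x →L[ℝ] E :=
  mfderiv 𝓘(ℝ, Model n) 𝓘(ℝ, E) φ x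

/-- The differential of the inverse of a chart. -/
def dSymm (φ : OpenPartialHomeomorph M E) (w : E) : E →L[ℝ] TS n (φ.symm w) :=
  mfderiv 𝓘(ℝ, E) 𝓘(ℝ, Model n) φ.symm w

/-- The pullback of a form by the inverse of a chart. -/
def pull (φ : OpenPartialHomeomorph M E) {k : ℕ} (α : Form n M k) (w : E) : E [⋀^Fin k]→L[ℝ] ℝ :=
  (α (φ.symm w)).compContinuousLinearMap (dSymm φ w)

/-- The coordinate expression of a field of endomorphisms. -/
def pullEnd (φ : OpenPartialHomeomorph M E) (A : EndField n M) (w : E) : E →L[ℝ] E :=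
  (dChart φ (φ.symm w)).comp ((A (φ.symm w)).comp (dSymm φ w))

variable {φ : OpenPartialHomeomorph M E} {φ₁ : OpenPartialHomeomorph M E₁}
  {φ₂ : OpenPartialHomeomorph M E₂}

theorem IsSmoothChart.contMDiffAt (h : IsSmoothChart (n := n) φ) {x : M} (hx : x ∈ φ.source) :
    ContMDiffAt 𝓘(ℝ, Model n) 𝓘(ℝ, E) ∞ φ x :=
  (h.smooth x hx).contMDiffAt (φ.open_source.mem_nhds hx)

theorem IsSmoothChart.contMDiffAt_symm (h : IsSmoothChart (n := n) φ) {w : E}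
    (hw : w ∈ φ.target) : ContMDiffAt 𝓘(ℝ, E) 𝓘(ℝ, Model n) ∞ φ.symm w :=
  (h.smooth_symm w hw).contMDiffAt (φ.open_target.mem_nhds hw)

theorem IsSmoothChart.mdiffAt (h : IsSmoothChart (n := n) φ) {x : M} (hx : x ∈ φ.source) :
    MDifferentiableAt 𝓘(ℝ, Model n) 𝓘(ℝ, E) φ x :=
  (h.contMDiffAt hx).mdifferentiableAt (by simp)

theorem IsSmoothChart.mdiffAt_symm (h : IsSmoothChart (n := n) φ) {w : E}
    (hw : w ∈ φ.target) : MDifferentiableAt 𝓘(ℝ, E) 𝓘(ℝ, Model n) φ.symm w :=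
  (h.contMDiffAt_symm hw).mdifferentiableAt (by simp)

theorem dChart_dSymm (h : IsSmoothChart (n := n) φ) {w : E} (hw : w ∈ φ.target) (v : E) :
    dChart (n := n) φ (φ.symm w) (dSymm φ w v) = v := by
  have h1 := mfderiv_comp w (h.mdiffAt (φ.map_target hw)) (h.mdiffAt_symm hw)
  have h2 : mfderiv 𝓘(ℝ, E) 𝓘(ℝ, E) (φ ∘ φ.symm) w = mfderiv 𝓘(ℝ, E) 𝓘(ℝ, E) id w := by
    apply Filter.EventuallyEq.mfderiv_eq
    filter_upwards [φ.open_target.mem_nhds hw] with z hz using φ.right_inv hz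
  rw [h2, mfderiv_id] at h1
  exact (congrArg (fun A : E →L[ℝ] E => A v) h1).symm

theorem dSymm_dChart (h : IsSmoothChart (n := n) φ) {w : E} (hw : w ∈ φ.target)
    (v : TS n (φ.symm w)) :
    dSymm φ w (dChart φ (φ.symm w) v) = v := by
  have hx := φ.map_target hw
  have e : φ (φ.symm w) = w := φ.right_inv hw
  have h0 : MDifferentiableAt 𝓘(ℝ, E) 𝓘(ℝ, Model n) φ.symm (φ (φ.symm w)) := by
    rw [e]; exact h.mdiffAt_symm hw
  have h1 := mfderiv_comp (φ.symm w) h0 (h.mdiffAt hx)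
  have h2 : mfderiv 𝓘(ℝ, Model n) 𝓘(ℝ, Model n) (φ.symm ∘ φ) (φ.symm w)
      = mfderiv 𝓘(ℝ, Model n) 𝓘(ℝ, Model n) id (φ.symm w) := by
    apply Filter.EventuallyEq.mfderiv_eq
    filter_upwards [φ.open_source.mem_nhds hx] with z hz using φ.left_inv hz
  have h3 := congrArg (fun A : Model n →L[ℝ] Model n => A v) h1
  have h4 : mfderiv 𝓘(ℝ, Model n) 𝓘(ℝ, Model n) (φ.symm ∘ φ) (φ.symm w) v = v := by
    rw [h2, mfderiv_id]; rfl
  have h5 : ∀ z : E, z = w → (mfderiv 𝓘(ℝ, E) 𝓘(ℝ, Model n) φ.symm z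
      (dChart φ (φ.symm w) v) : Model n) = dSymm (n := n) φ w (dChart φ (φ.symm w) v) := by
    rintro z rfl; rfl
  exact (h5 _ e).symm.trans (h3.symm.trans h4)

theorem pull_apply_dChart (h : IsSmoothChart (n := n) φ) {k : ℕ} (α : Form n M k) {x : M}
    (hx : x ∈ φ.source) : (pull φ α (φ x)).compContinuousLinearMap (dChart φ x) = α x := by
  obtain ⟨w, hw, rfl⟩ : ∃ w ∈ φ.target, φ.symm w = x := ⟨φ x, φ.map_source hx, φ.left_inv hx⟩
  rw [φ.right_inv hw]
  ext v
  simp only [pull, ContinuousAlternatingMap.compContinuousLinearMap_apply]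
  congr 1
  ext1 i
  exact dSymm_dChart h hw (v i)

theorem form_eq_of_pull_eq (h : IsSmoothChart (n := n) φ) {k : ℕ} {α β : Form n M k} {x : M}
    (hx : x ∈ φ.source) (he : pull φ α (φ x) = pull φ β (φ x)) : α x = β x := by
  rw [← pull_apply_dChart h α hx, he, pull_apply_dChart h β hx]

theorem contDiffAt_transition (h₁ : IsSmoothChart (n := n) φ₁) (h₂ : IsSmoothChart (n := n) φ₂)
    {w : E₁} (hw : w ∈ φ₁.target) (hw₂ : φ₁.symm w ∈ φ₂.source) :
    ContDiffAt ℝ ∞ (φ₂ ∘ φ₁.symm) w :=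
  contMDiffAt_iff_contDiffAt.1
    ((h₂.contMDiffAt hw₂).comp w (h₁.contMDiffAt_symm hw))

theorem fderiv_transition (h₁ : IsSmoothChart (n := n) φ₁) (h₂ : IsSmoothChart (n := n) φ₂)
    {w : E₁} (hw : w ∈ φ₁.target) (hw₂ : φ₁.symm w ∈ φ₂.source) :
    fderiv ℝ (φ₂ ∘ φ₁.symm) w = (dChart (n := n) φ₂ (φ₁.symm w)).comp (dSymm φ₁ w) := by
  have h1 := mfderiv_comp w (h₂.mdiffAt hw₂) (h₁.mdiffAt_symm hw)
  rw [← mfderiv_eq_fderiv]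
  exact h1

theorem fderiv_transition_dChart (h₁ : IsSmoothChart (n := n) φ₁)
    (h₂ : IsSmoothChart (n := n) φ₂) {x : M} (hx : x ∈ φ₁.source) (hx₂ : x ∈ φ₂.source) :
    (fderiv ℝ (φ₂ ∘ φ₁.symm) (φ₁ x)).comp (dChart (n := n) φ₁ x) = dChart φ₂ x := by
  obtain ⟨w, hw, rfl⟩ : ∃ w ∈ φ₁.target, φ₁.symm w = x := ⟨φ₁ x, φ₁.map_source hx, φ₁.left_inv hx⟩
  rw [φ₁.right_inv hw, fderiv_transition h₁ h₂ hw hx₂]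
  ext v
  simp only [ContinuousLinearMap.comp_apply]
  rw [dSymm_dChart h₁ hw]

theorem pull_transition (h₁ : IsSmoothChart (n := n) φ₁) (h₂ : IsSmoothChart (n := n) φ₂)
    {k : ℕ} (α : Form n M k)
    {w : E₁} (hw : w ∈ φ₁.target) (hw₂ : φ₁.symm w ∈ φ₂.source) :
    pull φ₁ α w = (pull φ₂ α ((φ₂ ∘ φ₁.symm) w)).compContinuousLinearMap
      (fderiv ℝ (φ₂ ∘ φ₁.symm) w) := by
  rw [fderiv_transition h₁ h₂ hw hw₂]
  have := pull_apply_dChart h₂ α hw₂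
  conv_lhs => rw [pull, ← this]
  rfl

set_option linter.unusedSectionVars false in
theorem eventually_mem_transition {w : E₁} (hw : w ∈ φ₁.target) (hw₂ : φ₁.symm w ∈ φ₂.source) :
    ∀ᶠ z in 𝓝 w, z ∈ φ₁.target ∧ φ₁.symm z ∈ φ₂.source :=
  Filter.Eventually.and (φ₁.open_target.mem_nhds hw)
    ((φ₁.continuousAt_symm hw).eventually (φ₂.open_source.mem_nhds hw₂))

theorem extD_eq [IsManifold 𝓘(ℝ, Model n) ∞ M] (h : IsSmoothChart (n := n) φ) {k : ℕ}
    {α : Form n M k} {x : M} (hx : x ∈ φ.source) (hα : DifferentiableAt ℝ (pull φ α) (φ x)) :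
    extD α x = (extDeriv (pull φ α) (φ x)).compContinuousLinearMap (dChart φ x) := by
  set c := chartAt (Model n) x with hc
  have hcs : IsSmoothChart (n := n) c := isSmoothChart_chartAt x
  have hxc : x ∈ c.source := mem_chart_source _ x
  have hw : c x ∈ c.target := c.map_source hxc
  have hws : c.symm (c x) = x := c.left_inv hxc
  have hw₂ : c.symm (c x) ∈ φ.source := by rw [hws]; exact hx
  have e1 : pull c α =ᶠ[𝓝 (c x)] fun y =>
      (pull φ α ((φ ∘ c.symm) y)).compContinuousLinearMap (fderiv ℝ (φ ∘ c.symm) y) := by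
    filter_upwards [eventually_mem_transition hw hw₂] with y hy
    exact pull_transition hcs h α hy.1 hy.2
  have e2 : (φ ∘ c.symm) (c x) = φ x := by simp [hws]
  have e3 : extDeriv (pull c α) (c x) = (extDeriv (pull φ α) (φ x)).compContinuousLinearMap
      (fderiv ℝ (φ ∘ c.symm) (c x)) := by
    rw [e1.extDeriv_eq]
    have hd : DifferentiableAt ℝ (pull φ α) ((φ ∘ c.symm) (c x)) := by rw [e2]; exact hα
    rw [extDeriv_pullback hd (contDiffAt_transition hcs h hw hw₂)
      (by rw [minSmoothness_of_isRCLikeNormedField]; exact two_le_infty), e2]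
  have e4 : extD α x = (extDeriv (pull c α) (c x)).compContinuousLinearMap (dChart c x) := rfl
  rw [e4, e3, ← fderiv_transition_dChart hcs h hxc hx]
  rfl

theorem pull_extD [IsManifold 𝓘(ℝ, Model n) ∞ M] (h : IsSmoothChart (n := n) φ) {k : ℕ}
    {α : Form n M k} {w : E} (hw : w ∈ φ.target) (hα : DifferentiableAt ℝ (pull φ α) w) :
    pull φ (extD α) w = extDeriv (pull φ α) w := by
  have e : φ (φ.symm w) = w := φ.right_inv hw
  rw [pull, extD_eq h (φ.map_target hw) (by rwa [e]), e]
  ext v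
  simp only [ContinuousAlternatingMap.compContinuousLinearMap_apply]
  congr 1
  ext1 i
  exact dChart_dSymm h hw (v i)

theorem contDiffWithinAt_pull [FiniteDimensional ℝ E₁] [FiniteDimensional ℝ E₂]
    (h₁ : IsSmoothChart (n := n) φ₁) (h₂ : IsSmoothChart (n := n) φ₂)
    {k : ℕ} {S : Set ℝ} {α : ℝ → Form n M k} {t : ℝ}
    {w : E₁} (hw : w ∈ φ₁.target) (hw₂ : φ₁.symm w ∈ φ₂.source)
    (hα : ContDiffOn ℝ ∞ (fun p : ℝ × E₂ => pull φ₂ (α p.1) p.2) (S ×ˢ φ₂.target)) (ht : t ∈ S) :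
    ContDiffWithinAt ℝ ∞ (fun p : ℝ × E₁ => pull φ₁ (α p.1) p.2) (S ×ˢ φ₁.target) (t, w) := by
  set θ := φ₂ ∘ φ₁.symm with hθ
  set U : Set E₁ := φ₁.target ∩ φ₁.symm ⁻¹' φ₂.source with hU
  have hUo : IsOpen U := φ₁.isOpen_inter_preimage_symm φ₂.open_source
  have hwU : w ∈ U := ⟨hw, hw₂⟩
  have hθU : ∀ z ∈ U, ContDiffAt ℝ ∞ θ z := fun z hz => contDiffAt_transition h₁ h₂ hz.1 hz.2
  suffices H : ContDiffWithinAt ℝ ∞ (fun p : ℝ × E₁ => pull φ₁ (α p.1) p.2) (S ×ˢ U) (t, w) by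
    refine H.mono_of_mem_nhdsWithin ?_
    have : Set.univ ×ˢ U ∈ 𝓝 (t, w) := (isOpen_univ.prod hUo).mem_nhds ⟨trivial, hwU⟩
    filter_upwards [mem_nhdsWithin_of_mem_nhds this, self_mem_nhdsWithin] with p hp hp'
    exact ⟨hp'.1, hp.2⟩
  have e : ∀ p ∈ S ×ˢ U, pull φ₁ (α p.1) p.2 =
      (pull φ₂ (α p.1) (θ p.2)).compContinuousLinearMap (fderiv ℝ θ p.2) := fun p hp =>
    pull_transition h₁ h₂ _ hp.2.1 hp.2.2
  refine ContDiffWithinAt.congr ?_ e (e _ ⟨ht, hwU⟩)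
  have hθ2 : ContDiffWithinAt ℝ ∞ (fun p : ℝ × E₁ => θ p.2) (S ×ˢ U) (t, w) :=
    ((hθU w hwU).comp (t, w) contDiffAt_snd).contDiffWithinAt
  have hD : ContDiffAt ℝ ∞ (fderiv ℝ θ) w := (hθU w hwU).fderiv_right (by simp)
  refine contDiffWithinAt_form fun v => ?_
  simp only [ContinuousAlternatingMap.compContinuousLinearMap_apply]
  refine ContDiffWithinAt.form_apply_vec ?_ ?_
  · have hm : Set.MapsTo (fun p : ℝ × E₁ => (p.1, θ p.2)) (S ×ˢ U) (S ×ˢ φ₂.target) :=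
      fun p hp => ⟨hp.1, φ₂.map_source hp.2.2⟩
    exact (hα (t, θ w) ⟨ht, φ₂.map_source hw₂⟩).comp (t, w)
      (contDiffWithinAt_fst.prodMk hθ2) hm
  · refine contDiffWithinAt_pi.2 fun i => ?_
    exact (((hD.comp (t, w) contDiffAt_snd).clm_apply contDiffAt_const).contDiffWithinAt :)

theorem SmoothFamilyOn.contDiffOn_pull [IsManifold 𝓘(ℝ, Model n) ∞ M] [FiniteDimensional ℝ E]
    (h : IsSmoothChart (n := n) φ) {k : ℕ} {S : Set ℝ} {α : ℝ → Form n M k}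
    (hα : SmoothFamilyOn S α) :
    ContDiffOn ℝ ∞ (fun p : ℝ × E => pull φ (α p.1) p.2) (S ×ˢ φ.target) := by
  rintro ⟨t, w⟩ ⟨ht, hw⟩
  exact contDiffWithinAt_pull h (isSmoothChart_chartAt (φ.symm w)) hw (mem_chart_source _ _)
    (hα (φ.symm w)) ht

theorem smoothFamilyOn_of_charts [IsManifold 𝓘(ℝ, Model n) ∞ M] [FiniteDimensional ℝ E] {k : ℕ}
    {S : Set ℝ} {α : ℝ → Form n M k}
    (hα : ∀ x : M, ∃ φ : OpenPartialHomeomorph M E, IsSmoothChart (n := n) φ ∧ x ∈ φ.source ∧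
      ContDiffOn ℝ ∞ (fun p : ℝ × E => pull φ (α p.1) p.2) (S ×ˢ φ.target)) :
    SmoothFamilyOn S α := by
  rintro x₀ ⟨t, w⟩ ⟨ht, hw⟩
  obtain ⟨φ, h, hx, hs⟩ := hα ((chartAt (Model n) x₀).symm w)
  exact contDiffWithinAt_pull (isSmoothChart_chartAt x₀) h hw hx hs ht

/-- A form is smooth when all its coordinate expressions are. -/
def IsSmoothForm {k : ℕ} (α : Form n M k) : Prop := SmoothFamilyOn Set.univ fun _ => α


end Charts

end GenKahler

end

noncomputable section

namespace GenKahler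

section FlatOps

variable {E : Type*} [NormedAddCommGroup E] [NormedSpace ℝ E]

/-- `d^c u = - du ∘ J` on a vector space with a constant endomorphism `J`. -/
def fdc (J : E →L[ℝ] E) (u : E → ℝ) (w : E) : E [⋀^Fin 1]→L[ℝ] ℝ :=
  oneForm (-(fderiv ℝ u w).comp J)

/-- `i ∂∂̄ u = (1 / 2) d d^c u` on a vector space with a constant endomorphism `J`. -/
def fiddbar (J : E →L[ℝ] E) (u : E → ℝ) (w : E) : E [⋀^Fin 2]→L[ℝ] ℝ :=
  (1 / 2 : ℝ) • extDeriv (fdc J u) w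

/-- The `J`-invariant part of an alternating form of degree two. -/
def fpart11 (J : E →L[ℝ] E) (β : E [⋀^Fin 2]→L[ℝ] ℝ) : E [⋀^Fin 2]→L[ℝ] ℝ :=
  (1 / 2 : ℝ) • (β + β.compContinuousLinearMap J)

theorem fpart11_apply (J : E →L[ℝ] E) (β : E [⋀^Fin 2]→L[ℝ] ℝ) (X Y : E) :
    fpart11 J β ![X, Y] = (1 / 2 : ℝ) * (β ![X, Y] + β ![J X, J Y]) := by
  rw [fpart11, ContinuousAlternatingMap.smul_apply, ContinuousAlternatingMap.add_apply,
    form_comp_two, smul_eq_mul]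

theorem differentiableAt_fderiv_of_contDiffAt {F : Type*} [NormedAddCommGroup F] [NormedSpace ℝ F]
    {u : E → F} {w : E} (hu : ContDiffAt ℝ 2 u w) :
    DifferentiableAt ℝ (fderiv ℝ u) w :=
  (hu.fderiv_right (m := 1) (by norm_num)).differentiableAt (by simp)

theorem fderiv_fderiv_symm {F : Type*} [NormedAddCommGroup F] [NormedSpace ℝ F]
    {u : E → F} {w : E} (hu : ContDiffAt ℝ 2 u w) (X Y : E) :
    fderiv ℝ (fderiv ℝ u) w X Y = fderiv ℝ (fderiv ℝ u) w Y X :=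
  (hu.isSymmSndFDerivAt (by simp)) X Y

theorem fderiv_fdc {J : E →L[ℝ] E} {u : E → ℝ} {w : E} (hu : ContDiffAt ℝ 2 u w) (X Y : E) :
    DifferentiableAt ℝ (fun w => -(fderiv ℝ u w).comp J) w ∧
    fderiv ℝ (fun w => -(fderiv ℝ u w).comp J) w X Y
      = -fderiv ℝ (fderiv ℝ u) w X (J Y) := by
  have h := differentiableAt_fderiv_of_contDiffAt hu
  have h1 : HasFDerivAt (fun w => -(fderiv ℝ u w).comp J)
      (-((ContinuousLinearMap.compL ℝ E E ℝ).flip J ∘L fderiv ℝ (fderiv ℝ u) w)) w :=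
    (((ContinuousLinearMap.compL ℝ E E ℝ).flip J).hasFDerivAt.comp w h.hasFDerivAt).neg
  exact ⟨h1.differentiableAt, by rw [h1.fderiv]; rfl⟩

theorem fiddbar_apply {J : E →L[ℝ] E} {u : E → ℝ} {w : E} (hu : ContDiffAt ℝ 2 u w) (X Y : E) :
    fiddbar J u w ![X, Y] = (1 / 2 : ℝ) *
      (fderiv ℝ (fderiv ℝ u) w Y (J X) - fderiv ℝ (fderiv ℝ u) w X (J Y)) := by
  rw [fiddbar, ContinuousAlternatingMap.smul_apply, smul_eq_mul]
  congr 1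
  have := extDeriv_oneForm_apply (E := E) (fderiv_fdc (J := J) hu X Y).1 X Y
  refine this.trans ?_
  rw [(fderiv_fdc (J := J) hu X Y).2, (fderiv_fdc (J := J) hu Y X).2]
  ring

theorem fiddbar_congr {J : E →L[ℝ] E} {u v : E → ℝ} {w : E} (h : u =ᶠ[𝓝 w] v) :
    fiddbar J u w = fiddbar J v w := by
  have : fdc J u =ᶠ[𝓝 w] fdc J v := by
    filter_upwards [h.fderiv (𝕜 := ℝ)] with z hz
    rw [fdc, fdc, hz]
  rw [fiddbar, fiddbar, this.extDeriv_eq]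

end FlatOps

variable {n : ℕ} {M : Type*} [TopologicalSpace M] [ChartedSpace (Model n) M]

section PullOps

variable {E : Type*} [NormedAddCommGroup E] [NormedSpace ℝ E] {φ : OpenPartialHomeomorph M E}

theorem pull_comp_end (h : IsSmoothChart (n := n) φ) {k : ℕ} (α : Form n M k) (A : EndField n M)
    {w : E} (hw : w ∈ φ.target) :
    pull φ (fun x => (α x).compContinuousLinearMap (A x)) w
      = (pull φ α w).compContinuousLinearMap (pullEnd φ A w) := by
  ext v
  simp only [pull, ContinuousAlternatingMap.compContinuousLinearMap_apply, pullEnd]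
  congr 1
  ext1 i
  exact (dSymm_dChart h hw _).symm

theorem dSymm_pullEnd (h : IsSmoothChart (n := n) φ) (A : EndField n M)
    {w : E} (hw : w ∈ φ.target) (v : E) :
    dSymm φ w (pullEnd φ A w v) = A (φ.symm w) (dSymm φ w v) := by
  simp only [pullEnd, ContinuousLinearMap.comp_apply]
  rw [dSymm_dChart h hw]

theorem pullEnd_comp (h : IsSmoothChart (n := n) φ) (A B : EndField n M)
    {w : E} (hw : w ∈ φ.target) :
    pullEnd φ (fun x => (A x).comp (B x)) w = (pullEnd φ A w).comp (pullEnd φ B w) := by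
  ext v
  simp only [ContinuousLinearMap.comp_apply]
  rw [pullEnd, ContinuousLinearMap.comp_apply, ContinuousLinearMap.comp_apply,
    ContinuousLinearMap.comp_apply, ← dSymm_pullEnd h B hw, ← dSymm_pullEnd h A hw,
    dChart_dSymm h hw]

/-- If the coordinate expression of a function is differentiable, so is the function. -/
theorem mdifferentiableAt_of_coord (h : IsSmoothChart (n := n) φ) {u : M → ℝ} {w : E}
    (hw : w ∈ φ.target) (hu : DifferentiableAt ℝ (u ∘ φ.symm) w) :
    MDifferentiableAt 𝓘(ℝ, Model n) 𝓘(ℝ, ℝ) u (φ.symm w) := by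
  have hx := φ.map_target hw
  have e : φ (φ.symm w) = w := φ.right_inv hw
  have h1 : MDifferentiableAt 𝓘(ℝ, Model n) 𝓘(ℝ, ℝ) ((u ∘ φ.symm) ∘ φ) (φ.symm w) :=
    MDifferentiableAt.comp (φ.symm w) (I' := 𝓘(ℝ, E)) (by rw [e]; exact hu.mdifferentiableAt)
      (h.mdiffAt hx)
  refine h1.congr_of_eventuallyEq ?_
  filter_upwards [φ.open_source.mem_nhds hx] with z hz
  simp [φ.left_inv hz]

theorem fderiv_coord (h : IsSmoothChart (n := n) φ) {u : M → ℝ} {w : E}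
    (hw : w ∈ φ.target) (hu : DifferentiableAt ℝ (u ∘ φ.symm) w) :
    fderiv ℝ (u ∘ φ.symm) w = (dFun (n := n) u (φ.symm w)).comp (dSymm φ w) := by
  have h1 := mfderiv_comp w (mdifferentiableAt_of_coord h hw hu) (h.mdiffAt_symm hw)
  rw [mfderiv_eq_fderiv] at h1
  exact h1

end PullOps

/-! ### Holomorphic charts -/

/-- The complex model space. -/
abbrev CE (n : ℕ) : Type := EuclideanSpace ℂ (Fin n)

/-- Multiplication by `i` on the complex model space. -/
def mulI (n : ℕ) : CE n →L[ℝ] CE n :=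
  (Complex.I • ContinuousLinearMap.id ℂ (CE n)).restrictScalars ℝ

@[simp] theorem mulI_apply (v : CE n) : mulI n v = Complex.I • v := rfl

theorem mulI_mulI (v : CE n) : mulI n (mulI n v) = -v := by
  simp [smul_smul]

theorem pullEnd_holo {J : EndField n M} {φ : OpenPartialHomeomorph M (CE n)}
    (h : IsHoloChart J φ) {w : CE n} (hw : w ∈ φ.target) : pullEnd φ J w = mulI n := by
  ext1 v
  simp only [pullEnd, ContinuousLinearMap.comp_apply]
  have := h.map_J (φ.symm w) (φ.map_target hw) (dSymm φ w v)
  refine this.trans ?_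
  rw [show coordDeriv φ (φ.symm w) (dSymm φ w v) = v from dChart_dSymm h.isSmoothChart hw v]
  rfl

theorem IsHoloChart.J_J {J : EndField n M} {φ : OpenPartialHomeomorph M (CE n)}
    (h : IsHoloChart J φ) {x : M} (hx : x ∈ φ.source) (v : TS n x) : J x (J x v) = -v := by
  obtain ⟨w, hw, rfl⟩ : ∃ w ∈ φ.target, φ.symm w = x := ⟨φ x, φ.map_source hx, φ.left_inv hx⟩
  obtain ⟨e, rfl⟩ : ∃ e, dSymm φ w e = v := ⟨_, dSymm_dChart h.isSmoothChart hw v⟩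
  rw [← dSymm_pullEnd h.isSmoothChart J hw, ← dSymm_pullEnd h.isSmoothChart J hw,
    pullEnd_holo h hw, mulI_mulI, map_neg]

theorem IsComplexStructure.J_J {J : EndField n M} (h : IsComplexStructure J) (x : M) (v : TS n x) :
    J x (J x v) = -v := by
  obtain ⟨φ, hx, hφ⟩ := h x
  exact hφ.J_J hx v

theorem dSymm_mulI {J : EndField n M} {φ : OpenPartialHomeomorph M (CE n)}
    (h : IsHoloChart J φ) {w : CE n} (hw : w ∈ φ.target) (v : CE n) :
    dSymm φ w (mulI n v) = J (φ.symm w) (dSymm φ w v) := by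
  rw [← pullEnd_holo h hw, dSymm_pullEnd h.isSmoothChart J hw]

section HoloPull

variable {J : EndField n M} {φ : OpenPartialHomeomorph M (CE n)}

theorem pull_dcFun (h : IsHoloChart J φ) {u : M → ℝ} {w : CE n}
    (hw : w ∈ φ.target) (hu : DifferentiableAt ℝ (u ∘ φ.symm) w) :
    pull φ (dcFun J u) w = fdc (mulI n) (u ∘ φ.symm) w := by
  ext v
  rw [fdc, fderiv_coord h.isSmoothChart hw hu, pull,
    ContinuousAlternatingMap.compContinuousLinearMap_apply]
  show (-((dFun u (φ.symm w)).comp (J (φ.symm w)))) (dSymm φ w (v 0))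
    = (-((dFun u (φ.symm w)).comp (dSymm φ w)).comp (mulI n)) (v 0)
  simp only [neg_apply, ContinuousLinearMap.comp_apply]
  rw [dSymm_mulI h hw]

theorem pull_dcFun_eventuallyEq (h : IsHoloChart J φ) {u : M → ℝ} {w : CE n}
    (hw : w ∈ φ.target) (hu : ContDiffAt ℝ 1 (u ∘ φ.symm) w) :
    pull φ (dcFun J u) =ᶠ[𝓝 w] fdc (mulI n) (u ∘ φ.symm) := by
  filter_upwards [φ.open_target.mem_nhds hw, hu.eventually (by simp)] with z hz hz'
  exact pull_dcFun h hz (hz'.differentiableAt (by simp))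

theorem pull_iddbar [IsManifold 𝓘(ℝ, Model n) ∞ M] (h : IsHoloChart J φ) {u : M → ℝ} {w : CE n}
    (hw : w ∈ φ.target) (hu : ContDiffAt ℝ 2 (u ∘ φ.symm) w) :
    pull φ (iddbar J u) w = fiddbar (mulI n) (u ∘ φ.symm) w := by
  have e := pull_dcFun_eventuallyEq h hw (hu.of_le (by norm_num))
  have hd : DifferentiableAt ℝ (pull φ (dcFun J u)) w :=
    (differentiableAt_oneForm (fderiv_fdc (J := mulI n) hu 0 0).1).congr_of_eventuallyEq e
  have h1 : pull φ (iddbar J u) w = (1 / 2 : ℝ) • pull φ (extD (dcFun J u)) w := by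
    ext v; rfl
  rw [h1, pull_extD h.isSmoothChart hw hd, e.extDeriv_eq, fiddbar]

theorem pull_part11 (h : IsHoloChart J φ) (β : Form n M 2) {w : CE n} (hw : w ∈ φ.target) :
    pull φ (part11 J β) w = fpart11 (mulI n) (pull φ β w) := by
  rw [fpart11, ← pullEnd_holo h hw, ← pull_comp_end h.isSmoothChart β J hw]
  ext v
  rfl

theorem pull_dcForm [IsManifold 𝓘(ℝ, Model n) ∞ M] (h : IsHoloChart J φ) (β : Form n M 2)
    {w : CE n} (hw : w ∈ φ.target) (hd : DifferentiableAt ℝ (pull φ β) w) :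
    pull φ (dcForm J β) w = -(extDeriv (pull φ β) w).compContinuousLinearMap (mulI n) := by
  rw [← pull_extD h.isSmoothChart hw hd, ← pullEnd_holo h hw,
    ← pull_comp_end h.isSmoothChart _ J hw]
  ext v
  rfl

end HoloPull

end GenKahler

end

noncomputable section


namespace GenKahler

/-! ### Smoothness of complex differentiable maps of several variables -/

section Osgood

variable {E : Type} [NormedAddCommGroup E] [NormedSpace ℂ E] [FiniteDimensional ℂ E]
  {F : Type} [NormedAddCommGroup F] [NormedSpace ℂ F] [FiniteDimensional ℂ F]

theorem exists_bound_fderiv {g : E → F} {U : Set E} (hU : IsOpen U) (hg : DifferentiableOn ℂ g U)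
    {w₀ : E} (hw₀ : w₀ ∈ U) : ∃ r > 0, ∃ C : ℝ, Metric.closedBall w₀ (2 * r) ⊆ U ∧
      ∀ w ∈ Metric.closedBall w₀ r, ‖fderiv ℂ g w‖ ≤ C := by
  have : ProperSpace E := FiniteDimensional.proper ℂ E
  obtain ⟨ε, hε, hεU⟩ := Metric.nhds_basis_closedBall.mem_iff.1 (hU.mem_nhds hw₀)
  obtain ⟨K, hK⟩ := (isCompact_closedBall w₀ ε).exists_bound_of_continuousOn
    (hg.continuousOn.mono hεU)
  have hK0 : 0 ≤ K := (norm_nonneg _).trans (hK w₀ (Metric.mem_closedBall_self hε.le))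
  refine ⟨ε / 2, half_pos hε, K / (ε / 2), by rwa [mul_div_cancel₀ _ (by norm_num)], ?_⟩
  intro w hw
  refine ContinuousLinearMap.opNorm_le_of_unit_norm (𝕜 := ℂ)
    (div_nonneg hK0 (half_pos hε).le) fun v hv => ?_
  have hmem : ∀ ζ ∈ Metric.closedBall (0 : ℂ) (ε / 2), w + ζ • v ∈ Metric.closedBall w₀ ε := by
    intro ζ hζ
    rw [mem_closedBall_iff_norm] at *
    calc ‖w + ζ • v - w₀‖ = ‖(w - w₀) + ζ • v‖ := by congr 1; abel
      _ ≤ ‖w - w₀‖ + ‖ζ • v‖ := norm_add_le _ _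
      _ ≤ ε / 2 + ε / 2 := by
          refine add_le_add hw ?_
          rw [norm_smul, hv, mul_one]; simpa using hζ
      _ = ε := by ring
  have hd : ∀ ζ ∈ Metric.closedBall (0 : ℂ) (ε / 2),
      HasDerivAt (fun ζ : ℂ => g (w + ζ • v)) (fderiv ℂ g (w + ζ • v) v) ζ := by
    intro ζ hζ
    have h1 : HasFDerivAt g (fderiv ℂ g (w + ζ • v)) (w + ζ • v) :=
      (hg.differentiableAt (hU.mem_nhds (hεU (hmem ζ hζ)))).hasFDerivAt
    have h2 : HasDerivAt (fun ζ : ℂ => w + ζ • v) v ζ := by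
      simpa using ((hasDerivAt_id ζ).smul_const v).const_add w
    exact h1.comp_hasDerivAt ζ h2
  have h3 := Complex.norm_deriv_le_of_forall_mem_sphere_norm_le (c := (0 : ℂ)) (R := ε / 2)
    (C := K) (f := fun ζ : ℂ => g (w + ζ • v)) (half_pos hε)
    (DifferentiableOn.diffContOnCl_ball (U := Metric.closedBall 0 (ε / 2))
      (fun ζ hζ => (hd ζ hζ).differentiableAt.differentiableWithinAt) subset_rfl)
    (fun ζ hζ => hK _ (hmem ζ (Metric.sphere_subset_closedBall hζ)))
  rw [(hd 0 (Metric.mem_closedBall_self (half_pos hε).le)).deriv] at h3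
  simpa using h3

theorem differentiableOn_fderiv_apply {g : E → F} {U : Set E} (hU : IsOpen U)
    (hg : DifferentiableOn ℂ g U) (v : E) :
    DifferentiableOn ℂ (fun w => fderiv ℂ g w v) U := by
  intro w₀ hw₀
  refine DifferentiableAt.differentiableWithinAt ?_
  let _ : NormedSpace ℝ E := NormedSpace.complexToReal
  have : CompleteSpace F := FiniteDimensional.complete ℂ F
  have : ProperSpace E := FiniteDimensional.proper ℂ E
  have : ProperSpace (E →L[ℂ] F) := FiniteDimensional.proper ℂ _
  obtain ⟨r, hr, C, hrU, hC⟩ := exists_bound_fderiv hU hg hw₀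
  have hC0 : 0 ≤ C := (norm_nonneg _).trans (hC w₀ (Metric.mem_closedBall_self hr.le))
  obtain ⟨ρ, hρ, hρv⟩ : ∃ ρ > 0, ρ * ‖v‖ ≤ r / 2 := by
    refine ⟨r / 2 / (‖v‖ + 1), by positivity, ?_⟩
    rw [div_mul_eq_mul_div, div_le_iff₀ (by positivity)]
    nlinarith [norm_nonneg v]
  have hmem : ∀ w ∈ Metric.ball w₀ (r / 2), ∀ ζ ∈ Metric.closedBall (0 : ℂ) ρ,
      w + ζ • v ∈ Metric.closedBall w₀ r := by
    intro w hw ζ hζ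
    rw [mem_closedBall_iff_norm] at *
    rw [mem_ball_iff_norm] at hw
    calc ‖w + ζ • v - w₀‖ = ‖(w - w₀) + ζ • v‖ := by congr 1; abel
      _ ≤ ‖w - w₀‖ + ‖ζ • v‖ := norm_add_le _ _
      _ ≤ r / 2 + r / 2 := by
          refine add_le_add hw.le (le_trans ?_ hρv)
          rw [norm_smul]
          gcongr
          simpa using hζ
      _ = r := by ring
  have hdU : ∀ z ∈ Metric.closedBall w₀ r, DifferentiableAt ℂ g z := fun z hz =>
    hg.differentiableAt (hU.mem_nhds (hrU (Metric.closedBall_subset_closedBall (by linarith) hz)))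
  have hform : ∀ w ∈ Metric.ball w₀ (r / 2), fderiv ℂ g w v = (2 * Real.pi * Complex.I : ℂ)⁻¹ •
      ∮ ζ in C(0, ρ), (ζ - 0) ^ (-2 : ℤ) • g (w + ζ • v) := by
    intro w hw
    have hd : ∀ ζ ∈ Metric.closedBall (0 : ℂ) ρ,
        HasDerivAt (fun ζ : ℂ => g (w + ζ • v)) (fderiv ℂ g (w + ζ • v) v) ζ := by
      intro ζ hζ
      have h1 := (hdU _ (hmem w hw ζ hζ)).hasFDerivAt
      have h2 : HasDerivAt (fun ζ : ℂ => w + ζ • v) v ζ := by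
        simpa using ((hasDerivAt_id ζ).smul_const v).const_add w
      exact h1.comp_hasDerivAt ζ h2
    have h3 := DifferentiableOn.deriv_eq_smul_circleIntegral (c := (0 : ℂ)) (R := ρ)
      (f := fun ζ : ℂ => g (w + ζ • v)) hρ
      (fun ζ hζ => (hd ζ hζ).differentiableAt.differentiableWithinAt)
    rw [(hd 0 (Metric.mem_closedBall_self hρ.le)).deriv] at h3
    have h4 : ∀ ζ : ℂ, (ζ - 0) ^ (-2 : ℤ) = 1 / (ζ - 0) ^ 2 := fun ζ => by
      rw [zpow_neg, one_div]; norm_cast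
    simp only [h4]
    rw [h3, smul_smul, inv_mul_cancel₀ Complex.two_pi_I_ne_zero, one_smul]
    simp
  have hball : Metric.ball w₀ (r / 2) ∈ 𝓝 w₀ := Metric.ball_mem_nhds _ (half_pos hr)
  have hcm : ∀ θ : ℝ, circleMap 0 ρ θ ∈ Metric.closedBall (0 : ℂ) ρ := fun θ =>
    circleMap_mem_closedBall _ hρ.le _
  set c : ℝ → ℂ := fun θ => deriv (circleMap 0 ρ) θ * (circleMap 0 ρ θ - 0) ^ (-2 : ℤ) with hc
  have hcc : Continuous c := by
    simp only [hc, deriv_circleMap]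
    refine Continuous.mul (by fun_prop) ?_
    refine Continuous.zpow₀ (by fun_prop) _ fun θ => Or.inl ?_
    simpa using hρ.ne'
  have hgc : ∀ w ∈ Metric.ball w₀ (r / 2), Continuous fun θ => c θ • g (w + circleMap 0 ρ θ • v) := by
    intro w hw
    refine hcc.smul (continuous_iff_continuousAt.2 fun θ => ?_)
    exact ContinuousAt.comp (f := fun θ => w + circleMap 0 ρ θ • v)
      (hdU _ (hmem w hw _ (hcm θ))).continuousAt (by fun_prop)
  have hlip : LipschitzOnWith (Real.toNNReal C) g (Metric.closedBall w₀ r) := by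
    refine Convex.lipschitzOnWith_of_nnnorm_fderiv_le (𝕜 := ℂ) hdU (fun z hz => ?_)
      (convex_closedBall _ _)
    rw [← NNReal.coe_le_coe, Real.coe_toNNReal _ hC0]
    exact hC z hz
  have key := (intervalIntegral.hasFDerivAt_integral_of_dominated_loc_of_lip (𝕜 := ℂ)
    (μ := MeasureTheory.volume) (s := Metric.ball w₀ (r / 2)) (a := 0) (b := 2 * Real.pi)
    (bound := fun θ => ‖c θ‖ * C) (F := fun w θ => c θ • g (w + circleMap 0 ρ θ • v))
    (F' := fun θ => c θ • fderiv ℂ g (w₀ + circleMap 0 ρ θ • v)) (x₀ := w₀)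
    hball ?_ ?_ ?_ ?_ ?_ ?_).2
  · have hd : DifferentiableAt ℂ (fun w => (2 * Real.pi * Complex.I : ℂ)⁻¹ •
        ∮ ζ in C(0, ρ), (ζ - 0) ^ (-2 : ℤ) • g (w + ζ • v)) w₀ := by
      refine DifferentiableAt.const_smul ?_ _
      convert key.differentiableAt using 2 with w
      simp only [circleIntegral, hc, smul_smul]
    exact hd.congr_of_eventuallyEq (Filter.eventually_of_mem hball hform)
  · exact Filter.eventually_of_mem hball fun w hw => (hgc w hw).aestronglyMeasurable
  · exact (hgc w₀ (Metric.mem_ball_self (half_pos hr))).intervalIntegrable _ _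
  · let _ : MeasurableSpace E := borel E
    have : BorelSpace E := ⟨rfl⟩
    have h1 : Measurable fun θ => fderiv ℂ g (w₀ + circleMap 0 ρ θ • v) :=
      (measurable_fderiv ℂ g).comp
        (Continuous.measurable (f := fun θ => w₀ + circleMap 0 ρ θ • v) (by fun_prop))
    exact (hcc.aestronglyMeasurable).smul h1.aestronglyMeasurable
  · refine Filter.Eventually.of_forall fun θ _ => ?_
    rw [lipschitzOnWith_iff_norm_sub_le]
    intro w hw w' hw'
    have h2 := (lipschitzOnWith_iff_norm_sub_le.1 hlip) (hmem w hw _ (hcm θ))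
      (hmem w' hw' _ (hcm θ))
    rw [← smul_sub, norm_smul]
    rw [Real.coe_toNNReal _ hC0] at h2
    have h3 : (w + circleMap 0 ρ θ • v) - (w' + circleMap 0 ρ θ • v) = w - w' := by abel
    rw [h3] at h2
    rw [Real.coe_nnabs, abs_of_nonneg (by positivity), mul_assoc]
    gcongr
  · exact (hcc.norm.mul continuous_const).intervalIntegrable _ _
  · refine Filter.Eventually.of_forall fun θ _ => ?_
    have h1 := (hdU _ (hmem w₀ (Metric.mem_ball_self (half_pos hr)) _ (hcm θ))).hasFDerivAt
    have h2 : HasFDerivAt (fun w => w + circleMap 0 ρ θ • v) (ContinuousLinearMap.id ℂ E) w₀ :=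
      (hasFDerivAt_id w₀).add_const _
    exact (h1.comp w₀ h2).const_smul (c θ)

theorem differentiableOn_fderiv_of_isOpen {g : E → F} {U : Set E} (hU : IsOpen U)
    (hg : DifferentiableOn ℂ g U) : DifferentiableOn ℂ (fderiv ℂ g) U := by
  let b := Module.finBasis ℂ E
  let L : (E →L[ℂ] F) →ₗ[ℂ] (Fin (Module.finrank ℂ E) → F) :=
    { toFun := fun A i => A (b i), map_add' := fun _ _ => rfl, map_smul' := fun _ _ => rfl }
  have hL : LinearMap.ker L = ⊥ := by
    rw [LinearMap.ker_eq_bot]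
    intro A B h
    apply ContinuousLinearMap.coe_injective
    exact b.ext fun i => congrFun h i
  obtain ⟨R, hR⟩ := L.exists_leftInverse_of_injective hL
  have h1 : DifferentiableOn ℂ (fun w => LinearMap.toContinuousLinearMap R
      (fun i => fderiv ℂ g w (b i))) U :=
    (LinearMap.toContinuousLinearMap R).differentiable.comp_differentiableOn
      (differentiableOn_pi.2 fun i => differentiableOn_fderiv_apply hU hg (b i))
  refine h1.congr fun w _ => ?_
  exact (LinearMap.congr_fun hR (fderiv ℂ g w)).symm

theorem contDiffOn_of_differentiableOn_complex (m : ℕ) :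
    ∀ {F : Type} [NormedAddCommGroup F] [NormedSpace ℂ F] [FiniteDimensional ℂ F]
    {g : E → F} {U : Set E}, IsOpen U → DifferentiableOn ℂ g U → ContDiffOn ℂ m g U := by
  induction m with
  | zero =>
    intro F _ _ _ g U _ hg
    exact contDiffOn_zero.2 hg.continuousOn
  | succ m ih =>
    intro F _ _ _ g U hU hg
    exact (contDiffOn_succ_iff_fderiv_of_isOpen hU).2 ⟨hg, fun h => absurd h (WithTop.natCast_ne_top _),
      ih hU (differentiableOn_fderiv_of_isOpen hU hg)⟩

theorem contDiffOn_infty_of_differentiableOn_complex {g : E → F} {U : Set E} (hU : IsOpen U)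
    (hg : DifferentiableOn ℂ g U) : ContDiffOn ℂ ∞ g U :=
  contDiffOn_infty.2 fun m => contDiffOn_of_differentiableOn_complex m hU hg

end Osgood

end GenKahler

end

noncomputable section

namespace GenKahler

/-! ### Hermitian forms and their determinants -/

section HermLinAlg

open scoped ComplexOrder

variable {V : Type*} [AddCommGroup V] [Module ℝ V] [TopologicalSpace V]

/-- The sesquilinear form of a `J`-invariant symmetric form. -/
def cform (J : V → V) (h : V → V → ℝ) (v w : V) : ℂ :=
  (((h v w : ℝ) : ℂ) - Complex.I * ((h (J v) w : ℝ) : ℂ)) / 2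

/-- The Gram matrix of the sesquilinear form. -/
def cgram (J : V → V) (h : V → V → ℝ) {k : ℕ} (Z : Fin k → V) : Matrix (Fin k) (Fin k) ℂ :=
  Matrix.of fun a b => cform J h (Z a) (Z b)

/-- The determinant of the sesquilinear form. -/
def cdet (J : V → V) (h : V → V → ℝ) {k : ℕ} (Z : Fin k → V) : ℝ :=
  (cgram J h Z).det.re

/-- The action of complex numbers on a real vector space with complex structure `J`. -/
def cact (J : V → V) (c : ℂ) (v : V) : V := c.re • v + c.im • J v

/-- `h` is a positive definite `J`-Hermitian form on the `J`-stable subspace `D`. -/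
structure IsHermOn (J : V →L[ℝ] V) (D : Submodule ℝ V) (h : V →L[ℝ] V →L[ℝ] ℝ) : Prop where
  J_J : ∀ v, J (J v) = -v
  stable : ∀ v ∈ D, J v ∈ D
  symm : ∀ v ∈ D, ∀ w ∈ D, h v w = h w v
  pos : ∀ v ∈ D, v ≠ 0 → 0 < h v v
  map_J : ∀ v ∈ D, ∀ w ∈ D, h (J v) (J w) = h v w

/-- `Z` is a complex basis of `D`. -/
def IsCBasis (J : V → V) (D : Submodule ℝ V) {k : ℕ} (Z : Fin k → V) : Prop :=
  (∀ a, Z a ∈ D) ∧ (∀ a, J (Z a) ∈ D) ∧ ∀ v ∈ D, ∃! c : Fin k → ℂ, v = ∑ a, cact J (c a) (Z a)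

variable {J : V →L[ℝ] V} {D : Submodule ℝ V} {h : V →L[ℝ] V →L[ℝ] ℝ}

theorem IsHermOn.mono (H : IsHermOn J D h) {D' : Submodule ℝ V} (hD : D' ≤ D)
    (hs : ∀ v ∈ D', J v ∈ D') : IsHermOn J D' h :=
  ⟨H.J_J, hs, fun v hv w hw => H.symm v (hD hv) w (hD hw), fun v hv => H.pos v (hD hv),
    fun v hv w hw => H.map_J v (hD hv) w (hD hw)⟩

theorem IsHermOn.cact_mem (H : IsHermOn J D h) (c : ℂ) {v : V} (hv : v ∈ D) : cact J c v ∈ D :=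
  D.add_mem (D.smul_mem _ hv) (D.smul_mem _ (H.stable v hv))

theorem IsHermOn.J_left (H : IsHermOn J D h) {v w : V} (hv : v ∈ D) (hw : w ∈ D) :
    h (J v) w = -h v (J w) := by
  have := H.map_J (J v) (H.stable v hv) w hw
  rw [H.J_J, map_neg] at this
  simpa using this.symm

theorem cform_add_left (v v' w : V) :
    cform J (fun a b => h a b) (v + v') w
      = cform J (fun a b => h a b) v w + cform J (fun a b => h a b) v' w := by
  simp only [cform, map_add, add_apply]
  push_cast; ring

theorem cform_sum_left {ι : Type*} (s : Finset ι) (v : ι → V) (w : V) :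
    cform J (fun a b => h a b) (∑ i ∈ s, v i) w = ∑ i ∈ s, cform J (fun a b => h a b) (v i) w := by
  classical
  induction s using Finset.induction_on with
  | empty => simp [cform]
  | insert i s hi ih => rw [Finset.sum_insert hi, Finset.sum_insert hi, cform_add_left, ih]

theorem IsHermOn.cform_cact_left (H : IsHermOn J D h) (c : ℂ) (v w : V) :
    cform J (fun a b => h a b) (cact J c v) w = c * cform J (fun a b => h a b) v w := by
  have e : c = c.re + c.im * Complex.I := (Complex.re_add_im c).symm
  conv_rhs => rw [e]
  simp only [cform, cact, map_add, map_smul, add_apply, smul_apply, H.J_J, map_neg, neg_apply,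
    smul_eq_mul]
  push_cast
  linear_combination (c.im * (h (J v)) w / 2 : ℂ) * Complex.I_mul_I

theorem IsHermOn.cform_conj (H : IsHermOn J D h) {v w : V} (hv : v ∈ D) (hw : w ∈ D) :
    cform J (fun a b => h a b) w v = starRingEnd ℂ (cform J (fun a b => h a b) v w) := by
  simp only [cform, map_div₀, map_sub, map_mul, Complex.conj_ofReal, Complex.conj_I]
  rw [H.J_left hw hv, H.symm w hw v hv, H.symm w hw (J v) (H.stable v hv)]
  have : starRingEnd ℂ 2 = 2 := Complex.conj_ofNat 2
  rw [this]
  push_cast; ring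

theorem IsHermOn.cform_self (H : IsHermOn J D h) {v : V} (hv : v ∈ D) :
    cform J (fun a b => h a b) v v = ((h v v / 2 : ℝ) : ℂ) := by
  have h1 : h (J v) v = 0 := by
    have h2 := H.J_left hv hv
    rw [H.symm v hv _ (H.stable v hv)] at h2
    linarith
  simp [cform, h1]

/-- Change of frame for the Gram matrix. -/
theorem IsHermOn.cgram_change (H : IsHermOn J D h) {k : ℕ} {Z Z' : Fin k → V}
    (hZ : ∀ a, Z a ∈ D) (B : Matrix (Fin k) (Fin k) ℂ)
    (hB : ∀ a, Z' a = ∑ c, cact J (B a c) (Z c)) :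
    cgram J (fun a b => h a b) Z' = B * cgram J (fun a b => h a b) Z * B.conjTranspose := by
  have hs : ∀ a, ∑ c, cact J (B a c) (Z c) ∈ D := fun a =>
    D.sum_mem fun c _ => H.cact_mem _ (hZ c)
  ext a b
  simp only [cgram, Matrix.of_apply, Matrix.mul_apply, Matrix.conjTranspose_apply, hB]
  rw [cform_sum_left, Finset.sum_congr rfl fun c _ => H.cform_cact_left _ _ _]
  have h1 : ∀ c, cform J (fun a b => h a b) (Z c) (∑ d, cact J (B b d) (Z d))
      = ∑ d, cform J (fun a b => h a b) (Z c) (Z d) * star (B b d) := fun c => by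
    rw [H.cform_conj (hs b) (hZ c), cform_sum_left, map_sum]
    refine Finset.sum_congr rfl fun d _ => ?_
    rw [H.cform_cact_left, map_mul, ← H.cform_conj (hZ d) (hZ c), mul_comm]
    rfl
  simp only [h1, Finset.mul_sum, Finset.sum_mul]
  rw [Finset.sum_comm]
  refine Finset.sum_congr rfl fun d _ => Finset.sum_congr rfl fun c _ => by ring

theorem IsHermOn.cdet_change (H : IsHermOn J D h) {k : ℕ} {Z Z' : Fin k → V}
    (hZ : ∀ a, Z a ∈ D) (B : Matrix (Fin k) (Fin k) ℂ)
    (hB : ∀ a, Z' a = ∑ c, cact J (B a c) (Z c)) :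
    cdet J (fun a b => h a b) Z' = Complex.normSq B.det * cdet J (fun a b => h a b) Z := by
  rw [cdet, H.cgram_change hZ B hB, Matrix.det_mul, Matrix.det_mul, Matrix.det_conjTranspose,
    mul_right_comm]
  have : B.det * star B.det = ((Complex.normSq B.det : ℝ) : ℂ) := Complex.mul_conj _
  rw [this, Complex.re_ofReal_mul, cdet]

theorem IsHermOn.posDef_cgram (H : IsHermOn J D h) {k : ℕ} {Z : Fin k → V}
    (hZ : IsCBasis J D Z) : (cgram J (fun a b => h a b) Z).PosDef := by
  rw [Matrix.posDef_iff_dotProduct_mulVec]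
  refine ⟨?_, fun x hx => ?_⟩
  · ext a b
    exact (H.cform_conj (hZ.1 b) (hZ.1 a)).symm
  · set v : V := ∑ a, cact J (star (x a)) (Z a) with hv
    have hvD : v ∈ D := D.sum_mem fun c _ => H.cact_mem _ (hZ.1 c)
    have hv0 : v ≠ 0 := by
      intro h0
      obtain ⟨c, _, hu⟩ := hZ.2.2 0 D.zero_mem
      have h1 := hu (fun a => star (x a)) h0.symm
      have h2 := hu (fun _ => 0) (by simp [cact])
      apply hx
      ext a
      have := congrFun (h1.trans h2.symm) a
      simpa using this
    have h3 : star x ⬝ᵥ (cgram J (fun a b => h a b) Z).mulVec x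
        = cform J (fun a b => h a b) v v := by
      rw [hv, cform_sum_left]
      simp only [dotProduct, Matrix.mulVec, cgram, Matrix.of_apply]
      refine Finset.sum_congr rfl fun a _ => ?_
      rw [H.cform_cact_left]
      congr 1
      rw [← hv, H.cform_conj hvD (hZ.1 a), hv, cform_sum_left, map_sum]
      refine Finset.sum_congr rfl fun b _ => ?_
      rw [H.cform_cact_left, map_mul, ← H.cform_conj (hZ.1 b) (hZ.1 a), mul_comm]
      simp
    rw [h3, H.cform_self hvD]
    exact_mod_cast half_pos (H.pos v hvD hv0)

theorem IsHermOn.cdet_pos (H : IsHermOn J D h) {k : ℕ} {Z : Fin k → V}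
    (hZ : IsCBasis J D Z) : 0 < cdet J (fun a b => h a b) Z :=
  (Complex.pos_iff.1 (H.posDef_cgram hZ).det_pos).1

theorem IsHermOn.det_cgram (H : IsHermOn J D h) {k : ℕ} {Z : Fin k → V}
    (hZ : IsCBasis J D Z) :
    (cgram J (fun a b => h a b) Z).det = (cdet J (fun a b => h a b) Z : ℂ) := by
  have := (Complex.pos_iff.1 (H.posDef_cgram hZ).det_pos).2
  exact Complex.ext (by simp [cdet]) (by simpa using this.symm)

theorem IsCBasis.finrank {k : ℕ} {Z : Fin k → V} (hZ : IsCBasis J D Z) :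
    Module.finrank ℝ D = 2 * k := by
  let L : (Fin k → ℂ) →ₗ[ℝ] D :=
    { toFun := fun c => ⟨∑ a, cact J (c a) (Z a), D.sum_mem fun a _ =>
        D.add_mem (D.smul_mem _ (hZ.1 a)) (D.smul_mem _ (hZ.2.1 a))⟩
      map_add' := fun c d => by
        ext
        simp only [cact, Pi.add_apply, Complex.add_re, Complex.add_im, Submodule.coe_add,
          ← Finset.sum_add_distrib]
        refine Finset.sum_congr rfl fun a _ => ?_
        module
      map_smul' := fun r c => by
        ext
        simp only [cact, Pi.smul_apply, Complex.smul_re, Complex.smul_im, RingHom.id_apply,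
          Submodule.coe_smul, Finset.smul_sum, smul_eq_mul]
        refine Finset.sum_congr rfl fun a _ => ?_
        module }
  have hL : Function.Bijective L := by
    constructor
    · intro c d hcd
      obtain ⟨e, _, hu⟩ := hZ.2.2 (L c) (L c).2
      exact (hu c rfl).trans (hu d (by rw [hcd]; rfl)).symm
    · rintro ⟨v, hv⟩
      obtain ⟨c, hc, _⟩ := hZ.2.2 v hv
      exact ⟨c, Subtype.ext hc.symm⟩
  have := (LinearEquiv.ofBijective L hL).finrank_eq
  rw [← this]
  simp [Module.finrank_pi_fintype, Complex.finrank_real_complex, mul_comm]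

theorem IsCBasis.exists_matrix {k : ℕ} {Z Z' : Fin k → V} (hZ : IsCBasis J D Z)
    (hZ' : ∀ a, Z' a ∈ D) :
    ∃ B : Matrix (Fin k) (Fin k) ℂ, ∀ a, Z' a = ∑ c, cact J (B a c) (Z c) := by
  choose B hB _ using fun a => hZ.2.2 (Z' a) (hZ' a)
  exact ⟨B, hB⟩

end HermLinAlg

/-! ### Pluriharmonic functions -/

section Pluriharmonic

/-- The real part of a holomorphic function is smooth and pluriharmonic. -/
theorem pluriharmonic_re {n : ℕ} {F : CE n → ℂ} {U : Set (CE n)} (hU : IsOpen U)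
    (hF : DifferentiableOn ℂ F U) {w : CE n} (hw : w ∈ U) :
    ContDiffAt ℝ ∞ (fun z => (F z).re) w ∧ fiddbar (mulI n) (fun z => (F z).re) w = 0 := by
  have hsm : ContDiffAt ℝ ∞ (fun z => (F z).re) w :=
    Complex.reCLM.contDiff.contDiffAt.comp w
      (((contDiffOn_infty_of_differentiableOn_complex hU hF).contDiffAt
        (hU.mem_nhds hw)).restrict_scalars ℝ)
  refine ⟨hsm, two_form_ext fun X Y => ?_⟩
  have h2 : ContDiffAt ℝ 2 (fun z => (F z).re) w := hsm.of_le two_le_infty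
  rw [fiddbar_apply h2]
  have hD : ∀ z ∈ U, fderiv ℝ (fun z => (F z).re) z
      = Complex.reCLM.comp ((fderiv ℂ F z).restrictScalars ℝ) := fun z hz => by
    have h1 : HasFDerivAt F (fderiv ℂ F z) z := (hF.differentiableAt (hU.mem_nhds hz)).hasFDerivAt
    exact (Complex.reCLM.hasFDerivAt.comp z (h1.restrictScalars ℝ)).fderiv
  have hF' := differentiableOn_fderiv_of_isOpen hU hF
  have hDD : ∀ X Y : CE n, fderiv ℝ (fderiv ℝ (fun z => (F z).re)) w X Y
      = (fderiv ℂ (fderiv ℂ F) w X Y).re := fun X Y => by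
    have e : fderiv ℝ (fun z => (F z).re) =ᶠ[𝓝 w] fun z =>
        Complex.reCLM.comp ((fderiv ℂ F z).restrictScalars ℝ) :=
      Filter.eventually_of_mem (hU.mem_nhds hw) hD
    have h3 := ((hF'.differentiableAt (hU.mem_nhds hw)).hasFDerivAt).restrictScalars ℝ
    have h4 : HasFDerivAt (fun z => Complex.reCLM.comp ((fderiv ℂ F z).restrictScalars ℝ))
        (((ContinuousLinearMap.compL ℝ (CE n) ℂ ℝ Complex.reCLM) ∘L
          (ContinuousLinearMap.restrictScalarsL ℂ (CE n) ℂ ℝ ℝ)) ∘L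
          (fderiv ℂ (fderiv ℂ F) w).restrictScalars ℝ) w :=
      ((ContinuousLinearMap.compL ℝ (CE n) ℂ ℝ Complex.reCLM) ∘L
          (ContinuousLinearMap.restrictScalarsL ℂ (CE n) ℂ ℝ ℝ)).hasFDerivAt.comp w h3
    rw [e.fderiv_eq, h4.fderiv]
    rfl
  have hsymm : fderiv ℂ (fderiv ℂ F) w X Y = fderiv ℂ (fderiv ℂ F) w Y X :=
    (((contDiffOn_infty_of_differentiableOn_complex hU hF).contDiffAt
      (hU.mem_nhds hw)).isSymmSndFDerivAt (by simpa using two_le_infty)) X Y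
  rw [hDD, hDD, mulI_apply, mulI_apply, map_smul, map_smul, hsymm]
  simp

/-- `log |f|²` is smooth and pluriharmonic where the holomorphic function `f` does not vanish. -/
theorem pluriharmonic_log_normSq {n : ℕ} {f : CE n → ℂ} {U : Set (CE n)} (hU : IsOpen U)
    (hf : DifferentiableOn ℂ f U) {w : CE n} (hw : w ∈ U) (h0 : f w ≠ 0) :
    ContDiffAt ℝ ∞ (fun z => Real.log (Complex.normSq (f z))) w ∧
      fiddbar (mulI n) (fun z => Real.log (Complex.normSq (f z))) w = 0 := by
  have hc : ContinuousOn (fun z => f z / f w) U := hf.continuousOn.div_const _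
  set U' := U ∩ (fun z => f z / f w) ⁻¹' Complex.slitPlane with hU'
  have hU'o : IsOpen U' := hc.isOpen_inter_preimage hU Complex.isOpen_slitPlane
  have hw' : w ∈ U' := ⟨hw, by simp [div_self h0]⟩
  have hL : DifferentiableOn ℂ (fun z => 2 * Complex.log (f z / f w)
      + (Real.log (Complex.normSq (f w)) : ℂ)) U' :=
    (DifferentiableOn.const_mul (DifferentiableOn.clog
      (by simpa only [div_eq_mul_inv] using (hf.mono Set.inter_subset_left).mul_const (f w)⁻¹)
      fun z hz => hz.2) 2).add_const _
  have e : (fun z => Real.log (Complex.normSq (f z))) =ᶠ[𝓝 w] fun z =>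
      (2 * Complex.log (f z / f w) + (Real.log (Complex.normSq (f w)) : ℂ)).re := by
    filter_upwards [hU'o.mem_nhds hw'] with z hz
    have hz0 : f z ≠ 0 := by
      intro h
      have := hz.2
      simp [h] at this
    simp only [Complex.add_re, Complex.mul_re, Complex.log_re, Complex.ofReal_re, Complex.re_ofNat,
      Complex.im_ofNat, zero_mul, sub_zero, norm_div, Complex.normSq_eq_norm_sq]
    rw [Real.log_div (norm_ne_zero_iff.2 hz0) (norm_ne_zero_iff.2 h0), Real.log_pow, Real.log_pow]
    push_cast; ring
  have h := pluriharmonic_re hU'o hL hw'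
  exact ⟨h.1.congr_of_eventuallyEq e, (fiddbar_congr e).trans h.2⟩

end Pluriharmonic

end GenKahler

end

noncomputable section

namespace GenKahler

theorem contDiffWithinAt_det {F : Type*} [NormedAddCommGroup F] [NormedSpace ℝ F] {𝔸 : Type*}
    [NormedCommRing 𝔸] [NormedAlgebra ℝ 𝔸] {ι : Type*} [Fintype ι] [DecidableEq ι]
    {m : WithTop ℕ∞} {A : F → Matrix ι ι 𝔸} {s : Set F} {w : F}
    (h : ∀ i j, ContDiffWithinAt ℝ m (fun w => A w i j) s w) :
    ContDiffWithinAt ℝ m (fun w => (A w).det) s w := by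
  simp only [Matrix.det_apply']
  exact ContDiffWithinAt.sum fun σ _ => contDiffWithinAt_const.mul
    (contDiffWithinAt_prod fun i _ => h _ _)

theorem differentiableOn_det {F : Type*} [NormedAddCommGroup F] [NormedSpace ℂ F]
    {ι : Type*} [Fintype ι] [DecidableEq ι]
    {A : F → Matrix ι ι ℂ} {s : Set F}
    (h : ∀ i j, DifferentiableOn ℂ (fun w => A w i j) s) :
    DifferentiableOn ℂ (fun w => (A w).det) s := by
  simp only [Matrix.det_apply']
  exact DifferentiableOn.fun_sum fun σ _ => (differentiableOn_const _).mul
    fun w hw =>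
    (HasFDerivWithinAt.finsetProd fun i _ =>
      (h (σ i) i w hw).hasFDerivWithinAt).differentiableWithinAt

section FlatAdd

variable {E : Type*} [NormedAddCommGroup E] [NormedSpace ℝ E]

theorem fderiv_fderiv_add {u v : E → ℝ} {w : E} (hu : ContDiffAt ℝ 2 u w)
    (hv : ContDiffAt ℝ 2 v w) :
    fderiv ℝ (fderiv ℝ (fun z => u z + v z)) w
      = fderiv ℝ (fderiv ℝ u) w + fderiv ℝ (fderiv ℝ v) w := by
  have e : fderiv ℝ (fun z => u z + v z) =ᶠ[𝓝 w] fun z => fderiv ℝ u z + fderiv ℝ v z := by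
    filter_upwards [hu.eventually (by simp), hv.eventually (by simp)] with z h1 h2
    exact fderiv_fun_add (h1.differentiableAt (by simp)) (h2.differentiableAt (by simp))
  rw [e.fderiv_eq, fderiv_fun_add (differentiableAt_fderiv_of_contDiffAt hu)
    (differentiableAt_fderiv_of_contDiffAt hv)]

theorem fderiv_fderiv_const_mul {u : E → ℝ} {w : E} (hu : ContDiffAt ℝ 2 u w) (c : ℝ) :
    fderiv ℝ (fderiv ℝ (fun z => c * u z)) w = c • fderiv ℝ (fderiv ℝ u) w := by
  have e : fderiv ℝ (fun z => c * u z) =ᶠ[𝓝 w] fun z => c • fderiv ℝ u z := by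
    filter_upwards [hu.eventually (by simp)] with z h1
    exact fderiv_const_mul (h1.differentiableAt (by simp)) c
  rw [e.fderiv_eq, fderiv_fun_const_smul (differentiableAt_fderiv_of_contDiffAt hu)]

theorem fiddbar_add {J : E →L[ℝ] E} {u v : E → ℝ} {w : E} (hu : ContDiffAt ℝ 2 u w)
    (hv : ContDiffAt ℝ 2 v w) :
    fiddbar J (fun z => u z + v z) w = fiddbar J u w + fiddbar J v w := by
  refine two_form_ext fun X Y => ?_
  rw [fiddbar_apply (hu.add hv), ContinuousAlternatingMap.add_apply, fiddbar_apply hu,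
    fiddbar_apply hv, fderiv_fderiv_add hu hv]
  simp only [add_apply]; ring

theorem fiddbar_const_mul {J : E →L[ℝ] E} {u : E → ℝ} {w : E} (hu : ContDiffAt ℝ 2 u w) (c : ℝ) :
    fiddbar J (fun z => c * u z) w = c • fiddbar J u w := by
  refine two_form_ext fun X Y => ?_
  rw [fiddbar_apply (contDiffAt_const.mul hu), ContinuousAlternatingMap.smul_apply,
    fiddbar_apply hu, fderiv_fderiv_const_mul hu]
  simp only [smul_apply, smul_eq_mul]; ring

theorem fiddbar_sub {J : E →L[ℝ] E} {u v : E → ℝ} {w : E} (hu : ContDiffAt ℝ 2 u w)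
    (hv : ContDiffAt ℝ 2 v w) :
    fiddbar J (fun z => u z - v z) w = fiddbar J u w - fiddbar J v w := by
  have h := fiddbar_add (J := J) hu (contDiffAt_const.mul hv (f := fun _ => (-1 : ℝ)))
  rw [fiddbar_const_mul hv] at h
  have e : (fun z => u z - v z) = fun z => u z + -1 * v z := by funext z; ring
  rw [e, h]
  ext x
  simp [sub_eq_add_neg]

end FlatAdd

variable {n : ℕ} {M : Type*} [TopologicalSpace M] [ChartedSpace (Model n) M]

/-- The bilinear form `g(X, Y) = ω₁(X, J Y)`, as a continuous bilinear map. -/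
def metricBil (J : EndField n M) (ω₁ : Form n M 2) : BilinField n M := fun x =>
  (show Model n →L[ℝ] Model n →L[ℝ] ℝ from
    ((toBil (Model n) (ω₁ x)).flip.comp (J x : Model n →L[ℝ] Model n)).flip)

theorem metricBil_apply (J : EndField n M) (ω₁ : Form n M 2) (x : M) (X Y : TS n x) :
    metricBil J ω₁ x X Y = metricOf J ω₁ x X Y :=
  toBil_apply (E := Model n) (ω₁ x) X (J x Y)

theorem metricOf_eq (J : EndField n M) (ω₁ : Form n M 2) :
    metricOf J ω₁ = fun x X Y => metricBil J ω₁ x X Y := by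
  funext x X Y; exact (metricBil_apply J ω₁ x X Y).symm

/-- The coordinate expression of a field of bilinear forms. -/
def pullBil {E : Type*} [NormedAddCommGroup E] [NormedSpace ℝ E]
    (φ : OpenPartialHomeomorph M E) (h : BilinField n M) (w : E) : E →L[ℝ] E →L[ℝ] ℝ :=
  (show Model n →L[ℝ] Model n →L[ℝ] ℝ from h (φ.symm w)).bilinearComp
    (show E →L[ℝ] Model n from dSymm φ w) (show E →L[ℝ] Model n from dSymm φ w)

@[simp] theorem pullBil_apply {E : Type*} [NormedAddCommGroup E] [NormedSpace ℝ E]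
    (φ : OpenPartialHomeomorph M E) (h : BilinField n M) (w X Y : E) :
    pullBil φ h w X Y = h (φ.symm w) (dSymm φ w X) (dSymm φ w Y) := rfl

section Chern

variable {J : EndField n M} {φ : OpenPartialHomeomorph M (CE n)}

theorem hermDet_chart (hφ : IsHoloChart J φ) (h : BilinField n M) {w : CE n} (hw : w ∈ φ.target)
    {k : ℕ} (Z : Fin k → TS n (φ.symm w)) :
    hermDet J (φ.symm w) (fun X Y => h (φ.symm w) X Y) Z
      = cdet (mulI n) (fun X Y => pullBil φ h w X Y) (fun a => dChart φ (φ.symm w) (Z a)) := by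
  show (cgram (J (φ.symm w)) (fun X Y => h (φ.symm w) X Y) Z).det.re
    = (cgram (mulI n) (fun X Y => pullBil φ h w X Y) (fun a => dChart φ (φ.symm w) (Z a))).det.re
  congr 2
  ext a b
  simp only [cgram, Matrix.of_apply, cform, pullBil_apply]
  rw [dSymm_mulI hφ hw, dSymm_dChart hφ.isSmoothChart hw, dSymm_dChart hφ.isSmoothChart hw]

theorem contDiffWithinAt_cdet {F : Type*} [NormedAddCommGroup F] [NormedSpace ℝ F]
    {E : Type*} [NormedAddCommGroup E] [NormedSpace ℝ E] {m : WithTop ℕ∞}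
    (J : E →L[ℝ] E) {H : F → E →L[ℝ] E →L[ℝ] ℝ} {k : ℕ} {Z : Fin k → F → E} {s : Set F} {w : F}
    (hH : ContDiffWithinAt ℝ m H s w) (hZ : ∀ a, ContDiffWithinAt ℝ m (Z a) s w) :
    ContDiffWithinAt ℝ m (fun w => cdet J (fun X Y => H w X Y) (fun a => Z a w)) s w := by
  refine Complex.reCLM.contDiff.contDiffAt.comp_contDiffWithinAt w (contDiffWithinAt_det ?_)
  intro a b
  simp only [cgram, cform, Matrix.of_apply, div_eq_mul_inv]
  refine ContDiffWithinAt.mul (ContDiffWithinAt.sub ?_ (contDiffWithinAt_const.mul ?_))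
    contDiffWithinAt_const
  · exact Complex.ofRealCLM.contDiff.contDiffAt.comp_contDiffWithinAt w
      ((hH.clm_apply (hZ a)).clm_apply (hZ b))
  · exact Complex.ofRealCLM.contDiff.contDiffAt.comp_contDiffWithinAt w
      ((hH.clm_apply (J.contDiff.contDiffAt.comp_contDiffWithinAt w (hZ a))).clm_apply (hZ b))

theorem dChart_cact (hφ : IsHoloChart J φ) {x : M} (hx : x ∈ φ.source) (c : ℂ) (v : TS n x) :
    dChart φ x (cact (J x) c v) = c • dChart φ x v := by
  rw [cact, map_add, map_smul, map_smul]
  have : dChart φ x (J x v) = Complex.I • dChart φ x v := hφ.map_J x hx v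
  rw [this]
  conv_rhs => rw [← Complex.re_add_im c, add_smul, mul_smul]
  rfl

/-- Two holomorphic frames of a subbundle differ by a function whose `log |·|²` is pluriharmonic. -/
theorem exists_pluriharmonic_frame_change (hφ : IsHoloChart J φ)
    {D : ∀ x : M, Submodule ℝ (TS n x)} {h : BilinField n M} {U U' : Set M}
    (hD : ∀ y ∈ U, IsHermOn (J y) (D y) (h y)) {k k' : ℕ} {Z : Fin k → ∀ x : M, TS n x}
    {Z' : Fin k' → ∀ x : M, TS n x} (hZ : IsHoloFrame J D U Z) (hZ' : IsHoloFrame J D U' Z')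
    {w : CE n} (hw : w ∈ φ.target) (hwU : φ.symm w ∈ U) (hwU' : φ.symm w ∈ U') :
    ∃ p : CE n → ℝ, ContDiffAt ℝ ∞ p w ∧ fiddbar (mulI n) p w = 0 ∧ ∀ᶠ z in 𝓝 w,
      Real.log (hermDet J (φ.symm z) (fun X Y => h (φ.symm z) X Y) (fun a => Z' a (φ.symm z)))
      = Real.log (hermDet J (φ.symm z) (fun X Y => h (φ.symm z) X Y) (fun a => Z a (φ.symm z)))
        + p z := by
  have hk : k = k' := by
    have h1 := IsCBasis.finrank (J := J (φ.symm w)) (hZ.basis _ hwU)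
    have h2 := IsCBasis.finrank (J := J (φ.symm w)) (hZ'.basis _ hwU')
    omega
  subst hk
  set V : Set (CE n) := φ.target ∩ φ.symm ⁻¹' (U ∩ U') with hV
  have hVo : IsOpen V := φ.isOpen_inter_preimage_symm (hZ.isOpen.inter hZ'.isOpen)
  have hwV : w ∈ V := ⟨hw, hwU, hwU'⟩
  set ζ : Fin k → CE n → CE n := fun a z => dChart φ (φ.symm z) (Z a (φ.symm z)) with hζ
  set ζ' : Fin k → CE n → CE n := fun a z => dChart φ (φ.symm z) (Z' a (φ.symm z)) with hζ'
  have hζd : ∀ a, DifferentiableOn ℂ (ζ a) V := fun a => (hZ.holo φ hφ a).mono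
    (fun z hz => ⟨hz.1, hz.2.1⟩)
  have hζd' : ∀ a, DifferentiableOn ℂ (ζ' a) V := fun a => (hZ'.holo φ hφ a).mono
    (fun z hz => ⟨hz.1, hz.2.2⟩)
  let L : (Fin k → ℂ) →ₗ[ℂ] CE n :=
    { toFun := fun c => ∑ a, c a • ζ a w
      map_add' := fun c d => by simp [add_smul, Finset.sum_add_distrib]
      map_smul' := fun r c => by simp [Finset.smul_sum, mul_smul] }
  have hL : LinearMap.ker L = ⊥ := by
    rw [LinearMap.ker_eq_bot']
    intro c hc
    obtain ⟨e, _, hu⟩ := (hZ.basis _ hwU).2.2 0 (Submodule.zero_mem _)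
    have h0 : (∑ a, cact (J (φ.symm w)) (c a) (Z a (φ.symm w))) = 0 := by
      rw [← dSymm_dChart hφ.isSmoothChart hw (∑ a, cact (J (φ.symm w)) (c a) (Z a (φ.symm w))),
        map_sum]
      simp only [dChart_cact hφ (φ.map_target hw)]
      have : ∑ a, c a • dChart φ (φ.symm w) (Z a (φ.symm w)) = 0 := hc
      rw [this, map_zero]
    exact (hu c h0.symm).trans (hu 0 (by simp)).symm
  obtain ⟨ℓ, hℓ⟩ := L.exists_leftInverse_of_injective hL
  let ℓc : CE n →L[ℂ] (Fin k → ℂ) := LinearMap.toContinuousLinearMap ℓ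
  set N : CE n → Matrix (Fin k) (Fin k) ℂ := fun z => Matrix.of fun a b => ℓc (ζ a z) b with hN
  set N' : CE n → Matrix (Fin k) (Fin k) ℂ := fun z => Matrix.of fun a b => ℓc (ζ' a z) b with hN'
  have hNd : DifferentiableOn ℂ (fun z => (N z).det) V := differentiableOn_det fun a b =>
    ((ContinuousLinearMap.proj (R := ℂ) (φ := fun _ : Fin k => ℂ) b).comp
      ℓc).differentiable.comp_differentiableOn (hζd a)
  have hNd' : DifferentiableOn ℂ (fun z => (N' z).det) V := differentiableOn_det fun a b =>
    ((ContinuousLinearMap.proj (R := ℂ) (φ := fun _ : Fin k => ℂ) b).comp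
      ℓc).differentiable.comp_differentiableOn (hζd' a)
  have hN1 : N w = 1 := by
    ext a b
    have h1 : ζ a w = L (Pi.single a 1) := by
      show _ = ∑ c, (Pi.single a (1 : ℂ) : Fin k → ℂ) c • ζ c w
      simp [Pi.single_apply]
    have h2 : ℓc (ζ a w) = Pi.single a 1 := by
      rw [h1]; exact LinearMap.congr_fun hℓ _
    simp only [hN, Matrix.of_apply, h2, Matrix.one_apply, Pi.single_apply, eq_comm]
  have hchange : ∀ z ∈ V, ∃ B : Matrix (Fin k) (Fin k) ℂ, N' z = B * N z ∧ B.det ≠ 0 ∧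
      hermDet J (φ.symm z) (fun X Y => h (φ.symm z) X Y) (fun a => Z' a (φ.symm z))
      = Complex.normSq B.det *
        hermDet J (φ.symm z) (fun X Y => h (φ.symm z) X Y) (fun a => Z a (φ.symm z)) ∧
      0 < hermDet J (φ.symm z) (fun X Y => h (φ.symm z) X Y) (fun a => Z a (φ.symm z)) := by
    intro z hz
    have hb : IsCBasis (J (φ.symm z)) (D (φ.symm z)) (fun a => Z a (φ.symm z)) :=
      hZ.basis _ hz.2.1
    have hb' : IsCBasis (J (φ.symm z)) (D (φ.symm z)) (fun a => Z' a (φ.symm z)) :=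
      hZ'.basis _ hz.2.2
    obtain ⟨B, hB⟩ := hb.exists_matrix hb'.1
    have hdet := (hD _ hz.2.1).cdet_change hb.1 B hB
    have hp := (hD _ hz.2.1).cdet_pos hb
    have hp' := (hD _ hz.2.1).cdet_pos hb'
    refine ⟨B, ?_, fun h0 => ?_, hdet, hp⟩
    · ext a b
      simp only [hN, hN', Matrix.of_apply, Matrix.mul_apply]
      have h1 : ζ' a z = ∑ c, B a c • ζ c z := by
        simp only [hζ, hζ']
        rw [hB a, map_sum]
        exact Finset.sum_congr rfl fun c _ => dChart_cact hφ (φ.map_target hz.1) _ _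
      rw [h1, map_sum, Finset.sum_apply]
      exact Finset.sum_congr rfl fun c _ => by rw [map_smul]; rfl
    · rw [hdet, h0] at hp'
      simp at hp'
  have hN0 : (N w).det ≠ 0 := by rw [hN1]; simp
  have hN0' : (N' w).det ≠ 0 := by
    obtain ⟨B, h1, h2, _⟩ := hchange w hwV
    rw [h1, Matrix.det_mul]
    exact mul_ne_zero h2 hN0
  have hp1 := pluriharmonic_log_normSq hVo hNd hwV hN0
  have hp2 := pluriharmonic_log_normSq hVo hNd' hwV hN0'
  refine ⟨fun z => Real.log (Complex.normSq (N' z).det) - Real.log (Complex.normSq (N z).det),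
    hp2.1.sub hp1.1, ?_, ?_⟩
  · rw [fiddbar_sub (hp2.1.of_le two_le_infty) (hp1.1.of_le two_le_infty), hp1.2, hp2.2, sub_zero]
  · have hcont : ContinuousAt (fun z => (N z).det) w :=
      (hNd.continuousOn).continuousAt (hVo.mem_nhds hwV)
    filter_upwards [hVo.mem_nhds hwV, hcont.eventually_ne hN0] with z hz hz0
    obtain ⟨B, h1, h2, h3, h4⟩ := hchange z hz
    have hB : Complex.normSq B.det ≠ 0 := by simpa using h2
    rw [h3, Real.log_mul hB h4.ne', h1, Matrix.det_mul, map_mul,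
      Real.log_mul hB (by simpa using hz0)]
    ring

theorem pull_neg_form {E : Type*} [NormedAddCommGroup E] [NormedSpace ℝ E]
    (φ : OpenPartialHomeomorph M E) {k : ℕ} (α : Form n M k) (w : E) :
    pull φ (-α) w = -pull φ α w := by
  ext v; rfl

/-- The first Chern form in a holomorphic chart, computed with any holomorphic frame. -/
theorem pull_chernForm [IsManifold 𝓘(ℝ, Model n) ∞ M] (hφ : IsHoloChart J φ)
    {D : ∀ x : M, Submodule ℝ (TS n x)} {h : BilinField n M} {U : Set M}
    (hD : ∀ y ∈ U, IsHermOn (J y) (D y) (h y)) {k : ℕ} {Z : Fin k → ∀ x : M, TS n x}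
    (hZ : IsHoloFrame J D U Z) {w : CE n} (hw : w ∈ φ.target) (hwU : φ.symm w ∈ U)
    (hsm : ContDiffAt ℝ 2 (fun z => Real.log (hermDet J (φ.symm z)
      (fun X Y => h (φ.symm z) X Y) (fun a => Z a (φ.symm z)))) w) :
    pull φ (chernForm J D (fun x X Y => h x X Y)) w = -fiddbar (mulI n)
      (fun z => Real.log (hermDet J (φ.symm z)
        (fun X Y => h (φ.symm z) X Y) (fun a => Z a (φ.symm z)))) w := by
  classical
  have H : ∃ (k : ℕ) (Z : Fin k → ∀ y : M, TS n y) (U : Set M),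
      φ.symm w ∈ U ∧ IsHoloFrame J D U Z := ⟨k, Z, U, hwU, hZ⟩
  obtain ⟨hwU', hZ'⟩ := H.choose_spec.choose_spec.choose_spec
  set Z' := H.choose_spec.choose with hZ'def
  set u : M → ℝ := fun y => Real.log (hermDet J y (fun X Y => h y X Y) (fun a => Z' a y)) with hu
  have e1 : chernForm J D (fun x X Y => h x X Y) (φ.symm w) = -iddbar J u (φ.symm w) := by
    rw [chernForm, dif_pos H]
  have e2 : pull φ (chernForm J D (fun x X Y => h x X Y)) w = -pull φ (iddbar J u) w := by
    rw [pull, e1]; ext v; rfl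
  obtain ⟨p, hp, hp0, hpe⟩ := exists_pluriharmonic_frame_change hφ hD hZ hZ' hw hwU hwU'
  have e3 : u ∘ φ.symm =ᶠ[𝓝 w] fun z => Real.log (hermDet J (φ.symm z)
      (fun X Y => h (φ.symm z) X Y) (fun a => Z a (φ.symm z))) + p z := hpe
  have hp2 := hp.of_le two_le_infty
  have hu2 : ContDiffAt ℝ 2 (u ∘ φ.symm) w := (hsm.add hp2).congr_of_eventuallyEq e3
  rw [e2, pull_iddbar hφ hw hu2, fiddbar_congr e3, fiddbar_add hsm hp2, hp0, add_zero]

end Chern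

end GenKahler

end

noncomputable section

namespace GenKahler

/-! ### Bilinear forms, inverses and traces -/

section Bil

variable {E : Type*} [NormedAddCommGroup E] [NormedSpace ℝ E] [FiniteDimensional ℝ E]
  {E₁ : Type*} [NormedAddCommGroup E₁] [NormedSpace ℝ E₁] [FiniteDimensional ℝ E₁]
  {F : Type*} [NormedAddCommGroup F] [NormedSpace ℝ F]

/-- A positive definite bilinear form is invertible as a map to the dual space. -/
theorem exists_equiv_of_pos {G : E →L[ℝ] E →L[ℝ] ℝ} (hpos : ∀ v, v ≠ 0 → 0 < G v v) :
    ∃ e : E ≃L[ℝ] (E →L[ℝ] ℝ), (e : E →L[ℝ] E →L[ℝ] ℝ) = G := by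
  have hinj : Function.Injective G.toLinearMap := by
    rw [← LinearMap.ker_eq_bot, LinearMap.ker_eq_bot']
    intro v hv
    by_contra h
    have h1 := hpos v h
    have h2 : G v = 0 := hv
    rw [h2] at h1
    simp at h1
  have hdim : Module.finrank ℝ E = Module.finrank ℝ (E →L[ℝ] ℝ) := by
    rw [(LinearMap.toContinuousLinearMap (𝕜 := ℝ) (E := E) (F' := ℝ)).symm.finrank_eq]
    exact Subspace.dual_finrank_eq.symm
  let e := LinearEquiv.ofInjectiveOfFinrankEq G.toLinearMap hinj hdim
  refine ⟨e.toContinuousLinearEquiv, ?_⟩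
  ext v w
  rfl

theorem inverse_apply_self {T : E →L[ℝ] E₁} (e : E ≃L[ℝ] E₁) (he : (e : E →L[ℝ] E₁) = T) (v : E) :
    T.inverse (T v) = v := by
  subst he; simp

theorem self_apply_inverse {T : E →L[ℝ] E₁} (e : E ≃L[ℝ] E₁) (he : (e : E →L[ℝ] E₁) = T) (v : E₁) :
    T (T.inverse v) = v := by
  subst he; simp

theorem hasFDerivAt_inverse {T : F → E →L[ℝ] E₁} {y : F} (hT : DifferentiableAt ℝ T y)
    (e : E ≃L[ℝ] E₁) (he : (e : E →L[ℝ] E₁) = T y) :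
    DifferentiableAt ℝ (fun z => (T z).inverse) y ∧ ∀ Y v, fderiv ℝ (fun z => (T z).inverse) y Y v
      = -(T y).inverse (fderiv ℝ T y Y ((T y).inverse v)) := by
  have hd : DifferentiableAt ℝ (fun z => (T z).inverse) y := by
    have h1 : DifferentiableAt ℝ ContinuousLinearMap.inverse (T y) := by
      rw [← he]
      exact (contDiffAt_map_inverse (n := 1) e).differentiableAt (by simp)
    exact h1.comp y hT
  refine ⟨hd, fun Y v => ?_⟩
  have hev : ∀ᶠ z in 𝓝 y, ∃ e' : E ≃L[ℝ] E₁, (e' : E →L[ℝ] E₁) = T z := by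
    have := (ContinuousLinearEquiv.nhds e)
    rw [he] at this
    exact hT.continuousAt.eventually this
  have h2 : (fun z => T z ((T z).inverse v)) =ᶠ[𝓝 y] fun _ => v := by
    filter_upwards [hev] with z hz
    obtain ⟨e', he'⟩ := hz
    exact self_apply_inverse e' he' v
  have h3 := (hT.hasFDerivAt.clm_apply
    (hd.hasFDerivAt.clm_apply (hasFDerivAt_const v y))).fderiv
  rw [h2.fderiv_eq] at h3
  have h4 := congrArg (fun A => A Y) h3
  simp at h4
  have h5 := congrArg (T y).inverse h4
  rw [map_zero, map_add, inverse_apply_self e he] at h5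
  exact eq_neg_of_add_eq_zero_left h5.symm

theorem contDiffWithinAt_inverse {T : F → E →L[ℝ] E₁} {y : F} {s : Set F} {m : WithTop ℕ∞}
    (hT : ContDiffWithinAt ℝ m T s y) (e : E ≃L[ℝ] E₁) (he : (e : E →L[ℝ] E₁) = T y) :
    ContDiffWithinAt ℝ m (fun z => (T z).inverse) s y := by
  have h1 : ContDiffAt ℝ m ContinuousLinearMap.inverse (T y) := by
    rw [← he]; exact contDiffAt_map_inverse e
  exact h1.comp_contDiffWithinAt y hT

theorem trL_eq_sum {ι : Type*} [Fintype ι] [DecidableEq ι] (b : Module.Basis ι ℝ E)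
    (K : (E →L[ℝ] ℝ) →L[ℝ] E) (c : E →L[ℝ] E →L[ℝ] ℝ) :
    trL E (K ∘L c) = ∑ i, ∑ j, c (b i) (b j) * LinearMap.toContinuousLinearMap (b.coord i)
      (K (LinearMap.toContinuousLinearMap (b.coord j))) := by
  rw [trL_basis b]
  refine Finset.sum_congr rfl fun i _ => ?_
  have h1 : c (b i) = ∑ j, c (b i) (b j) • LinearMap.toContinuousLinearMap (b.coord j) := by
    apply ContinuousLinearMap.coe_injective
    refine b.ext fun k => ?_
    simp [Finsupp.single_apply]
  have h2 : K (c (b i)) = ∑ j, c (b i) (b j) • K (LinearMap.toContinuousLinearMap (b.coord j)) := by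
    conv_lhs => rw [h1, map_sum]
    simp only [map_smul]
  rw [ContinuousLinearMap.comp_apply, h2, map_sum, Finsupp.finsetSum_apply]
  simp

theorem trL_antisymm (K : (E →L[ℝ] ℝ) →L[ℝ] E) (hK : ∀ η ζ : E →L[ℝ] ℝ, η (K ζ) = -ζ (K η))
    (c : E →L[ℝ] E →L[ℝ] ℝ) (hc : ∀ v w, c v w = c w v) : trL E (K ∘L c) = 0 := by
  classical
  have h := trL_eq_sum (Module.finBasis ℝ E) K c
  have h2 : trL E (K ∘L c) = -trL E (K ∘L c) := by
    conv_lhs => rw [h, Finset.sum_comm]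
    rw [h, ← Finset.sum_neg_distrib]
    refine Finset.sum_congr rfl fun i _ => ?_
    rw [← Finset.sum_neg_distrib]
    refine Finset.sum_congr rfl fun j _ => ?_
    rw [hc, hK]; ring
  linarith

/-- The trace of the adjoint of an endomorphism. -/
theorem trL_adjoint (G : E →L[ℝ] E →L[ℝ] ℝ) (e : E ≃L[ℝ] (E →L[ℝ] ℝ))
    (he : (e : E →L[ℝ] E →L[ℝ] ℝ) = G) (A : E →L[ℝ] E) :
    trL E (G.inverse ∘L ((ContinuousLinearMap.compL ℝ E E ℝ).flip A ∘L G)) = trL E A := by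
  classical
  rw [trL_comm ((ContinuousLinearMap.compL ℝ E E ℝ).flip A ∘L G) G.inverse,
    ContinuousLinearMap.comp_assoc]
  have h1 : G ∘L G.inverse = ContinuousLinearMap.id ℝ _ := by
    ext1 v; exact self_apply_inverse e he v
  rw [h1, ContinuousLinearMap.comp_id]
  let b := Module.finBasis ℝ E
  let d : Module.Basis _ ℝ (E →L[ℝ] ℝ) :=
    b.dualBasis.map (LinearMap.toContinuousLinearMap (𝕜 := ℝ) (E := E) (F' := ℝ))
  rw [trL_basis d, trL_basis b]
  refine Finset.sum_congr rfl fun i _ => ?_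
  have hr : ∀ η : E →L[ℝ] ℝ, d.repr η i = η (b i) := fun η =>
    b.dualBasis_repr ((LinearMap.toContinuousLinearMap (𝕜 := ℝ) (E := E) (F' := ℝ)).symm η) i
  have hdi : d i = LinearMap.toContinuousLinearMap (b.coord i) := by
    simp only [d, Module.Basis.map_apply]
    rw [b.coe_dualBasis]
  rw [hr, hdi]
  rfl

end Bil

section DetDeriv

theorem hasFDerivAt_det {F : Type*} [NormedAddCommGroup F] [NormedSpace ℝ F]
    {𝔸 : Type*} [NormedCommRing 𝔸] [NormedAlgebra ℝ 𝔸]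
    {ι : Type*} [Fintype ι] [DecidableEq ι] {A : F → Matrix ι ι 𝔸} {y : F}
    (hA : ∀ i j, DifferentiableAt ℝ (fun z => A z i j) y) (X : F) :
    DifferentiableAt ℝ (fun z => (A z).det) y ∧ fderiv ℝ (fun z => (A z).det) y X
      = ((A y).adjugate * Matrix.of fun i j => fderiv ℝ (fun z => A z i j) y X).trace := by
  have h1 : HasFDerivAt (fun z => (A z).det) (∑ σ : Equiv.Perm ι, ((Equiv.Perm.sign σ : ℤ) : 𝔸) •
      ∑ i, (∏ j ∈ Finset.univ.erase i, A y (σ j) j) • fderiv ℝ (fun z => A z (σ i) i) y) y := by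
    simp only [Matrix.det_apply']
    refine HasFDerivAt.fun_sum fun σ _ => HasFDerivAt.const_mul ?_ _
    exact HasFDerivAt.finsetProd fun i _ => (hA (σ i) i).hasFDerivAt
  refine ⟨h1.differentiableAt, ?_⟩
  rw [h1.fderiv]
  have h2 : ∀ i, ((A y).adjugate * Matrix.of fun i j => fderiv ℝ (fun z => A z i j) y X) i i
      = ∑ σ : Equiv.Perm ι, ((Equiv.Perm.sign σ : ℤ) : 𝔸) *
        ((∏ j ∈ Finset.univ.erase i, A y (σ j) j) * fderiv ℝ (fun z => A z (σ i) i) y X) := by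
    intro i
    have h3 : ((A y).adjugate * Matrix.of fun i j => fderiv ℝ (fun z => A z i j) y X) i i
        = ((A y).updateCol i fun k => fderiv ℝ (fun z => A z k i) y X).det := by
      rw [← Matrix.cramer_apply, Matrix.cramer_eq_adjugate_mulVec]
      rfl
    rw [h3, Matrix.det_apply']
    refine Finset.sum_congr rfl fun σ _ => ?_
    congr 1
    rw [← Finset.mul_prod_erase _ _ (Finset.mem_univ i), mul_comm]
    congr 1
    · refine Finset.prod_congr rfl fun j hj => ?_
      rw [Matrix.updateCol_ne (Finset.ne_of_mem_erase hj)]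
    · rw [Matrix.updateCol_self]
  simp only [Matrix.trace, Matrix.diag_apply, h2]
  rw [Finset.sum_comm]
  simp [Finset.mul_sum]

end DetDeriv

end GenKahler

end

noncomputable section

namespace GenKahler

/-! ### The codifferential as a divergence -/

section CodiffFlat

variable {m : ℕ}

/-- The Gram matrix of a bilinear form in the standard basis. -/
def gramE (G : EuclideanSpace ℝ (Fin m) →L[ℝ] EuclideanSpace ℝ (Fin m) →L[ℝ] ℝ) :
    Matrix (Fin m) (Fin m) ℝ :=
  Matrix.of fun i j => G (EuclideanSpace.single i 1) (EuclideanSpace.single j 1)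

theorem sum_coord_single (v : EuclideanSpace ℝ (Fin m)) :
    ∑ i, v i • EuclideanSpace.single i (1 : ℝ) = v := by
  ext j
  simp [Finset.sum_apply, Pi.single_apply]

theorem trL_euclidean (A : EuclideanSpace ℝ (Fin m) →L[ℝ] EuclideanSpace ℝ (Fin m)) :
    trL _ A = ∑ i, A (EuclideanSpace.single i 1) i := by
  rw [trL_basis (EuclideanSpace.basisFun (Fin m) ℝ).toBasis]
  simp

variable {G : EuclideanSpace ℝ (Fin m) →L[ℝ] EuclideanSpace ℝ (Fin m) →L[ℝ] ℝ}

theorem posDef_gramE (hs : ∀ v w, G v w = G w v) (hpos : ∀ v, v ≠ 0 → 0 < G v v) :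
    (gramE G).PosDef := by
  rw [Matrix.posDef_iff_dotProduct_mulVec]
  refine ⟨?_, fun x hx => ?_⟩
  · ext i j
    simp [gramE, hs (EuclideanSpace.single j 1)]
  · have h1 : star x ⬝ᵥ (gramE G).mulVec x = G (WithLp.toLp 2 x) (WithLp.toLp 2 x) := by
      conv_rhs => rw [← sum_coord_single (WithLp.toLp 2 x)]
      simp only [map_sum, map_smul, sum_apply, smul_apply, dotProduct, Matrix.mulVec, gramE,
        Matrix.of_apply, Pi.star_apply, star_trivial, smul_eq_mul, Finset.mul_sum]
      rw [Finset.sum_comm]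
      exact Finset.sum_congr rfl fun i _ => Finset.sum_congr rfl fun j _ => by ring
    rw [h1]
    exact hpos _ fun h => hx (by simpa using h)

theorem inverse_eq_gramE (hs : ∀ v w, G v w = G w v) (hpos : ∀ v, v ≠ 0 → 0 < G v v)
    (η : EuclideanSpace ℝ (Fin m) →L[ℝ] ℝ) (i : Fin m) :
    G.inverse η i = ∑ j, (gramE G)⁻¹ i j * η (EuclideanSpace.single j 1) := by
  obtain ⟨e, he⟩ := exists_equiv_of_pos hpos
  set v : EuclideanSpace ℝ (Fin m) :=
    WithLp.toLp 2 fun i => ∑ j, (gramE G)⁻¹ i j * η (EuclideanSpace.single j 1) with hv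
  have hdet : IsUnit (gramE G).det := (posDef_gramE hs hpos).det_pos.ne'.isUnit
  have h1 : G v = η := by
    have h2 : ∀ k, G v (EuclideanSpace.single k 1) = η (EuclideanSpace.single k 1) := fun k => by
      have h3 : G v (EuclideanSpace.single k 1)
          = ((gramE G) * (gramE G)⁻¹).mulVec (fun j => η (EuclideanSpace.single j 1)) k := by
        rw [← Matrix.mulVec_mulVec]
        conv_lhs => rw [← sum_coord_single v]
        simp only [map_sum, map_smul, sum_apply, smul_apply, smul_eq_mul, Matrix.mulVec, dotProduct,
          hv]
        refine Finset.sum_congr rfl fun i _ => ?_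
        rw [hs, mul_comm]; rfl
      rw [h3, Matrix.mul_nonsing_inv _ hdet, Matrix.one_mulVec]
    ext w
    rw [← sum_coord_single w, map_sum, map_sum]
    exact Finset.sum_congr rfl fun k _ => by rw [map_smul, map_smul, h2]
  have h2 := inverse_apply_self e he v
  rw [h1] at h2
  rw [h2]

theorem trL_inverse_comp (hs : ∀ v w, G v w = G w v) (hpos : ∀ v, v ≠ 0 → 0 < G v v)
    {B : EuclideanSpace ℝ (Fin m) →L[ℝ] EuclideanSpace ℝ (Fin m) →L[ℝ] ℝ}
    (hB : ∀ v w, B v w = B w v) :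
    trL _ (G.inverse ∘L B) = ((gramE G)⁻¹ * gramE B).trace := by
  rw [trL_euclidean]
  simp only [ContinuousLinearMap.comp_apply, inverse_eq_gramE hs hpos, Matrix.trace,
    Matrix.diag_apply, Matrix.mul_apply]
  refine Finset.sum_congr rfl fun i _ => Finset.sum_congr rfl fun j _ => ?_
  rw [hB]; rfl

theorem fderiv_symm_of_symm {E F : Type*} [NormedAddCommGroup E] [NormedSpace ℝ E]
    [NormedAddCommGroup F] [NormedSpace ℝ F]
    {G : F → E →L[ℝ] E →L[ℝ] ℝ} {y : F} (hG : DifferentiableAt ℝ G y)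
    (hs : ∀ᶠ z in 𝓝 y, ∀ v w, G z v w = G z w v) (X : F) (v w : E) :
    fderiv ℝ G y X v w = fderiv ℝ G y X w v := by
  have h : ∀ v w, fderiv ℝ (fun z => G z v w) y X = fderiv ℝ G y X v w := fun v w => by
    have h1 := ((hG.hasFDerivAt.clm_apply (hasFDerivAt_const v y)).clm_apply
      (hasFDerivAt_const w y)).fderiv
    rw [h1]; simp
  rw [← h, ← h]
  have e : (fun z => G z v w) =ᶠ[𝓝 y] fun z => G z w v := by
    filter_upwards [hs] with z hz using hz v w
  rw [e.fderiv_eq]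

theorem differentiableAt_flip {E F K : Type*} [NormedAddCommGroup E] [NormedSpace ℝ E]
    [NormedAddCommGroup F] [NormedSpace ℝ F] [NormedAddCommGroup K] [NormedSpace ℝ K]
    {B : K → E →L[ℝ] F →L[ℝ] ℝ} {y : K} (hB : DifferentiableAt ℝ B y) :
    DifferentiableAt ℝ (fun y => (B y).flip) y := by
  have h : IsBoundedLinearMap ℝ (fun A : E →L[ℝ] F →L[ℝ] ℝ => A.flip) :=
    IsLinearMap.with_bound ⟨fun _ _ => rfl, fun _ _ => rfl⟩ 1 fun A => by
      rw [ContinuousLinearMap.opNorm_flip, one_mul]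
  exact DifferentiableAt.comp (𝕜 := ℝ) (F := E →L[ℝ] F →L[ℝ] ℝ) (G := F →L[ℝ] E →L[ℝ] ℝ)
    (g := fun A => A.flip) y h.differentiableAt hB

/-- The divergence formula for the components of the codifferential. -/
theorem codiff_components
    {G B : EuclideanSpace ℝ (Fin m) → EuclideanSpace ℝ (Fin m) →L[ℝ] EuclideanSpace ℝ (Fin m) →L[ℝ] ℝ}
    {y₀ : EuclideanSpace ℝ (Fin m)}
    (hG : DifferentiableAt ℝ G y₀) (hB : DifferentiableAt ℝ B y₀)
    (hs : ∀ᶠ y in 𝓝 y₀, ∀ v w, G y v w = G y w v)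
    (hpos : ∀ᶠ y in 𝓝 y₀, ∀ v, v ≠ 0 → 0 < G y v v) (X : EuclideanSpace ℝ (Fin m)) :
    ∑ k, (-∑ j, gramE (G y₀) k j * (√(gramE (G y₀)).det)⁻¹ *
      ∑ i, fderiv ℝ (fun y => √(gramE (G y)).det *
        ((gramE (G y))⁻¹ * gramE (B y) * ((gramE (G y))⁻¹).transpose) i j) y₀
          (EuclideanSpace.single i 1)) * X k
    = -(trL _ (fderiv ℝ (fun y => (G y).inverse ((B y).flip ((G y).inverse (G y₀ X)))) y₀)
      + 1 / 2 * trL _ ((G y₀).inverse ∘L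
        fderiv ℝ G y₀ ((G y₀).inverse ((B y₀).flip ((G y₀).inverse (G y₀ X)))))) := by
  classical
  have hs0 := hs.self_of_nhds
  have hpos0 := hpos.self_of_nhds
  obtain ⟨e, he⟩ := exists_equiv_of_pos hpos0
  have hinv := (hasFDerivAt_inverse hG e he).1
  set ξ := G y₀ X with hξ
  set d : EuclideanSpace ℝ (Fin m) → ℝ := fun y => (gramE (G y)).det with hd
  have hd0 : 0 < d y₀ := (posDef_gramE hs0 hpos0).det_pos
  have hGe : ∀ i j, DifferentiableAt ℝ (fun y => gramE (G y) i j) y₀ := fun i j =>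
    (hG.clm_apply (differentiableAt_const _)).clm_apply (differentiableAt_const _)
  have hGe' : ∀ i j Y, fderiv ℝ (fun y => gramE (G y) i j) y₀ Y = gramE (fderiv ℝ G y₀ Y) i j :=
    fun i j Y => by
      have h1 := ((hG.hasFDerivAt.clm_apply (hasFDerivAt_const (EuclideanSpace.single i (1 : ℝ)) y₀)
        ).clm_apply (hasFDerivAt_const (EuclideanSpace.single j (1 : ℝ)) y₀)).fderiv
      have h2 : (fun y => gramE (G y) i j)
        = fun y => G y (EuclideanSpace.single i 1) (EuclideanSpace.single j 1) := rfl
      rw [h2, h1]; simp [gramE]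
  have hdd : DifferentiableAt ℝ d y₀ := (hasFDerivAt_det hGe 0).1
  have hdd' : ∀ Y, fderiv ℝ d y₀ Y = d y₀ * trL _ ((G y₀).inverse ∘L fderiv ℝ G y₀ Y) := fun Y => by
    rw [(hasFDerivAt_det hGe Y).2, trL_inverse_comp hs0 hpos0
      (fderiv_symm_of_symm hG hs Y)]
    have h3 : (Matrix.of fun i j => fderiv ℝ (fun y => gramE (G y) i j) y₀ Y)
        = gramE (fderiv ℝ G y₀ Y) := by ext i j; exact hGe' i j Y
    rw [h3, Matrix.inv_def, Ring.inverse_eq_inv', Matrix.smul_mul, Matrix.trace_smul, smul_eq_mul,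
      ← mul_assoc, mul_inv_cancel₀ hd0.ne', one_mul]
  have hsq : DifferentiableAt ℝ (fun y => √(d y)) y₀ := hdd.sqrt hd0.ne'
  have hsq' : ∀ Y, fderiv ℝ (fun y => √(d y)) y₀ Y
      = √(d y₀) * (1 / 2 * trL _ ((G y₀).inverse ∘L fderiv ℝ G y₀ Y)) := fun Y => by
    have h1 := (hdd.hasFDerivAt.sqrt hd0.ne').fderiv
    rw [h1, smul_apply, hdd', smul_eq_mul]
    have h2 : √(d y₀) ≠ 0 := (Real.sqrt_pos.2 hd0).ne'
    have h3 : d y₀ = √(d y₀) * √(d y₀) := (Real.mul_self_sqrt hd0.le).symm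
    field_simp
    linear_combination (trL _ ((G y₀).inverse ∘L fderiv ℝ G y₀ Y)) * h3
  set W : (EuclideanSpace ℝ (Fin m) →L[ℝ] ℝ) → EuclideanSpace ℝ (Fin m) → EuclideanSpace ℝ (Fin m) :=
    fun η y => (G y).inverse ((B y).flip ((G y).inverse η)) with hW
  have hBf : DifferentiableAt ℝ (fun y => (B y).flip) y₀ :=
    differentiableAt_flip hB
  have hWd : ∀ η, DifferentiableAt ℝ (W η) y₀ := fun η =>
    hinv.clm_apply (hBf.clm_apply (hinv.clm_apply (differentiableAt_const η)))
  have hWc : ∀ η i, DifferentiableAt ℝ (fun y => W η y i) y₀ := fun η i =>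
    ((EuclideanSpace.proj i : EuclideanSpace ℝ (Fin m) →L[ℝ] ℝ).differentiableAt.comp y₀ (hWd η) :)
  have hWc' : ∀ η i Y, fderiv ℝ (fun y => W η y i) y₀ Y = fderiv ℝ (W η) y₀ Y i := fun η i Y => by
    have := ((EuclideanSpace.proj i : EuclideanSpace ℝ (Fin m) →L[ℝ] ℝ).hasFDerivAt.comp y₀
      (hWd η).hasFDerivAt).fderiv
    exact congrArg (fun A => A Y) this
  have hR : ∀ᶠ y in 𝓝 y₀, ∀ i j,
      ((gramE (G y))⁻¹ * gramE (B y) * ((gramE (G y))⁻¹).transpose) i j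
        = W (EuclideanSpace.proj j : EuclideanSpace ℝ (Fin m) →L[ℝ] ℝ) y i := by
    filter_upwards [hs, hpos] with y hy hy' i j
    have h1 : (G y).inverse (EuclideanSpace.proj j : EuclideanSpace ℝ (Fin m) →L[ℝ] ℝ)
        = ∑ b, (gramE (G y))⁻¹ b j • EuclideanSpace.single b (1 : ℝ) := by
      conv_lhs => rw [← sum_coord_single ((G y).inverse _)]
      refine Finset.sum_congr rfl fun b _ => ?_
      rw [inverse_eq_gramE hy hy']
      simp
    simp only [hW]
    rw [inverse_eq_gramE hy hy', h1]
    simp only [Matrix.mul_apply, Matrix.transpose_apply, ContinuousLinearMap.flip_apply, map_sum,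
      map_smul, smul_eq_mul, sum_apply, smul_apply, Finset.sum_mul, Finset.mul_sum]
    rw [Finset.sum_comm]
    refine Finset.sum_congr rfl fun a _ => Finset.sum_congr rfl fun b _ => ?_
    have h2 : (gramE (G y))⁻¹ j b = (gramE (G y))⁻¹ b j :=
      congrFun (congrFun (posDef_gramE hy hy').inv.isHermitian b) j
    rw [h2]
    simp only [gramE, Matrix.of_apply]
    ring
  have hterm : ∀ i j, fderiv ℝ (fun y => √(gramE (G y)).det *
        ((gramE (G y))⁻¹ * gramE (B y) * ((gramE (G y))⁻¹).transpose) i j) y₀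
          (EuclideanSpace.single i 1)
      = √(d y₀) * fderiv ℝ (W (EuclideanSpace.proj j)) y₀ (EuclideanSpace.single i 1) i
        + W (EuclideanSpace.proj j) y₀ i * fderiv ℝ (fun y => √(d y)) y₀
          (EuclideanSpace.single i 1) := fun i j => by
    have e1 : (fun y => √(gramE (G y)).det *
        ((gramE (G y))⁻¹ * gramE (B y) * ((gramE (G y))⁻¹).transpose) i j) =ᶠ[𝓝 y₀]
        fun y => √(d y) * W (EuclideanSpace.proj j) y i := by
      filter_upwards [hR] with y hy
      rw [hy]
    rw [e1.fderiv_eq, fderiv_fun_mul hsq (hWc _ i)]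
    simp [hWc']
  have hξW : ∀ y, W ξ y = ∑ j, ξ (EuclideanSpace.single j 1) • W (EuclideanSpace.proj j) y := by
    intro y
    have h1 : ξ = ∑ j, ξ (EuclideanSpace.single j 1) •
        (EuclideanSpace.proj j : EuclideanSpace ℝ (Fin m) →L[ℝ] ℝ) := by
      ext v
      conv_lhs => rw [← sum_coord_single v]
      simp [mul_comm]
    conv_lhs => rw [h1]
    simp only [hW, map_sum, map_smul]
  have hξW' : ∀ Y, fderiv ℝ (W ξ) y₀ Y = ∑ j, ξ (EuclideanSpace.single j 1) •
      fderiv ℝ (W (EuclideanSpace.proj j)) y₀ Y := by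
    intro Y
    have h1 : W ξ = fun y => ∑ j, ξ (EuclideanSpace.single j 1) • W (EuclideanSpace.proj j) y :=
      funext hξW
    have h2 := (HasFDerivAt.fun_sum fun j (_ : j ∈ Finset.univ) =>
      ((hWd (EuclideanSpace.proj j)).hasFDerivAt.const_smul (ξ (EuclideanSpace.single j 1)))).fderiv
    rw [h1]
    refine (congrArg (fun A => A Y) h2).trans ?_
    simp [sum_apply]
  have hξX : ∀ j, ∑ k, X k * gramE (G y₀) k j = ξ (EuclideanSpace.single j 1) := fun j => by
    rw [hξ]
    conv_rhs => rw [← sum_coord_single X]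
    simp [gramE]
  have hq : √(d y₀) ≠ 0 := (Real.sqrt_pos.2 hd0).ne'
  have h1 : ∀ k, (-∑ j, gramE (G y₀) k j * (√(gramE (G y₀)).det)⁻¹ *
      ∑ i, fderiv ℝ (fun y => √(gramE (G y)).det *
        ((gramE (G y))⁻¹ * gramE (B y) * ((gramE (G y))⁻¹).transpose) i j) y₀
          (EuclideanSpace.single i 1)) * X k
      = -∑ j, (X k * gramE (G y₀) k j) * ∑ i,
        (fderiv ℝ (W (EuclideanSpace.proj j)) y₀ (EuclideanSpace.single i 1) i
        + W (EuclideanSpace.proj j) y₀ i * (1 / 2 * trL _ ((G y₀).inverse ∘L fderiv ℝ G y₀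
          (EuclideanSpace.single i 1)))) := fun k => by
    rw [neg_mul, Finset.sum_mul]
    congr 1
    refine Finset.sum_congr rfl fun j _ => ?_
    have h2 : ∀ i, fderiv ℝ (fun y => √(gramE (G y)).det *
        ((gramE (G y))⁻¹ * gramE (B y) * ((gramE (G y))⁻¹).transpose) i j) y₀
          (EuclideanSpace.single i 1) = √(d y₀) *
        (fderiv ℝ (W (EuclideanSpace.proj j)) y₀ (EuclideanSpace.single i 1) i
        + W (EuclideanSpace.proj j) y₀ i * (1 / 2 * trL _ ((G y₀).inverse ∘L fderiv ℝ G y₀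
          (EuclideanSpace.single i 1)))) := fun i => by
      rw [hterm, hsq']; ring
    simp only [h2]
    rw [← Finset.mul_sum]
    have h3 : (√(gramE (G y₀)).det)⁻¹ * √(d y₀) = 1 := inv_mul_cancel₀ hq
    linear_combination (gramE (G y₀) k j * (∑ i,
        (fderiv ℝ (W (EuclideanSpace.proj j)) y₀ (EuclideanSpace.single i 1) i
        + W (EuclideanSpace.proj j) y₀ i * (1 / 2 * trL _ ((G y₀).inverse ∘L fderiv ℝ G y₀
          (EuclideanSpace.single i 1))))) * X k) * h3
  simp only [h1, Finset.sum_neg_distrib]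
  congr 1
  rw [Finset.sum_comm]
  simp only [← Finset.sum_mul, hξX]
  have hV : trL _ ((G y₀).inverse ∘L fderiv ℝ G y₀ (W ξ y₀))
      = ∑ i, W ξ y₀ i * trL _ ((G y₀).inverse ∘L fderiv ℝ G y₀ (EuclideanSpace.single i 1)) := by
    conv_lhs => rw [← sum_coord_single (W ξ y₀)]
    simp only [map_sum, map_smul, ContinuousLinearMap.comp_finsetSum, ContinuousLinearMap.comp_smul,
      smul_eq_mul]
  show _ = trL _ (fderiv ℝ (W ξ) y₀) + 1 / 2 * trL _ ((G y₀).inverse ∘L fderiv ℝ G y₀ (W ξ y₀))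
  rw [hV, trL_euclidean, Finset.mul_sum, ← Finset.sum_add_distrib]
  simp only [Finset.mul_sum]
  rw [Finset.sum_comm]
  refine Finset.sum_congr rfl fun i _ => ?_
  rw [hξW', hξW]
  simp only [WithLp.ofLp_sum, WithLp.ofLp_smul, Finset.sum_apply, Pi.smul_apply, smul_eq_mul]
  rw [Finset.sum_mul, Finset.mul_sum, ← Finset.sum_add_distrib]
  exact Finset.sum_congr rfl fun j _ => by ring

end CodiffFlat

end GenKahler

end

noncomputable section

namespace GenKahler

/-! ### The codifferential of a Kähler form in a holomorphic chart -/

section Transform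

variable {E : Type*} [NormedAddCommGroup E] [NormedSpace ℝ E] [FiniteDimensional ℝ E]
  {F : Type*} [NormedAddCommGroup F] [NormedSpace ℝ F] [FiniteDimensional ℝ F]

/-- The divergence of the vector field `G⁻¹(ξ ∘ J)` in transformed coordinates. -/
theorem divergence_transform {θ : E → F} {T : E → E →L[ℝ] F} {y₀ : E}
    (hθ : HasFDerivAt θ (T y₀) y₀) (hT : DifferentiableAt ℝ T y₀)
    (hTs : ∀ X Y, fderiv ℝ T y₀ X Y = fderiv ℝ T y₀ Y X) (eT : E ≃L[ℝ] F)
    (heT : (eT : E →L[ℝ] F) = T y₀) {G : F → F →L[ℝ] F →L[ℝ] ℝ}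
    (hG : DifferentiableAt ℝ G (θ y₀)) (hGs : ∀ X Y, G (θ y₀) X Y = G (θ y₀) Y X)
    (hpos : ∀ X, X ≠ 0 → 0 < G (θ y₀) X X) (J : F →L[ℝ] F)
    (hJ : ∀ X Y, G (θ y₀) (J X) Y = -G (θ y₀) X (J Y))
    {GE : E → E →L[ℝ] E →L[ℝ] ℝ} (hGEd : DifferentiableAt ℝ GE y₀)
    (hGE : ∀ᶠ y in 𝓝 y₀, ∀ X Y, GE y X Y = G (θ y) (T y X) (T y Y))
    (ξ : E →L[ℝ] ℝ) {V : E → E} (hV : V =ᶠ[𝓝 y₀] fun y =>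
      (T y).inverse ((G (θ y)).inverse ((ξ ∘L (T y).inverse) ∘L J))) {v : F}
    (hv : v = (G (θ y₀)).inverse ((ξ ∘L (T y₀).inverse) ∘L J)) :
    trL E (fderiv ℝ V y₀) + 1 / 2 * trL E ((GE y₀).inverse ∘L fderiv ℝ GE y₀ (V y₀))
      = -trL F ((G (θ y₀)).inverse ∘L (fderiv ℝ G (θ y₀)).flip v)
        + 1 / 2 * trL F ((G (θ y₀)).inverse ∘L fderiv ℝ G (θ y₀) v) := by
  obtain ⟨e, he⟩ := exists_equiv_of_pos hpos
  set w := θ y₀ with hw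
  set N := (T y₀).inverse with hN
  have hNT : ∀ X, N (T y₀ X) = X := inverse_apply_self eT heT
  have hTN : ∀ X, T y₀ (N X) = X := self_apply_inverse eT heT
  set A := fderiv ℝ T y₀ with hA
  obtain ⟨hNd, hNd'⟩ := hasFDerivAt_inverse hT eT heT
  have hGθ : HasFDerivAt (fun y => G (θ y)) ((fderiv ℝ G w).comp (T y₀)) y₀ :=
    HasFDerivAt.comp (𝕜 := ℝ) (F := F) (G := F →L[ℝ] F →L[ℝ] ℝ) (g := G) (f := θ) y₀
      hG.hasFDerivAt hθ
  obtain ⟨hId, hId'⟩ := hasFDerivAt_inverse hGθ.differentiableAt e he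
  rw [hGθ.fderiv] at hId'
  let C : (F →L[ℝ] E) →L[ℝ] (F →L[ℝ] ℝ) :=
    (ContinuousLinearMap.compL ℝ F F ℝ).flip J ∘L (ContinuousLinearMap.compL ℝ F E ℝ ξ)
  have hC : ∀ S, C S = (ξ ∘L S) ∘L J := fun S => rfl
  have hV0 : V y₀ = N v := by rw [hV.self_of_nhds, hv]
  have hVd : ∀ Y, fderiv ℝ V y₀ Y = -N (A Y (N v))
      - N ((G w).inverse (fderiv ℝ G w (T y₀ Y) v))
      - N ((G w).inverse (((ξ ∘L N) ∘L A Y ∘L N) ∘L J)) := by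
    intro Y
    have h1 := (hNd.hasFDerivAt.clm_apply (hId.hasFDerivAt.clm_apply
      (C.hasFDerivAt.comp y₀ hNd.hasFDerivAt))).fderiv
    have h2 : fderiv ℝ V y₀ = fderiv ℝ (fun y => (T y).inverse
        ((G (θ y)).inverse ((⇑C ∘ fun z => (T z).inverse) y))) y₀ := hV.fderiv_eq
    rw [h2, h1]
    have h3 : (fderiv ℝ (fun z => (T z).inverse) y₀) Y = -(N ∘L A Y ∘L N) := by
      ext Z; exact hNd' Y Z
    simp only [add_apply, ContinuousLinearMap.comp_apply, ContinuousLinearMap.flip_apply,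
      Function.comp_apply, hC, ← hN, ← hw, hId', ← hv, h3, neg_apply, map_add, map_neg]
    have h4 : (ξ ∘L (-(N ∘L A Y ∘L N))) ∘L J = -(((ξ ∘L N) ∘L A Y ∘L N) ∘L J) := by
      ext Z; simp
    rw [h4]
    simp only [map_neg]
    abel
  let K : (F →L[ℝ] ℝ) →L[ℝ] F := (G w).inverse ∘L (ContinuousLinearMap.compL ℝ F F ℝ).flip J
  let c : F →L[ℝ] F →L[ℝ] ℝ := (ContinuousLinearMap.compL ℝ F E ℝ).flip N ∘L
    (ContinuousLinearMap.compL ℝ E F ℝ (ξ ∘L N)) ∘L A ∘L N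
  have hc : ∀ X Y, c X Y = ξ (N (A (N X) (N Y))) := fun X Y => rfl
  have hKc : trL F (K ∘L c) = 0 := by
    refine trL_antisymm K (fun η ζ => ?_) c (fun X Y => by rw [hc, hc, hTs])
    have h1 : ∀ ζ : F →L[ℝ] ℝ, K ζ = -J ((G w).inverse ζ) := fun ζ => by
      have h2 : ζ ∘L J = G w (-J ((G w).inverse ζ)) := by
        ext Z
        rw [map_neg, neg_apply, hJ, neg_neg, self_apply_inverse e he]
        rfl
      show (G w).inverse (ζ ∘L J) = _
      rw [h2, inverse_apply_self e he]
    rw [h1, h1]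
    conv_lhs => rw [← self_apply_inverse e he η]
    conv_rhs => rw [← self_apply_inverse e he ζ]
    rw [map_neg, map_neg, hGs, hJ, neg_neg]
  have hdec : fderiv ℝ V y₀ = -(N ∘L A (N v)) - N ∘L (((G w).inverse ∘L (fderiv ℝ G w).flip v)
      ∘L T y₀) - N ∘L ((K ∘L c) ∘L T y₀) := by
    ext1 Y
    rw [hVd]
    simp only [sub_apply, neg_apply, ContinuousLinearMap.comp_apply, ContinuousLinearMap.flip_apply]
    rw [hTs Y]
    have h1 : (ξ ∘L N) ∘L A Y ∘L N = c (T y₀ Y) := by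
      ext Z
      simp only [ContinuousLinearMap.comp_apply, hc, hNT]
    rw [h1]
    rfl
  have hTN' : T y₀ ∘L N = ContinuousLinearMap.id ℝ F := by ext1 X; exact hTN X
  have htr1 : trL E (fderiv ℝ V y₀) = -trL E (N ∘L A (N v))
      - trL F ((G w).inverse ∘L (fderiv ℝ G w).flip v) := by
    have h1 : ∀ S : F →L[ℝ] F, trL E (N ∘L (S ∘L T y₀)) = trL F S := fun S => by
      rw [trL_comm (S ∘L T y₀) N, ContinuousLinearMap.comp_assoc, hTN', ContinuousLinearMap.comp_id]
    rw [hdec, map_sub, map_sub, map_neg, h1, h1, hKc, sub_zero]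
  have hGE0 := hGE.self_of_nhds
  have hGEpos : ∀ X, X ≠ 0 → 0 < GE y₀ X X := fun X hX => by
    rw [hGE0]
    refine hpos _ fun h => hX ?_
    rw [← hNT X, h, map_zero]
  obtain ⟨e', he'⟩ := exists_equiv_of_pos hGEpos
  have hGEinv : ∀ μ : E →L[ℝ] ℝ, (GE y₀).inverse μ = N ((G w).inverse (μ ∘L N)) := fun μ => by
    have h1 : GE y₀ (N ((G w).inverse (μ ∘L N))) = μ := by
      ext Z
      rw [hGE0, hTN, self_apply_inverse e he]
      simp [hNT]
    rw [← inverse_apply_self e' he' (N ((G w).inverse (μ ∘L N))), h1]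
  have hGE' : ∀ W X Y, fderiv ℝ GE y₀ W X Y = fderiv ℝ G w (T y₀ W) (T y₀ X) (T y₀ Y)
      + G w (A W X) (T y₀ Y) + G w (T y₀ X) (A W Y) := fun W X Y => by
    have h1 : HasFDerivAt (fun y => GE y X Y) _ y₀ := (hGEd.hasFDerivAt.clm_apply
      (hasFDerivAt_const X y₀)).clm_apply (hasFDerivAt_const Y y₀)
    have h2 : HasFDerivAt (fun y => G (θ y) (T y X) (T y Y)) _ y₀ :=
      (hGθ.clm_apply (hT.hasFDerivAt.clm_apply (hasFDerivAt_const X y₀))).clm_apply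
        (hT.hasFDerivAt.clm_apply (hasFDerivAt_const Y y₀))
    have h3 : (fun y => GE y X Y) =ᶠ[𝓝 y₀] fun y => G (θ y) (T y X) (T y Y) := by
      filter_upwards [hGE] with y hy using hy X Y
    have h4 := h1.fderiv.symm.trans (h3.fderiv_eq.trans h2.fderiv)
    have h5 := congrArg (fun S => S W) h4
    simp at h5
    rw [h5]
    ring
  have htr2 : trL E ((GE y₀).inverse ∘L fderiv ℝ GE y₀ (V y₀))
      = trL F ((G w).inverse ∘L fderiv ℝ G w v) + 2 * trL E (N ∘L A (N v)) := by
    rw [hV0]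
    have h1 : (GE y₀).inverse ∘L fderiv ℝ GE y₀ (N v)
        = N ∘L ((G w).inverse ∘L fderiv ℝ G w v) ∘L T y₀ + N ∘L A (N v)
          + N ∘L ((G w).inverse ∘L
            ((ContinuousLinearMap.compL ℝ F F ℝ).flip (A (N v) ∘L N) ∘L G w)) ∘L T y₀ := by
      ext1 X
      simp only [add_apply, ContinuousLinearMap.comp_apply, hGEinv]
      rw [← map_add, ← map_add]
      congr 1
      have h2 : A (N v) X = (G w).inverse (G w (A (N v) X)) := (inverse_apply_self e he _).symm
      rw [h2, ← map_add, ← map_add]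
      congr 1
      ext Z
      simp [hGE', hTN]
    have h3 : ∀ S : F →L[ℝ] F, trL E (N ∘L S ∘L T y₀) = trL F S := fun S => by
      rw [trL_comm (S ∘L T y₀) N, ContinuousLinearMap.comp_assoc, hTN', ContinuousLinearMap.comp_id]
    rw [h1, map_add, map_add, h3, h3, trL_adjoint (G w) e he, trL_comm N (A (N v))]
    ring
  rw [htr1, htr2]
  ring

end Transform

section Smoothness

variable {E : Type*} [NormedAddCommGroup E] [NormedSpace ℝ E] [FiniteDimensional ℝ E]
  {D : Type*} [NormedAddCommGroup D] [NormedSpace ℝ D] {F : Type*} [NormedAddCommGroup F]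
  [NormedSpace ℝ F]

theorem contDiffWithinAt_clm {m : WithTop ℕ∞} {f : D → E →L[ℝ] F} {s : Set D} {x : D}
    (h : ∀ v, ContDiffWithinAt ℝ m (fun z => f z v) s x) : ContDiffWithinAt ℝ m f s x := by
  let d := Module.finrank ℝ E
  have hd : d = Module.finrank ℝ (Fin d → ℝ) := (Module.finrank_fin_fun ℝ).symm
  let e₁ := ContinuousLinearEquiv.ofFinrankEq hd
  let e₂ := (e₁.arrowCongr (1 : F ≃L[ℝ] F)).trans (ContinuousLinearEquiv.piRing (Fin d))
  rw [← Function.id_comp f, ← e₂.symm_comp_self]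
  exact e₂.symm.contDiff.contDiffAt.comp_contDiffWithinAt x
    (contDiffWithinAt_pi.2 fun i => h _)

theorem contDiffWithinAt_bil {m : WithTop ℕ∞} {f : D → E →L[ℝ] E →L[ℝ] ℝ} {s : Set D} {x : D}
    (h : ∀ v w, ContDiffWithinAt ℝ m (fun z => f z v w) s x) : ContDiffWithinAt ℝ m f s x :=
  contDiffWithinAt_clm fun v => contDiffWithinAt_clm fun w => h v w

theorem contDiffAt_bil {m : WithTop ℕ∞} {f : D → E →L[ℝ] E →L[ℝ] ℝ} {x : D}
    (h : ∀ v w, ContDiffAt ℝ m (fun z => f z v w) x) : ContDiffAt ℝ m f x :=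
  contDiffWithinAt_univ.1 (contDiffWithinAt_bil fun v w => contDiffWithinAt_univ.2 (h v w))

theorem differentiableAt_bil {f : D → E →L[ℝ] E →L[ℝ] ℝ} {x : D}
    (h : ∀ v w, ContDiffAt ℝ ∞ (fun z => f z v w) x) : DifferentiableAt ℝ f x :=
  (contDiffAt_bil h).differentiableAt (by simp)

/-- The one-form `X ↦ tr(G⁻¹ D_X G)`. -/
def traceD (G : E → E →L[ℝ] E →L[ℝ] ℝ) (w : E) : E →L[ℝ] ℝ :=
  trL E ∘L (ContinuousLinearMap.compL ℝ E (E →L[ℝ] ℝ) E (G w).inverse) ∘L fderiv ℝ G w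

/-- The one-form `X ↦ tr(Y ↦ G⁻¹ ((D_Y G) X))`. -/
def traceDflip (G : E → E →L[ℝ] E →L[ℝ] ℝ) (w : E) : E →L[ℝ] ℝ :=
  trL E ∘L (ContinuousLinearMap.compL ℝ E (E →L[ℝ] ℝ) E (G w).inverse) ∘L (fderiv ℝ G w).flip

theorem traceD_apply (G : E → E →L[ℝ] E →L[ℝ] ℝ) (w X : E) :
    traceD G w X = trL E ((G w).inverse ∘L fderiv ℝ G w X) := rfl

theorem traceDflip_apply (G : E → E →L[ℝ] E →L[ℝ] ℝ) (w X : E) :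
    traceDflip G w X = trL E ((G w).inverse ∘L (fderiv ℝ G w).flip X) := rfl

end Smoothness

section Metric

variable {n : ℕ} {M : Type*} [TopologicalSpace M] [ChartedSpace (Model n) M]
  {J : EndField n M} {φ : OpenPartialHomeomorph M (CE n)} {ω₁ : Form n M 2}

theorem IsHermitianForm.isHermOn (h : IsHermitianForm J ω₁) {x : M} (hJ : ∀ v, J x (J x v) = -v) :
    IsHermOn (J x) ⊤ (metricBil J ω₁ x) := by
  have hs : ∀ v w : TS n x, ω₁ x ![v, J x w] = ω₁ x ![w, J x v] := fun v w => by
    have h1 := h.1 x w (J x v)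
    rw [hJ] at h1
    have h2 := form_swap (E := Model n) (ω₁ x) v (J x w)
    have h3 := (toBil (Model n) (ω₁ x) (J x w)).map_neg v
    have h4 : ω₁ x ![J x w, -v] = -ω₁ x ![J x w, v] :=
      (toBil_apply (E := Model n) (ω₁ x) (J x w) (-v)).symm.trans
        (h3.trans (congrArg Neg.neg (toBil_apply (E := Model n) (ω₁ x) (J x w) v)))
    exact h2.trans (h4.symm.trans h1)
  refine ⟨hJ, fun _ _ => trivial, fun v _ w _ => ?_, fun v _ hv => ?_, fun v _ w _ => ?_⟩
  · rw [metricBil_apply, metricBil_apply]; exact hs v w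
  · rw [metricBil_apply]; exact h.2 x v hv
  · rw [metricBil_apply, metricBil_apply]; exact h.1 x v (J x w)

theorem isHermOn_pullBil (hφ : IsHoloChart J φ) {w : CE n} (hw : w ∈ φ.target) {h : BilinField n M}
    (H : IsHermOn (J (φ.symm w)) ⊤ (h (φ.symm w))) : IsHermOn (mulI n) ⊤ (pullBil φ h w) := by
  refine ⟨mulI_mulI, fun _ _ => trivial, fun v _ z _ => H.symm _ trivial _ trivial,
    fun v _ hv => H.pos _ trivial fun h0 => hv ?_, fun v _ z _ => ?_⟩
  · have h1 := congrArg (dChart φ (φ.symm w)) h0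
    rw [map_zero] at h1
    exact (dChart_dSymm hφ.isSmoothChart hw v).symm.trans h1
  · rw [pullBil_apply, dSymm_mulI hφ hw, dSymm_mulI hφ hw]
    exact H.map_J _ trivial _ trivial

theorem pullBil_metricBil (hφ : IsHoloChart J φ) {w : CE n} (hw : w ∈ φ.target) (X Y : CE n) :
    pullBil φ (metricBil J ω₁) w X Y = pull φ ω₁ w ![X, mulI n Y] := by
  rw [pullBil_apply, metricBil_apply, metricOf, ← dSymm_mulI hφ hw]
  exact (form_comp_two _ _ X (mulI n Y)).symm

theorem contDiffOn_pullBil_metricBil (hφ : IsHoloChart J φ) {S : Set ℝ} {ω₁ : ℝ → Form n M 2}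
    (h : ContDiffOn ℝ ∞ (fun p : ℝ × CE n => pull φ (ω₁ p.1) p.2) (S ×ˢ φ.target)) :
    ContDiffOn ℝ ∞ (fun p : ℝ × CE n => pullBil φ (metricBil J (ω₁ p.1)) p.2) (S ×ˢ φ.target) := by
  intro p hp
  refine contDiffWithinAt_bil fun X Y => ?_
  have h1 : ∀ q ∈ S ×ˢ φ.target, pullBil φ (metricBil J (ω₁ q.1)) q.2 X Y
      = pull φ (ω₁ q.1) q.2 ![X, mulI n Y] := fun q hq => pullBil_metricBil hφ hq.2 X Y
  exact (ContDiffWithinAt.form_apply (h p hp) _).congr h1 (h1 p hp)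

theorem IsSmoothForm.contDiffAt_pull [IsManifold 𝓘(ℝ, Model n) ∞ M] {E : Type*}
    [NormedAddCommGroup E] [NormedSpace ℝ E] [FiniteDimensional ℝ E]
    {ψ : OpenPartialHomeomorph M E} {k : ℕ} {α : Form n M k}
    (hα : IsSmoothForm α) (h : IsSmoothChart (n := n) ψ) {w : E} (hw : w ∈ ψ.target) :
    ContDiffAt ℝ ∞ (pull ψ α) w := by
  have h1 := (SmoothFamilyOn.contDiffOn_pull h hα).contDiffAt
    ((isOpen_univ.prod ψ.open_target).mem_nhds (show ((0 : ℝ), w) ∈ Set.univ ×ˢ ψ.target from ⟨trivial, hw⟩))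
  exact (h1.comp w (contDiffAt_const.prodMk contDiffAt_id) :)

theorem dChart_injective {E : Type*} [NormedAddCommGroup E] [NormedSpace ℝ E]
    {ψ : OpenPartialHomeomorph M E} (h : IsSmoothChart (n := n) ψ) {x : M} (hx : x ∈ ψ.source) :
    Function.Injective (dChart (n := n) ψ x) := by
  obtain ⟨w, hw, rfl⟩ : ∃ w ∈ ψ.target, ψ.symm w = x := ⟨ψ x, ψ.map_source hx, ψ.left_inv hx⟩
  exact Function.LeftInverse.injective (dSymm_dChart h hw)

theorem pullBil_dChart {E : Type*} [NormedAddCommGroup E] [NormedSpace ℝ E]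
    {ψ : OpenPartialHomeomorph M E} (h : IsSmoothChart (n := n) ψ) (b : BilinField n M) {x : M}
    (hx : x ∈ ψ.source) (u v : TS n x) :
    pullBil ψ b (ψ x) (dChart ψ x u) (dChart ψ x v) = b x u v := by
  obtain ⟨w, hw, rfl⟩ : ∃ w ∈ ψ.target, ψ.symm w = x := ⟨ψ x, ψ.map_source hx, ψ.left_inv hx⟩
  rw [ψ.right_inv hw, pullBil_apply, dSymm_dChart h hw, dSymm_dChart h hw]

set_option maxHeartbeats 1000000 in
/-- The codifferential of the Kähler form of a Hermitian metric in a holomorphic chart. -/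
theorem pull_codiff [IsManifold 𝓘(ℝ, Model n) ∞ M] (hJ : IsComplexStructure J)
    (hφ : IsHoloChart J φ) (hω : IsHermitianForm J ω₁) (hsm : IsSmoothForm ω₁) {w : CE n}
    (hw : w ∈ φ.target) :
    pull φ (codiff (metricOf J ω₁) ω₁) w
      = oneForm (((1 / 2 : ℝ) • traceD (pullBil φ (metricBil J ω₁)) w
        - traceDflip (pullBil φ (metricBil J ω₁)) w) ∘L mulI n) := by
  obtain ⟨x, hx⟩ : ∃ x, φ.symm w = x := ⟨_, rfl⟩
  set ψ := chartAt (Model n) x with hψ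
  have hψs : IsSmoothChart (n := n) ψ := isSmoothChart_chartAt x
  have hφs := hφ.isSmoothChart
  have hxψ : x ∈ ψ.source := mem_chart_source _ x
  set y₀ := ψ x with hy₀
  have hy₀t : y₀ ∈ ψ.target := ψ.map_source hxψ
  have hsx : ψ.symm y₀ = x := ψ.left_inv hxψ
  have hy₀s : ψ.symm y₀ ∈ φ.source := by rw [hsx, ← hx]; exact φ.map_target hw
  set θ := φ ∘ ψ.symm with hθ
  have hθy : θ y₀ = w := by simp [hθ, hsx, ← hx, φ.right_inv hw]
  have hθs : ContDiffAt ℝ ∞ θ y₀ := contDiffAt_transition hψs hφs hy₀t hy₀s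
  set h := metricBil J ω₁ with hh
  set G := pullBil φ h with hG
  set GE := pullBil ψ h with hGE
  set B : Model n → Model n →L[ℝ] Model n →L[ℝ] ℝ := fun y => toBil _ (pull ψ ω₁ y) with hB
  have hHG : ∀ z ∈ φ.target, IsHermOn (mulI n) ⊤ (G z) := fun z hz =>
    isHermOn_pullBil hφ hz (hω.isHermOn (hJ.J_J _))
  have hev := eventually_mem_transition hy₀t hy₀s
  have hTeq : ∀ᶠ y in 𝓝 y₀, fderiv ℝ θ y = (dChart (n := n) φ (ψ.symm y)).comp (dSymm ψ y) := by
    filter_upwards [hev] with y hy using fderiv_transition hψs hφs hy.1 hy.2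
  have hTequiv : ∀ᶠ y in 𝓝 y₀, ∃ e : Model n ≃L[ℝ] CE n, (e : Model n →L[ℝ] CE n) = fderiv ℝ θ y := by
    filter_upwards [hev, hTeq] with y hy hy'
    have hinj : Function.Injective (fderiv ℝ θ y).toLinearMap := by
      have h1 : Function.Injective (dChart (n := n) φ (ψ.symm y) ∘ dSymm (n := n) ψ y) :=
        (dChart_injective hφs hy.2).comp
          (Function.LeftInverse.injective (dChart_dSymm hψs hy.1))
      rw [hy']; exact h1
    have hdim : Module.finrank ℝ (Model n) = Module.finrank ℝ (CE n) := by
      have h1 := finrank_real_of_complex (CE n)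
      rw [h1, finrank_euclideanSpace_fin, finrank_euclideanSpace_fin]
    exact ⟨(LinearEquiv.ofInjectiveOfFinrankEq _ hinj hdim).toContinuousLinearEquiv, by ext1; rfl⟩
  have hGEG : ∀ᶠ y in 𝓝 y₀, ∀ X Y, GE y X Y = G (θ y) (fderiv ℝ θ y X) (fderiv ℝ θ y Y) := by
    filter_upwards [hev, hTeq] with y hy hy' X Y
    rw [hy']
    exact (pullBil_dChart hφs h hy.2 _ _).symm
  have hGd' : ∀ z ∈ φ.target, ContDiffAt ℝ ∞ G z := fun z hz => by
    refine contDiffAt_bil fun X Y => ?_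
    refine ContDiffAt.congr_of_eventuallyEq
      (contDiffAt_form_iff.1 (hsm.contDiffAt_pull hφs hz) ![X, mulI n Y]) ?_
    filter_upwards [φ.open_target.mem_nhds hz] with z' hz' using pullBil_metricBil hφ hz' X Y
  have hGd : ContDiffAt ℝ ∞ G w := hGd' w hw
  have hDθ : ContDiffAt ℝ ∞ (fderiv ℝ θ) y₀ := hθs.fderiv_right (by simp)
  have hGEd : DifferentiableAt ℝ GE y₀ := by
    refine differentiableAt_bil fun X Y => ?_
    have hGd2 : ContDiffAt ℝ ∞ G (θ y₀) := by rw [hθy]; exact hGd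
    have h1 : ContDiffAt ℝ ∞ (fun y => G (θ y)) y₀ :=
      ContDiffAt.comp (𝕜 := ℝ) (F := CE n) (g := G) (f := θ) y₀ hGd2 hθs
    have h2 : ∀ X : Model n, ContDiffAt ℝ ∞ (fun y => fderiv ℝ θ y X) y₀ := fun X =>
      hDθ.clm_apply contDiffAt_const
    refine ContDiffAt.congr_of_eventuallyEq ((h1.clm_apply (h2 X)).clm_apply (h2 Y)) ?_
    filter_upwards [hGEG] with y hy using hy X Y
  have hBd : DifferentiableAt ℝ B y₀ := by
    refine differentiableAt_bil fun X Y => ?_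
    simp only [hB, toBil_apply]
    exact contDiffAt_form_iff.1 (hsm.contDiffAt_pull hψs hy₀t) ![X, Y]
  have hGEs : ∀ᶠ y in 𝓝 y₀, (∀ X Y, GE y X Y = GE y Y X) ∧ (∀ X, X ≠ 0 → 0 < GE y X X) := by
    filter_upwards [hev] with y hy
    have H := hω.isHermOn (x := ψ.symm y) (hJ.J_J _)
    refine ⟨fun X Y => H.symm _ trivial _ trivial, fun X hX => H.pos _ trivial fun h0 => hX ?_⟩
    exact (Function.LeftInverse.injective (dChart_dSymm hψs hy.1)) (h0.trans (map_zero _).symm)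
  have hBG : ∀ᶠ y in 𝓝 y₀, ∀ X Z,
      B y Z X = GE y X ((fderiv ℝ θ y).inverse (mulI n (fderiv ℝ θ y Z))) := by
    filter_upwards [hev, hTeq, hTequiv] with y hy hy' ⟨e, he⟩ X Z
    have h1 : dSymm (n := n) ψ y ((fderiv ℝ θ y).inverse (mulI n (fderiv ℝ θ y Z)))
        = J (ψ.symm y) (dSymm ψ y Z) := by
      apply dChart_injective hφs hy.2
      have h2 := self_apply_inverse e he (mulI n (fderiv ℝ θ y Z))
      have h3 := hφ.map_J (ψ.symm y) hy.2 (dSymm ψ y Z)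
      refine Eq.trans ?_ h3.symm
      have h4 := congrArg (fun A => A ((fderiv ℝ θ y).inverse (mulI n (fderiv ℝ θ y Z)))) hy'
      refine (h4.symm.trans h2).trans ?_
      rw [hy']; rfl
    have h4 : GE y X ((fderiv ℝ θ y).inverse (mulI n (fderiv ℝ θ y Z)))
        = metricBil J ω₁ (ψ.symm y) (dSymm ψ y X) (J (ψ.symm y) (dSymm ψ y Z)) := by
      rw [← h1]; rfl
    have h5 : B y Z X = ω₁ (ψ.symm y) ![dSymm ψ y Z, dSymm ψ y X] :=
      (toBil_apply _ _ _).trans (form_comp_two _ _ Z X)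
    rw [h4, h5, metricBil_apply, metricOf, hJ.J_J]
    have h6 : ω₁ (ψ.symm y) ![dSymm ψ y X, -dSymm ψ y Z]
        = -ω₁ (ψ.symm y) ![dSymm ψ y X, dSymm ψ y Z] :=
      (toBil_apply (E := Model n) (ω₁ (ψ.symm y)) (dSymm ψ y X) (-dSymm ψ y Z)).symm.trans
        ((map_neg _ _).trans (congrArg Neg.neg (toBil_apply (E := Model n) _ _ _)))
    rw [h6]
    exact form_swap (E := Model n) _ _ _
  have hVeq : ∀ ξ : Model n →L[ℝ] ℝ, (fun y => (GE y).inverse ((B y).flip ((GE y).inverse ξ)))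
      =ᶠ[𝓝 y₀] fun y => (fderiv ℝ θ y).inverse
        ((G (θ y)).inverse ((ξ ∘L (fderiv ℝ θ y).inverse) ∘L mulI n)) := by
    intro ξ
    filter_upwards [hev, hTequiv, hGEG, hGEs, hBG] with y hy ⟨e, he⟩ hy2 hy3 hy4
    obtain ⟨e2, he2⟩ := exists_equiv_of_pos hy3.2
    obtain ⟨e3, he3⟩ := exists_equiv_of_pos (G := G (θ y))
      (fun X hX => (hHG _ (φ.map_source hy.2)).pos X trivial hX)
    rw [← inverse_apply_self e2 he2 ((fderiv ℝ θ y).inverse _)]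
    congr 1
    ext Z
    rw [ContinuousLinearMap.flip_apply, hy4, self_apply_inverse e2 he2, hy2,
      self_apply_inverse e he, self_apply_inverse e3 he3]
    rfl
  have key := fun X => codiff_components hGEd hBd (hGEs.mono fun _ h => h.1)
    (hGEs.mono fun _ h => h.2) X
  obtain ⟨e, he⟩ := hTequiv.self_of_nhds
  have hθd : HasFDerivAt θ (fderiv ℝ θ y₀) y₀ := (hθs.differentiableAt (by simp)).hasFDerivAt
  have hGdθ : DifferentiableAt ℝ G (θ y₀) := by rw [hθy]; exact hGd.differentiableAt (by simp)
  have HG : IsHermOn (mulI n) ⊤ (G (θ y₀)) := by rw [hθy]; exact hHG w hw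
  have main : ∀ X : Model n,
      -(trL _ (fderiv ℝ (fun y => (GE y).inverse ((B y).flip ((GE y).inverse (GE y₀ X)))) y₀)
      + 1 / 2 * trL _ ((GE y₀).inverse ∘L
        fderiv ℝ GE y₀ ((GE y₀).inverse ((B y₀).flip ((GE y₀).inverse (GE y₀ X))))))
      = 1 / 2 * traceD G w (mulI n (fderiv ℝ θ y₀ X)) - traceDflip G w (mulI n (fderiv ℝ θ y₀ X)) := by
    intro X
    obtain ⟨e3, he3⟩ := exists_equiv_of_pos (G := G (θ y₀)) (fun X hX => HG.pos X trivial hX)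
    have hv : -mulI n (fderiv ℝ θ y₀ X) = (G (θ y₀)).inverse
        ((GE y₀ X ∘L (fderiv ℝ θ y₀).inverse) ∘L mulI n) := by
      rw [← inverse_apply_self e3 he3 (-mulI n (fderiv ℝ θ y₀ X))]
      congr 1
      ext Z
      rw [map_neg, neg_apply, HG.J_left trivial trivial, neg_neg]
      show _ = GE y₀ X ((fderiv ℝ θ y₀).inverse (mulI n Z))
      rw [hGEG.self_of_nhds, self_apply_inverse e he]
    have h1 := divergence_transform hθd (hDθ.differentiableAt (by simp))
      (fderiv_fderiv_symm (hθs.of_le two_le_infty)) e he hGdθ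
      (fun X Y => HG.symm X trivial Y trivial) (fun X hX => HG.pos X trivial hX) (mulI n)
      (fun X Y => HG.J_left trivial trivial) hGEd hGEG (GE y₀ X) (hVeq _) hv
    rw [h1, hθy, map_neg, map_neg, ContinuousLinearMap.comp_neg, ContinuousLinearMap.comp_neg,
      map_neg, map_neg, traceD_apply, traceDflip_apply]
    ring
  subst hx
  refine ContinuousAlternatingMap.ext fun v => ?_
  have hT : fderiv ℝ θ y₀ (dChart (n := n) ψ (φ.symm w) (dSymm φ w (v 0))) = v 0 := by
    have h1 := fderiv_transition_dChart hψs hφs hxψ (φ.map_target hw)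
    have h2 := congrArg (fun A => A (dSymm (n := n) φ w (v 0))) h1
    exact h2.trans (dChart_dSymm hφs hw _)
  have h1 := (key (dChart (n := n) ψ (φ.symm w) (dSymm φ w (v 0)))).trans (main _)
  rw [hT] at h1
  refine Eq.trans ?_ h1
  rw [metricOf_eq]
  show (∑ k, _ • (EuclideanSpace.proj k : Model n →L[ℝ] ℝ).comp (chartDeriv (φ.symm w)))
    (dSymm φ w (v 0)) = _
  rw [sum_apply]
  refine Finset.sum_congr rfl fun k _ => ?_
  have hBr : ∀ y, gramE (B y) = Matrix.of fun a b => inChart ω₁ (φ.symm w) y ![stdVec a, stdVec b] :=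
    fun y => by ext a b; exact toBil_apply (E := Model n) (pull ψ ω₁ y) _ _
  simp only [hBr]
  rfl

end Metric

end GenKahler

end

noncomputable section

namespace GenKahler

/-! ### Smoothness of bilinear fields in charts -/

section BilinSmooth

variable {n : ℕ} {M : Type*} [TopologicalSpace M] [ChartedSpace (Model n) M]
  [IsManifold 𝓘(ℝ, Model n) ∞ M] {E : Type*} [NormedAddCommGroup E] [NormedSpace ℝ E]
  [FiniteDimensional ℝ E] {φ : OpenPartialHomeomorph M E}

theorem contMDiffOn_dSymm (hφ : IsSmoothChart (n := n) φ) (X : E) :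
    ContMDiffOn 𝓘(ℝ, E) (𝓘(ℝ, Model n).prod 𝓘(ℝ, Model n)) ∞
      (fun w => Bundle.TotalSpace.mk' (Model n) (E := fun x : M => TS n x) (φ.symm w) (dSymm φ w X))
      φ.target := by
  have h1 : ContMDiffOn 𝓘(ℝ, E) 𝓘(ℝ, Model n) ∞ φ.symm φ.target := fun w hw =>
    (hφ.contMDiffAt_symm hw).contMDiffWithinAt
  have h2 := h1.contMDiffOn_tangentMapWithin (m := ∞) (by simp) φ.open_target.uniqueMDiffOn
  have h3 : ContMDiff 𝓘(ℝ, E) (𝓘(ℝ, E).prod 𝓘(ℝ, E)) ∞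
      (fun w => (Bundle.TotalSpace.mk' E (E := TangentSpace 𝓘(ℝ, E)) w X : TangentBundle 𝓘(ℝ, E) E)) :=
    contMDiff_vectorSpace_iff_contDiff.2 contDiff_const
  refine (h2.comp h3.contMDiffOn (fun w hw => hw)).congr fun w hw => ?_
  show _ = (⟨φ.symm w, mfderivWithin 𝓘(ℝ, E) 𝓘(ℝ, Model n) φ.symm φ.target w X⟩ : TangentBundle _ M)
  rw [mfderivWithin_of_isOpen φ.open_target hw]
  rfl

theorem contDiffOn_pullBil (hφ : IsSmoothChart (n := n) φ) {h : BilinField n M}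
    (hs : ContMDiff 𝓘(ℝ, Model n)
    (𝓘(ℝ, Model n).prod 𝓘(ℝ, Model n →L[ℝ] Model n →L[ℝ] ℝ)) ∞
    (fun x : M => Bundle.TotalSpace.mk' (Model n →L[ℝ] Model n →L[ℝ] ℝ)
      (E := fun x : M => TS n x →L[ℝ] TS n x →L[ℝ] ℝ) x (h x))) :
    ContDiffOn ℝ ∞ (pullBil φ h) φ.target := by
  intro w hw
  refine contDiffWithinAt_bil fun X Y => ?_
  have h0 : ContMDiffWithinAt 𝓘(ℝ, E) 𝓘(ℝ, Model n) ∞ φ.symm φ.target w :=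
    (hφ.contMDiffAt_symm hw).contMDiffWithinAt
  have h1 : ContMDiffWithinAt 𝓘(ℝ, E) (𝓘(ℝ, Model n).prod 𝓘(ℝ)) ∞
      (fun m => Bundle.TotalSpace.mk' ℝ (E := Bundle.Trivial M ℝ) (φ.symm m)
        (h (φ.symm m) (dSymm φ m X) (dSymm φ m Y))) φ.target w := by
    apply ContMDiffWithinAt.clm_bundle_apply₂ (F₁ := Model n) (F₂ := Model n)
    · exact ContMDiffAt.comp_contMDiffWithinAt w hs.contMDiffAt h0
    · exact contMDiffOn_dSymm hφ X w hw
    · exact contMDiffOn_dSymm hφ Y w hw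
  simp only [Bundle.contMDiffWithinAt_totalSpace] at h1
  exact contMDiffWithinAt_iff_contDiffWithinAt.1 h1.2

end BilinSmooth

section ComplexTrace

variable {E : Type*} [NormedAddCommGroup E] [NormedSpace ℂ E] [FiniteDimensional ℂ E]
  [FiniteDimensional ℝ E]

theorem trL_restrictScalars (A : E →L[ℂ] E) :
    trL E (A.restrictScalars ℝ) = 2 * (LinearMap.trace ℂ E A.toLinearMap).re := by
  classical
  let b := Module.finBasis ℂ E
  rw [trL_basis (Complex.basisOneI.smulTower b), LinearMap.trace_eq_matrix_trace ℂ b,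
    Fintype.sum_prod_type_right]
  simp only [Matrix.trace, Matrix.diag_apply, LinearMap.toMatrix_apply, Complex.re_sum,
    Finset.mul_sum, Fin.sum_univ_two, Module.Basis.smulTower_repr, Module.Basis.smulTower_apply]
  refine Finset.sum_congr rfl fun i _ => ?_
  simp
  ring

end ComplexTrace

end GenKahler

end

noncomputable section

namespace GenKahler

/-! ### Complex differentiability -/

section ComplexDiff

variable {E : Type*} [NormedAddCommGroup E] [NormedSpace ℂ E] {F : Type*} [NormedAddCommGroup F]
  [NormedSpace ℂ F] {D : Type*} [NormedAddCommGroup D] [NormedSpace ℂ D]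

/-- A real linear map that commutes with `i`, as a complex linear map. -/
def toComplexCLM (A : E →L[ℝ] F) (h : ∀ v, A (Complex.I • v) = Complex.I • A v) : E →L[ℂ] F where
  toFun := A
  map_add' := map_add A
  map_smul' c v := by
    conv_lhs => rw [← Complex.re_add_im c, mul_comm, add_smul, mul_smul]
    rw [RingHom.id_apply]
    conv_rhs => rw [← Complex.re_add_im c, mul_comm, add_smul, mul_smul]
    have h1 : ∀ (r : ℝ) (u : E), A ((r : ℂ) • u) = (r : ℂ) • A u := fun r u => by
      rw [Complex.coe_smul, Complex.coe_smul, map_smul]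
    simp only [map_add, h1, h]
  cont := A.cont

theorem differentiableAt_complex_of_real {f : E → F} {x : E} (hf : DifferentiableAt ℝ f x)
    (hi : ∀ X, fderiv ℝ f x (Complex.I • X) = Complex.I • fderiv ℝ f x X) :
    DifferentiableAt ℂ f x :=
  (hasFDerivAt_of_restrictScalars ℝ (f' := toComplexCLM (fderiv ℝ f x) hi) hf.hasFDerivAt
    (by ext v; rfl)).differentiableAt

theorem differentiableAt_clm_of_apply [FiniteDimensional ℂ E] {f : D → E →L[ℂ] F} {x : D}
    (h : ∀ v, DifferentiableAt ℂ (fun z => f z v) x) : DifferentiableAt ℂ f x := by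
  let d := Module.finrank ℂ E
  have hd : d = Module.finrank ℂ (Fin d → ℂ) := (Module.finrank_fin_fun ℂ).symm
  let e₁ := ContinuousLinearEquiv.ofFinrankEq hd
  let e₂ := (e₁.arrowCongr (1 : F ≃L[ℂ] F)).trans (ContinuousLinearEquiv.piRing (Fin d))
  rw [← Function.id_comp f, ← e₂.symm_comp_self]
  exact e₂.symm.differentiableAt.comp x (differentiableAt_pi.2 fun i => h _)

theorem fderiv_real_eq {f : E → F} {x : E} (hf : DifferentiableAt ℂ f x) :
    fderiv ℝ f x = (fderiv ℂ f x).restrictScalars ℝ :=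
  (hf.hasFDerivAt.restrictScalars ℝ).fderiv

end ComplexDiff

/-! ### The flat model of a commuting generalized Kähler structure -/

section FlatGK

variable {n : ℕ}

/-- A holomorphic field of involutions `P` of `ℂⁿ` on `U`, whose eigenbundles are closed under the
symmetric derivative. -/
structure FlatGK (U : Set (CE n)) (P : CE n → CE n →L[ℂ] CE n) : Prop where
  isOpen : IsOpen U
  holo : DifferentiableOn ℂ P U
  sq : ∀ w ∈ U, ∀ X, P w (P w X) = X
  tau_pos : ∀ w ∈ U, ∀ X Y, P w X = X → P w Y = Y → fderiv ℂ P w X Y = fderiv ℂ P w Y X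
  tau_neg : ∀ w ∈ U, ∀ X Y, P w X = -X → P w Y = -Y → fderiv ℂ P w X Y = fderiv ℂ P w Y X

/-- A Kähler form on `U` of a metric for which `P` is symmetric, closed along the eigenbundles. -/
structure FlatMetric (U : Set (CE n)) (P : CE n → CE n →L[ℂ] CE n)
    (Ω : CE n → CE n [⋀^Fin 2]→L[ℝ] ℝ) : Prop where
  smooth : ContDiffOn ℝ ∞ Ω U
  inv_I : ∀ w ∈ U, ∀ X Y, Ω w ![mulI n X, mulI n Y] = Ω w ![X, Y]
  inv_P : ∀ w ∈ U, ∀ X Y, Ω w ![P w X, P w Y] = Ω w ![X, Y]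
  pos : ∀ w ∈ U, ∀ X, X ≠ 0 → 0 < Ω w ![X, mulI n X]
  closed_pos : ∀ w ∈ U, ∀ X Y V, P w X = X → P w Y = Y → P w V = V →
    extDeriv Ω w ![X, Y, V] = 0
  closed_neg : ∀ w ∈ U, ∀ X Y V, P w X = -X → P w Y = -Y → P w V = -V →
    extDeriv Ω w ![X, Y, V] = 0

theorem hasFDerivAt_toBil {E : Type*} [NormedAddCommGroup E] [NormedSpace ℝ E]
    {Ω : E → E [⋀^Fin 2]→L[ℝ] ℝ} {w : E} (h : DifferentiableAt ℝ Ω w) :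
    HasFDerivAt (fun y => toBil E (Ω y)) ((toBil E).comp (fderiv ℝ Ω w)) w :=
  HasFDerivAt.comp (𝕜 := ℝ) (G := E →L[ℝ] E →L[ℝ] ℝ) (g := toBil E) w
    (ContinuousLinearMap.hasFDerivAt (F := E →L[ℝ] E →L[ℝ] ℝ) (toBil E)) h.hasFDerivAt

theorem extDeriv_toBil {E : Type*} [NormedAddCommGroup E] [NormedSpace ℝ E]
    {Ω : E → E [⋀^Fin 2]→L[ℝ] ℝ} {w : E} (h : DifferentiableAt ℝ Ω w) (X Y Z : E) :
    extDeriv Ω w ![X, Y, Z] = fderiv ℝ (fun y => toBil E (Ω y)) w X Y Z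
      - fderiv ℝ (fun y => toBil E (Ω y)) w Y X Z + fderiv ℝ (fun y => toBil E (Ω y)) w Z X Y := by
  have h1 := hasFDerivAt_toBil h
  have h2 : ∀ A B C : E, fderiv ℝ (fun y => Ω y ![A, B]) w C
      = fderiv ℝ (fun y => toBil E (Ω y)) w C A B := fun A B C => by
    have h3 := (((h1.clm_apply (hasFDerivAt_const A w)).clm_apply (hasFDerivAt_const B w))).fderiv
    rw [h1.fderiv]
    simp only [toBil_apply] at h3
    rw [h3]
    simp
  rw [extDeriv_two_apply h, h2, h2, h2]

/-- The Nijenhuis tensor of an endomorphism field that is constant in some coordinates vanishes. -/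
theorem nijenhuis_symm {E : Type*} [NormedAddCommGroup E] [NormedSpace ℝ E] {F : Type*}
    [NormedAddCommGroup F] [NormedSpace ℝ F] {T : E → E →L[ℝ] F} {K : E → E →L[ℝ] E} {w : E}
    (hT : DifferentiableAt ℝ T w) (hK : DifferentiableAt ℝ K w) (J : F →L[ℝ] F)
    (hJ : ∀ v, J (J v) = -v)
    (hTs : ∀ X Y, fderiv ℝ T w X Y = fderiv ℝ T w Y X) (hinj : Function.Injective (T w))
    (h : ∀ᶠ y in 𝓝 w, ∀ Y, T y (K y Y) = J (T y Y)) (X Y : E) :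
    fderiv ℝ K w (K w X) Y - K w (fderiv ℝ K w X Y)
      = fderiv ℝ K w (K w Y) X - K w (fderiv ℝ K w Y X) := by
  have h0 := h.self_of_nhds
  have h1 : ∀ X Y, T w (fderiv ℝ K w X Y) = J (fderiv ℝ T w X Y) - fderiv ℝ T w X (K w Y) := by
    intro X Y
    have e1 := (hT.hasFDerivAt.clm_apply (hK.hasFDerivAt.clm_apply (hasFDerivAt_const Y w))).fderiv
    have e2 := (J.hasFDerivAt.comp w (hT.hasFDerivAt.clm_apply (hasFDerivAt_const Y w))).fderiv
    have e3 : (fun y => T y (K y Y)) =ᶠ[𝓝 w] (J ∘ fun y => T y Y) := by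
      filter_upwards [h] with y hy using hy Y
    have e4 := congrArg (fun A => A X) (e1.symm.trans (e3.fderiv_eq.trans e2))
    simp at e4
    rw [← e4]; abel
  apply hinj
  simp only [map_sub, h1, h0, hJ]
  rw [hTs (K w X) Y, hTs (K w Y) X, hTs (K w X) (K w Y), hTs X Y]
  abel

theorem FlatGK.neg {U : Set (CE n)} {P : CE n → CE n →L[ℂ] CE n} (H : FlatGK U P) :
    FlatGK U (-P) := by
  have h1 : ∀ w, fderiv ℂ (-P) w = -fderiv ℂ P w := fun w => fderiv_neg
  refine ⟨H.isOpen, H.holo.neg, fun w hw X => by simp [H.sq w hw], fun w hw X Y hX hY => ?_,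
    fun w hw X Y hX hY => ?_⟩
  · have := H.tau_neg w hw X Y (neg_eq_iff_eq_neg.1 hX) (neg_eq_iff_eq_neg.1 hY)
    simp [h1, this]
  · have := H.tau_pos w hw X Y (neg_inj.1 hX) (neg_inj.1 hY)
    simp [h1, this]

theorem FlatMetric.neg {U : Set (CE n)} {P : CE n → CE n →L[ℂ] CE n}
    {Ω : CE n → CE n [⋀^Fin 2]→L[ℝ] ℝ} (H : FlatMetric U P Ω) : FlatMetric U (-P) Ω := by
  refine ⟨H.smooth, H.inv_I, fun w hw X Y => ?_, H.pos, fun w hw X Y V hX hY hV => ?_,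
    fun w hw X Y V hX hY hV => ?_⟩
  · have h := H.inv_P w hw X Y
    show Ω w ![-(P w X), -(P w Y)] = _
    rw [← h, ← toBil_apply, ← toBil_apply]
    simp only [map_neg, neg_apply, neg_neg]
  · exact H.closed_neg w hw X Y V (neg_eq_iff_eq_neg.1 hX) (neg_eq_iff_eq_neg.1 hY)
      (neg_eq_iff_eq_neg.1 hV)
  · exact H.closed_pos w hw X Y V (neg_inj.1 hX) (neg_inj.1 hY) (neg_inj.1 hV)

variable {U : Set (CE n)} {P : CE n → CE n →L[ℝ] CE n} {Ω Ωm : CE n → CE n [⋀^Fin 2]→L[ℝ] ℝ}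

theorem involution_anticomm {w : CE n} (hP : DifferentiableAt ℝ P w)
    (hsq : ∀ᶠ y in 𝓝 w, ∀ X, P y (P y X) = X) (X Y : CE n) :
    P w (fderiv ℝ P w X Y) = -fderiv ℝ P w X (P w Y) := by
  have e1 := (hP.hasFDerivAt.clm_apply (hP.hasFDerivAt.clm_apply (hasFDerivAt_const Y w))).fderiv
  have e2 : (fun y => P y (P y Y)) =ᶠ[𝓝 w] fun _ => Y := by
    filter_upwards [hsq] with y hy using hy Y
  rw [e2.fderiv_eq] at e1
  have e3 := congrArg (fun A => A X) e1
  simp at e3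
  exact eq_neg_of_add_eq_zero_left e3.symm

/-- The exterior derivative of the second Kähler form `-Ω(P·, ·)`. -/
theorem extDeriv_twist {w : CE n} (hP : DifferentiableAt ℝ P w) (hΩ : DifferentiableAt ℝ Ω w)
    (hΩm : DifferentiableAt ℝ Ωm w)
    (h : ∀ᶠ y in 𝓝 w, ∀ X Y, Ωm y ![X, Y] = -Ω y ![P y X, Y]) (X Y V : CE n) :
    extDeriv Ωm w ![X, Y, V] =
      -(fderiv ℝ (fun y => toBil _ (Ω y)) w X (P w Y) V
        - fderiv ℝ (fun y => toBil _ (Ω y)) w Y (P w X) V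
        + fderiv ℝ (fun y => toBil _ (Ω y)) w V (P w X) Y)
      - (Ω w ![fderiv ℝ P w X Y - fderiv ℝ P w Y X, V] + Ω w ![fderiv ℝ P w V X, Y]) := by
  have hB := (hasFDerivAt_toBil hΩ).differentiableAt
  have hBm := (hasFDerivAt_toBil hΩm).differentiableAt
  have h1 : ∀ X Y V, fderiv ℝ (fun y => toBil _ (Ωm y)) w X Y V
      = -fderiv ℝ (fun y => toBil _ (Ω y)) w X (P w Y) V
        - toBil _ (Ω w) (fderiv ℝ P w X Y) V := by
    intro X Y V
    have e1 := ((hBm.hasFDerivAt.clm_apply (hasFDerivAt_const Y w)).clm_apply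
      (hasFDerivAt_const V w)).fderiv
    have e2 := ((hB.hasFDerivAt.clm_apply (hP.hasFDerivAt.clm_apply (hasFDerivAt_const Y w))).clm_apply
      (hasFDerivAt_const V w)).neg.fderiv
    have e3 : (fun y => toBil _ (Ωm y) Y V) =ᶠ[𝓝 w] (-fun y => toBil _ (Ω y) (P y Y) V) := by
      filter_upwards [h] with y hy
      simp [hy]
    have e4 := congrArg (fun A => A X) (e1.symm.trans (e3.fderiv_eq.trans e2))
    simp only [add_apply, neg_apply, ContinuousLinearMap.comp_apply, ContinuousLinearMap.flip_apply,
      zero_apply, map_zero, zero_add] at e4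
    rw [e4]
    ring
  rw [extDeriv_toBil hΩm, h1, h1, h1, ← toBil_apply, ← toBil_apply, map_sub, sub_apply]
  ring

theorem form_smul_three {E : Type*} [NormedAddCommGroup E] [NormedSpace ℝ E]
    (α : E [⋀^Fin 3]→L[ℝ] ℝ) (a b c : ℝ) (X Y V : E) :
    α ![a • X, b • Y, c • V] = a * b * c * α ![X, Y, V] := by
  have h := α.map_smul_univ ![a, b, c] ![X, Y, V]
  rw [Fin.prod_univ_three] at h
  rw [← smul_eq_mul, show a * b * c = ![a, b, c] 0 * ![a, b, c] 1 * ![a, b, c] 2 from rfl, ← h]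
  congr 1
  ext i
  fin_cases i <;> rfl

theorem flatGK_of_real (hU : IsOpen U) (hP : ContDiffOn ℝ ∞ P U)
    (hsq : ∀ w ∈ U, ∀ X, P w (P w X) = X) (hcomm : ∀ w ∈ U, ∀ X, P w (mulI n X) = mulI n (P w X))
    (hΩ : ContDiffOn ℝ ∞ Ω U) (hΩm : ContDiffOn ℝ ∞ Ωm U)
    (hI : ∀ w ∈ U, ∀ X Y, Ω w ![mulI n X, mulI n Y] = Ω w ![X, Y])
    (hinv : ∀ w ∈ U, ∀ X Y, Ω w ![P w X, P w Y] = Ω w ![X, Y])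
    (hpos : ∀ w ∈ U, ∀ X, X ≠ 0 → 0 < Ω w ![X, mulI n X])
    (htw : ∀ w ∈ U, ∀ X Y, Ωm w ![X, Y] = -Ω w ![P w X, Y])
    (hN : ∀ w ∈ U, ∀ X Y,
      fderiv ℝ P w (mulI n (P w X)) Y - P w (mulI n (fderiv ℝ P w X Y))
      = fderiv ℝ P w (mulI n (P w Y)) X - P w (mulI n (fderiv ℝ P w Y X)))
    (hdc : ∀ w ∈ U, ∀ X Y V, -extDeriv Ω w ![mulI n X, mulI n Y, mulI n V]
      = extDeriv Ωm w ![-mulI n (P w X), -mulI n (P w Y), -mulI n (P w V)]) :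
    ∃ Q : CE n → CE n →L[ℂ] CE n, FlatGK U Q ∧ (∀ w ∈ U, ∀ X, Q w X = P w X) ∧
      FlatMetric U Q Ω := by
  have hPd : ∀ w ∈ U, DifferentiableAt ℝ P w := fun w hw =>
    (hP.contDiffAt (hU.mem_nhds hw)).differentiableAt (by simp)
  have hΩd : ∀ w ∈ U, DifferentiableAt ℝ Ω w := fun w hw =>
    (hΩ.contDiffAt (hU.mem_nhds hw)).differentiableAt (by simp)
  have hΩmd : ∀ w ∈ U, DifferentiableAt ℝ Ωm w := fun w hw =>
    (hΩm.contDiffAt (hU.mem_nhds hw)).differentiableAt (by simp)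
  have hanti : ∀ w ∈ U, ∀ X Y, P w (fderiv ℝ P w X Y) = -fderiv ℝ P w X (P w Y) := fun w hw =>
    involution_anticomm (hPd w hw) (by filter_upwards [hU.mem_nhds hw] with y hy using hsq y hy)
  have hDI : ∀ w ∈ U, ∀ X Y, fderiv ℝ P w X (mulI n Y) = mulI n (fderiv ℝ P w X Y) := by
    intro w hw X Y
    have e1 := ((hPd w hw).hasFDerivAt.clm_apply (hasFDerivAt_const (mulI n Y) w)).fderiv
    have e2 := ((mulI n).hasFDerivAt.comp w
      ((hPd w hw).hasFDerivAt.clm_apply (hasFDerivAt_const Y w))).fderiv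
    have e3 : (fun y => P y (mulI n Y)) =ᶠ[𝓝 w] (mulI n ∘ fun y => P y Y) := by
      filter_upwards [hU.mem_nhds hw] with y hy using hcomm y hy Y
    have e4 := congrArg (fun A => A X) (e1.symm.trans (e3.fderiv_eq.trans e2))
    simpa using e4
  have horth : ∀ w ∈ U, ∀ ε : ℝ, ε * ε = 1 → ∀ a b, P w a = -ε • a → P w b = ε • b →
      Ω w ![a, b] = 0 := by
    intro w hw ε hε a b ha hb
    have h := hinv w hw a b
    rw [ha, hb, ← toBil_apply, ← toBil_apply] at h
    simp only [map_smul, smul_apply, smul_eq_mul] at h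
    rw [← toBil_apply]
    linear_combination -1 / 2 * h - 1 / 2 * toBil _ (Ω w) a b * hε
  have hDeig : ∀ w ∈ U, ∀ ε : ℝ, ∀ X Y, P w Y = ε • Y →
      P w (fderiv ℝ P w X Y) = -ε • fderiv ℝ P w X Y := by
    intro w hw ε X Y hY
    rw [hanti w hw, hY, map_smul, neg_smul]
  have hIeig : ∀ w ∈ U, ∀ ε : ℝ, ∀ X, P w X = ε • X → P w (mulI n X) = ε • mulI n X := by
    intro w hw ε X hX
    rw [hcomm w hw, hX, map_smul]
  have htwd : ∀ w ∈ U, ∀ ε : ℝ, ε * ε = 1 → ∀ X Y V, P w X = ε • X → P w Y = ε • Y →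
      extDeriv Ωm w ![X, Y, V] = -(ε * extDeriv Ω w ![X, Y, V])
        - Ω w ![fderiv ℝ P w X Y - fderiv ℝ P w Y X, V] := by
    intro w hw ε hε X Y V hX hY
    rw [extDeriv_twist (hPd w hw) (hΩd w hw) (hΩmd w hw)
      (by filter_upwards [hU.mem_nhds hw] with y hy using htw y hy), extDeriv_toBil (hΩd w hw),
      horth w hw ε hε _ Y (hDeig w hw ε V X hX) hY, hX, hY]
    simp only [map_smul, smul_apply, smul_eq_mul]
    ring
  have hdc' : ∀ w ∈ U, ∀ a b c : ℝ, ∀ X Y V, P w X = a • X → P w Y = b • Y → P w V = c • V →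
      extDeriv Ω w ![X, Y, V] = a * b * c * extDeriv Ωm w ![X, Y, V] := by
    intro w hw a b c X Y V hX hY hV
    have h := hdc w hw (-mulI n X) (-mulI n Y) (-mulI n V)
    simp only [map_neg, mulI_mulI, neg_neg] at h
    have h1 : ∀ e : ℝ, ∀ Z, P w Z = e • Z → mulI n (P w (mulI n Z)) = -e • Z := fun e Z hZ => by
      rw [hIeig w hw e Z hZ, map_smul, mulI_mulI, smul_neg, neg_smul]
    rw [h1 a X hX, h1 b Y hY, h1 c V hV, form_smul_three] at h
    linarith
  have htau : ∀ w ∈ U, ∀ ε : ℝ, ε * ε = 1 → ∀ X Y, P w X = ε • X → P w Y = ε • Y →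
      fderiv ℝ P w X Y = fderiv ℝ P w Y X := by
    intro w hw ε hε X Y hX hY
    set t := fderiv ℝ P w X Y - fderiv ℝ P w Y X with ht
    have h1 : P w (mulI n t) = -ε • mulI n t := by
      refine hIeig w hw _ t ?_
      rw [ht, map_sub, hDeig w hw ε X Y hY, hDeig w hw ε Y X hX, smul_sub]
    have h2 := hdc' w hw ε ε (-ε) X Y (mulI n t) hX hY h1
    rw [htwd w hw ε hε X Y _ hX hY, ← ht] at h2
    have h3 : ε * Ω w ![t, mulI n t] = 0 := by
      linear_combination -h2 - (extDeriv Ω w ![X, Y, mulI n t] * (1 + ε * ε)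
        + ε * Ω w ![t, mulI n t]) * hε
    by_contra hne
    have h4 := hpos w hw t (sub_ne_zero.2 hne)
    rcases mul_eq_zero.1 h3 with h5 | h5
    · rw [h5] at hε; norm_num at hε
    · exact h4.ne' h5
  have hclosed : ∀ w ∈ U, ∀ ε : ℝ, ε * ε = 1 → ∀ X Y V, P w X = ε • X → P w Y = ε • Y →
      P w V = ε • V → extDeriv Ω w ![X, Y, V] = 0 := by
    intro w hw ε hε X Y V hX hY hV
    have h2 := hdc' w hw ε ε ε X Y V hX hY hV
    rw [htwd w hw ε hε X Y _ hX hY, htau w hw ε hε X Y hX hY, sub_self] at h2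
    rw [← toBil_apply, map_zero, zero_apply] at h2
    linear_combination 1 / 2 * h2 - 1 / 2 * (ε * ε + 1) * extDeriv Ω w ![X, Y, V] * hε
  have hmix : ∀ w ∈ U, ∀ ε : ℝ, ε * ε = 1 → ∀ X Y, P w X = ε • X → P w Y = -ε • Y →
      fderiv ℝ P w (mulI n X) Y = mulI n (fderiv ℝ P w X Y) := by
    intro w hw ε hε X Y hX hY
    set a := mulI n (fderiv ℝ P w (mulI n X) Y) + fderiv ℝ P w X Y with ha
    set b := mulI n (fderiv ℝ P w (mulI n Y) X) + fderiv ℝ P w Y X with hb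
    have hPa : P w a = ε • a := by
      rw [ha, map_add, hcomm w hw, hDeig w hw _ _ Y hY, hDeig w hw _ _ Y hY, neg_neg, map_smul,
        smul_add]
    have hPb : P w b = -ε • b := by
      rw [hb, map_add, hcomm w hw, hDeig w hw _ _ X hX, hDeig w hw _ _ X hX, map_smul, smul_add]
    have h1 := hN w hw X Y
    rw [hX, hY, hcomm w hw, hcomm w hw, hDeig w hw _ _ Y hY, hDeig w hw _ _ X hX] at h1
    simp only [map_smul, smul_apply, neg_neg] at h1
    have h2 : ε • a = -ε • b := by
      have h3 := congrArg (mulI n) h1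
      simp only [map_sub, map_smul, mulI_mulI] at h3
      rw [ha, hb, smul_add, smul_add]
      simp only [smul_neg, sub_neg_eq_add, neg_smul] at h3 ⊢
      rw [h3]
    have h4 : a = -b := by
      have := congrArg (fun v => ε • v) h2
      simpa [smul_smul, hε] using this
    have h5 : ε • a = ε • b := by
      rw [← hPa, h4, map_neg, hPb, neg_smul, neg_neg]
    have h6 : a = b := by
      have := congrArg (fun v => ε • v) h5
      simpa [smul_smul, hε] using this
    have h7 : a = 0 := by
      rw [← h6] at h4
      have h9 : (2 : ℝ) • a = 0 := by
        rw [two_smul]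
        nth_rewrite 1 [h4]
        exact neg_add_cancel a
      simpa using h9
    have h8 := congrArg (mulI n) h7
    rw [ha, map_add, mulI_mulI, map_zero] at h8
    exact (neg_add_eq_zero.1 h8)
  have hsame : ∀ w ∈ U, ∀ ε : ℝ, ε * ε = 1 → ∀ X Y, P w X = ε • X → P w Y = ε • Y →
      fderiv ℝ P w (mulI n X) Y = mulI n (fderiv ℝ P w X Y) := by
    intro w hw ε hε X Y hX hY
    rw [htau w hw ε hε _ _ (hIeig w hw ε X hX) hY, hDI w hw, htau w hw ε hε _ _ hY hX]
  have hhol : ∀ w ∈ U, ∀ X Y, fderiv ℝ P w (mulI n X) Y = mulI n (fderiv ℝ P w X Y) := by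
    intro w hw X Y
    have hdec : ∀ Z, ∃ Zp Zm, P w Zp = (1 : ℝ) • Zp ∧ P w Zm = (-1 : ℝ) • Zm ∧ Z = Zp + Zm := by
      intro Z
      refine ⟨(1 / 2 : ℝ) • (Z + P w Z), (1 / 2 : ℝ) • (Z - P w Z), ?_, ?_, ?_⟩
      · rw [map_smul, map_add, hsq w hw, one_smul, add_comm]
      · rw [map_smul, map_sub, hsq w hw, neg_one_smul, ← smul_neg, neg_sub]
      · module
    obtain ⟨Xp, Xm, hXp, hXm, rfl⟩ := hdec X
    obtain ⟨Yp, Ym, hYp, hYm, rfl⟩ := hdec Y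
    have e1 := hsame w hw 1 (by norm_num) Xp Yp hXp hYp
    have e2 := hsame w hw (-1) (by norm_num) Xm Ym hXm hYm
    have e3 := hmix w hw 1 (by norm_num) Xp Ym hXp hYm
    have e4 := hmix w hw (-1) (by norm_num) Xm Yp hXm (by rw [neg_neg]; exact hYp)
    simp only [map_add, add_apply, e1, e2, e3, e4]
  classical
  let Q : CE n → CE n →L[ℂ] CE n := fun w =>
    if h : w ∈ U then toComplexCLM (P w) (hcomm w h) else 0
  have hQ : ∀ w ∈ U, ∀ X, Q w X = P w X := fun w hw X => by
    simp only [Q, dif_pos hw]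
    rfl
  have hQd : ∀ w ∈ U, DifferentiableAt ℂ Q w := by
    intro w hw
    refine differentiableAt_clm_of_apply fun v => ?_
    have e : (fun z => Q z v) =ᶠ[𝓝 w] fun z => P z v := by
      filter_upwards [hU.mem_nhds hw] with y hy using hQ y hy v
    have e1 := (hPd w hw).hasFDerivAt.clm_apply (hasFDerivAt_const v w)
    refine (differentiableAt_complex_of_real e1.differentiableAt fun X => ?_).congr_of_eventuallyEq e
    rw [e1.fderiv]
    simpa using hhol w hw X v
  have hQf : ∀ w ∈ U, ∀ X Y, fderiv ℂ Q w X Y = fderiv ℝ P w X Y := by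
    intro w hw X Y
    have e : (fun z => Q z Y) =ᶠ[𝓝 w] fun z => P z Y := by
      filter_upwards [hU.mem_nhds hw] with y hy using hQ y hy Y
    have e1 := (hPd w hw).hasFDerivAt.clm_apply (hasFDerivAt_const Y w)
    have e2 := (hQd w hw).hasFDerivAt.clm_apply (hasFDerivAt_const Y w)
    have e3 := e.fderiv_eq (𝕜 := ℝ)
    rw [e1.fderiv, fderiv_real_eq e2.differentiableAt, e2.fderiv] at e3
    simpa using congrArg (fun A => A X) e3
  have hp : ∀ w ∈ U, ∀ X, Q w X = X → P w X = (1 : ℝ) • X := fun w hw X h => by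
    rw [← hQ w hw, h, one_smul]
  have hm : ∀ w ∈ U, ∀ X, Q w X = -X → P w X = (-1 : ℝ) • X := fun w hw X h => by
    rw [← hQ w hw, h, neg_one_smul]
  refine ⟨Q, ⟨hU, fun w hw => (hQd w hw).differentiableWithinAt, fun w hw X => ?_,
    fun w hw X Y hX hY => ?_, fun w hw X Y hX hY => ?_⟩, hQ, ⟨hΩ, hI, fun w hw X Y => ?_, hpos,
    fun w hw X Y V hX hY hV => ?_, fun w hw X Y V hX hY hV => ?_⟩⟩
  · rw [hQ w hw, hQ w hw, hsq w hw]
  · rw [hQf w hw, hQf w hw, htau w hw 1 (by norm_num) X Y (hp w hw X hX) (hp w hw Y hY)]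
  · rw [hQf w hw, hQf w hw, htau w hw (-1) (by norm_num) X Y (hm w hw X hX) (hm w hw Y hY)]
  · rw [hQ w hw, hQ w hw, hinv w hw]
  · exact hclosed w hw 1 (by norm_num) X Y V (hp w hw X hX) (hp w hw Y hY) (hp w hw V hV)
  · exact hclosed w hw (-1) (by norm_num) X Y V (hm w hw X hX) (hm w hw Y hY) (hm w hw V hV)

end FlatGK

end GenKahler

end

noncomputable section

namespace GenKahler

/-! ### Generalized Kähler structures in holomorphic charts -/

section GKChart

variable {n : ℕ} {M : Type*} [TopologicalSpace M] [ChartedSpace (Model n) M]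
  [IsManifold 𝓘(ℝ, Model n) ∞ M]

theorem exists_equiv_transition {φ χ : OpenPartialHomeomorph M (CE n)}
    (h₁ : IsSmoothChart (n := n) φ) (h₂ : IsSmoothChart (n := n) χ)
    {w : CE n} (hw : w ∈ φ.target) (hw₂ : φ.symm w ∈ χ.source) :
    ∃ e : CE n ≃L[ℝ] CE n, (e : CE n →L[ℝ] CE n) = fderiv ℝ (χ ∘ φ.symm) w := by
  have hinj : Function.Injective (fderiv ℝ (χ ∘ φ.symm) w).toLinearMap := by
    have h1 : Function.Injective (dChart (n := n) χ (φ.symm w) ∘ dSymm (n := n) φ w) :=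
      (dChart_injective h₂ hw₂).comp (Function.LeftInverse.injective (dChart_dSymm h₁ hw))
    rw [fderiv_transition h₁ h₂ hw hw₂]; exact h1
  exact ⟨(LinearEquiv.ofInjectiveOfFinrankEq _ hinj rfl).toContinuousLinearEquiv, by ext1; rfl⟩

variable {J : EndField n M} {φ χ : OpenPartialHomeomorph M (CE n)}

theorem fderiv_transition_pullEnd (h₁ : IsSmoothChart (n := n) φ) (hχ : IsHoloChart J χ)
    {w : CE n} (hw : w ∈ φ.target) (hw₂ : φ.symm w ∈ χ.source) (Y : CE n) :
    fderiv ℝ (χ ∘ φ.symm) w (pullEnd φ J w Y) = mulI n (fderiv ℝ (χ ∘ φ.symm) w Y) := by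
  rw [fderiv_transition h₁ hχ.isSmoothChart hw hw₂]
  simp only [ContinuousLinearMap.comp_apply]
  rw [dSymm_pullEnd h₁ J hw]
  exact hχ.map_J _ hw₂ _

/-- A complex structure is smooth in any smooth chart, and its Nijenhuis tensor vanishes. -/
theorem contDiffAt_pullEnd (h₁ : IsSmoothChart (n := n) φ) (hJ : IsComplexStructure J)
    {w : CE n} (hw : w ∈ φ.target) : ContDiffAt ℝ ∞ (pullEnd φ J) w ∧
    ∀ X Y, fderiv ℝ (pullEnd φ J) w (pullEnd φ J w X) Y
        - pullEnd φ J w (fderiv ℝ (pullEnd φ J) w X Y)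
      = fderiv ℝ (pullEnd φ J) w (pullEnd φ J w Y) X
        - pullEnd φ J w (fderiv ℝ (pullEnd φ J) w Y X) := by
  obtain ⟨χ, hxχ, hχ⟩ := hJ (φ.symm w)
  set T := fderiv ℝ (χ ∘ φ.symm) with hT
  have hθ : ContDiffAt ℝ ∞ (χ ∘ φ.symm) w := contDiffAt_transition h₁ hχ.isSmoothChart hw hxχ
  have hTs : ContDiffAt ℝ ∞ T w := hθ.fderiv_right (by simp)
  have hev : ∀ᶠ y in 𝓝 w, ∀ Y, T y (pullEnd φ J y Y) = mulI n (T y Y) := by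
    filter_upwards [eventually_mem_transition (φ₂ := χ) hw hxχ] with y hy Y
    exact fderiv_transition_pullEnd h₁ hχ hy.1 hy.2 Y
  obtain ⟨e, he⟩ := exists_equiv_transition h₁ hχ.isSmoothChart hw hxχ
  have hsm : ContDiffAt ℝ ∞ (pullEnd φ J) w := by
    have h2 : ContDiffAt ℝ ∞ (fun y => (T y).inverse ∘L (mulI n ∘L T y)) w :=
      (contDiffWithinAt_univ.1 (contDiffWithinAt_inverse (contDiffWithinAt_univ.2 hTs) e he)).clm_comp
        (contDiffAt_const.clm_comp hTs)
    refine h2.congr_of_eventuallyEq ?_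
    filter_upwards [hev, eventually_mem_transition (φ₂ := χ) hw hxχ] with y hy hy'
    obtain ⟨e', he'⟩ := exists_equiv_transition h₁ hχ.isSmoothChart hy'.1 hy'.2
    ext1 Y
    simp only [ContinuousLinearMap.comp_apply]
    rw [← hy Y, inverse_apply_self e' he']
  refine ⟨hsm, nijenhuis_symm (hTs.differentiableAt (by simp)) (hsm.differentiableAt (by simp))
    (mulI n) mulI_mulI (fderiv_fderiv_symm (hθ.of_le two_le_infty)) ?_ hev⟩
  have h3 : T w = (e : CE n →L[ℝ] CE n) := he.symm
  rw [h3]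
  exact e.injective

variable {Jp Jm : EndField n M} {g₀ : Bundle.ContMDiffRiemannianMetric 𝓘(ℝ, Model n) ∞ (Model n)
  (fun x : M => TS n x)} {ω₀ ωm : Form n M 2}

theorem contDiffOn_pull_kahler {J' : EndField n M} (h₁ : IsSmoothChart (n := n) φ)
    (hJ' : IsComplexStructure J') {ω' : Form n M 2} (hω : IsKahlerForm g₀.inner J' ω') :
    ContDiffOn ℝ ∞ (pull φ ω') φ.target := by
  intro w hw
  refine contDiffWithinAt_form fun v => ?_
  have h1 : ∀ y ∈ φ.target, pull φ ω' y v = pullBil φ g₀.inner y (pullEnd φ J' y (v 0)) (v 1) := by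
    intro y hy
    have e : v = ![v 0, v 1] := by ext1 i; fin_cases i <;> rfl
    rw [pullBil_apply, dSymm_pullEnd h₁ J' hy, ← hω]
    conv_lhs => rw [e]
    exact form_comp_two _ _ _ _
  refine ContDiffWithinAt.congr ?_ h1 (h1 w hw)
  have h2 := contDiffOn_pullBil h₁ g₀.contMDiff w hw
  have h3 := (contDiffAt_pullEnd h₁ hJ' hw).1.contDiffWithinAt (s := φ.target)
  exact (h2.clm_apply (h3.clm_apply contDiffWithinAt_const)).clm_apply contDiffWithinAt_const

theorem pull_kahler {J' : EndField n M} {ω' : Form n M 2}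
    (hω : IsKahlerForm g₀.inner J' ω') {y : CE n} (X Y : CE n) :
    pull φ ω' y ![X, Y] = g₀.inner (φ.symm y) (J' (φ.symm y) (dSymm φ y X)) (dSymm φ y Y) := by
  rw [← hω]
  exact form_comp_two _ _ _ _

theorem IsGeneralizedKahler.exists_flat (hGK : IsGeneralizedKahler g₀ Jp Jm ω₀ ωm)
    (hcomm : ∀ x : M, (Jp x).comp (Jm x) = (Jm x).comp (Jp x)) (hφ : IsHoloChart Jp φ) :
    ∃ Q : CE n → CE n →L[ℂ] CE n, FlatGK φ.target Q ∧
      (∀ w ∈ φ.target, ∀ X, Q w X = pullEnd φ (prodJ Jp Jm) w X) ∧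
      FlatMetric φ.target Q (pull φ ω₀) := by
  have hφs := hφ.isSmoothChart
  have hJJ := fun x => hGK.complex_p.J_J x
  have hJJm := fun x => hGK.complex_m.J_J x
  have hc : ∀ x v, Jp x (Jm x v) = Jm x (Jp x v) := fun x v => congrArg (fun A => A v) (hcomm x)
  set P := pullEnd φ (prodJ Jp Jm) with hP
  set K := pullEnd φ Jm with hK
  have hPK : ∀ w ∈ φ.target, P w = mulI n ∘L K w := fun w hw => by
    rw [hP, ← pullEnd_holo hφ hw]
    exact pullEnd_comp hφs Jp Jm hw
  have hKP : ∀ w ∈ φ.target, ∀ X, K w X = -mulI n (P w X) := fun w hw X => by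
    rw [hPK w hw, ContinuousLinearMap.comp_apply, mulI_mulI, neg_neg]
  have hKs : ∀ w ∈ φ.target, ContDiffAt ℝ ∞ K w := fun w hw =>
    (contDiffAt_pullEnd hφs hGK.complex_m hw).1
  have hPev : ∀ w ∈ φ.target, P =ᶠ[𝓝 w] fun y => mulI n ∘L K y := fun w hw => by
    filter_upwards [φ.open_target.mem_nhds hw] with y hy using hPK y hy
  have hPs : ContDiffOn ℝ ∞ P φ.target := fun w hw =>
    ((contDiffAt_const.clm_comp (hKs w hw)).congr_of_eventuallyEq (hPev w hw)).contDiffWithinAt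
  have hdP : ∀ w ∈ φ.target, ∀ X Y, fderiv ℝ P w X Y = mulI n (fderiv ℝ K w X Y) := by
    intro w hw X Y
    rw [(hPev w hw).fderiv_eq]
    have := ((hasFDerivAt_const (mulI n) w).clm_comp
      ((hKs w hw).differentiableAt (by simp)).hasFDerivAt).fderiv
    rw [this]
    simp
  have hdS : ∀ w ∈ φ.target, ∀ X, dSymm (n := n) φ w (P w X)
      = Jp (φ.symm w) (Jm (φ.symm w) (dSymm φ w X)) := fun w hw X =>
    dSymm_pullEnd hφs (prodJ Jp Jm) hw X
  have hinj : ∀ w ∈ φ.target, Function.Injective (dSymm (n := n) φ w) := fun w hw =>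
    Function.LeftInverse.injective (dChart_dSymm hφs hw)
  have hcI : ∀ w ∈ φ.target, ∀ X, P w (mulI n X) = mulI n (P w X) := fun w hw X => by
    apply hinj w hw
    rw [hdS w hw, dSymm_mulI hφ hw, dSymm_mulI hφ hw, hdS w hw,
      hc _ (dSymm φ w X)]
  have hΩ := contDiffOn_pull_kahler (φ := φ) hφs hGK.complex_p hGK.kahler_p
  have hΩm := contDiffOn_pull_kahler (φ := φ) hφs hGK.complex_m hGK.kahler_m
  refine flatGK_of_real (Ωm := pull φ ωm) φ.open_target hPs (fun w hw X => ?_) hcI hΩ hΩm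
    (fun w hw X Y => ?_) (fun w hw X Y => ?_) (fun w hw X hX => ?_) (fun w hw X Y => ?_)
    (fun w hw X Y => ?_) (fun w hw X Y V => ?_)
  · apply hinj w hw
    rw [hdS w hw, hdS w hw, ← hc, hJJ, hJJm, neg_neg]
  · rw [pull_kahler hGK.kahler_p, pull_kahler hGK.kahler_p, dSymm_mulI hφ hw,
      dSymm_mulI hφ hw, hGK.compat_p]
  · rw [pull_kahler hGK.kahler_p, pull_kahler hGK.kahler_p, hdS w hw, hdS w hw,
      hGK.compat_p, hc, hGK.compat_m]
  · rw [pull_kahler hGK.kahler_p, dSymm_mulI hφ hw, hGK.compat_p]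
    exact g₀.pos _ _ fun h0 => hX (hinj w hw (h0.trans (map_zero _).symm))
  · rw [pull_kahler hGK.kahler_m, pull_kahler hGK.kahler_p, hdS w hw, hJJ, map_neg,
      neg_apply, neg_neg]
  · have h1 := (contDiffAt_pullEnd hφs hGK.complex_m hw).2 X Y
    have h2 : ∀ X Y, fderiv ℝ P w (mulI n (P w X)) Y - P w (mulI n (fderiv ℝ P w X Y))
        = -mulI n (fderiv ℝ K w (K w X) Y - K w (fderiv ℝ K w X Y)) := by
      intro X Y
      have e1 : mulI n (P w X) = -K w X := by rw [hKP w hw, neg_neg]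
      rw [e1, hcI w hw, ← neg_neg (mulI n (P w _)), ← hKP w hw, hdP w hw, hdP w hw, map_neg,
        neg_apply, map_neg, map_sub]
      have e2 : K w (mulI n (fderiv ℝ K w X Y)) = mulI n (K w (fderiv ℝ K w X Y)) := by
        rw [hKP w hw, hKP w hw, hcI w hw, map_neg]
      rw [e2]
      abel
    rw [h2, h2]
    exact congrArg (fun v => -mulI n v) h1
  · have hd1 := (hΩ.contDiffAt (φ.open_target.mem_nhds hw)).differentiableAt (by simp)
    have hd2 := (hΩm.contDiffAt (φ.open_target.mem_nhds hw)).differentiableAt (by simp)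
    have h1 : pull φ (dcForm Jp ω₀) w ![X, Y, V] = pull φ (-dcForm Jm ωm) w ![X, Y, V] := by
      rw [hGK.dc_eq]
    rw [pull_dcForm hφ ω₀ hw hd1, pull_neg_form] at h1
    have h2 : pull φ (dcForm Jm ωm) w = -(extDeriv (pull φ ωm) w).compContinuousLinearMap (K w) := by
      rw [← pull_extD hφs hw hd2, hK, ← pull_comp_end hφs _ Jm hw]
      ext v
      rfl
    rw [h2, neg_neg, ContinuousAlternatingMap.neg_apply, form_comp_three, form_comp_three,
      hKP w hw, hKP w hw, hKP w hw] at h1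
    exact h1

end GKChart

end GenKahler

end

noncomputable section

namespace GenKahler

/-! ### The twisted second-order operator in a holomorphic chart -/

section FlatBox

variable {n : ℕ}

/-- The real field of endomorphisms underlying a field of complex linear endomorphisms. -/
def reP (P : CE n → CE n →L[ℂ] CE n) (w : CE n) : CE n →L[ℝ] CE n := (P w).restrictScalars ℝ

@[simp] theorem reP_apply (P : CE n → CE n →L[ℂ] CE n) (w X : CE n) : reP P w X = P w X := rfl

theorem mulI_clm (A : CE n →L[ℂ] CE n) (X : CE n) : A (mulI n X) = mulI n (A X) := by simp

theorem contDiffOn_reP {P : CE n → CE n →L[ℂ] CE n} {U : Set (CE n)} (hU : IsOpen U)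
    (hP : DifferentiableOn ℂ P U) : ContDiffOn ℝ ∞ (reP P) U := by
  intro w hw
  refine contDiffWithinAt_clm fun v => ?_
  have h1 : DifferentiableOn ℂ (fun z => P z v) U := hP.clm_apply (differentiableOn_const v)
  exact (((contDiffOn_infty_of_differentiableOn_complex hU h1) w hw).restrict_scalars ℝ)

theorem fderiv_reP {P : CE n → CE n →L[ℂ] CE n} {w : CE n} (hP : DifferentiableAt ℂ P w)
    (hPr : DifferentiableAt ℝ (reP P) w) (X Y : CE n) :
    fderiv ℝ (reP P) w X Y = fderiv ℂ P w X Y := by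
  have e1 := hPr.hasFDerivAt.clm_apply (hasFDerivAt_const Y w)
  have e2 := hP.hasFDerivAt.clm_apply (hasFDerivAt_const Y w)
  have e3 := e1.fderiv
  have e4 : (fun z => reP P z Y) = fun z => P z Y := rfl
  rw [e4, fderiv_real_eq e2.differentiableAt, e2.fderiv] at e3
  simpa using (congrArg (fun A => A X) e3).symm

theorem FlatGK.differentiableAt {U : Set (CE n)} {P : CE n → CE n →L[ℂ] CE n} (H : FlatGK U P)
    {w : CE n} (hw : w ∈ U) : DifferentiableAt ℂ P w :=
  (H.holo w hw).differentiableAt (H.isOpen.mem_nhds hw)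

theorem FlatGK.contDiffAt {U : Set (CE n)} {P : CE n → CE n →L[ℂ] CE n} (H : FlatGK U P)
    {w : CE n} (hw : w ∈ U) : ContDiffAt ℝ ∞ (reP P) w :=
  (contDiffOn_reP H.isOpen H.holo).contDiffAt (H.isOpen.mem_nhds hw)

theorem FlatGK.differentiableAt_re {U : Set (CE n)} {P : CE n → CE n →L[ℂ] CE n} (H : FlatGK U P)
    {w : CE n} (hw : w ∈ U) : DifferentiableAt ℝ (reP P) w :=
  (H.contDiffAt hw).differentiableAt (by simp)

/-- `π₊ - π₋` on forms of degree two, for the involution `A`. -/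
def twist {E : Type*} [NormedAddCommGroup E] [NormedSpace ℝ E] (A : E →L[ℝ] E)
    (β : E [⋀^Fin 2]→L[ℝ] ℝ) : E [⋀^Fin 2]→L[ℝ] ℝ :=
  β.compContinuousLinearMap ((1 / 2 : ℝ) • (ContinuousLinearMap.id ℝ E + A))
    - β.compContinuousLinearMap ((1 / 2 : ℝ) • (ContinuousLinearMap.id ℝ E - A))

theorem twist_apply {E : Type*} [NormedAddCommGroup E] [NormedSpace ℝ E] (A : E →L[ℝ] E)
    (β : E [⋀^Fin 2]→L[ℝ] ℝ) (X Y : E) :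
    twist A β ![X, Y] = 1 / 2 * (β ![X, A Y] + β ![A X, Y]) := by
  rw [twist, ContinuousAlternatingMap.sub_apply, form_comp_two, form_comp_two]
  simp only [← toBil_apply, smul_apply, add_apply, sub_apply, ContinuousLinearMap.id_apply,
    map_smul, map_add, map_sub, smul_eq_mul]
  ring

theorem twist_add {E : Type*} [NormedAddCommGroup E] [NormedSpace ℝ E] (A : E →L[ℝ] E)
    (β γ : E [⋀^Fin 2]→L[ℝ] ℝ) : twist A (β + γ) = twist A β + twist A γ :=
  two_form_ext fun X Y => by
    simp only [twist_apply, ContinuousAlternatingMap.add_apply]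
    ring

theorem twist_smul {E : Type*} [NormedAddCommGroup E] [NormedSpace ℝ E] (A : E →L[ℝ] E) (c : ℝ)
    (β : E [⋀^Fin 2]→L[ℝ] ℝ) : twist A (c • β) = c • twist A β :=
  two_form_ext fun X Y => by
    simp only [twist_apply, ContinuousAlternatingMap.smul_apply, smul_eq_mul]
    ring

/-- The operator `δ₊δ₊ᶜ - δ₋δ₋ᶜ` on functions. -/
def fbox (P : CE n → CE n →L[ℂ] CE n) (u : CE n → ℝ) (w : CE n) : CE n [⋀^Fin 2]→L[ℝ] ℝ :=
  twist (reP P w) (fiddbar (mulI n) u w)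

theorem fiddbar_inv_I {u : CE n → ℝ} {w : CE n} (hu : ContDiffAt ℝ 2 u w) (X Y : CE n) :
    fiddbar (mulI n) u w ![mulI n X, mulI n Y] = fiddbar (mulI n) u w ![X, Y] := by
  rw [fiddbar_apply hu, fiddbar_apply hu, mulI_mulI, mulI_mulI, map_neg, map_neg,
    fderiv_fderiv_symm hu (mulI n Y), fderiv_fderiv_symm hu (mulI n X)]
  ring

theorem fbox_inv_I {P : CE n → CE n →L[ℂ] CE n} {u : CE n → ℝ} {w : CE n}
    (hu : ContDiffAt ℝ 2 u w) (X Y : CE n) :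
    fbox P u w ![mulI n X, mulI n Y] = fbox P u w ![X, Y] := by
  rw [fbox, twist_apply, twist_apply, reP_apply, reP_apply, mulI_clm, mulI_clm, fiddbar_inv_I hu,
    fiddbar_inv_I hu]
  rfl

theorem contDiffAt_fiddbar {u : CE n → ℝ} {w : CE n} (hu : ContDiffAt ℝ ∞ u w) :
    ContDiffAt ℝ ∞ (fiddbar (mulI n) u) w := by
  rw [← contDiffWithinAt_univ]
  refine contDiffWithinAt_form fun v => ?_
  rw [contDiffWithinAt_univ]
  have hD : ContDiffAt ℝ ∞ (fderiv ℝ (fderiv ℝ u)) w :=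
    (hu.fderiv_right (m := ∞) (by simp)).fderiv_right (by simp)
  have h1 : ContDiffAt ℝ ∞ (fun z => (1 / 2 : ℝ) * (fderiv ℝ (fderiv ℝ u) z (v 1) (mulI n (v 0))
      - fderiv ℝ (fderiv ℝ u) z (v 0) (mulI n (v 1)))) w :=
    contDiffAt_const.mul (((hD.clm_apply contDiffAt_const).clm_apply contDiffAt_const).sub
      ((hD.clm_apply contDiffAt_const).clm_apply contDiffAt_const))
  refine h1.congr_of_eventuallyEq ?_
  filter_upwards [(hu.of_le two_le_infty).eventually (by simp)] with z hz
  have e : v = ![v 0, v 1] := by ext1 i; fin_cases i <;> rfl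
  conv_lhs => rw [e]
  exact fiddbar_apply hz _ _

theorem extDeriv_fiddbar {u : CE n → ℝ} {w : CE n} (hu : ContDiffAt ℝ ∞ u w) :
    extDeriv (fiddbar (mulI n) u) w = 0 := by
  have h1 : ContDiffAt ℝ ∞ (fdc (mulI n) u) w := by
    rw [← contDiffWithinAt_univ]
    refine contDiffWithinAt_form fun v => ?_
    rw [contDiffWithinAt_univ]
    have hD : ContDiffAt ℝ ∞ (fderiv ℝ u) w := hu.fderiv_right (m := ∞) (by simp)
    exact ((hD.clm_apply (contDiffAt_const (c := mulI n (v 0)))).neg :)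
  have h2 : fiddbar (mulI n) u = (1 / 2 : ℝ) • extDeriv (fdc (mulI n) u) := rfl
  rw [h2, extDeriv_smul, extDeriv_extDeriv_apply h1
    (by rw [minSmoothness_of_isRCLikeNormedField]; exact two_le_infty), smul_zero]

theorem contDiffAt_fbox {U : Set (CE n)} {P : CE n → CE n →L[ℂ] CE n} (H : FlatGK U P)
    {u : CE n → ℝ} {w : CE n} (hw : w ∈ U) (hu : ContDiffAt ℝ ∞ u w) :
    ContDiffAt ℝ ∞ (fbox P u) w := by
  refine contDiffAt_form_iff.2 fun v => ?_
  have hb := contDiffAt_fiddbar hu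
  have hP := H.contDiffAt hw
  have h2 : ∀ v : CE n, ContDiffAt ℝ ∞ (fun z => reP P z v) w := fun v =>
    hP.clm_apply contDiffAt_const
  have h3 : ∀ a b : CE n → CE n, ContDiffAt ℝ ∞ a w → ContDiffAt ℝ ∞ b w →
      ContDiffAt ℝ ∞ (fun z => fiddbar (mulI n) u z ![a z, b z]) w := fun a b ha hb' => by
    rw [← contDiffWithinAt_univ]
    refine ContDiffWithinAt.form_apply_vec (u := fun z => ![a z, b z]) hb.contDiffWithinAt
      (contDiffWithinAt_pi.2 fun i => ?_)
    fin_cases i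
    · exact ha.contDiffWithinAt
    · exact hb'.contDiffWithinAt
  have e : v = ![v 0, v 1] := by ext1 i; fin_cases i <;> rfl
  rw [e]
  simp only [fbox, twist_apply]
  exact contDiffAt_const.mul ((h3 _ _ contDiffAt_const (h2 (v 1))).add
    (h3 _ _ (h2 (v 0)) contDiffAt_const))

/-- `δ₊δ₊ᶜ - δ₋δ₋ᶜ` of a function is the `(1,1)` part of an exact form. -/
theorem fbox_eq_part11 {U : Set (CE n)} {P : CE n → CE n →L[ℂ] CE n} (H : FlatGK U P)
    {u : CE n → ℝ} {w : CE n} (hw : w ∈ U) (hu : ContDiffAt ℝ 2 u w) :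
    DifferentiableAt ℝ (fun y => fderiv ℝ u y ∘L reP P y ∘L mulI n) w ∧
    fbox P u w = -(1 / 2 : ℝ) • fpart11 (mulI n)
      (extDeriv (fun y => oneForm (fderiv ℝ u y ∘L reP P y ∘L mulI n)) w) := by
  have hD := (differentiableAt_fderiv_of_contDiffAt hu).hasFDerivAt
  have hP := (H.differentiableAt_re hw).hasFDerivAt
  have h1 := hD.clm_comp (hP.clm_comp (hasFDerivAt_const (mulI n) w))
  refine ⟨h1.differentiableAt, two_form_ext fun X Y => ?_⟩
  have h2 : ∀ X Y, fderiv ℝ (fun y => fderiv ℝ u y ∘L reP P y ∘L mulI n) w X Y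
      = fderiv ℝ (fderiv ℝ u) w X (P w (mulI n Y)) + fderiv ℝ u w (fderiv ℂ P w X (mulI n Y)) := by
    intro X Y
    rw [h1.fderiv]
    simp [← fderiv_reP (H.differentiableAt hw) (H.differentiableAt_re hw), add_comm]
  rw [ContinuousAlternatingMap.smul_apply, fpart11_apply]
  have h3 : ∀ X Y, extDeriv (fun y => oneForm (fderiv ℝ u y ∘L reP P y ∘L mulI n)) w ![X, Y]
      = fderiv ℝ (fun y => fderiv ℝ u y ∘L reP P y ∘L mulI n) w X Y
        - fderiv ℝ (fun y => fderiv ℝ u y ∘L reP P y ∘L mulI n) w Y X := fun X Y =>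
    extDeriv_oneForm_apply h1.differentiableAt X Y
  have h4 : ∀ X : CE n, fderiv ℂ P w (mulI n X) = Complex.I • fderiv ℂ P w X := fun X =>
    (fderiv ℂ P w).map_smul Complex.I X
  rw [h3, h3, h2, h2, h2, h2, fbox, twist_apply, fiddbar_apply hu, fiddbar_apply hu]
  have h5 : ∀ v : CE n, Complex.I • v = mulI n v := fun _ => rfl
  simp only [mulI_mulI, map_neg, h4, smul_apply, reP_apply, h5, mulI_clm, smul_eq_mul]
  rw [fderiv_fderiv_symm hu (P w Y), fderiv_fderiv_symm hu Y (mulI n (P w X)),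
    fderiv_fderiv_symm hu (mulI n Y)]
  ring

/-- `dd^c` of the `(1,1)` part of a closed form vanishes. -/
theorem extDeriv_dc_part11 {β : CE n → CE n [⋀^Fin 2]→L[ℝ] ℝ} {w : CE n}
    (hβ : ∀ᶠ y in 𝓝 w, ContDiffAt ℝ ∞ β y) (hd : ∀ᶠ y in 𝓝 w, extDeriv β y = 0) :
    extDeriv (fun y => -(extDeriv (fun z => fpart11 (mulI n) (β z)) y).compContinuousLinearMap
      (mulI n)) w = 0 := by
  set γ : CE n → CE n [⋀^Fin 2]→L[ℝ] ℝ := fun z =>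
    (β z).compContinuousLinearMap (ContinuousLinearMap.id ℝ _ + mulI n) - β z
      - (β z).compContinuousLinearMap (mulI n) with hγ
  have hc : ∀ A : CE n →L[ℝ] CE n, ∀ z, ContDiffAt ℝ ∞ β z →
      ContDiffAt ℝ ∞ (fun z => (β z).compContinuousLinearMap A) z := fun A z hz =>
    contDiffAt_form_iff.2 fun v => contDiffAt_form_iff.1 hz (fun i => A (v i))
  have hγa : ∀ z X Y, γ z ![X, Y] = β z ![X, mulI n Y] + β z ![mulI n X, Y] := fun z X Y => by
    simp only [hγ, ContinuousAlternatingMap.sub_apply]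
    rw [form_comp_two, form_comp_two]
    simp only [← toBil_apply, add_apply, ContinuousLinearMap.id_apply, map_add]
    ring
  have hγs : ∀ z, ContDiffAt ℝ ∞ β z → ContDiffAt ℝ ∞ γ z := fun z hz =>
    ((hc _ z hz).sub hz).sub (hc _ z hz)
  have hpart : ∀ z, ContDiffAt ℝ ∞ β z →
      ContDiffAt ℝ ∞ (fun z => fpart11 (mulI n) (β z)) z := fun z hz =>
    (contDiffAt_const (c := (1 / 2 : ℝ))).smul (hz.add (hc _ z hz))
  have e : (fun y => -(extDeriv (fun z => fpart11 (mulI n) (β z)) y).compContinuousLinearMap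
      (mulI n)) =ᶠ[𝓝 w] (1 / 2 : ℝ) • extDeriv γ := by
    filter_upwards [hd, hβ] with y hy hys
    have hyd : DifferentiableAt ℝ β y := hys.differentiableAt (by simp)
    have hb := (hasFDerivAt_toBil hyd).differentiableAt.hasFDerivAt
    have happ : ∀ X Y, HasFDerivAt (fun y => toBil (CE n) (β y) X Y)
        ((ContinuousLinearMap.apply ℝ ℝ Y).comp ((ContinuousLinearMap.apply ℝ (CE n →L[ℝ] ℝ) X).comp
          (fderiv ℝ (fun y => toBil (CE n) (β y)) y))) y := fun X Y => by
      refine ((hb.clm_apply (hasFDerivAt_const X y)).clm_apply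
        (hasFDerivAt_const Y y)).congr_fderiv ?_
      ext v
      simp
    have hder : ∀ (α : CE n → CE n [⋀^Fin 2]→L[ℝ] ℝ), ContDiffAt ℝ ∞ α y → ∀ V X Y : CE n,
        HasFDerivAt (fun y => α y ![X, Y]) (((ContinuousLinearMap.apply ℝ ℝ Y).comp
          ((ContinuousLinearMap.apply ℝ (CE n →L[ℝ] ℝ) X).comp
          (fderiv ℝ (fun y => toBil (CE n) (α y)) y)))) y := fun α hα V X Y => by
      have e0 : (fun y => α y ![X, Y]) = fun y => toBil (CE n) (α y) X Y := by
        funext z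
        rw [toBil_apply]
      rw [e0]
      refine (((hasFDerivAt_toBil (hα.differentiableAt (by simp))).differentiableAt.hasFDerivAt.clm_apply
        (hasFDerivAt_const X y)).clm_apply (hasFDerivAt_const Y y)).congr_fderiv ?_
      ext v
      simp
    have hγb : ∀ V X Y, fderiv ℝ (fun y => toBil (CE n) (γ y)) y V X Y
        = fderiv ℝ (fun y => toBil (CE n) (β y)) y V X (mulI n Y)
          + fderiv ℝ (fun y => toBil (CE n) (β y)) y V (mulI n X) Y := fun V X Y => by
      have e1 := hder γ (hγs y hys) V X Y
      have e2 := (happ X (mulI n Y)).add (happ (mulI n X) Y)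
      have e3 : (fun y => γ y ![X, Y]) = ((fun y => toBil (CE n) (β y) X (mulI n Y))
        + fun y => toBil (CE n) (β y) (mulI n X) Y) := by
        funext z
        rw [hγa, Pi.add_apply, toBil_apply, toBil_apply]
      rw [e3] at e1
      exact congrArg (fun A => A V) (e1.unique e2)
    have hpb : ∀ V X Y, fderiv ℝ (fun y => toBil (CE n) (fpart11 (mulI n) (β y))) y V X Y
        = (1 / 2 : ℝ) * (fderiv ℝ (fun y => toBil (CE n) (β y)) y V X Y
          + fderiv ℝ (fun y => toBil (CE n) (β y)) y V (mulI n X) (mulI n Y)) := fun V X Y => by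
      have e1 := hder _ (hpart y hys) V X Y
      have e2 := ((happ X Y).add (happ (mulI n X) (mulI n Y))).const_mul (1 / 2 : ℝ)
      have e3 : (fun y => fpart11 (mulI n) (β y) ![X, Y]) = (fun z => (1 / 2 : ℝ) *
          ((fun y => toBil (CE n) (β y) X Y)
        + fun y => toBil (CE n) (β y) (mulI n X) (mulI n Y)) z) := by
        funext z
        rw [fpart11_apply, Pi.add_apply, toBil_apply, toBil_apply]
      rw [e3] at e1
      exact congrArg (fun A => A V) (e1.unique e2)
    have hcl : ∀ X Y V, fderiv ℝ (fun y => toBil (CE n) (β y)) y X Y V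
        - fderiv ℝ (fun y => toBil (CE n) (β y)) y Y X V
        + fderiv ℝ (fun y => toBil (CE n) (β y)) y V X Y = 0 := fun X Y V => by
      rw [← extDeriv_toBil hyd, hy]
      rfl
    ext v
    have ev : v = ![v 0, v 1, v 2] := by ext1 i; fin_cases i <;> rfl
    rw [ev, ContinuousAlternatingMap.neg_apply, form_comp_three,
      extDeriv_toBil ((hpart y hys).differentiableAt (by simp)), Pi.smul_apply,
      ContinuousAlternatingMap.smul_apply, extDeriv_toBil ((hγs y hys).differentiableAt (by simp))]
    simp only [hpb, hγb, mulI_mulI, map_neg, neg_apply, smul_eq_mul]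
    linear_combination (-1 / 2 : ℝ) * (hcl (mulI n (v 0)) (mulI n (v 1)) (mulI n (v 2))
      + hcl (mulI n (v 0)) (v 1) (v 2) + hcl (v 0) (mulI n (v 1)) (v 2)
      + hcl (v 0) (v 1) (mulI n (v 2)))
  rw [e.extDeriv_eq, extDeriv_smul, extDeriv_extDeriv_apply (hγs w hβ.self_of_nhds)
    (by rw [minSmoothness_of_isRCLikeNormedField]; exact two_le_infty), smul_zero]

theorem fbox_neg (P : CE n → CE n →L[ℂ] CE n) (u : CE n → ℝ) (w : CE n) :
    fbox (-P) u w = -fbox P u w :=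
  two_form_ext fun X Y => by
    rw [ContinuousAlternatingMap.neg_apply, fbox, fbox, twist_apply, twist_apply]
    simp only [← toBil_apply, reP_apply, Pi.neg_apply, neg_apply, map_neg]
    ring

theorem fbox_inv_P {P : CE n → CE n →L[ℂ] CE n} {u : CE n → ℝ} {w : CE n}
    (hsq : ∀ X, P w (P w X) = X) (X Y : CE n) :
    fbox P u w ![P w X, P w Y] = fbox P u w ![X, Y] := by
  rw [fbox, twist_apply, twist_apply]
  simp only [reP_apply, hsq]
  ring

theorem extDeriv_fbox_of_pos {U : Set (CE n)} {P : CE n → CE n →L[ℂ] CE n} (H : FlatGK U P)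
    {u : CE n → ℝ} {w : CE n} (hw : w ∈ U) (hu : ContDiffAt ℝ ∞ u w) {X Y V : CE n}
    (hX : P w X = X) (hY : P w Y = Y) (hV : P w V = V) :
    extDeriv (fbox P u) w ![X, Y, V] = 0 := by
  have hb := (hasFDerivAt_toBil ((contDiffAt_fiddbar hu).differentiableAt (by simp)))
  have hf := (hasFDerivAt_toBil ((contDiffAt_fbox H hw hu).differentiableAt (by simp)))
  have hP := (H.differentiableAt_re hw).hasFDerivAt
  set B := fun y => toBil (CE n) (fiddbar (mulI n) u y) with hB
  have hder : ∀ X Y V : CE n, fderiv ℝ (fun y => toBil (CE n) (fbox P u y)) w V X Y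
      = 1 / 2 * (fderiv ℝ B w V X (P w Y) + B w X (fderiv ℂ P w V Y)
        + (fderiv ℝ B w V (P w X) Y + B w (fderiv ℂ P w V X) Y)) := fun X Y V => by
    have e1 := (hf.clm_apply (hasFDerivAt_const X w)).clm_apply (hasFDerivAt_const Y w)
    have e2 := (((hb.clm_apply (hasFDerivAt_const X w)).clm_apply
      (hP.clm_apply (hasFDerivAt_const Y w))).add ((hb.clm_apply
      (hP.clm_apply (hasFDerivAt_const X w))).clm_apply (hasFDerivAt_const Y w))).const_mul
      (1 / 2 : ℝ)
    have e3 : (fun y => toBil (CE n) (fbox P u y) X Y) = fun z => (1 / 2 : ℝ) *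
        (((fun y => B y X (reP P y Y)) + fun y => B y (reP P y X) Y) z) := by
      funext z
      rw [toBil_apply, fbox, twist_apply, Pi.add_apply]
      simp only [hB, toBil_apply]
    rw [e3] at e1
    have e4 := congrArg (fun A => A V) (e1.unique e2)
    rw [hf.fderiv, hb.fderiv]
    simp [← fderiv_reP (H.differentiableAt hw) (H.differentiableAt_re hw)] at e4 ⊢
    rw [e4]
    ring
  have hcl := extDeriv_toBil ((contDiffAt_fiddbar hu).differentiableAt (by simp)) X Y V
  rw [extDeriv_fiddbar hu] at hcl
  rw [extDeriv_toBil ((contDiffAt_fbox H hw hu).differentiableAt (by simp)), hder, hder, hder, hX,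
    hY, hV, H.tau_pos w hw Y X hY hX, H.tau_pos w hw V X hV hX, H.tau_pos w hw V Y hV hY]
  have hs : B w (fderiv ℂ P w X V) Y = -B w Y (fderiv ℂ P w X V) := by
    simp only [hB, toBil_apply]
    exact form_swap _ _ _
  have h0 : (0 : CE n [⋀^Fin 3]→L[ℝ] ℝ) ![X, Y, V] = 0 := rfl
  rw [h0] at hcl
  linear_combination -hcl + 1 / 2 * hs

theorem extDeriv_fbox_of_neg {U : Set (CE n)} {P : CE n → CE n →L[ℂ] CE n} (H : FlatGK U P)
    {u : CE n → ℝ} {w : CE n} (hw : w ∈ U) (hu : ContDiffAt ℝ ∞ u w) {X Y V : CE n}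
    (hX : P w X = -X) (hY : P w Y = -Y) (hV : P w V = -V) :
    extDeriv (fbox P u) w ![X, Y, V] = 0 := by
  have h := extDeriv_fbox_of_pos H.neg hw hu (X := X) (Y := Y) (V := V) (by simp [hX])
    (by simp [hY]) (by simp [hV])
  have e : fbox (-P) u = (-1 : ℝ) • fbox P u := by
    funext z
    rw [fbox_neg]
    exact (neg_one_smul ℝ _).symm
  rw [e, extDeriv_smul, ContinuousAlternatingMap.smul_apply] at h
  simpa using h

/-- Adding `(δ₊δ₊ᶜ - δ₋δ₋ᶜ) u` preserves the class of flat metrics, as long as positivity holds. -/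
theorem FlatMetric.add_fbox {U V : Set (CE n)} {P : CE n → CE n →L[ℂ] CE n}
    {Ω Ω' : CE n → CE n [⋀^Fin 2]→L[ℝ] ℝ} {u : CE n → ℝ} (hP : FlatGK U P) (H : FlatMetric U P Ω)
    (hVU : V ⊆ U) (hV : IsOpen V) (hu : ContDiffOn ℝ ∞ u V)
    (e : ∀ w ∈ V, Ω' w = Ω w + fbox P u w)
    (hpos : ∀ w ∈ V, ∀ X, X ≠ 0 → 0 < Ω' w ![X, mulI n X]) : FlatMetric V P Ω' := by
  have hu' : ∀ w ∈ V, ContDiffAt ℝ ∞ u w := fun w hw => hu.contDiffAt (hV.mem_nhds hw)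
  have hΩ : ∀ w ∈ V, ContDiffAt ℝ ∞ Ω w := fun w hw =>
    (H.smooth.mono hVU).contDiffAt (hV.mem_nhds hw)
  have ee : ∀ w ∈ V, Ω' =ᶠ[𝓝 w] fun y => Ω y + fbox P u y := fun w hw => by
    filter_upwards [hV.mem_nhds hw] with y hy using e y hy
  have hd : ∀ w ∈ V, ∀ X Y Z, extDeriv Ω' w ![X, Y, Z]
      = extDeriv Ω w ![X, Y, Z] + extDeriv (fbox P u) w ![X, Y, Z] := fun w hw X Y Z => by
    rw [(ee w hw).extDeriv_eq]
    have := extDeriv_add ((hΩ w hw).differentiableAt (by simp))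
      ((contDiffAt_fbox hP (hVU hw) (hu' w hw)).differentiableAt (by simp))
    exact congrArg (fun A => A ![X, Y, Z]) this
  refine ⟨fun w hw => ?_, fun w hw X Y => ?_, fun w hw X Y => ?_, hpos,
    fun w hw X Y Z hX hY hZ => ?_, fun w hw X Y Z hX hY hZ => ?_⟩
  · exact (((hΩ w hw).add (contDiffAt_fbox hP (hVU hw) (hu' w hw))).congr_of_eventuallyEq
      (ee w hw)).contDiffWithinAt
  · rw [e w hw, ContinuousAlternatingMap.add_apply, ContinuousAlternatingMap.add_apply,
      H.inv_I w (hVU hw), fbox_inv_I ((hu' w hw).of_le two_le_infty)]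
  · rw [e w hw, ContinuousAlternatingMap.add_apply, ContinuousAlternatingMap.add_apply,
      H.inv_P w (hVU hw), fbox_inv_P (hP.sq w (hVU hw))]
  · rw [hd w hw, H.closed_pos w (hVU hw) X Y Z hX hY hZ,
      extDeriv_fbox_of_pos hP (hVU hw) (hu' w hw) hX hY hZ, add_zero]
  · rw [hd w hw, H.closed_neg w (hVU hw) X Y Z hX hY hZ,
      extDeriv_fbox_of_neg hP (hVU hw) (hu' w hw) hX hY hZ, add_zero]

/-- `dd^c (δ₊δ₊ᶜ - δ₋δ₋ᶜ) u = 0`. -/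
theorem extDeriv_dc_fbox {U : Set (CE n)} {P : CE n → CE n →L[ℂ] CE n} (H : FlatGK U P)
    {u : CE n → ℝ} {w : CE n} (hw : w ∈ U) (hu : ∀ᶠ y in 𝓝 w, ContDiffAt ℝ ∞ u y) :
    extDeriv (fun y => -(extDeriv (fbox P u) y).compContinuousLinearMap (mulI n)) w = 0 := by
  set a : CE n → CE n →L[ℝ] ℝ := fun y => (-(1 / 2) : ℝ) • (fderiv ℝ u y ∘L reP P y ∘L mulI n)
    with ha
  have has : ∀ y ∈ U, ContDiffAt ℝ ∞ u y → ContDiffAt ℝ ∞ (fun y => oneForm (a y)) y :=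
    fun y hy huy => contDiffAt_form_iff.2 fun v => by
      have h1 : ContDiffAt ℝ ∞ (fun z => fderiv ℝ u z (reP P z (mulI n (v 0)))) y :=
        (huy.fderiv_right (m := ∞) (by simp)).clm_apply
          ((H.contDiffAt hy).clm_apply contDiffAt_const)
      exact contDiffAt_const.mul h1
  have hdd : ∀ y ∈ U, ContDiffAt ℝ ∞ u y →
      extDeriv (extDeriv fun y => oneForm (a y)) y = 0 := fun y hy huy =>
    extDeriv_extDeriv_apply (has y hy huy)
      (by rw [minSmoothness_of_isRCLikeNormedField]; exact two_le_infty)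
  have hev : ∀ᶠ y in 𝓝 w, y ∈ U ∧ ContDiffAt ℝ ∞ u y :=
    (Filter.eventually_of_mem (H.isOpen.mem_nhds hw) fun _ h => h).and hu
  have hβ : ∀ᶠ y in 𝓝 w, ContDiffAt ℝ ∞ (extDeriv fun y => oneForm (a y)) y := by
    filter_upwards [hev] with y hy
    have h1 : ContDiffAt ℝ ∞ (fderiv ℝ fun y => oneForm (a y)) y :=
      (has y hy.1 hy.2).fderiv_right (m := ∞) (by simp)
    exact (ContinuousAlternatingMap.alternatizeUncurryFinCLM ℝ (CE n) ℝ).contDiff.contDiffAt.comp y h1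
  have e : fbox P u =ᶠ[𝓝 w] fun z => fpart11 (mulI n) (extDeriv (fun y => oneForm (a y)) z) := by
    filter_upwards [hev] with y hy
    rw [(fbox_eq_part11 H hy.1 (hy.2.of_le two_le_infty)).2]
    have e1 : (fun y => oneForm (a y))
        = (-(1 / 2) : ℝ) • fun y => oneForm (fderiv ℝ u y ∘L reP P y ∘L mulI n) := by
      funext z
      ext v
      rfl
    rw [e1, extDeriv_smul]
    refine two_form_ext fun X Y => ?_
    simp only [ContinuousAlternatingMap.smul_apply, fpart11_apply, smul_eq_mul]
    ring
  have e' : (fun y => -(extDeriv (fbox P u) y).compContinuousLinearMap (mulI n)) =ᶠ[𝓝 w]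
      fun y => -(extDeriv (fun z => fpart11 (mulI n) (extDeriv (fun y => oneForm (a y)) z)) y).compContinuousLinearMap
        (mulI n) := by
    filter_upwards [e.eventuallyEq_nhds] with y hy
    rw [hy.extDeriv_eq]
  rw [e'.extDeriv_eq]
  exact extDeriv_dc_part11 hβ (by filter_upwards [hev] with y hy using hdd y hy.1 hy.2)

end FlatBox

end GenKahler

end

noncomputable section

namespace GenKahler

/-! ### Complex bases -/

section Bases

theorem IsCBasis.map {V V' : Type*} [AddCommGroup V] [Module ℝ V] [AddCommGroup V'] [Module ℝ V']
    {J : V → V} {J' : V' → V'} {D : Submodule ℝ V} {D' : Submodule ℝ V'} {k : ℕ} {Z : Fin k → V}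
    (hZ : IsCBasis J D Z) (L : V →ₗ[ℝ] V') (hL : Function.Injective L)
    (hJ : ∀ v, L (J v) = J' (L v)) (hD : ∀ v ∈ D, L v ∈ D') (hD' : ∀ v' ∈ D', ∃ v ∈ D, L v = v') :
    IsCBasis J' D' (fun a => L (Z a)) := by
  have hc : ∀ c : Fin k → ℂ, L (∑ a, cact J (c a) (Z a)) = ∑ a, cact J' (c a) (L (Z a)) := fun c => by
    simp only [map_sum, cact, map_add, map_smul, hJ]
  refine ⟨fun a => hD _ (hZ.1 a), fun a => ?_, fun v' hv' => ?_⟩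
  · rw [← hJ]
    exact hD _ (hZ.2.1 a)
  · obtain ⟨v, hv, rfl⟩ := hD' v' hv'
    obtain ⟨c, hc1, hc2⟩ := hZ.2.2 v hv
    refine ⟨c, ?_, fun d hd => hc2 d (hL ?_)⟩
    · show L v = ∑ a, cact J' (c a) (L (Z a))
      rw [← hc]
      exact congrArg L hc1
    · rw [hd, hc]

variable {n : ℕ}

theorem isCBasis_of_basis (W : Submodule ℂ (CE n)) {k : ℕ} (b : Module.Basis (Fin k) ℂ W) :
    IsCBasis (mulI n) (W.restrictScalars ℝ) (fun a => (b a : CE n)) := by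
  have hc : ∀ (c : ℂ) (v : CE n), cact (mulI n) c v = c • v := fun c v => by
    conv_rhs => rw [← Complex.re_add_im c, add_smul, mul_smul]
    rfl
  refine ⟨fun a => (b a).2, fun a => W.smul_mem Complex.I (b a).2, fun v hv => ?_⟩
  simp only [hc]
  refine ⟨b.repr ⟨v, hv⟩, ?_, fun d hd => ?_⟩
  · have h := congrArg Subtype.val (b.sum_repr ⟨v, hv⟩)
    rw [Submodule.coe_sum] at h
    exact h.symm
  · have h : (⟨v, hv⟩ : W) = ∑ a, d a • b a := Subtype.ext (by rw [Submodule.coe_sum]; exact hd)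
    rw [h, b.repr_sum_self]

/-- The `+1` eigenspace of `P w`. -/
def eigP (P : CE n → CE n →L[ℂ] CE n) (w : CE n) : Submodule ℝ (CE n) :=
  (LinearMap.ker (P w - ContinuousLinearMap.id ℂ (CE n)).toLinearMap).restrictScalars ℝ

theorem mem_eigP {P : CE n → CE n →L[ℂ] CE n} {w X : CE n} : X ∈ eigP P w ↔ P w X = X := by
  simp [eigP, sub_eq_zero]

/-- The parallel-type transport `(1 + P(w) P(w₀)) / 2`, which intertwines `P(w₀)` and `P(w)`. -/
def frameMap (P : CE n → CE n →L[ℂ] CE n) (w₀ w : CE n) : CE n →L[ℂ] CE n :=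
  (1 / 2 : ℂ) • (ContinuousLinearMap.id ℂ (CE n) + (P w).comp (P w₀))

variable {U : Set (CE n)} {P : CE n → CE n →L[ℂ] CE n}

theorem FlatGK.intertwine (H : FlatGK U P) {w₀ w : CE n} (hw₀ : w₀ ∈ U) (hw : w ∈ U) (X : CE n) :
    P w (frameMap P w₀ w X) = frameMap P w₀ w (P w₀ X) := by
  simp only [frameMap, smul_apply, add_apply, ContinuousLinearMap.id_apply,
    ContinuousLinearMap.comp_apply, map_smul, map_add, H.sq w hw, H.sq w₀ hw₀]
  rw [add_comm]

theorem FlatGK.frameMap_self (H : FlatGK U P) {w₀ : CE n} (hw₀ : w₀ ∈ U) :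
    frameMap P w₀ w₀ = ContinuousLinearMap.id ℂ (CE n) := by
  ext1 X
  simp only [frameMap, smul_apply, add_apply, ContinuousLinearMap.id_apply,
    ContinuousLinearMap.comp_apply, H.sq w₀ hw₀]
  rw [← two_smul ℂ, smul_smul]
  norm_num

theorem FlatGK.differentiableOn_frameMap (H : FlatGK U P) (w₀ : CE n) :
    DifferentiableOn ℂ (frameMap P w₀) U := by
  have h1 : DifferentiableOn ℂ (fun w => (P w).comp (P w₀)) U :=
    H.holo.clm_comp (differentiableOn_const _)
  exact ((differentiableOn_const (ContinuousLinearMap.id ℂ (CE n))).add h1).const_smul (1 / 2 : ℂ)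

theorem FlatGK.exists_frame_nhds (H : FlatGK U P) {w₀ : CE n} (hw₀ : w₀ ∈ U) :
    ∃ V, IsOpen V ∧ w₀ ∈ V ∧ V ⊆ U ∧
      ∀ w ∈ V, ∃ e : CE n ≃L[ℂ] CE n, (e : CE n →L[ℂ] CE n) = frameMap P w₀ w := by
  have hc : ContinuousOn (frameMap P w₀) U := (H.differentiableOn_frameMap w₀).continuousOn
  have hO := ContinuousLinearEquiv.isOpen (𝕜 := ℂ) (E := CE n) (F := CE n)
  refine ⟨U ∩ frameMap P w₀ ⁻¹' _, hc.isOpen_inter_preimage H.isOpen hO, ⟨hw₀, ?_⟩,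
    Set.inter_subset_left, fun w hw => hw.2⟩
  rw [Set.mem_preimage, H.frameMap_self hw₀]
  exact ⟨ContinuousLinearEquiv.refl ℂ _, rfl⟩

theorem FlatGK.isCBasis_frameMap (H : FlatGK U P) {w₀ w : CE n} (hw₀ : w₀ ∈ U) (hw : w ∈ U)
    (he : ∃ e : CE n ≃L[ℂ] CE n, (e : CE n →L[ℂ] CE n) = frameMap P w₀ w) {k : ℕ}
    {e : Fin k → CE n} (hb : IsCBasis (mulI n) (eigP P w₀) e) :
    IsCBasis (mulI n) (eigP P w) (fun a => frameMap P w₀ w (e a)) := by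
  obtain ⟨ε, hε⟩ := he
  have hε' : ∀ X, frameMap P w₀ w X = ε X := fun X => by rw [← hε]; rfl
  refine hb.map (J' := mulI n) ((frameMap P w₀ w).restrictScalars ℝ).toLinearMap ?_ ?_ ?_ ?_
  · intro X Y h
    exact ε.injective ((hε' X).symm.trans (Eq.trans h (hε' Y)))
  · intro v
    exact mulI_clm (frameMap P w₀ w) v
  · intro v hv
    rw [mem_eigP] at hv ⊢
    exact (H.intertwine hw₀ hw v).trans (by rw [hv]; rfl)
  · intro v hv
    rw [mem_eigP] at hv
    have h1 : frameMap P w₀ w (ε.symm v) = v := by rw [hε', ε.apply_symm_apply]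
    refine ⟨ε.symm v, mem_eigP.2 (ε.injective ?_), h1⟩
    rw [← hε', ← hε', ← H.intertwine hw₀ hw, h1, hv]

theorem exists_isCBasis_eigP (P : CE n → CE n →L[ℂ] CE n) (w : CE n) :
    ∃ (k : ℕ) (e : Fin k → CE n), IsCBasis (mulI n) (eigP P w) e :=
  ⟨_, _, isCBasis_of_basis _ (Module.finBasis ℂ _)⟩

theorem flatGK_id {U : Set (CE n)} (hU : IsOpen U) :
    FlatGK U (fun _ => ContinuousLinearMap.id ℂ (CE n)) := by
  have h : ∀ w, fderiv ℂ (fun _ : CE n => ContinuousLinearMap.id ℂ (CE n)) w = 0 := fun w =>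
    (hasFDerivAt_const _ w).fderiv
  exact ⟨hU, differentiableOn_const _, fun _ _ _ => rfl, fun w _ X Y _ _ => by rw [h]; rfl,
    fun w _ X Y _ _ => by rw [h]; rfl⟩

end Bases

/-! ### Holomorphic frames and local potentials of the Chern form -/

section Frames

variable {n : ℕ} {M : Type*} [TopologicalSpace M] [ChartedSpace (Model n) M]
  [IsManifold 𝓘(ℝ, Model n) ∞ M] {J : EndField n M} {φ χ : OpenPartialHomeomorph M (CE n)}

theorem differentiableOn_transition (hφ : IsHoloChart J φ) (hχ : IsHoloChart J χ) :
    DifferentiableOn ℂ (χ ∘ φ.symm) (φ.target ∩ φ.symm ⁻¹' χ.source) := by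
  intro w hw
  have h1 := contDiffAt_transition hφ.isSmoothChart hχ.isSmoothChart hw.1 hw.2
  refine (differentiableAt_complex_of_real (h1.differentiableAt (by simp)) fun X => ?_).differentiableWithinAt
  rw [fderiv_transition hφ.isSmoothChart hχ.isSmoothChart hw.1 hw.2]
  have h2 := dSymm_mulI hφ hw.1 X
  show dChart χ (φ.symm w) (dSymm φ w (mulI n X)) = mulI n (dChart χ (φ.symm w) (dSymm φ w X))
  rw [h2]
  exact hχ.map_J _ hw.2 _

/-- A vector field on `M` given by a vector field in a chart. -/
def pushField (φ : OpenPartialHomeomorph M (CE n)) (ζ : CE n → CE n) (x : M) : TS n x :=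
  (dSymm (n := n) φ (φ x) (ζ (φ x)) : Model n)

theorem pushField_symm {w : CE n} (hw : w ∈ φ.target) (ζ : CE n → CE n) :
    pushField φ ζ (φ.symm w) = dSymm φ w (ζ w) := by
  have h : ∀ z, z = w → (dSymm (n := n) φ z (ζ z) : Model n) = (dSymm (n := n) φ w (ζ w) : Model n) := by
    rintro z rfl; rfl
  exact h _ (φ.right_inv hw)

theorem isCBasis_dSymm (hφ : IsHoloChart J φ) {P : CE n → CE n →L[ℂ] CE n}
    {D : ∀ x : M, Submodule ℝ (TS n x)}
    (hD : ∀ w ∈ φ.target, ∀ X, dSymm φ w X ∈ D (φ.symm w) ↔ P w X = X) {w : CE n}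
    (hw : w ∈ φ.target) {k : ℕ} {e : Fin k → CE n} (he : IsCBasis (mulI n) (eigP P w) e) :
    IsCBasis (J (φ.symm w)) (D (φ.symm w)) (fun a => dSymm φ w (e a)) := by
  refine he.map (J' := J (φ.symm w)) (dSymm φ w).toLinearMap ?_ (fun v => dSymm_mulI hφ hw v) ?_ ?_
  · intro X Y h
    rw [← dChart_dSymm hφ.isSmoothChart hw X, ← dChart_dSymm hφ.isSmoothChart hw Y]
    exact congrArg _ h
  · intro v hv
    exact (hD w hw v).2 (mem_eigP.1 hv)
  · intro v hv
    refine ⟨dChart φ (φ.symm w) v, mem_eigP.2 ((hD w hw _).1 ?_), dSymm_dChart hφ.isSmoothChart hw v⟩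
    rwa [dSymm_dChart hφ.isSmoothChart hw v]

theorem isHoloFrame_pushField (hφ : IsHoloChart J φ) {P : CE n → CE n →L[ℂ] CE n}
    {D : ∀ x : M, Submodule ℝ (TS n x)}
    (hD : ∀ w ∈ φ.target, ∀ X, dSymm φ w X ∈ D (φ.symm w) ↔ P w X = X) {V : Set (CE n)}
    (hV : IsOpen V) {k : ℕ} {ζ : Fin k → CE n → CE n}
    (hζ : ∀ a, DifferentiableOn ℂ (ζ a) V)
    (hb : ∀ w ∈ V, IsCBasis (mulI n) (eigP P w) (fun a => ζ a w)) :
    IsHoloFrame J D (φ.source ∩ φ ⁻¹' V) (fun a => pushField φ (ζ a)) := by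
  refine ⟨φ.isOpen_inter_preimage hV, ?_, fun χ hχ a => ?_⟩
  · rintro x ⟨hx, hxV⟩
    obtain ⟨w, hw, rfl⟩ : ∃ w ∈ φ.target, φ.symm w = x := ⟨φ x, φ.map_source hx, φ.left_inv hx⟩
    rw [Set.mem_preimage, φ.right_inv hw] at hxV
    have h := isCBasis_dSymm hφ hD hw (hb w hxV)
    simp only [pushField_symm hw]
    exact h
  · set S := χ.target ∩ χ.symm ⁻¹' (φ.source ∩ φ ⁻¹' V)
    have h1 : DifferentiableOn ℂ (φ ∘ χ.symm) S :=
      (differentiableOn_transition hχ hφ).mono fun w hw => ⟨hw.1, hw.2.1⟩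
    have hO : IsOpen (φ.target ∩ φ.symm ⁻¹' χ.source) := φ.symm.isOpen_inter_preimage χ.open_source
    have h2 := differentiableOn_fderiv_of_isOpen hO (differentiableOn_transition hφ hχ)
    have hmaps : Set.MapsTo (φ ∘ χ.symm) S (φ.target ∩ φ.symm ⁻¹' χ.source) := fun w hw => by
      refine ⟨φ.map_source hw.2.1, ?_⟩
      show φ.symm (φ (χ.symm w)) ∈ χ.source
      rw [φ.left_inv hw.2.1]
      exact χ.map_target hw.1
    have h3 := (h2.comp h1 hmaps).clm_apply ((hζ a).comp h1 fun w hw => hw.2.2)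
    refine h3.congr fun w hw => ?_
    have hz := hmaps hw
    have hT : fderiv ℂ (χ ∘ φ.symm) ((φ ∘ χ.symm) w) (ζ a ((φ ∘ χ.symm) w))
        = fderiv ℝ (χ ∘ φ.symm) ((φ ∘ χ.symm) w) (ζ a ((φ ∘ χ.symm) w)) := by
      rw [fderiv_real_eq ((differentiableOn_transition hφ hχ _ hz).differentiableAt (hO.mem_nhds hz))]
      rfl
    show _ = fderiv ℂ (χ ∘ φ.symm) ((φ ∘ χ.symm) w) (ζ a ((φ ∘ χ.symm) w))
    rw [hT, fderiv_transition hφ.isSmoothChart hχ.isSmoothChart hz.1 hz.2]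
    have e1 : φ.symm ((φ ∘ χ.symm) w) = χ.symm w := φ.left_inv hw.2.1
    have e2 : ∀ x, x = χ.symm w → coordDeriv χ (χ.symm w) (pushField φ (ζ a) (χ.symm w))
        = coordDeriv χ x (pushField φ (ζ a) x) := by rintro x rfl; rfl
    rw [e2 _ e1, pushField_symm hz.1]
    rfl

/-- Local potentials of the Chern form of a Hermitian metric on a holomorphic eigenbundle. -/
theorem exists_chern_potential (hφ : IsHoloChart J φ) {P : CE n → CE n →L[ℂ] CE n}
    (hP : FlatGK φ.target P) {D : ∀ x : M, Submodule ℝ (TS n x)}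
    (hD : ∀ w ∈ φ.target, ∀ X, dSymm φ w X ∈ D (φ.symm w) ↔ P w X = X)
    {w₀ : CE n} (hw₀ : w₀ ∈ φ.target) :
    ∃ (V : Set (CE n)) (k : ℕ) (e : Fin k → CE n), IsOpen V ∧ w₀ ∈ V ∧ V ⊆ φ.target ∧
      IsCBasis (mulI n) (eigP P w₀) e ∧
      (∀ w ∈ V, IsCBasis (mulI n) (eigP P w) (fun a => frameMap P w₀ w (e a))) ∧
      ∀ h : BilinField n M, (∀ x, IsHermOn (J x) (D x) (h x)) →
        ∀ {W : Set (CE n)}, IsOpen W → W ⊆ V → ContDiffOn ℝ ∞ (pullBil φ h) W →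
        ContDiffOn ℝ ∞ (fun w => Real.log (cdet (mulI n) (fun X Y => pullBil φ h w X Y)
          (fun a => frameMap P w₀ w (e a)))) W ∧
        ∀ w ∈ W, pull φ (chernForm J D (fun x X Y => h x X Y)) w = -fiddbar (mulI n)
          (fun w => Real.log (cdet (mulI n) (fun X Y => pullBil φ h w X Y)
            (fun a => frameMap P w₀ w (e a)))) w := by
  obtain ⟨V, hV, hw₀V, hVt, hiso⟩ := hP.exists_frame_nhds hw₀
  obtain ⟨k, e, he⟩ := exists_isCBasis_eigP P w₀
  have hb : ∀ w ∈ V, IsCBasis (mulI n) (eigP P w) (fun a => frameMap P w₀ w (e a)) := fun w hw =>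
    hP.isCBasis_frameMap hw₀ (hVt hw) (hiso w hw) he
  refine ⟨V, k, e, hV, hw₀V, hVt, he, hb, fun h hh W hW hWV hs => ?_⟩
  have hfr := isHoloFrame_pushField (J := J) hφ hD hV (ζ := fun a w => frameMap P w₀ w (e a))
    (fun a => ((hP.differentiableOn_frameMap w₀).mono hVt).clm_apply (differentiableOn_const _)) hb
  have hdet : ∀ w ∈ V, hermDet J (φ.symm w) (fun X Y => h (φ.symm w) X Y)
      (fun a => pushField φ (fun w => frameMap P w₀ w (e a)) (φ.symm w))
      = cdet (mulI n) (fun X Y => pullBil φ h w X Y) (fun a => frameMap P w₀ w (e a)) := fun w hw => by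
    rw [hermDet_chart hφ h (hVt hw)]
    simp only [pushField_symm (hVt hw)]
    congr 1
    funext a
    exact dChart_dSymm hφ.isSmoothChart (hVt hw) _
  have hpos : ∀ w ∈ V, 0 < cdet (mulI n) (fun X Y => pullBil φ h w X Y)
      (fun a => frameMap P w₀ w (e a)) := fun w hw => by
    rw [← hdet w hw]
    have h1 := hfr.basis (φ.symm w) ⟨φ.map_target (hVt hw), by
      rw [Set.mem_preimage, φ.right_inv (hVt hw)]; exact hw⟩
    exact (hh _).cdet_pos h1
  have hsm : ContDiffOn ℝ ∞ (fun w => Real.log (cdet (mulI n) (fun X Y => pullBil φ h w X Y)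
      (fun a => frameMap P w₀ w (e a)))) W := by
    intro w hw
    refine ContDiffWithinAt.log (contDiffWithinAt_cdet (mulI n) (hs w hw) fun a => ?_)
      (hpos w (hWV hw)).ne'
    have h1 : DifferentiableOn ℂ (fun w => frameMap P w₀ w (e a)) V :=
      ((hP.differentiableOn_frameMap w₀).mono hVt).clm_apply (differentiableOn_const _)
    exact (((contDiffOn_infty_of_differentiableOn_complex hV h1).mono hWV) w hw).restrict_scalars ℝ
  refine ⟨hsm, fun w hw => ?_⟩
  have hev : (fun z => Real.log (hermDet J (φ.symm z) (fun X Y => h (φ.symm z) X Y)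
      (fun a => pushField φ (fun w => frameMap P w₀ w (e a)) (φ.symm z)))) =ᶠ[𝓝 w]
      fun w => Real.log (cdet (mulI n) (fun X Y => pullBil φ h w X Y)
            (fun a => frameMap P w₀ w (e a))) := by
    filter_upwards [hV.mem_nhds (hWV hw)] with z hz
    rw [hdet z hz]
  have hwU : φ.symm w ∈ φ.source ∩ φ ⁻¹' V := ⟨φ.map_target (hVt (hWV hw)), by
    rw [Set.mem_preimage, φ.right_inv (hVt (hWV hw))]; exact hWV hw⟩
  rw [pull_chernForm hφ (fun y _ => hh y) hfr (hVt (hWV hw)) hwU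
    (((hsm.contDiffAt (hW.mem_nhds hw)).of_le two_le_infty).congr_of_eventuallyEq hev),
    fiddbar_congr hev]

end Frames

end GenKahler

end

noncomputable section

namespace GenKahler

/-! ### Traces of bilinear forms with respect to a metric -/

section TraceG

variable {E : Type*} [NormedAddCommGroup E] [NormedSpace ℝ E] [FiniteDimensional ℝ E]

/-- The trace of a bilinear form with respect to the metric `G`. -/
def trG (G : E →L[ℝ] E →L[ℝ] ℝ) : (E →L[ℝ] E →L[ℝ] ℝ) →L[ℝ] ℝ :=
  trL E ∘L ContinuousLinearMap.compL ℝ E (E →L[ℝ] ℝ) E G.inverse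

theorem trG_apply (G B : E →L[ℝ] E →L[ℝ] ℝ) : trG G B = trL E (G.inverse ∘L B) := rfl

theorem trG_sub (G A B : E →L[ℝ] E →L[ℝ] ℝ) : trG G (A - B) = trG G A - trG G B :=
  map_sub (trG G) A B

theorem trG_neg (G A : E →L[ℝ] E →L[ℝ] ℝ) : trG G (-A) = -trG G A := map_neg (trG G) A

theorem traceD_eq_trG (G : E → E →L[ℝ] E →L[ℝ] ℝ) (w X : E) :
    traceD G w X = trG (G w) (fderiv ℝ G w X) := rfl

theorem traceDflip_eq_trG (G : E → E →L[ℝ] E →L[ℝ] ℝ) (w X : E) :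
    traceDflip G w X = trG (G w) ((fderiv ℝ G w).flip X) := rfl

/-- Precomposition of the second argument of a bilinear form. -/
def precompR (B : E →L[ℝ] E →L[ℝ] ℝ) (A : E →L[ℝ] E) : E →L[ℝ] E →L[ℝ] ℝ := (B.flip ∘L A).flip

@[simp] theorem precompR_apply (B : E →L[ℝ] E →L[ℝ] ℝ) (A : E →L[ℝ] E) (X Y : E) :
    precompR B A X Y = B X (A Y) := rfl

variable {G : E →L[ℝ] E →L[ℝ] ℝ}

theorem inverse_comp_adjoint (hG : ∀ v, v ≠ 0 → 0 < G v v) {A A' : E →L[ℝ] E}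
    (hA : ∀ X Y, G (A X) Y = G X (A' Y)) (η : E →L[ℝ] ℝ) :
    G.inverse (η ∘L A') = A (G.inverse η) := by
  obtain ⟨e, he⟩ := exists_equiv_of_pos hG
  have h : η ∘L A' = G (A (G.inverse η)) := by
    ext1 Y
    rw [hA, self_apply_inverse e he]
    rfl
  rw [h, inverse_apply_self e he]

theorem trG_precomp (hG : ∀ v, v ≠ 0 → 0 < G v v) {A A' : E →L[ℝ] E}
    (hA : ∀ X Y, G (A X) Y = G X (A' Y)) (B : E →L[ℝ] E →L[ℝ] ℝ) :
    trG G (B ∘L A) = trG G (precompR B A') := by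
  have h1 : G.inverse ∘L precompR B A' = A ∘L (G.inverse ∘L B) := by
    ext1 X
    exact inverse_comp_adjoint hG hA (B X)
  rw [trG_apply, trG_apply, h1, trL_comm (G.inverse ∘L B) A]
  rfl

theorem trG_flip (hG : ∀ v, v ≠ 0 → 0 < G v v) (hs : ∀ X Y, G X Y = G Y X)
    (B : E →L[ℝ] E →L[ℝ] ℝ) : trG G B.flip = trG G B := by
  obtain ⟨e, he⟩ := exists_equiv_of_pos hG
  have h1 : ∀ η ζ : E →L[ℝ] ℝ, η (G.inverse ζ) = ζ (G.inverse η) := fun η ζ => by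
    conv_lhs => rw [← self_apply_inverse e he η]
    conv_rhs => rw [← self_apply_inverse e he ζ]
    rw [hs]
  classical
  have h2 := trL_eq_sum (Module.finBasis ℝ E) G.inverse
  rw [trG_apply, trG_apply, h2, h2, Finset.sum_comm]
  refine Finset.sum_congr rfl fun i _ => Finset.sum_congr rfl fun j _ => ?_
  rw [h1]
  rfl

theorem trG_self_comp (hG : ∀ v, v ≠ 0 → 0 < G v v) (A : E →L[ℝ] E) : trG G (G ∘L A) = trL E A := by
  obtain ⟨e, he⟩ := exists_equiv_of_pos hG
  rw [trG_apply]
  congr 1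
  ext1 X
  exact inverse_apply_self e he _

theorem trG_bilinearComp (hG : ∀ v, v ≠ 0 → 0 < G v v) (S : E ≃L[ℝ] E) {G' : E →L[ℝ] E →L[ℝ] ℝ}
    (hG' : ∀ X Y, G' X Y = G (S X) (S Y)) {B B' : E →L[ℝ] E →L[ℝ] ℝ}
    (hB : ∀ X Y, B' X Y = B (S X) (S Y)) : trG G' B' = trG G B := by
  obtain ⟨e, he⟩ := exists_equiv_of_pos hG
  have hp : ∀ v, v ≠ 0 → 0 < G' v v := fun v hv => by
    rw [hG']
    exact hG _ fun h => hv (S.injective (h.trans (map_zero S).symm))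
  obtain ⟨e', he'⟩ := exists_equiv_of_pos hp
  have h1 : G'.inverse ∘L B' = (S.symm : E →L[ℝ] E) ∘L ((G.inverse ∘L B) ∘L (S : E →L[ℝ] E)) := by
    ext1 X
    have h2 : B' X = G' (S.symm (G.inverse (B (S X)))) := by
      ext1 Y
      rw [hG', S.apply_symm_apply, self_apply_inverse e he, hB]
    show G'.inverse (B' X) = S.symm (G.inverse (B (S X)))
    rw [h2, inverse_apply_self e' he']
  rw [trG_apply, h1, trL_comm ((G.inverse ∘L B) ∘L (S : E →L[ℝ] E)) (S.symm : E →L[ℝ] E),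
    trG_apply]
  congr 1
  ext1 X
  simp

variable {I Q : E →L[ℝ] E}

theorem trG_proj (hG : ∀ v, v ≠ 0 → 0 < G v v) (hadj : ∀ X Y, G (Q X) Y = G X (Q Y))
    (hQQ : ∀ Y, Q (Q Y) = Q Y) (C : E →L[ℝ] E →L[ℝ] ℝ) :
    trG G (precompR (C ∘L Q) Q) = trG G (C ∘L Q) := by
  rw [← trG_precomp hG hadj]
  congr 1
  ext1 Y
  exact congrArg C (hQQ Y)

theorem trG_complex (hG : ∀ v, v ≠ 0 → 0 < G v v) (hI : ∀ v, I (I v) = -v)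
    (hadj : ∀ X Y, G (I X) Y = G X (-I Y)) (C : E →L[ℝ] E →L[ℝ] ℝ) :
    trG G (precompR (C ∘L I) I) = trG G C := by
  have h1 : precompR (C ∘L I) I = (precompR C I) ∘L I := rfl
  rw [h1, trG_precomp (A' := -I) hG hadj]
  congr 1
  ext Y V
  rw [precompR_apply, precompR_apply, neg_apply, map_neg, hI, neg_neg]

/-- The trace along an eigenbundle of a form that satisfies the closedness relation. -/
theorem trG_of_closed (hG : ∀ v, v ≠ 0 → 0 < G v v) (hs : ∀ X Y, G X Y = G Y X)
    (hI : ∀ v, I (I v) = -v) (hIadj : ∀ X Y, G (I X) Y = G X (-I Y))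
    (hadj : ∀ X Y, G (Q X) Y = G X (Q Y)) (hQQ : ∀ Y, Q (Q Y) = Q Y) (hQI : ∀ Y, Q (I Y) = I (Q Y))
    {B C : E →L[ℝ] E →L[ℝ] ℝ} (h : ∀ Y V, B (Q Y) (Q V) = C (Q Y) (Q V) - B (I (Q V)) (I (Q Y))) :
    trG G (B ∘L Q) = 1 / 2 * trG G (C ∘L Q) := by
  have h1 : precompR (B ∘L Q) Q = precompR (C ∘L Q) Q
      - (precompR ((precompR (B ∘L Q) Q) ∘L I) I).flip := by
    ext Y V
    have h2 := h Y V
    rw [← hQI, ← hQI] at h2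
    exact h2
  have h2 := congrArg (trG G) h1
  rw [trG_sub, trG_flip hG hs, trG_complex hG hI hIadj, trG_proj hG hadj hQQ,
    trG_proj hG hadj hQQ] at h2
  linarith

/-- The trace along the complementary eigenbundle, in terms of the second fundamental form `T`. -/
theorem trG_of_torsion (hG : ∀ v, v ≠ 0 → 0 < G v v)
    (hI : ∀ v, I (I v) = -v) (hIadj : ∀ X Y, G (I X) Y = G X (-I Y))
    (hadj : ∀ X Y, G (Q X) Y = G X (Q Y)) (hQQ : ∀ Y, Q (Q Y) = Q Y) (hQI : ∀ Y, Q (I Y) = I (Q Y))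
    {B : E →L[ℝ] E →L[ℝ] ℝ} {T : E →L[ℝ] E →L[ℝ] E} {X : E} (hT : ∀ Y V, T (I Y) (I V) = -T Y V)
    (hTX : ∀ Y, Q (T Y X) = T Y X)
    (h : ∀ Y V, B Y (Q V) = 1 / 2 * G X (T Y (Q V)) - 1 / 2 * G (T Y X) (Q V)) :
    trG G (B ∘L Q) = -(1 / 2 * trL E (T.flip X)) := by
  set C₁ : E →L[ℝ] E →L[ℝ] ℝ := (ContinuousLinearMap.compL ℝ E E ℝ (G X)) ∘L T with hC₁
  set C₂ : E →L[ℝ] E →L[ℝ] ℝ := G ∘L T.flip X with hC₂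
  have h2 : precompR (B ∘L Q) Q = (1 / 2 : ℝ) • precompR (C₁ ∘L Q) Q
      - (1 / 2 : ℝ) • precompR (C₂ ∘L Q) Q := by
    ext Y V
    exact h (Q Y) V
  have h3 : trG G (precompR (C₁ ∘L Q) Q) = 0 := by
    have h4 : precompR ((precompR (C₁ ∘L Q) Q) ∘L I) I = -precompR (C₁ ∘L Q) Q := by
      ext Y V
      show G X (T (Q (I Y)) (Q (I V))) = -(G X (T (Q Y) (Q V)))
      rw [hQI, hQI, hT, map_neg]
    have h5 := trG_complex hG hI hIadj (precompR (C₁ ∘L Q) Q)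
    rw [h4, trG_neg] at h5
    linarith
  have h6 : precompR C₂ Q = G ∘L T.flip X := by
    ext Y V
    show G (T Y X) (Q V) = G (T Y X) V
    rw [← hadj, hTX]
  have h7 := congrArg (trG G) h2
  rw [trG_proj hG hadj hQQ, trG_sub, (trG G).map_smul, (trG G).map_smul, h3,
    trG_proj hG hadj hQQ, trG_precomp hG hadj C₂, h6, trG_self_comp hG] at h7
  rw [h7]
  simp

end TraceG

/-! ### The torsion one-form of a flat metric -/

section Torsion

variable {n : ℕ} {U : Set (CE n)} {P : CE n → CE n →L[ℂ] CE n}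
  {Ω : CE n → CE n [⋀^Fin 2]→L[ℝ] ℝ} {G : CE n → CE n →L[ℝ] CE n →L[ℝ] ℝ}

/-- The projection `(1 + P) / 2`. -/
def projP (P : CE n → CE n →L[ℂ] CE n) (w : CE n) : CE n →L[ℝ] CE n :=
  (1 / 2 : ℝ) • (ContinuousLinearMap.id ℝ _ + reP P w)

theorem projP_apply (P : CE n → CE n →L[ℂ] CE n) (w X : CE n) :
    projP P w X = (1 / 2 : ℝ) • (X + P w X) := rfl

theorem projP_add_neg (P : CE n → CE n →L[ℂ] CE n) (w X : CE n) :
    projP P w X + projP (-P) w X = X := by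
  rw [projP_apply, projP_apply, Pi.neg_apply, neg_apply]
  module

theorem projP_sub_neg (P : CE n → CE n →L[ℂ] CE n) (w X : CE n) :
    projP P w X - projP (-P) w X = P w X := by
  rw [projP_apply, projP_apply, Pi.neg_apply, neg_apply]
  module

theorem FlatGK.P_projP (H : FlatGK U P) {w : CE n} (hw : w ∈ U) (X : CE n) :
    P w (projP P w X) = projP P w X := by
  have h : P w ((1 / 2 : ℝ) • (X + P w X)) = (1 / 2 : ℝ) • (P w X + X) := by
    have := (reP P w).map_smul (1 / 2 : ℝ) (X + P w X)
    rw [map_add] at this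
    simpa only [reP_apply, H.sq w hw] using this
  rw [projP_apply, h, add_comm]

theorem projP_of_eq {w X : CE n} (h : P w X = X) : projP P w X = X := by
  rw [projP_apply, h]
  module

theorem projP_mulI (P : CE n → CE n →L[ℂ] CE n) (w X : CE n) :
    projP P w (mulI n X) = mulI n (projP P w X) := by
  rw [projP_apply, projP_apply, mulI_clm, map_smul, map_add]

/-- The metric `G(X, Y) = Ω(X, iY)` of a flat metric. -/
structure IsFlatMetricBil (U : Set (CE n)) (Ω : CE n → CE n [⋀^Fin 2]→L[ℝ] ℝ)
    (G : CE n → CE n →L[ℝ] CE n →L[ℝ] ℝ) : Prop where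
  eq : ∀ w ∈ U, ∀ X Y, G w X Y = Ω w ![X, mulI n Y]

theorem FlatMetric.contDiffAt_G (H : FlatMetric U P Ω) (hU : IsOpen U) (hG : IsFlatMetricBil U Ω G)
    {w : CE n} (hw : w ∈ U) : ContDiffAt ℝ ∞ G w := by
  refine contDiffAt_bil fun X Y => ?_
  have e : (fun z => G z X Y) =ᶠ[𝓝 w] fun z => Ω z ![X, mulI n Y] := by
    filter_upwards [hU.mem_nhds hw] with z hz using hG.eq z hz X Y
  exact (contDiffAt_form_iff.1 (H.smooth.contDiffAt (hU.mem_nhds hw)) _).congr_of_eventuallyEq e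

theorem FlatMetric.symm (H : FlatMetric U P Ω) (hG : IsFlatMetricBil U Ω G) {w : CE n}
    (hw : w ∈ U) (X Y : CE n) : G w X Y = G w Y X := by
  rw [hG.eq w hw, hG.eq w hw, ← H.inv_I w hw Y, mulI_mulI, form_swap (Ω w) X]
  simp only [← toBil_apply, map_neg]

theorem FlatMetric.G_I (H : FlatMetric U P Ω) (hG : IsFlatMetricBil U Ω G) {w : CE n}
    (hw : w ∈ U) (X Y : CE n) : G w (mulI n X) Y = G w X (-mulI n Y) := by
  rw [hG.eq w hw, hG.eq w hw, H.inv_I w hw, map_neg, mulI_mulI, neg_neg]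

theorem FlatMetric.G_P (H : FlatMetric U P Ω) (hP : FlatGK U P) (hG : IsFlatMetricBil U Ω G)
    {w : CE n} (hw : w ∈ U) (X Y : CE n) : G w (P w X) Y = G w X (P w Y) := by
  rw [hG.eq w hw, hG.eq w hw, ← H.inv_P w hw X, ← mulI_clm, hP.sq w hw]

theorem FlatMetric.G_projP (H : FlatMetric U P Ω) (hP : FlatGK U P) (hG : IsFlatMetricBil U Ω G)
    {w : CE n} (hw : w ∈ U) (X Y : CE n) : G w (projP P w X) Y = G w X (projP P w Y) := by
  rw [projP_apply, projP_apply]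
  simp only [map_smul, map_add, smul_apply, add_apply, H.G_P hP hG hw]

theorem FlatMetric.G_pos (H : FlatMetric U P Ω) (hG : IsFlatMetricBil U Ω G) {w : CE n}
    (hw : w ∈ U) (X : CE n) (hX : X ≠ 0) : 0 < G w X X := by
  rw [hG.eq w hw]
  exact H.pos w hw X hX

/-- `X ↦ tr_G (D_X G restricted to the eigenbundle)`. -/
def traceP (P : CE n → CE n →L[ℂ] CE n) (G : CE n → CE n →L[ℝ] CE n →L[ℝ] ℝ) (w X : CE n) : ℝ :=
  trG (G w) (fderiv ℝ G w X ∘L projP P w)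

theorem traceP_add (P : CE n → CE n →L[ℂ] CE n) (G : CE n → CE n →L[ℝ] CE n →L[ℝ] ℝ)
    (w X Y : CE n) : traceP P G w (X + Y) = traceP P G w X + traceP P G w Y := by
  rw [traceP, traceP, traceP, ← map_add, map_add, ContinuousLinearMap.add_comp]

theorem traceP_add_neg (P : CE n → CE n →L[ℂ] CE n) (G : CE n → CE n →L[ℝ] CE n →L[ℝ] ℝ)
    (w X : CE n) : traceP P G w X + traceP (-P) G w X = traceD G w X := by
  rw [traceP, traceP, ← map_add, traceD_eq_trG]
  congr 1
  ext1 Y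
  have h := projP_add_neg P w Y
  conv_rhs => rw [← h, map_add]
  rfl

/-- `X ↦ tr (Y ↦ (D_Y P) (P X)) / 2`. -/
def torsP (P : CE n → CE n →L[ℂ] CE n) (w X : CE n) : ℝ :=
  1 / 2 * trL (CE n) (((fderiv ℂ P w).flip (P w X)).restrictScalars ℝ)

theorem hasFDerivAt_bil_apply {w : CE n} (hd : DifferentiableAt ℝ G w) (Y Z : CE n) :
    HasFDerivAt (fun z => G z Y Z) (((ContinuousLinearMap.apply ℝ ℝ Z).comp
          ((ContinuousLinearMap.apply ℝ (CE n →L[ℝ] ℝ) Y).comp (fderiv ℝ G w)))) w := by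
  refine ((hd.hasFDerivAt.clm_apply (hasFDerivAt_const Y w)).clm_apply
    (hasFDerivAt_const Z w)).congr_fderiv ?_
  ext v
  simp

theorem FlatMetric.traceDflip_of_pos (H : FlatMetric U P Ω) (hP : FlatGK U P)
    (hG : IsFlatMetricBil U Ω G) {w : CE n} (hw : w ∈ U) {X : CE n} (hX : P w X = X) :
    traceDflip G w X = 1 / 2 * traceP P G w X - torsP P w X := by
  have hpos := H.G_pos hG hw
  have hsym := H.symm hG hw
  have hd : DifferentiableAt ℝ G w := (H.contDiffAt_G hP.isOpen hG hw).differentiableAt (by simp)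
  have hΩd : DifferentiableAt ℝ Ω w :=
    (H.smooth.contDiffAt (hP.isOpen.mem_nhds hw)).differentiableAt (by simp)
  have hadj := H.G_projP hP hG hw
  have hadj' : ∀ X Y, G w (projP (-P) w X) Y = G w X (projP (-P) w Y) :=
    H.neg.G_projP hP.neg hG hw
  set D := fderiv ℝ G w with hD
  set B := D.flip X with hB
  have hBa : ∀ Y V, B Y V = D Y X V := fun Y V => rfl
  set Q := projP P w with hQ
  set Q' := projP (-P) w with hQ'
  have hQQ : ∀ Y, Q (Q Y) = Q Y := fun Y => projP_of_eq (hP.P_projP hw Y)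
  have hQQ' : ∀ Y, Q' (Q' Y) = Q' Y := fun Y => projP_of_eq (hP.neg.P_projP hw Y)
  have hIadj : ∀ X Y, G w (mulI n X) Y = G w X ((-mulI n) Y) := H.G_I hG hw
  -- the part along the eigenbundle of `X`
  have hΩ : ∀ Y A C, fderiv ℝ (fun y => toBil (CE n) (Ω y)) w Y A C = D Y (mulI n A) C := by
    intro Y A C
    have h1 := ((hasFDerivAt_toBil hΩd).clm_apply (hasFDerivAt_const A w)).clm_apply
      (hasFDerivAt_const C w)
    have h2 := hasFDerivAt_bil_apply hd (mulI n A) C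
    have h3 : (fun y => toBil (CE n) (Ω y) A C) =ᶠ[𝓝 w] fun y => G y (mulI n A) C := by
      filter_upwards [hP.isOpen.mem_nhds hw] with y hy
      rw [H.G_I hG hy, hG.eq y hy, map_neg, mulI_mulI, neg_neg, toBil_apply]
    have h4 := congrArg (fun A => A Y) ((h2.congr_of_eventuallyEq h3).unique h1)
    rw [(hasFDerivAt_toBil hΩd).fderiv]
    simp at h4 ⊢
    exact h4.symm
  have hIt : ∀ Y A C, D Y (mulI n A) C = -D Y A (mulI n C) := by
    intro Y A C
    have h1 := hasFDerivAt_bil_apply hd (mulI n A) C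
    have h2 := (hasFDerivAt_bil_apply hd A (mulI n C)).neg
    have h3 : (fun y => G y (mulI n A) C) =ᶠ[𝓝 w] -(fun y => G y A (mulI n C)) := by
      filter_upwards [hP.isOpen.mem_nhds hw] with y hy
      rw [H.G_I hG hy, map_neg]
      rfl
    exact congrArg (fun A => A Y) ((h2.congr_of_eventuallyEq h3).unique h1).symm
  have hK : ∀ Y V, B (Q Y) (Q V) = D X (Q Y) (Q V) - B (mulI n (Q V)) (mulI n (Q Y)) := by
    intro Y V
    have h1 := H.closed_pos w hw X (Q Y) (mulI n (Q V)) hX (hP.P_projP hw Y)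
      (by rw [mulI_clm, hP.P_projP hw V])
    rw [extDeriv_toBil hΩd, hΩ, hΩ, hΩ, hIt X, hIt (Q Y), hIt (mulI n (Q V)), mulI_mulI] at h1
    simp only [map_neg] at h1
    rw [hBa, hBa]
    linarith
  have hfirst : trG (G w) (B ∘L Q) = 1 / 2 * traceP P G w X :=
    trG_of_closed hpos hsym mulI_mulI hIadj hadj hQQ (projP_mulI P w) hK
  -- the complementary part
  have hPd := (hP.differentiableAt_re hw).hasFDerivAt
  have hDP : ∀ Y V, D Y (P w X) V + G w (fderiv ℂ P w Y X) V
      = D Y X (P w V) + G w X (fderiv ℂ P w Y V) := by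
    intro Y V
    have h1 := (hd.hasFDerivAt.clm_apply (hPd.clm_apply (hasFDerivAt_const X w))).clm_apply
      (hasFDerivAt_const V w)
    have h2 := (hd.hasFDerivAt.clm_apply (hasFDerivAt_const X w)).clm_apply
      (hPd.clm_apply (hasFDerivAt_const V w))
    have h3 : (fun y => G y (reP P y X) V) =ᶠ[𝓝 w] fun y => G y X (reP P y V) := by
      filter_upwards [hP.isOpen.mem_nhds hw] with y hy using H.G_P hP hG hy X V
    have h4 := congrArg (fun A => A Y) ((h2.congr_of_eventuallyEq h3).unique h1)
    rw [← fderiv_reP (hP.differentiableAt hw) (hP.differentiableAt_re hw),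
      ← fderiv_reP (hP.differentiableAt hw) (hP.differentiableAt_re hw)]
    simp at h4
    linarith
  set R : CE n →L[ℝ] CE n →L[ℝ] CE n :=
    (ContinuousLinearMap.restrictScalarsL ℂ (CE n) (CE n) ℝ ℝ).comp
      ((fderiv ℂ P w).restrictScalars ℝ) with hR
  have hRa : ∀ Y V, R Y V = fderiv ℂ P w Y V := fun Y V => rfl
  have hsecond : trG (G w) (B ∘L Q') = -torsP P w X := by
    have hQ'P : ∀ V, P w (Q' V) = -Q' V := fun V => by
      have := hP.neg.P_projP hw V
      exact neg_eq_iff_eq_neg.1 this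
    rw [torsP, hX]
    refine trG_of_torsion (T := R) (X := X) hpos mulI_mulI hIadj hadj' hQQ' (projP_mulI (-P) w)
      (fun Y V => ?_) (fun Y => ?_) fun Y V => ?_
    · have h1 : fderiv ℂ P w (Complex.I • Y) = Complex.I • fderiv ℂ P w Y :=
        (fderiv ℂ P w).map_smul Complex.I Y
      show fderiv ℂ P w (Complex.I • Y) (mulI n V) = -fderiv ℂ P w Y V
      rw [h1, smul_apply, mulI_clm]
      exact mulI_mulI _
    · have h1 := involution_anticomm (P := reP P) (hP.differentiableAt_re hw)
        (by filter_upwards [hP.isOpen.mem_nhds hw] with y hy using hP.sq y hy) Y X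
      rw [fderiv_reP (hP.differentiableAt hw) (hP.differentiableAt_re hw),
        fderiv_reP (hP.differentiableAt hw) (hP.differentiableAt_re hw), reP_apply, reP_apply,
        hX] at h1
      refine projP_of_eq ?_
      rw [hRa, Pi.neg_apply, neg_apply, h1, neg_neg]
    · have h2 := hDP Y (Q' V)
      rw [hX, hQ'P, map_neg] at h2
      rw [hBa, hRa, hRa]
      linarith
  have hsplit : B = B ∘L Q + B ∘L Q' := by
    ext1 Y
    conv_lhs => rw [← projP_add_neg P w Y, map_add]
    rfl
  rw [traceDflip_eq_trG, ← hD, ← hB, hsplit, (trG (G w)).map_add, hfirst, hsecond]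
  ring

theorem FlatMetric.traceDflip_eq (H : FlatMetric U P Ω) (hP : FlatGK U P)
    (hG : IsFlatMetricBil U Ω G) {w : CE n} (hw : w ∈ U) (X : CE n) :
    traceDflip G w X = 1 / 2 * traceP P G w (projP P w X)
      + 1 / 2 * traceP (-P) G w (projP (-P) w X) - torsP P w X := by
  have h1 := H.traceDflip_of_pos hP hG hw (hP.P_projP hw X)
  have h2 := H.neg.traceDflip_of_pos hP.neg hG hw (hP.neg.P_projP hw X)
  have h3 : torsP P w (projP P w X) + torsP (-P) w (projP (-P) w X) = torsP P w X := by
    have h4 : ∀ Y, torsP (-P) w Y = torsP P w Y := fun Y => by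
      rw [torsP, torsP]
      congr 2
      ext1 V
      have h5 : fderiv ℂ (-P) w = -fderiv ℂ P w := fderiv_neg
      simp [h5]
    rw [h4]
    conv_rhs => rw [← projP_add_neg P w X]
    rw [torsP, torsP, torsP, ← mul_add, ← map_add]
    congr 2
    ext1 V
    simp
  conv_lhs => rw [← projP_add_neg P w X, map_add, h1, h2]
  rw [← h3]
  ring

end Torsion

end GenKahler

end

noncomputable section

namespace GenKahler

/-! ### The derivative of the logarithm of the determinant -/

section LogDet

variable {n : ℕ}

theorem trL_eq_of_frame {k : ℕ} {e : Fin k → CE n} {D : Submodule ℝ (CE n)}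
    (he : IsCBasis (mulI n) D e) {Q : CE n →L[ℝ] CE n} (hQ : ∀ X, Q X ∈ D)
    (hQ' : ∀ X ∈ D, Q X = X) {A : CE n →L[ℝ] CE n} (hA : ∀ X, A (mulI n X) = mulI n (A X))
    {m : Matrix (Fin k) (Fin k) ℂ} (hm : ∀ a, A (e a) = ∑ c, cact (mulI n) (m a c) (e c)) :
    trL (CE n) (A ∘L Q) = 2 * m.trace.re := by
  have hc : ∀ (c : ℂ) (v : CE n), cact (mulI n) c v = c • v := fun c v => by
    conv_rhs => rw [← Complex.re_add_im c, add_smul, mul_smul]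
    rfl
  simp only [hc] at hm
  let ι : (Fin k → ℂ) →ₗ[ℝ] CE n :=
    { toFun := fun c => ∑ a, c a • e a
      map_add' := fun c d => by simp only [Pi.add_apply, add_smul, Finset.sum_add_distrib]
      map_smul' := fun r c => by
        simp only [Pi.smul_apply, RingHom.id_apply, Finset.smul_sum, smul_assoc] }
  have hιD : ∀ c, ι c ∈ D := fun c => by
    show ∑ a, c a • e a ∈ D
    refine D.sum_mem fun a _ => ?_
    rw [← hc]
    exact D.add_mem (D.smul_mem _ (he.1 a)) (D.smul_mem _ (he.2.1 a))
  have hιi : Function.Injective ι := by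
    intro c d h
    obtain ⟨b, _, hb⟩ := he.2.2 (ι c) (hιD c)
    simp only [hc] at hb
    rw [hb c rfl, hb d h]
  obtain ⟨g, hg⟩ := ι.exists_leftInverse_of_injective (LinearMap.ker_eq_bot.2 hιi)
  have hgι : ∀ c, g (ι c) = c := fun c => congrArg (fun L => L c) hg
  have hιg : ∀ v ∈ D, ι (g v) = v := by
    intro v hv
    obtain ⟨c, h1, _⟩ := he.2.2 v hv
    simp only [hc] at h1
    have h2 : v = ι c := h1
    rw [h2, hgι]
  let ι' : (Fin k → ℂ) →L[ℝ] CE n := LinearMap.toContinuousLinearMap ι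
  let π : CE n →L[ℝ] (Fin k → ℂ) := (LinearMap.toContinuousLinearMap g) ∘L Q
  let R : (Fin k → ℂ) →L[ℂ] (Fin k → ℂ) := LinearMap.toContinuousLinearMap (Matrix.toLin' m.transpose)
  have hAc : ∀ (c : ℂ) (v : CE n), A (c • v) = c • A v := fun c v => (toComplexCLM A hA).map_smul c v
  have h1 : A ∘L Q = (ι' ∘L R.restrictScalars ℝ) ∘L π := by
    ext1 v
    have h2 : Q v = ι (g (Q v)) := (hιg _ (hQ v)).symm
    show A (Q v) = ι (R (g (Q v)))
    conv_lhs => rw [h2]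
    show A (∑ a, g (Q v) a • e a) = ∑ c, R (g (Q v)) c • e c
    have h3 : ∀ d, R d = m.transpose.mulVec d := fun d => rfl
    simp only [map_sum, hAc, hm, h3, Matrix.mulVec, dotProduct, Matrix.transpose_apply,
      Finset.smul_sum, Finset.sum_smul, smul_smul]
    rw [Finset.sum_comm]
    exact Finset.sum_congr rfl fun c _ => Finset.sum_congr rfl fun a _ => by rw [mul_comm]
  have h4 : π ∘L (ι' ∘L R.restrictScalars ℝ) = R.restrictScalars ℝ := by
    ext1 v
    show g (Q (ι (R v))) = R v
    rw [hQ' _ (hιD _), hgι]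
  rw [h1, trL_comm π (ι' ∘L R.restrictScalars ℝ), h4, trL_restrictScalars]
  congr 2
  show LinearMap.trace ℂ _ (Matrix.toLin' m.transpose) = _
  rw [Matrix.trace_toLin'_eq, Matrix.trace_transpose]

theorem hasFDerivAt_log_cdet {F : Type*} [NormedAddCommGroup F] [NormedSpace ℝ F]
    {Γ : F → CE n →L[ℝ] CE n →L[ℝ] ℝ} {w : F} (hd : DifferentiableAt ℝ Γ w)
    {D : Submodule ℝ (CE n)} (hΓ : IsHermOn (mulI n) ⊤ (Γ w)) {k : ℕ} {e : Fin k → CE n}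
    (he : IsCBasis (mulI n) D e) {Q : CE n →L[ℝ] CE n} (hQ : ∀ X, Q X ∈ D)
    (hQ' : ∀ X ∈ D, Q X = X) (hadj : ∀ X Y, Γ w (Q X) Y = Γ w X (Q Y)) (V : F)
    (hI : ∀ X Y, fderiv ℝ Γ w V (mulI n X) Y = -fderiv ℝ Γ w V X (mulI n Y))
    (hadj' : ∀ X Y, fderiv ℝ Γ w V (Q X) Y = fderiv ℝ Γ w V X (Q Y)) :
    fderiv ℝ (fun z => Real.log (cdet (mulI n) (fun X Y => Γ z X Y) e)) w V
      = 1 / 2 * trG (Γ w) (fderiv ℝ Γ w V ∘L Q) := by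
  have hpos : ∀ v, v ≠ 0 → 0 < Γ w v v := fun v hv => hΓ.pos v trivial hv
  obtain ⟨ε, hε⟩ := exists_equiv_of_pos hpos
  set A : CE n →L[ℝ] CE n := (Γ w).inverse ∘L fderiv ℝ Γ w V with hA
  have hΓA : ∀ X Y, Γ w (A X) Y = fderiv ℝ Γ w V X Y := fun X Y =>
    congrArg (fun B => B Y) (self_apply_inverse ε hε (fderiv ℝ Γ w V X))
  have hinj : ∀ X X', (∀ Y, Γ w X Y = Γ w X' Y) → X = X' := fun X X' h => by
    rw [← inverse_apply_self ε hε X, ← inverse_apply_self ε hε X']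
    congr 1
    ext1 Y
    exact h Y
  have hAI : ∀ X, A (mulI n X) = mulI n (A X) := fun X => hinj _ _ fun Y => by
    rw [hΓA, hI, ← hΓA, hΓ.J_left trivial trivial]
  have hAQ : ∀ X, A (Q X) = Q (A X) := fun X => hinj _ _ fun Y => by
    rw [hΓA, hadj', ← hΓA, hadj]
  have hDtop : IsHermOn (mulI n) D (Γ w) := by
    refine hΓ.mono le_top fun v hv => ?_
    obtain ⟨c, hc, _⟩ := he.2.2 v hv
    rw [hc, map_sum]
    refine D.sum_mem fun a _ => ?_
    rw [cact, map_add, map_smul, map_smul, mulI_mulI]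
    exact D.add_mem (D.smul_mem _ (he.2.1 a)) (D.smul_mem _ (D.neg_mem (he.1 a)))
  obtain ⟨m, hm⟩ := he.exists_matrix (Z' := fun a => A (e a)) fun a => by
    rw [← hQ' _ (he.1 a), hAQ]
    exact hQ _
  set H : F → Matrix (Fin k) (Fin k) ℂ := fun z => cgram (mulI n) (fun X Y => Γ z X Y) e with hH
  have hder : ∀ X Y, HasFDerivAt (fun z => Γ z X Y) (((ContinuousLinearMap.apply ℝ ℝ Y).comp
          ((ContinuousLinearMap.apply ℝ (CE n →L[ℝ] ℝ) X).comp (fderiv ℝ Γ w)))) w := fun X Y => by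
    refine ((hd.hasFDerivAt.clm_apply (hasFDerivAt_const X w)).clm_apply
      (hasFDerivAt_const Y w)).congr_fderiv ?_
    ext v
    simp
  have hHd : ∀ a b, HasFDerivAt (fun z => H z a b) ((1 / 2 : ℂ) • (Complex.ofRealCLM.comp
      (((ContinuousLinearMap.apply ℝ ℝ (e b)).comp
          ((ContinuousLinearMap.apply ℝ (CE n →L[ℝ] ℝ) (e a)).comp (fderiv ℝ Γ w))))
      - Complex.I • Complex.ofRealCLM.comp (((ContinuousLinearMap.apply ℝ ℝ (e b)).comp
          ((ContinuousLinearMap.apply ℝ (CE n →L[ℝ] ℝ) (mulI n (e a))).comp (fderiv ℝ Γ w)))))) w := by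
    intro a b
    have h1 := Complex.ofRealCLM.hasFDerivAt.comp w (hder (e a) (e b))
    have h2 := (Complex.ofRealCLM.hasFDerivAt.comp w (hder (mulI n (e a)) (e b))).const_mul Complex.I
    refine ((h1.sub h2).const_mul (1 / 2 : ℂ)).congr_of_eventuallyEq (Filter.Eventually.of_forall fun z => ?_)
    show (((Γ z (e a) (e b) : ℝ) : ℂ) - Complex.I * ((Γ z (mulI n (e a)) (e b) : ℝ) : ℂ)) / 2
      = 1 / 2 * (((Γ z (e a) (e b) : ℝ) : ℂ) - Complex.I * ((Γ z (mulI n (e a)) (e b) : ℝ) : ℂ))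
    ring
  have hH' : (Matrix.of fun a b => fderiv ℝ (fun z => H z a b) w V) = m * H w := by
    have h1 : (m * H w) = cgram (mulI n) (fun X Y => fderiv ℝ Γ w V X Y) e := by
      ext a b
      simp only [cgram, Matrix.of_apply, hH, Matrix.mul_apply]
      rw [Finset.sum_congr rfl fun c _ => (hΓ.cform_cact_left (m a c) (e c) (e b)).symm,
        ← cform_sum_left, ← hm]
      simp only [cform]
      rw [← hAI, hΓA, hΓA]
    rw [h1]
    ext a b
    rw [Matrix.of_apply, (hHd a b).fderiv]
    simp [cgram, cform]
    ring
  have hdet := hasFDerivAt_det (fun i j => (hHd i j).differentiableAt) V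
  have hcd : ((cdet (mulI n) (fun X Y => Γ w X Y) e : ℝ) : ℂ) = (H w).det := (hDtop.det_cgram he).symm
  have hcpos := hDtop.cdet_pos he
  have h3 : HasFDerivAt (fun z => cdet (mulI n) (fun X Y => Γ z X Y) e)
      (Complex.reCLM.comp (fderiv ℝ (fun z => (H z).det) w)) w :=
    Complex.reCLM.hasFDerivAt.comp w hdet.1.hasFDerivAt
  have h4 := (h3.log hcpos.ne').fderiv
  have h5 : fderiv ℝ (fun z => (H z).det) w V
      = ((cdet (mulI n) (fun X Y => Γ w X Y) e : ℝ) : ℂ) * m.trace := by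
    rw [hdet.2, hH', Matrix.trace_mul_comm, Matrix.mul_assoc, Matrix.mul_adjugate, hcd]
    simp
  have h6 : trG (Γ w) (fderiv ℝ Γ w V ∘L Q) = 2 * m.trace.re :=
    trL_eq_of_frame he hQ hQ' hAI hm
  rw [h4, h6]
  show (cdet (mulI n) (fun X Y => Γ w X Y) e)⁻¹ * (fderiv ℝ (fun z => (H z).det) w V).re = _
  rw [h5, Complex.re_ofReal_mul]
  field_simp

end LogDet

/-! ### Real parts of holomorphic one-forms -/

section ReHol

variable {n : ℕ} {U : Set (CE n)}

/-- `κ` is the real part of a holomorphic one-form. -/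
def IsReHol (U : Set (CE n)) (κ : CE n → CE n → ℝ) : Prop :=
  ∃ K : CE n → CE n →L[ℂ] ℂ, DifferentiableOn ℂ K U ∧ ∀ w ∈ U, ∀ X, κ w X = (K w X).re

theorem IsReHol.mono {κ : CE n → CE n → ℝ} (h : IsReHol U κ) {V : Set (CE n)} (hV : V ⊆ U) :
    IsReHol V κ := by
  obtain ⟨K, hK, h1⟩ := h
  exact ⟨K, hK.mono hV, fun w hw => h1 w (hV hw)⟩

theorem IsReHol.sub {κ₁ κ₂ : CE n → CE n → ℝ} (h₁ : IsReHol U κ₁) (h₂ : IsReHol U κ₂) :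
    IsReHol U (fun w X => κ₁ w X - κ₂ w X) := by
  obtain ⟨K₁, hK₁, e₁⟩ := h₁
  obtain ⟨K₂, hK₂, e₂⟩ := h₂
  refine ⟨fun w => K₁ w - K₂ w, hK₁.sub hK₂, fun w hw X => ?_⟩
  show κ₁ w X - κ₂ w X = _
  rw [e₁ w hw, e₂ w hw]
  rfl

theorem IsReHol.const_mul {κ : CE n → CE n → ℝ} (h : IsReHol U κ) (c : ℝ) :
    IsReHol U (fun w X => c * κ w X) := by
  obtain ⟨K, hK, e⟩ := h
  refine ⟨fun w => (c : ℂ) • K w, hK.const_smul (c : ℂ), fun w hw X => ?_⟩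
  show c * κ w X = _
  rw [e w hw, smul_apply, smul_eq_mul, Complex.re_ofReal_mul]

theorem IsReHol.comp {κ : CE n → CE n → ℝ} (h : IsReHol U κ) {P : CE n → CE n →L[ℂ] CE n}
    (hP : DifferentiableOn ℂ P U) : IsReHol U (fun w X => κ w (P w X)) := by
  obtain ⟨K, hK, e⟩ := h
  exact ⟨fun w => (K w).comp (P w), hK.clm_comp hP, fun w hw X => e w hw _⟩

/-- The `(1,1)` part of `d (κ ∘ i)` vanishes if `κ` is the real part of a holomorphic form. -/
theorem IsReHol.fpart11_extDeriv {κ : CE n → CE n → ℝ} (h : IsReHol U κ) (hU : IsOpen U)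
    {a : CE n → CE n →L[ℝ] ℝ} (ha : ∀ w ∈ U, ∀ X, a w X = κ w (mulI n X)) {w : CE n} (hw : w ∈ U) :
    DifferentiableAt ℝ a w ∧ fpart11 (mulI n) (extDeriv (fun y => oneForm (a y)) w) = 0 := by
  obtain ⟨K, hK, e⟩ := h
  have hKd := (hK w hw).differentiableAt (hU.mem_nhds hw)
  have h1 : ∀ X, HasFDerivAt (fun y => a y X) (Complex.reCLM.comp
      ((fderiv ℂ (fun y => K y (mulI n X)) w).restrictScalars ℝ)) w := fun X => by
    have h2 := (Complex.reCLM.hasFDerivAt.comp w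
      ((hKd.clm_apply (differentiableAt_const (mulI n X))).hasFDerivAt.restrictScalars ℝ))
    refine h2.congr_of_eventuallyEq ?_
    filter_upwards [hU.mem_nhds hw] with y hy
    rw [ha y hy, e y hy]
    rfl
  have hac : ContDiffAt ℝ ∞ a w := by
    rw [← contDiffWithinAt_univ]
    refine contDiffWithinAt_clm fun X => ?_
    rw [contDiffWithinAt_univ]
    have h3 : DifferentiableOn ℂ (fun y => K y (mulI n X)) U := hK.clm_apply (differentiableOn_const _)
    have h4 := ((contDiffOn_infty_of_differentiableOn_complex hU h3).contDiffAt
      (hU.mem_nhds hw)).restrict_scalars ℝ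
    refine (Complex.reCLM.contDiff.contDiffAt.comp w h4).congr_of_eventuallyEq ?_
    filter_upwards [hU.mem_nhds hw] with y hy
    rw [ha y hy, e y hy]
    rfl
  have had : DifferentiableAt ℝ a w := hac.differentiableAt (by simp)
  have h5 : ∀ X Y, fderiv ℝ a w X Y = (fderiv ℂ K w X (mulI n Y)).re := fun X Y => by
    have h6 := (had.hasFDerivAt.clm_apply (hasFDerivAt_const Y w)).unique (h1 Y)
    have h7 := congrArg (fun A => A X) h6
    have h8 := (hKd.hasFDerivAt.clm_apply (hasFDerivAt_const (mulI n Y) w)).fderiv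
    rw [h8] at h7
    simpa using h7
  refine ⟨had, two_form_ext fun X Y => ?_⟩
  have h9 : ∀ X Y, fderiv ℂ K w (mulI n X) Y = Complex.I * fderiv ℂ K w X Y := fun X Y => by
    have := (fderiv ℂ K w).map_smul Complex.I X
    show fderiv ℂ K w (Complex.I • X) Y = _
    rw [this]
    rfl
  have h10 : ∀ X Y, fderiv ℂ K w X (mulI n Y) = Complex.I * fderiv ℂ K w X Y := fun X Y =>
    (fderiv ℂ K w X).map_smul Complex.I Y
  rw [fpart11_apply, extDeriv_oneForm_apply had, extDeriv_oneForm_apply had]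
  simp only [h5, h9, h10]
  show _ = (0 : ℝ)
  simp

/-- The complex trace of an endomorphism. -/
def trC (n : ℕ) : (CE n →L[ℂ] CE n) →L[ℂ] ℂ :=
  LinearMap.toContinuousLinearMap
    ((LinearMap.trace ℂ (CE n)).comp (ContinuousLinearMap.coeLM ℂ))

theorem trL_eq_trC (A : CE n →L[ℂ] CE n) : trL (CE n) (A.restrictScalars ℝ) = 2 * (trC n A).re :=
  trL_restrictScalars A

theorem FlatGK.isReHol_torsP {P : CE n → CE n →L[ℂ] CE n} (H : FlatGK U P) :
    IsReHol U (torsP P) := by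
  refine ⟨fun w => trC n ∘L (fderiv ℂ P w).flip ∘L P w, fun w hw => ?_, fun w hw X => ?_⟩
  · refine (differentiableAt_clm_of_apply fun v => ?_).differentiableWithinAt
    have h1 : DifferentiableAt ℂ (fderiv ℂ P) w :=
      (differentiableOn_fderiv_of_isOpen H.isOpen H.holo w hw).differentiableAt
        (H.isOpen.mem_nhds hw)
    have h2 : DifferentiableAt ℂ (fun z => P z v) w :=
      (H.differentiableAt hw).clm_apply (differentiableAt_const v)
    have h3 : DifferentiableAt ℂ (fun z => ContinuousLinearMap.apply ℂ (CE n) (P z v)) w :=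
      differentiableAt_clm_of_apply fun A => A.differentiableAt.comp w h2
    exact (trC n).differentiableAt.comp w (h3.clm_comp h1)
  · rw [torsP, trL_eq_trC]
    show 1 / 2 * (2 * (trC n ((fderiv ℂ P w).flip (P w X))).re)
      = (trC n ((fderiv ℂ P w).flip (P w X))).re
    ring

/-- The logarithmic derivative of the frame map. -/
def kapP (P : CE n → CE n →L[ℂ] CE n) (w₀ w X : CE n) : ℝ :=
  trL (CE n) ((fderiv ℂ (frameMap P w₀) w X ∘L ((1 / 2 : ℂ) • (ContinuousLinearMap.id ℂ (CE n)
    + P w₀)) ∘L (frameMap P w₀ w).inverse).restrictScalars ℝ)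

theorem FlatGK.isReHol_kapP {P : CE n → CE n →L[ℂ] CE n} (H : FlatGK U P) (w₀ : CE n)
    {V : Set (CE n)} (hVU : V ⊆ U)
    (hV : ∀ w ∈ V, ∃ e : CE n ≃L[ℂ] CE n, (e : CE n →L[ℂ] CE n) = frameMap P w₀ w) :
    IsReHol V (kapP P w₀) := by
  set q : CE n →L[ℂ] CE n := (1 / 2 : ℂ) • (ContinuousLinearMap.id ℂ (CE n) + P w₀) with hq
  refine ⟨fun w => (2 : ℂ) • (trC n ∘L (ContinuousLinearMap.compL ℂ (CE n) (CE n) (CE n)).flip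
    (q ∘L (frameMap P w₀ w).inverse) ∘L fderiv ℂ (frameMap P w₀) w), fun w hw => ?_,
    fun w hw X => ?_⟩
  · have hS := H.differentiableOn_frameMap w₀
    have h1 : DifferentiableAt ℂ (fderiv ℂ (frameMap P w₀)) w :=
      (differentiableOn_fderiv_of_isOpen H.isOpen hS w (hVU hw)).differentiableAt
        (H.isOpen.mem_nhds (hVU hw))
    have h2 : DifferentiableAt ℂ (fun z => (frameMap P w₀ z).inverse) w := by
      obtain ⟨e, he⟩ := hV w hw
      have h3 : DifferentiableAt ℂ ContinuousLinearMap.inverse (frameMap P w₀ w) := by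
        rw [← he]
        exact (contDiffAt_map_inverse (n := 1) e).differentiableAt (by simp)
      exact h3.comp w ((hS w (hVU hw)).differentiableAt (H.isOpen.mem_nhds (hVU hw)))
    refine (DifferentiableAt.const_smul ?_ (2 : ℂ)).differentiableWithinAt
    refine differentiableAt_clm_of_apply fun v => ?_
    have h4 : DifferentiableAt ℂ (fun z => fderiv ℂ (frameMap P w₀) z v ∘L q ∘L
        (frameMap P w₀ z).inverse) w :=
      (h1.clm_apply (differentiableAt_const v)).clm_comp ((differentiableAt_const q).clm_comp h2)
    exact (trC n).differentiableAt.comp w h4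
  · rw [kapP, trL_eq_trC]
    have h : ∀ c : ℂ, 2 * c.re = (2 * c).re := fun c => by simp
    exact h _

end ReHol

/-! ### The flow identity in a holomorphic chart -/

section FlowIdentity

variable {n : ℕ} {U : Set (CE n)} {P : CE n → CE n →L[ℂ] CE n}
  {Ω : CE n → CE n [⋀^Fin 2]→L[ℝ] ℝ} {G : CE n → CE n →L[ℝ] CE n →L[ℝ] ℝ}

/-- `log det` of `G` in the frame transported from `w₀`. -/
def logDet (P : CE n → CE n →L[ℂ] CE n) (G : CE n → CE n →L[ℝ] CE n →L[ℝ] ℝ) (w₀ : CE n) {k : ℕ}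
    (e : Fin k → CE n) (w : CE n) : ℝ :=
  Real.log (cdet (mulI n) (fun X Y => G w X Y) (fun a => frameMap P w₀ w (e a)))

theorem FlatMetric.isHermOn (H : FlatMetric U P Ω) (hG : IsFlatMetricBil U Ω G) {w : CE n}
    (hw : w ∈ U) : IsHermOn (mulI n) ⊤ (G w) := by
  refine ⟨mulI_mulI, fun _ _ => trivial, fun X _ Y _ => H.symm hG hw X Y,
    fun X _ hX => H.G_pos hG hw X hX, fun X _ Y _ => ?_⟩
  rw [H.G_I hG hw, mulI_mulI, neg_neg]

theorem FlatMetric.fderiv_logDet (H : FlatMetric U P Ω) (hP : FlatGK U P)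
    (hG : IsFlatMetricBil U Ω G) {w₀ w : CE n} (hw₀ : w₀ ∈ U) (hw : w ∈ U)
    (hS : ∃ e : CE n ≃L[ℂ] CE n, (e : CE n →L[ℂ] CE n) = frameMap P w₀ w) {k : ℕ}
    {e : Fin k → CE n} (he : IsCBasis (mulI n) (eigP P w₀) e) (V : CE n) :
    fderiv ℝ (logDet P G w₀ e) w V = 1 / 2 * traceP P G w V + kapP P w₀ w V := by
  obtain ⟨ε, hε⟩ := hS
  have hSε : ∀ X, frameMap P w₀ w X = ε X := fun X => by rw [← hε]; rfl
  have hU := hP.isOpen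
  set S := frameMap P w₀ with hSdef
  set S' := fderiv ℂ S w with hS'
  have hSd : DifferentiableAt ℂ S w :=
    (hP.differentiableOn_frameMap w₀ w hw).differentiableAt (hU.mem_nhds hw)
  have hSX : ∀ X, HasFDerivAt (fun z => S z X)
      (((S'.flip X).restrictScalars ℝ : CE n →L[ℝ] CE n)) w := fun X => by
    have h1 := (hSd.hasFDerivAt.clm_apply (hasFDerivAt_const X w)).restrictScalars ℝ
    refine h1.congr_fderiv ?_
    ext1 v
    simp [hS']
  have hGs := H.contDiffAt_G hU hG hw
  have hd : DifferentiableAt ℝ G w := hGs.differentiableAt (by simp)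
  have hSs : ∀ X, ContDiffAt ℝ ∞ (fun z => S z X) w := fun X => by
    have h1 : DifferentiableOn ℂ (fun z => S z X) U :=
      (hP.differentiableOn_frameMap w₀).clm_apply (differentiableOn_const _)
    exact ((contDiffOn_infty_of_differentiableOn_complex hU h1).contDiffAt
      (hU.mem_nhds hw)).restrict_scalars ℝ
  set Γ : CE n → CE n →L[ℝ] CE n →L[ℝ] ℝ := fun z =>
    (G z).bilinearComp ((S z).restrictScalars ℝ) ((S z).restrictScalars ℝ) with hΓ
  have hΓa : ∀ z X Y, Γ z X Y = G z (S z X) (S z Y) := fun z X Y => rfl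
  have hΓd : DifferentiableAt ℝ Γ w := differentiableAt_bil fun X Y =>
    (hGs.clm_apply (hSs X)).clm_apply (hSs Y)
  have hΓ' : ∀ X Y, fderiv ℝ Γ w V X Y = fderiv ℝ G w V (S w X) (S w Y)
      + G w (S' V X) (S w Y) + G w (S w X) (S' V Y) := fun X Y => by
    have h1 := ((hd.hasFDerivAt.clm_apply (hSX X)).clm_apply (hSX Y))
    have h2 := (hΓd.hasFDerivAt.clm_apply (hasFDerivAt_const X w)).clm_apply
      (hasFDerivAt_const Y w)
    have h3 := congrArg (fun A => A V) (h2.unique h1)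
    simp at h3
    linarith
  have hev : ∀ᶠ z in 𝓝 w, z ∈ U := hU.mem_nhds hw
  have hΓI : ∀ z ∈ U, ∀ X Y, Γ z (mulI n X) Y = -Γ z X (mulI n Y) := fun z hz X Y => by
    rw [hΓa, hΓa, mulI_clm, mulI_clm, H.G_I hG hz, map_neg]
  set q : CE n →L[ℂ] CE n := (1 / 2 : ℂ) • (ContinuousLinearMap.id ℂ (CE n) + P w₀) with hq
  have hqP : ∀ X, projP P w₀ X = q X := fun X => by
    rw [projP_apply, hq, smul_apply, add_apply, ContinuousLinearMap.id_apply, ← Complex.coe_smul]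
    norm_num
  have hqS : ∀ z ∈ U, ∀ X, S z (projP P w₀ X) = projP P z (S z X) := fun z hz X => by
    rw [projP_apply, projP_apply, hP.intertwine hw₀ hz, ← map_add]
    exact ((S z).restrictScalars ℝ).map_smul (1 / 2 : ℝ) _
  have hΓQ : ∀ z ∈ U, ∀ X Y, Γ z (projP P w₀ X) Y = Γ z X (projP P w₀ Y) := fun z hz X Y => by
    rw [hΓa, hΓa, hqS z hz, hqS z hz, H.G_projP hP hG hz]
  have hder : ∀ (A C : CE n →L[ℝ] CE n) (s : ℝ), (∀ z ∈ U, ∀ X Y, Γ z (A X) Y = s * Γ z X (C Y)) →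
      ∀ X Y, fderiv ℝ Γ w V (A X) Y = s * fderiv ℝ Γ w V X (C Y) := fun A C s h X Y => by
    have h1 := hasFDerivAt_bil_apply hΓd (A X) Y
    have h2 := (hasFDerivAt_bil_apply hΓd X (C Y)).const_mul s
    have h3 : (fun z => Γ z (A X) Y) =ᶠ[𝓝 w] fun z => s * Γ z X (C Y) := by
      filter_upwards [hev] with z hz using h z hz X Y
    exact congrArg (fun A => A V) ((h2.congr_of_eventuallyEq h3).unique h1).symm
  have hherm : IsHermOn (mulI n) ⊤ (Γ w) := by
    refine ⟨mulI_mulI, fun _ _ => trivial, fun X _ Y _ => H.symm hG hw _ _,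
      fun X _ hX => H.G_pos hG hw _ fun h => hX (ε.injective ?_), fun X _ Y _ => ?_⟩
    · rw [← hSε, map_zero]
      exact h
    · rw [hΓI w hw, mulI_mulI, map_neg, neg_neg]
  have hlog : logDet P G w₀ e = fun z => Real.log (cdet (mulI n) (fun X Y => Γ z X Y) e) := by
    funext z
    rw [logDet, cdet, cdet]
    congr 3
    ext a b
    simp only [cgram, Matrix.of_apply, cform, hΓa]
    rw [mulI_clm]
  rw [hlog, hasFDerivAt_log_cdet hΓd (Q := projP P w₀) hherm he
    (fun X => mem_eigP.2 (hP.P_projP hw₀ X)) (fun X hX => projP_of_eq (mem_eigP.1 hX)) (hΓQ w hw) V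
    (fun X Y => by
      have h := hder (mulI n) (mulI n) (-1) (fun z hz X Y => by rw [hΓI z hz]; ring) X Y
      rw [h]; ring)
    (fun X Y => by
      have h := hder (projP P w₀) (projP P w₀) 1 (fun z hz X Y => by rw [hΓQ z hz]; ring) X Y
      rw [h]; ring)]
  have hpos := H.G_pos hG hw
  set T : CE n →L[ℝ] CE n := (S' V ∘L q ∘L (S w).inverse).restrictScalars ℝ with hT
  have hinv : ∀ X, (S w).inverse X = ε.symm X := fun X => by
    rw [← hε, ContinuousLinearMap.inverse_equiv]
    rfl
  have hTa : ∀ X, T X = S' V (q (ε.symm X)) := fun X => by rw [← hinv]; rfl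
  let εr : CE n ≃L[ℝ] CE n := ε.restrictScalars ℝ
  set T₂ : CE n →L[ℝ] CE n := (S' V ∘L (ε.symm : CE n →L[ℂ] CE n)).restrictScalars ℝ with hT₂
  have h1 : trG (Γ w) (fderiv ℝ Γ w V ∘L projP P w₀) = trG (G w) (fderiv ℝ G w V ∘L projP P w
      + G w ∘L T + precompR (G w ∘L projP P w) T₂) := by
    refine trG_bilinearComp hpos εr (fun X Y => ?_) fun X Y => ?_
    · rw [hΓa, hSε, hSε]
      rfl
    · have h2 : ∀ X, εr X = S w X := fun X => (hSε X).symm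
      have h3 : ∀ X, ε.symm (S w X) = X := fun X => by rw [hSε, ε.symm_apply_apply]
      have h4 : T₂ (S w Y) = S' V Y := congrArg (S' V) (h3 Y)
      have h5 : T (S w X) = S' V (projP P w₀ X) := by rw [hTa, h3, hqP]
      rw [h2, h2]
      show fderiv ℝ Γ w V (projP P w₀ X) Y = fderiv ℝ G w V (projP P w (S w X)) (S w Y)
        + G w (T (S w X)) (S w Y) + G w (projP P w (S w X)) (T₂ (S w Y))
      rw [hΓ', h4, h5, hqS w hw]
  have h6 : trG (G w) (precompR (G w ∘L projP P w) T₂) = trL (CE n) T := by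
    rw [← trG_flip hpos (H.symm hG hw)]
    have h7 : (precompR (G w ∘L projP P w) T₂).flip = G w ∘L (projP P w ∘L T₂) := by
      ext X Y
      show G w (projP P w Y) (T₂ X) = G w (projP P w (T₂ X)) Y
      rw [H.symm hG hw, H.G_projP hP hG hw]
    rw [h7, trG_self_comp hpos, trL_comm T₂ (projP P w)]
    congr 1
    ext1 X
    show S' V (ε.symm (projP P w X)) = T X
    rw [hTa, ← hqP]
    congr 1
    apply ε.injective
    rw [ε.apply_symm_apply, ← hSε, hqS w hw, hSε, ε.apply_symm_apply]
  rw [h1, map_add, map_add, h6, trG_self_comp hpos]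
  have h8 : kapP P w₀ w V = trL (CE n) T := rfl
  rw [h8, traceP]
  ring

end FlowIdentity

end GenKahler

end

noncomputable section

namespace GenKahler

/-! ### The tensor `P(ω)` in a holomorphic chart -/

section TraceSmooth

variable {E : Type*} [NormedAddCommGroup E] [NormedSpace ℝ E] [FiniteDimensional ℝ E]
  {G : E → E →L[ℝ] E →L[ℝ] ℝ} {w : E}

set_option maxSynthPendingDepth 4 in
theorem contDiffAt_traceD (hG : ContDiffAt ℝ ∞ G w) (hpos : ∀ v, v ≠ 0 → 0 < G w v v) :
    ContDiffAt ℝ ∞ (traceD G) w ∧ ContDiffAt ℝ ∞ (traceDflip G) w := by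
  obtain ⟨e, he⟩ := exists_equiv_of_pos hpos
  have h1 : ContDiffAt ℝ ∞ (fun y => (G y).inverse) w :=
    contDiffWithinAt_univ.1 (contDiffWithinAt_inverse (contDiffWithinAt_univ.2 hG) e he)
  have h2 : ContDiffAt ℝ ∞ (fderiv ℝ G) w := hG.fderiv_right (m := ∞) (by simp)
  constructor
  · refine contDiffWithinAt_univ.1 (contDiffWithinAt_clm fun X => contDiffWithinAt_univ.2 ?_)
    exact (trL E).contDiff.contDiffAt.comp w (h1.clm_comp (h2.clm_apply contDiffAt_const))
  · refine contDiffWithinAt_univ.1 (contDiffWithinAt_clm fun X => contDiffWithinAt_univ.2 ?_)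
    refine (trL E).contDiff.contDiffAt.comp w (h1.clm_comp ?_)
    refine contDiffAt_bil fun Y V => ?_
    have h3 : ContDiffAt ℝ ∞ (fun z => fderiv ℝ G z Y) w := h2.clm_apply contDiffAt_const
    have h4 : ContDiffAt ℝ ∞ (fun z => fderiv ℝ G z Y X) w := h3.clm_apply contDiffAt_const
    exact h4.clm_apply contDiffAt_const

/-- The one-form `(μ - λ / 4) ∘ i`, whose derivative is the tensor `P`. -/
def nuForm (n : ℕ) (G : CE n → CE n →L[ℝ] CE n →L[ℝ] ℝ) (w : CE n) : CE n →L[ℝ] ℝ :=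
  (traceDflip G w - (1 / 4 : ℝ) • traceD G w) ∘L mulI n

end TraceSmooth

section FPart

variable {E : Type*} [NormedAddCommGroup E] [NormedSpace ℝ E] (J : E →L[ℝ] E)

theorem fpart11_add (α β : E [⋀^Fin 2]→L[ℝ] ℝ) :
    fpart11 J (α + β) = fpart11 J α + fpart11 J β :=
  two_form_ext fun X Y => by
    simp only [fpart11_apply, ContinuousAlternatingMap.add_apply]
    ring

theorem fpart11_smul (c : ℝ) (α : E [⋀^Fin 2]→L[ℝ] ℝ) : fpart11 J (c • α) = c • fpart11 J α :=
  two_form_ext fun X Y => by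
    simp only [fpart11_apply, ContinuousAlternatingMap.smul_apply, smul_eq_mul]
    ring

theorem extDeriv_oneForm_add {a b : E → E →L[ℝ] ℝ} {w : E} (ha : DifferentiableAt ℝ a w)
    (hb : DifferentiableAt ℝ b w) : extDeriv (fun y => oneForm (a y + b y)) w
      = extDeriv (fun y => oneForm (a y)) w + extDeriv (fun y => oneForm (b y)) w :=
  two_form_ext fun X Y => by
    have h : DifferentiableAt ℝ (fun y => a y + b y) w := ha.add hb
    rw [ContinuousAlternatingMap.add_apply, extDeriv_oneForm_apply h, extDeriv_oneForm_apply ha,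
      extDeriv_oneForm_apply hb, fderiv_fun_add ha hb]
    simp only [add_apply]
    ring

theorem extDeriv_oneForm_smul {a : E → E →L[ℝ] ℝ} {w : E} (c : ℝ) (ha : DifferentiableAt ℝ a w) :
    extDeriv (fun y => oneForm (c • a y)) w = c • extDeriv (fun y => oneForm (a y)) w :=
  two_form_ext fun X Y => by
    have h : DifferentiableAt ℝ (fun y => c • a y) w := ha.const_smul c
    rw [ContinuousAlternatingMap.smul_apply, extDeriv_oneForm_apply h, extDeriv_oneForm_apply ha,
      fderiv_fun_const_smul ha]
    simp only [smul_apply, smul_eq_mul]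
    ring

end FPart

section FlowFlat

variable {n : ℕ} {U : Set (CE n)} {P : CE n → CE n →L[ℂ] CE n}
  {Ω : CE n → CE n [⋀^Fin 2]→L[ℝ] ℝ} {G : CE n → CE n →L[ℝ] CE n →L[ℝ] ℝ}

theorem FlatMetric.fpart11_nuForm (H : FlatMetric U P Ω) (hP : FlatGK U P)
    (hG : IsFlatMetricBil U Ω G) {w₀ : CE n} (hw₀ : w₀ ∈ U) {k l : ℕ}
    {e : Fin k → CE n} (he : IsCBasis (mulI n) (eigP P w₀) e)
    {e' : Fin l → CE n} (he' : IsCBasis (mulI n) (eigP (-P) w₀) e') {V : Set (CE n)}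
    (hV : IsOpen V) (hVU : V ⊆ U)
    (hS : ∀ w ∈ V, ∃ e : CE n ≃L[ℂ] CE n, (e : CE n →L[ℂ] CE n) = frameMap P w₀ w)
    (hL : ContDiffOn ℝ ∞ (logDet P G w₀ e) V) (hL' : ContDiffOn ℝ ∞ (logDet (-P) G w₀ e') V)
    {w : CE n} (hw : w ∈ V) :
    fpart11 (mulI n) (extDeriv (fun y => oneForm (nuForm n G y)) w)
      = -fbox P (fun y => logDet P G w₀ e y - logDet (-P) G w₀ e' y) w := by
  have hneg : frameMap (-P) w₀ = frameMap P w₀ := by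
    funext y
    ext1 X
    simp [frameMap]
  set L := fun y => logDet P G w₀ e y - logDet (-P) G w₀ e' y with hLdef
  have hLs : ContDiffOn ℝ ∞ L V := hL.sub hL'
  have hLd : ∀ y ∈ V, ∀ X, fderiv ℝ L y X = 1 / 2 * traceP P G y X + kapP P w₀ y X
      - (1 / 2 * traceP (-P) G y X + kapP (-P) w₀ y X) := by
    intro y hy X
    have h1 := ((hL.contDiffAt (hV.mem_nhds hy)).differentiableAt (by simp)).hasFDerivAt.sub
      ((hL'.contDiffAt (hV.mem_nhds hy)).differentiableAt (by simp)).hasFDerivAt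
    have h2 : fderiv ℝ L y = _ := h1.fderiv
    rw [h2, sub_apply, H.fderiv_logDet hP hG hw₀ (hVU hy) (hS y hy) he,
      H.neg.fderiv_logDet hP.neg hG hw₀ (hVU hy) (by rw [hneg]; exact hS y hy) he']
  set a : CE n → CE n →L[ℝ] ℝ := fun y => fderiv ℝ L y ∘L reP P y ∘L mulI n with ha
  set b : CE n → CE n →L[ℝ] ℝ := fun y => nuForm n G y - (1 / 2 : ℝ) • a y with hb
  have hκ : IsReHol V (fun y X => -(1 / 2) * (kapP P w₀ y (P y X) - kapP (-P) w₀ y (P y X))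
      - torsP P y X) := by
    have h1 := hP.isReHol_kapP w₀ hVU hS
    have h2 := hP.neg.isReHol_kapP w₀ hVU (by rw [hneg]; exact hS)
    exact (((h1.sub h2).comp (hP.holo.mono hVU)).const_mul (-(1 / 2))).sub (hP.isReHol_torsP.mono hVU)
  have hbκ : ∀ y ∈ V, ∀ X, b y X = -(1 / 2) * (kapP P w₀ y (P y (mulI n X))
      - kapP (-P) w₀ y (P y (mulI n X))) - torsP P y (mulI n X) := by
    intro y hy X
    obtain ⟨Z, hZ⟩ : ∃ Z, mulI n X = Z := ⟨_, rfl⟩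
    have h1 : b y X = traceDflip G y Z - 1 / 4 * traceD G y Z - 1 / 2 * fderiv ℝ L y (P y Z) := by
      rw [← hZ]; rfl
    have h2 := traceP_add_neg P G y Z
    have h3 := projP_add_neg P y Z
    have h4 := projP_sub_neg P y Z
    have h5 : ∀ R : CE n → CE n →L[ℂ] CE n, traceP R G y (P y Z)
        = traceP R G y (projP P y Z) - traceP R G y (projP (-P) y Z) := fun R => by
      have h6 := traceP_add R G y (P y Z) (projP (-P) y Z)
      rw [← h4, sub_add_cancel] at h6
      rw [← h4]
      linarith
    have h7 : ∀ R : CE n → CE n →L[ℂ] CE n, traceP R G y Z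
        = traceP R G y (projP P y Z) + traceP R G y (projP (-P) y Z) := fun R => by
      rw [← traceP_add, h3]
    rw [h1, hZ, H.traceDflip_eq hP hG (hVU hy), hLd y hy, ← h2, h7, h7, h5, h5]
    ring
  have hbd := hκ.fpart11_extDeriv hV hbκ hw
  have had := fbox_eq_part11 hP (hVU hw) ((hLs.contDiffAt (hV.mem_nhds hw)).of_le two_le_infty)
  have e1 : (fun y => oneForm (nuForm n G y)) = fun y => oneForm ((1 / 2 : ℝ) • a y + b y) := by
    funext y
    rw [hb]
    simp
  have h8 : DifferentiableAt ℝ (fun y => (1 / 2 : ℝ) • a y) w := had.1.fun_const_smul _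
  rw [e1, extDeriv_oneForm_add h8 hbd.1, extDeriv_oneForm_smul _ had.1, fpart11_add, hbd.2,
    fpart11_smul, had.2]
  ext v
  simp

end FlowFlat

section PluriP

variable {n : ℕ} {M : Type*} [TopologicalSpace M] [ChartedSpace (Model n) M]
  [IsManifold 𝓘(ℝ, Model n) ∞ M] {J : EndField n M} {φ : OpenPartialHomeomorph M (CE n)}
  {ω₁ : Form n M 2}

theorem SmoothFamilyOn.isSmoothForm {k : ℕ} {S : Set ℝ} {α : ℝ → Form n M k}
    (h : SmoothFamilyOn S α) {t : ℝ} (ht : t ∈ S) : IsSmoothForm (α t) := fun x₀ =>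
  (h x₀).comp (f := fun p : ℝ × Model n => (t, p.2)) (contDiff_const.prodMk contDiff_snd).contDiffOn
    fun _ hp => ⟨ht, hp.2⟩

theorem IsHermitianForm.isHermOn_pullBil (hω : IsHermitianForm J ω₁) (hφ : IsHoloChart J φ)
    {w : CE n} (hw : w ∈ φ.target) : IsHermOn (mulI n) ⊤ (pullBil φ (metricBil J ω₁) w) :=
  GenKahler.isHermOn_pullBil hφ hw (hω.isHermOn (hφ.J_J (φ.map_target hw)))

theorem IsSmoothForm.contDiffAt_pullBil (hsm : IsSmoothForm ω₁) (hφ : IsHoloChart J φ) {w : CE n}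
    (hw : w ∈ φ.target) : ContDiffAt ℝ ∞ (pullBil φ (metricBil J ω₁)) w := by
  refine contDiffAt_bil fun X Y => ?_
  refine (contDiffAt_form_iff.1 (hsm.contDiffAt_pull hφ.isSmoothChart hw)
    ![X, mulI n Y]).congr_of_eventuallyEq ?_
  filter_upwards [φ.open_target.mem_nhds hw] with y hy using pullBil_metricBil hφ hy X Y

theorem pull_pluriP (hJ : IsComplexStructure J) (hφ : IsHoloChart J φ) (hω : IsHermitianForm J ω₁)
    (hsm : IsSmoothForm ω₁) {w : CE n} (hw : w ∈ φ.target) :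
    pull φ (pluriP J ω₁) w = fpart11 (mulI n)
      (extDeriv (fun y => oneForm (nuForm n (pullBil φ (metricBil J ω₁)) y)) w) := by
  set G := pullBil φ (metricBil J ω₁) with hG
  have hGs : ∀ y ∈ φ.target, ContDiffAt ℝ ∞ G y := fun y hy => hsm.contDiffAt_pullBil hφ hy
  have hGh : ∀ y ∈ φ.target, IsHermOn (mulI n) ⊤ (G y) := fun y hy => hω.isHermOn_pullBil hφ hy
  have hGp : ∀ y ∈ φ.target, ∀ v, v ≠ 0 → 0 < G y v v := fun y hy v hv => (hGh y hy).pos v trivial hv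
  obtain ⟨hD, hDf⟩ := contDiffAt_traceD (hGs w hw) (hGp w hw)
  have hDd := hD.differentiableAt (by simp)
  have hDfd := hDf.differentiableAt (by simp)
  set lam : CE n → CE n →L[ℝ] ℝ := fun y => traceD G y ∘L mulI n with hlam
  have hlamd : DifferentiableAt ℝ lam w := hDd.clm_comp (differentiableAt_const _)
  have hmud : DifferentiableAt ℝ (fun y => traceDflip G y ∘L mulI n) w :=
    hDfd.clm_comp (differentiableAt_const _)
  have hnud : DifferentiableAt ℝ (nuForm n G) w :=
    (hDfd.sub (hDd.const_smul (1 / 4 : ℝ))).clm_comp (differentiableAt_const _)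
  -- the codifferential term
  have hcod : pull φ (codiff (metricOf J ω₁) ω₁) =ᶠ[𝓝 w]
      fun y => oneForm ((1 / 4 : ℝ) • lam y + (-1 : ℝ) • nuForm n G y) := by
    filter_upwards [φ.open_target.mem_nhds hw] with y hy
    rw [pull_codiff hJ hφ hω hsm hy]
    congr 1
    ext1 X
    simp only [nuForm, hlam, ContinuousLinearMap.comp_apply, sub_apply, smul_apply, add_apply,
      smul_eq_mul]
    ring
  have hcd : DifferentiableAt ℝ (pull φ (codiff (metricOf J ω₁) ω₁)) w :=
    (differentiableAt_oneForm ((hlamd.const_smul (1 / 4 : ℝ)).add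
      (hnud.const_smul (-1 : ℝ)))).congr_of_eventuallyEq hcod
  -- the Chern form
  have hPid := flatGK_id (n := n) φ.open_target
  obtain ⟨V, k, e, hV, hwV, hVt, he, hb, hpot⟩ := exists_chern_potential (J := J) hφ hPid
    (D := fun _ => ⊤) (fun y _ X => ⟨fun _ => rfl, fun _ => trivial⟩) hw
  have hS : ∀ y, frameMap (fun _ => ContinuousLinearMap.id ℂ (CE n)) w y
      = ContinuousLinearMap.id ℂ (CE n) := fun y =>
    FlatGK.frameMap_self hPid hw
  obtain ⟨hLs, hch⟩ := hpot (metricBil J ω₁) (fun x => hω.isHermOn (hJ.J_J x)) hV subset_rfl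
    fun y hy => (hGs y (hVt hy)).contDiffWithinAt
  simp only [hS, ContinuousLinearMap.id_apply] at hLs hch
  set L : CE n → ℝ := fun y => Real.log (cdet (mulI n) (fun X Y => G y X Y) e) with hL
  have hLd : ∀ y ∈ V, fderiv ℝ L y = (1 / 2 : ℝ) • traceD G y := by
    intro y hy
    ext1 X
    have hGd := (hGs y (hVt hy)).differentiableAt (by simp)
    have hI : fderiv ℝ G y X ∘L ContinuousLinearMap.id ℝ (CE n) = fderiv ℝ G y X := rfl
    rw [hL, hasFDerivAt_log_cdet hGd (Q := ContinuousLinearMap.id ℝ (CE n)) (hGh y (hVt hy)) he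
      (fun X => mem_eigP.2 rfl) (fun _ _ => rfl) (fun _ _ => rfl) X (fun A C => ?_)
      (fun _ _ => rfl), hI]
    · rfl
    · have h1 := hasFDerivAt_bil_apply hGd (mulI n A) C
      have h2 := (hasFDerivAt_bil_apply hGd A (mulI n C)).neg
      have h3 : (fun z => G z (mulI n A) C) =ᶠ[𝓝 y] -fun z => G z A (mulI n C) := by
        filter_upwards [φ.open_target.mem_nhds (hVt hy)] with z hz
        exact (hGh z hz).J_left trivial trivial
      exact congrArg (fun A => A X) ((h2.congr_of_eventuallyEq h3).unique h1).symm
  have hL2 : ContDiffAt ℝ 2 L w := (hLs.contDiffAt (hV.mem_nhds hwV)).of_le two_le_infty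
  have hchern : -fiddbar (mulI n) L w
      = (1 / 4 : ℝ) • fpart11 (mulI n) (extDeriv (fun y => oneForm (lam y)) w) := by
    have h1 : fdc (mulI n) L =ᶠ[𝓝 w] fun y => oneForm ((-(1 / 2) : ℝ) • lam y) := by
      filter_upwards [hV.mem_nhds hwV] with y hy
      rw [fdc, hLd y hy]
      congr 1
      ext1 X
      simp [hlam]
    have h2 : fiddbar (mulI n) L w = (-(1 / 4) : ℝ) • extDeriv (fun y => oneForm (lam y)) w := by
      rw [fiddbar, h1.extDeriv_eq, extDeriv_oneForm_smul _ hlamd, smul_smul]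
      norm_num
    have h3 : fpart11 (mulI n) (fiddbar (mulI n) L w) = fiddbar (mulI n) L w :=
      two_form_ext fun X Y => by
        rw [fpart11_apply, fiddbar_inv_I hL2]
        ring
    rw [← h3, h2, fpart11_smul]
    ext v
    simp
  have h0 : pull φ (pluriP J ω₁) w
      = -pull φ (part11 J (extD (codiff (metricOf J ω₁) ω₁))) w
        + pull φ (chernForm J (fun _ => ⊤) (fun x X Y => metricBil J ω₁ x X Y)) w := by
    rw [← metricOf_eq]
    ext v
    rfl
  have h4 : DifferentiableAt ℝ (fun y => (1 / 4 : ℝ) • lam y) w := hlamd.fun_const_smul _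
  have h5 : DifferentiableAt ℝ (fun y => (-1 : ℝ) • nuForm n G y) w := hnud.fun_const_smul _
  rw [h0, pull_part11 hφ _ hw, pull_extD hφ.isSmoothChart hw hcd, hcod.extDeriv_eq,
    extDeriv_oneForm_add h4 h5, extDeriv_oneForm_smul _ hlamd, extDeriv_oneForm_smul _ hnud,
    hch w hwV, hchern, fpart11_add, fpart11_smul, fpart11_smul]
  ext v
  simp

end PluriP

end GenKahler

end

noncomputable section

namespace GenKahler

/-! ### Families depending on time -/

section Families

variable {E X : Type*} [NormedAddCommGroup E] [NormedSpace ℝ E] [NormedAddCommGroup X]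
  [NormedSpace ℝ X] {S : Set ℝ} {V : Set E} {F F' : ℝ → E → X}

theorem timeInterval_convex (T : EReal) : Convex ℝ (timeInterval T) := by
  refine Set.OrdConnected.convex ⟨fun a ha b hb c hc => ⟨ha.1.trans hc.1, ?_⟩⟩
  exact lt_of_le_of_lt (EReal.coe_le_coe_iff.2 hc.2) hb.2

theorem timeInterval_nonempty_interior {T : EReal} (hT : 0 < T) :
    (interior (timeInterval T)).Nonempty := by
  obtain ⟨q, hq, hqT⟩ := EReal.lt_iff_exists_real_btwn.1 hT
  have hq' : 0 < q := EReal.coe_pos.1 hq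
  refine ⟨q / 2, mem_interior.2 ⟨Set.Ioo 0 q, fun s hs => ⟨hs.1.le, ?_⟩, isOpen_Ioo,
    by constructor <;> linarith⟩⟩
  exact lt_trans (EReal.coe_lt_coe_iff.2 hs.2) hqT

theorem uniqueDiffOn_timeInterval {T : EReal} (hT : 0 < T) : UniqueDiffOn ℝ (timeInterval T) :=
  uniqueDiffOn_convex (timeInterval_convex T) (timeInterval_nonempty_interior hT)

theorem timeInterval_subset_closure {T : EReal} (hT : 0 < T) :
    timeInterval T ⊆ closure (interior (timeInterval T)) := by
  rw [(timeInterval_convex T).closure_interior_eq_closure_of_nonempty_interior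
    (timeInterval_nonempty_interior hT)]
  exact subset_closure

theorem fderiv_family_eq (hV : IsOpen V)
    (hF : ContDiffOn ℝ ∞ (fun p : ℝ × E => F p.1 p.2) (S ×ˢ V)) {p : ℝ × E} (hp : p ∈ S ×ˢ V) :
    HasFDerivAt (F p.1) (fderivWithin ℝ (fun p : ℝ × E => F p.1 p.2) (S ×ˢ V) p ∘L
      ContinuousLinearMap.inr ℝ ℝ E) p.2 := by
  have h1 := ((hF p hp).differentiableWithinAt (by simp)).hasFDerivWithinAt
  have h2 : HasFDerivAt (fun y : E => (p.1, y)) (ContinuousLinearMap.inr ℝ ℝ E) p.2 :=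
    hasFDerivAt_prodMk_right p.1 p.2
  have h3 := HasFDerivWithinAt.comp (s := V) p.2 (f := fun y : E => (p.1, y)) h1
    h2.hasFDerivWithinAt fun y hy => ⟨hp.1, hy⟩
  exact h3.hasFDerivAt (hV.mem_nhds hp.2)

theorem contDiffOn_fderiv_family (hS : UniqueDiffOn ℝ S) (hV : IsOpen V)
    (hF : ContDiffOn ℝ ∞ (fun p : ℝ × E => F p.1 p.2) (S ×ˢ V)) :
    ContDiffOn ℝ ∞ (fun p : ℝ × E => fderiv ℝ (F p.1) p.2) (S ×ˢ V) := by
  have h1 := hF.fderivWithin (m := ∞) (hS.prod hV.uniqueDiffOn) (by simp)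
  exact (h1.clm_comp contDiffOn_const).congr fun p hp => (fderiv_family_eq hV hF hp).fderiv

theorem hasDerivWithinAt_family (hF : ContDiffOn ℝ ∞ (fun p : ℝ × E => F p.1 p.2) (S ×ˢ V))
    {p : ℝ × E} (hp : p ∈ S ×ˢ V) : HasDerivWithinAt (fun s => F s p.2)
      (fderivWithin ℝ (fun p : ℝ × E => F p.1 p.2) (S ×ˢ V) p (1, 0)) S p.1 := by
  have h1 := ((hF p hp).differentiableWithinAt (by simp)).hasFDerivWithinAt
  have h2 : HasDerivWithinAt (fun s : ℝ => (s, p.2)) ((1 : ℝ), (0 : E)) S p.1 :=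
    (hasDerivWithinAt_id _ _).prodMk (hasDerivWithinAt_const _ _ _)
  exact HasFDerivWithinAt.comp_hasDerivWithinAt (f := fun s : ℝ => (s, p.2)) p.1 h1 h2
    fun s hs => ⟨hs, hp.2⟩

theorem contDiffOn_timeDeriv (hS : UniqueDiffOn ℝ S) (hV : IsOpen V)
    (hF : ContDiffOn ℝ ∞ (fun p : ℝ × E => F p.1 p.2) (S ×ˢ V))
    (hd : ∀ t ∈ S, ∀ y ∈ V, HasDerivWithinAt (fun s => F s y) (F' t y) S t) :
    ContDiffOn ℝ ∞ (fun p : ℝ × E => F' p.1 p.2) (S ×ˢ V) := by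
  have h1 := hF.fderivWithin (m := ∞) (hS.prod hV.uniqueDiffOn) (by simp)
  refine (h1.clm_apply (g := fun _ => ((1 : ℝ), (0 : E))) contDiffOn_const).congr fun p hp => ?_
  exact (hS p.1 hp.1).eq_deriv _ (hd p.1 hp.1 p.2 hp.2) (hasDerivWithinAt_family hF hp)

theorem hasDerivWithinAt_fderiv_family (hS : UniqueDiffOn ℝ S) (hSc : S ⊆ closure (interior S))
    (hV : IsOpen V) (hF : ContDiffOn ℝ ∞ (fun p : ℝ × E => F p.1 p.2) (S ×ˢ V))
    (hd : ∀ t ∈ S, ∀ y ∈ V, HasDerivWithinAt (fun s => F s y) (F' t y) S t) {t : ℝ} (ht : t ∈ S)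
    {y : E} (hy : y ∈ V) (a : E) :
    HasDerivWithinAt (fun s => fderiv ℝ (F s) y a) (fderiv ℝ (F' t) y a) S t := by
  have hU := hS.prod hV.uniqueDiffOn
  have hp : ((t, y) : ℝ × E) ∈ S ×ˢ V := ⟨ht, hy⟩
  have h0 := hF.fderivWithin (m := ∞) hU (by simp)
  set D := fderivWithin ℝ (fun p : ℝ × E => F p.1 p.2) (S ×ˢ V) with hD
  have hDd := ((h0 (t, y) hp).differentiableWithinAt (by simp)).hasFDerivWithinAt
  have hsymm : IsSymmSndFDerivWithinAt ℝ (fun p : ℝ × E => F p.1 p.2) (S ×ˢ V) (t, y) := by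
    refine (hF (t, y) hp).isSymmSndFDerivWithinAt (n := ∞)
      (by rw [minSmoothness_of_isRCLikeNormedField]; exact two_le_infty) hU ?_ hp
    rw [interior_prod_eq, closure_prod_eq, hV.interior_eq]
    exact ⟨hSc ht, subset_closure hy⟩
  have h1 : HasDerivWithinAt (fun s => D (s, y) (0, a))
      (fderivWithin ℝ D (S ×ˢ V) (t, y) (1, 0) (0, a)) S t := by
    have h2 := hasDerivWithinAt_family (F := fun s z => D (s, z)) h0 hp
    exact (ContinuousLinearMap.apply ℝ X ((0 : ℝ), a)).hasFDerivAt.comp_hasDerivWithinAt t h2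
  have h3 : fderivWithin ℝ D (S ×ˢ V) (t, y) (1, 0) (0, a) = fderiv ℝ (F' t) y a := by
    rw [hsymm]
    have h4 : HasFDerivAt (fun z => D (t, z)) _ y :=
      fderiv_family_eq (F := fun s z => D (s, z)) hV h0 hp
    have h5 : HasFDerivAt (fun z => D (t, z) (1, 0)) _ y :=
      (ContinuousLinearMap.apply ℝ X ((1 : ℝ), (0 : E))).hasFDerivAt.comp y h4
    have h6 : F' t =ᶠ[𝓝 y] fun z => D (t, z) (1, 0) := by
      filter_upwards [hV.mem_nhds hy] with z hz
      exact (hS t ht).eq_deriv _ (hd t ht z hz) (hasDerivWithinAt_family (p := (t, z)) hF ⟨ht, hz⟩)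
    rw [h6.fderiv_eq, h5.fderiv]
    rfl
  rw [← h3]
  refine h1.congr_of_mem (fun s hs => ?_) ht
  rw [(fderiv_family_eq hV hF (p := (s, y)) ⟨hs, hy⟩).fderiv]
  rfl

theorem contDiffOn_family_slice (hF : ContDiffOn ℝ ∞ (fun p : ℝ × E => F p.1 p.2) (S ×ˢ V))
    {t : ℝ} (ht : t ∈ S) : ContDiffOn ℝ ∞ (F t) V :=
  hF.comp (f := fun y : E => (t, y)) (contDiff_const.prodMk contDiff_id).contDiffOn
    fun _ hy => ⟨ht, hy⟩

theorem hasDerivWithinAt_fderiv_fderiv_family (hS : UniqueDiffOn ℝ S)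
    (hSc : S ⊆ closure (interior S)) (hV : IsOpen V)
    (hF : ContDiffOn ℝ ∞ (fun p : ℝ × E => F p.1 p.2) (S ×ˢ V))
    (hd : ∀ t ∈ S, ∀ y ∈ V, HasDerivWithinAt (fun s => F s y) (F' t y) S t) {t : ℝ} (ht : t ∈ S)
    {y : E} (hy : y ∈ V) (a b : E) :
    HasDerivWithinAt (fun s => fderiv ℝ (fderiv ℝ (F s)) y a b)
      (fderiv ℝ (fderiv ℝ (F' t)) y a b) S t := by
  have h1 := (contDiffOn_fderiv_family hS hV hF).clm_apply (g := fun _ => b) contDiffOn_const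
  have h2 := hasDerivWithinAt_fderiv_family (F := fun s z => fderiv ℝ (F s) z b)
    (F' := fun s z => fderiv ℝ (F' s) z b) hS hSc hV h1
    (fun s hs z hz => hasDerivWithinAt_fderiv_family hS hSc hV hF hd hs hz b) ht hy a
  have h3 : ∀ {K : ℝ → E → X}, ContDiffOn ℝ ∞ (fun p : ℝ × E => K p.1 p.2) (S ×ˢ V) → ∀ s ∈ S,
      fderiv ℝ (fun z => fderiv ℝ (K s) z b) y a = fderiv ℝ (fderiv ℝ (K s)) y a b := by
    intro K hK s hs
    have h4 : DifferentiableAt ℝ (fderiv ℝ (K s)) y :=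
      ((contDiffOn_family_slice (F := fun s z => fderiv ℝ (K s) z)
        (contDiffOn_fderiv_family hS hV hK) hs).contDiffAt (hV.mem_nhds hy)).differentiableAt
        (by simp)
    rw [fderiv_clm_apply h4 (differentiableAt_const _)]
    simp
  rw [h3 (contDiffOn_timeDeriv hS hV hF hd) t ht] at h2
  exact h2.congr_of_mem (fun s hs => (h3 hF s hs).symm) ht

end Families

section FamilyBox

variable {n : ℕ} {S : Set ℝ} {U V : Set (CE n)} {P : CE n → CE n →L[ℂ] CE n} {F F' : ℝ → CE n → ℝ}

theorem contDiffOn_fbox_family (hP : FlatGK U P) (hVU : V ⊆ U) (hS : UniqueDiffOn ℝ S)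
    (hV : IsOpen V) (hF : ContDiffOn ℝ ∞ (fun p : ℝ × CE n => F p.1 p.2) (S ×ˢ V)) :
    ContDiffOn ℝ ∞ (fun p : ℝ × CE n => fbox P (F p.1) p.2) (S ×ˢ V) := by
  refine contDiffOn_form_iff.2 fun v => ?_
  have e : v = ![v 0, v 1] := by ext1 i; fin_cases i <;> rfl
  have h2 := contDiffOn_fderiv_family (F := fun s z => fderiv ℝ (F s) z) hS hV
    (contDiffOn_fderiv_family hS hV hF)
  have h3 : ∀ a b : ℝ × CE n → CE n, ContDiffOn ℝ ∞ a (S ×ˢ V) → ContDiffOn ℝ ∞ b (S ×ˢ V) →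
      ContDiffOn ℝ ∞ (fun p => fiddbar (mulI n) (F p.1) p.2 ![a p, b p]) (S ×ˢ V) := by
    intro a b ha hb
    have hI : ContDiff ℝ ∞ (mulI n) := (mulI n).contDiff
    refine (contDiffOn_const (c := (1 / 2 : ℝ)).mul (((h2.clm_apply hb).clm_apply
      (hI.comp_contDiffOn ha)).sub ((h2.clm_apply ha).clm_apply (hI.comp_contDiffOn hb)))).congr
      fun p hp => ?_
    exact fiddbar_apply (((contDiffOn_family_slice hF hp.1).contDiffAt
      (hV.mem_nhds hp.2)).of_le two_le_infty) _ _
  have hP' : ∀ v : CE n, ContDiffOn ℝ ∞ (fun p : ℝ × CE n => reP P p.2 v) (S ×ˢ V) := by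
    intro v
    have h1 : ContDiffOn ℝ ∞ (fun y => reP P y v) V := fun y hy =>
      ((hP.contDiffAt (hVU hy)).clm_apply contDiffAt_const).contDiffWithinAt
    exact h1.comp contDiff_snd.contDiffOn fun p hp => hp.2
  rw [e]
  simp only [fbox, twist_apply]
  exact contDiffOn_const.mul ((h3 _ _ contDiffOn_const (hP' (v 1))).add
    (h3 _ _ (hP' (v 0)) contDiffOn_const))

theorem hasDerivWithinAt_fbox_family (hS : UniqueDiffOn ℝ S) (hSc : S ⊆ closure (interior S))
    (hV : IsOpen V) (hF : ContDiffOn ℝ ∞ (fun p : ℝ × CE n => F p.1 p.2) (S ×ˢ V))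
    (hd : ∀ t ∈ S, ∀ y ∈ V, HasDerivWithinAt (fun s => F s y) (F' t y) S t) {t : ℝ} (ht : t ∈ S)
    {y : CE n} (hy : y ∈ V) (A B : CE n) :
    HasDerivWithinAt (fun s => fbox P (F s) y ![A, B]) (fbox P (F' t) y ![A, B]) S t := by
  have h1 : ∀ A B : CE n, HasDerivWithinAt (fun s => fiddbar (mulI n) (F s) y ![A, B])
      (fiddbar (mulI n) (F' t) y ![A, B]) S t := by
    intro A B
    have h2 := hasDerivWithinAt_fderiv_fderiv_family hS hSc hV hF hd ht hy
    have h3 := ((h2 B (mulI n A)).sub (h2 A (mulI n B))).const_mul (1 / 2 : ℝ)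
    have h4 : ∀ {K : ℝ → CE n → ℝ}, ContDiffOn ℝ ∞ (fun p : ℝ × CE n => K p.1 p.2) (S ×ˢ V) →
        ∀ s ∈ S, ContDiffAt ℝ 2 (K s) y := fun hK s hs =>
      ((contDiffOn_family_slice hK hs).contDiffAt (hV.mem_nhds hy)).of_le two_le_infty
    rw [fiddbar_apply (h4 (contDiffOn_timeDeriv hS hV hF hd) t ht)]
    exact h3.congr_of_mem (fun s hs => fiddbar_apply (h4 hF s hs) _ _) ht
  simp only [fbox, twist_apply]
  exact ((h1 _ _).add (h1 _ _)).const_mul _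

end FamilyBox

end GenKahler

end

noncomputable section

namespace GenKahler

/-! ### The form `ω^f` in a holomorphic chart -/

section Subbundles

variable {n : ℕ} {M : Type*} [TopologicalSpace M] [ChartedSpace (Model n) M]
  [IsManifold 𝓘(ℝ, Model n) ∞ M] {Jp Jm : EndField n M} {φ : OpenPartialHomeomorph M (CE n)}
  {Q : CE n → CE n →L[ℂ] CE n}

theorem mem_Tplus {x : M} {v : TS n x} : v ∈ Tplus Jp Jm x ↔ Jp x (Jm x v) = v := by
  rw [Tplus, LinearMap.mem_ker]
  exact sub_eq_zero

theorem mem_Tminus {x : M} {v : TS n x} : v ∈ Tminus Jp Jm x ↔ Jp x (Jm x v) = -v := by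
  rw [Tminus, LinearMap.mem_ker]
  exact add_eq_zero_iff_eq_neg

theorem dSymm_mem_Tplus (hφ : IsSmoothChart (n := n) φ)
    (hQ : ∀ w ∈ φ.target, ∀ X, Q w X = pullEnd φ (prodJ Jp Jm) w X) {w : CE n} (hw : w ∈ φ.target)
    (X : CE n) : dSymm φ w X ∈ Tplus Jp Jm (φ.symm w) ↔ Q w X = X := by
  have h1 : dSymm φ w (Q w X) = Jp (φ.symm w) (Jm (φ.symm w) (dSymm φ w X)) := by
    rw [hQ w hw]; exact dSymm_pullEnd hφ (prodJ Jp Jm) hw X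
  rw [mem_Tplus, ← h1]
  exact (Function.LeftInverse.injective (dChart_dSymm hφ hw)).eq_iff

theorem dSymm_mem_Tminus (hφ : IsSmoothChart (n := n) φ)
    (hQ : ∀ w ∈ φ.target, ∀ X, Q w X = pullEnd φ (prodJ Jp Jm) w X) {w : CE n} (hw : w ∈ φ.target)
    (X : CE n) : dSymm φ w X ∈ Tminus Jp Jm (φ.symm w) ↔ (-Q) w X = X := by
  have h1 : dSymm φ w (Q w X) = Jp (φ.symm w) (Jm (φ.symm w) (dSymm φ w X)) := by
    rw [hQ w hw]; exact dSymm_pullEnd hφ (prodJ Jp Jm) hw X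
  rw [mem_Tminus, ← h1, ← map_neg, (Function.LeftInverse.injective (dChart_dSymm hφ hw)).eq_iff,
    Pi.neg_apply, neg_apply, neg_eq_iff_eq_neg]

theorem Tplus_stable (hcomm : ∀ x : M, (Jp x).comp (Jm x) = (Jm x).comp (Jp x)) {x : M} {v : TS n x}
    (hv : v ∈ Tplus Jp Jm x) : Jp x v ∈ Tplus Jp Jm x := by
  have hc : ∀ v, Jp x (Jm x v) = Jm x (Jp x v) := fun v => congrArg (fun A => A v) (hcomm x)
  rw [mem_Tplus] at *
  rw [← hc, hv]

theorem Tminus_stable (hcomm : ∀ x : M, (Jp x).comp (Jm x) = (Jm x).comp (Jp x)) {x : M} {v : TS n x}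
    (hv : v ∈ Tminus Jp Jm x) : Jp x v ∈ Tminus Jp Jm x := by
  have hc : ∀ v, Jp x (Jm x v) = Jm x (Jp x v) := fun v => congrArg (fun A => A v) (hcomm x)
  rw [mem_Tminus] at *
  rw [← hc, hv, map_neg]

theorem pull_piPlus_sub_piMinus (hφ : IsSmoothChart (n := n) φ)
    (hQ : ∀ w ∈ φ.target, ∀ X, Q w X = pullEnd φ (prodJ Jp Jm) w X) (η : Form n M 2) {w : CE n}
    (hw : w ∈ φ.target) :
    pull φ (fun x => piPlus Jp Jm η x - piMinus Jp Jm η x) w = twist (reP Q w) (pull φ η w) := by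
  refine two_form_ext fun X Y => ?_
  have h1 : dSymm (n := n) φ w (reP Q w X) = prodJ Jp Jm (φ.symm w) (dSymm φ w X) := by
    rw [← dSymm_pullEnd hφ _ hw, ← hQ w hw]; rfl
  have h2 : dSymm (n := n) φ w (reP Q w Y) = prodJ Jp Jm (φ.symm w) (dSymm φ w Y) := by
    rw [← dSymm_pullEnd hφ _ hw, ← hQ w hw]; rfl
  have h3 : ∀ X Y, pull φ η w ![X, Y] = η (φ.symm w) ![dSymm φ w X, dSymm φ w Y] :=
    fun X Y => form_comp_two _ _ _ _
  have h4 := twist_apply (E := Model n) (prodJ Jp Jm (φ.symm w)) (η (φ.symm w)) (dSymm φ w X)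
    (dSymm φ w Y)
  rw [twist_apply, h3, h3, h1, h2]
  refine Eq.trans ?_ h4
  exact form_comp_two _ _ X Y

end Subbundles

section Local

variable {n : ℕ} {M : Type*} [TopologicalSpace M] [ChartedSpace (Model n) M]
  [IsManifold 𝓘(ℝ, Model n) ∞ M]
  {g₀ : Bundle.ContMDiffRiemannianMetric 𝓘(ℝ, Model n) ∞ (Model n) (fun x : M => TS n x)}
  {Jp Jm : EndField n M} {ω₀ ωm : Form n M 2} {hp hm : BilinField n M} {T : EReal}
  {f : ℝ → M → ℝ} {φ : OpenPartialHomeomorph M (CE n)}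

theorem fbox_add_mul {P : CE n → CE n →L[ℂ] CE n} {u v : CE n → ℝ} {w : CE n}
    (hu : ContDiffAt ℝ 2 u w) (hv : ContDiffAt ℝ 2 v w) (c : ℝ) :
    fbox P (fun y => u y + c * v y) w = fbox P u w + c • fbox P v w := by
  rw [fbox, fiddbar_add hu (contDiffAt_const.mul hv), fiddbar_const_mul hv, twist_add, twist_smul]
  rfl

theorem pull_boxForm (hφ : IsHoloChart Jp φ) {Q : CE n → CE n →L[ℂ] CE n}
    (hQ : ∀ w ∈ φ.target, ∀ X, Q w X = pullEnd φ (prodJ Jp Jm) w X) {u : M → ℝ} {w : CE n}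
    (hw : w ∈ φ.target) (hu : ContDiffAt ℝ 2 (u ∘ φ.symm) w) :
    pull φ (boxForm Jp Jm u) w = fbox Q (u ∘ φ.symm) w := by
  rw [fbox, ← pull_iddbar hφ hw hu, ← pull_piPlus_sub_piMinus hφ.isSmoothChart hQ _ hw]
  rfl

theorem pull_backgroundP (hφ : IsHoloChart Jp φ) {Q : CE n → CE n →L[ℂ] CE n}
    (hQ : ∀ w ∈ φ.target, ∀ X, Q w X = pullEnd φ (prodJ Jp Jm) w X) {w : CE n}
    (hw : w ∈ φ.target) {a b : CE n → ℝ} (ha : ContDiffAt ℝ 2 a w) (hb : ContDiffAt ℝ 2 b w)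
    (hpa : pull φ (chernForm Jp (Tplus Jp Jm) (fun x X Y => hp x X Y)) w = -fiddbar (mulI n) a w)
    (hmb : pull φ (chernForm Jp (Tminus Jp Jm) (fun x X Y => hm x X Y)) w = -fiddbar (mulI n) b w) :
    pull φ (backgroundP Jp Jm hp hm) w = -fbox Q (fun y => a y + (-1) * b y) w := by
  rw [fbox_add_mul ha hb, fbox, fbox, ← neg_eq_iff_eq_neg.2 hpa, ← neg_eq_iff_eq_neg.2 hmb,
    ← pull_neg_form, ← pull_neg_form, ← pull_piPlus_sub_piMinus hφ.isSmoothChart hQ _ hw,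
    ← pull_piPlus_sub_piMinus hφ.isSmoothChart hQ _ hw]
  ext v
  simp only [pull, backgroundP, piPlus, piMinus, ContinuousAlternatingMap.compContinuousLinearMap_apply,
    ContinuousAlternatingMap.add_apply, ContinuousAlternatingMap.sub_apply, Pi.neg_apply,
    ContinuousAlternatingMap.neg_apply, ContinuousAlternatingMap.smul_apply, smul_eq_mul]
  ring

theorem IsScalarFlow.contDiffOn_chart (hf : IsScalarFlow Jp Jm hp hm ω₀ T f)
    (hφ : IsSmoothChart (n := n) φ) :
    ContDiffOn ℝ ∞ (fun p : ℝ × CE n => f p.1 (φ.symm p.2)) (timeInterval T ×ˢ φ.target) := by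
  rw [← contMDiffOn_iff_contDiffOn]
  have h1 : ContMDiffOn 𝓘(ℝ, ℝ × CE n) (𝓘(ℝ, ℝ).prod 𝓘(ℝ, Model n)) ∞
      (fun p : ℝ × CE n => (p.1, φ.symm p.2)) (timeInterval T ×ˢ φ.target) := by
    refine ContMDiffOn.prodMk ?_ ?_
    · exact contDiff_fst.contDiffOn.contMDiffOn
    · exact hφ.smooth_symm.comp (contDiff_snd.contDiffOn.contMDiffOn) fun p hp => hp.2
  exact hf.smooth.comp h1 fun p hp => ⟨hp.1, trivial⟩

theorem hermDet_dSymm (hφ : IsHoloChart Jp φ) (h : BilinField n M) {w : CE n} (hw : w ∈ φ.target)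
    {k : ℕ} (z : Fin k → CE n) :
    hermDet Jp (φ.symm w) (fun X Y => h (φ.symm w) X Y) (fun i => dSymm φ w (z i))
      = cdet (mulI n) (fun X Y => pullBil φ h w X Y) z := by
  rw [hermDet_chart hφ h hw]
  congr 1
  funext i
  exact dChart_dSymm hφ.isSmoothChart hw _

theorem IsScalarFlow.hasDerivWithinAt_chart (hf : IsScalarFlow Jp Jm hp hm ω₀ T f)
    (hφ : IsHoloChart Jp φ) {Q : CE n → CE n →L[ℂ] CE n}
    (hQ : ∀ w ∈ φ.target, ∀ X, Q w X = pullEnd φ (prodJ Jp Jm) w X)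
    (hhp : ∀ x, IsHermOn (Jp x) (Tplus Jp Jm x) (hp x))
    (hhm : ∀ x, IsHermOn (Jp x) (Tminus Jp Jm x) (hm x)) {w : CE n} (hw : w ∈ φ.target)
    {k l : ℕ} {z : Fin k → CE n} {z' : Fin l → CE n} (hz : IsCBasis (mulI n) (eigP Q w) z)
    (hz' : IsCBasis (mulI n) (eigP (-Q) w) z') {t : ℝ} (ht : t ∈ timeInterval T)
    {G : BilinField n M} (hG : G = metricBil Jp (omegaF Jp Jm hp hm ω₀ f t))
    (hGh : IsHermOn (mulI n) ⊤ (pullBil φ G w)) :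
    HasDerivWithinAt (fun s => f s (φ.symm w))
      (Real.log (cdet (mulI n) (fun X Y => pullBil φ G w X Y) z)
        + Real.log (cdet (mulI n) (fun X Y => pullBil φ hm w X Y) z')
        - (Real.log (cdet (mulI n) (fun X Y => pullBil φ hp w X Y) z)
        + Real.log (cdet (mulI n) (fun X Y => pullBil φ G w X Y) z'))) (timeInterval T) t := by
  have hφs := hφ.isSmoothChart
  have hZ := isCBasis_dSymm (J := Jp) hφ
    (fun y hy X => dSymm_mem_Tplus (Jp := Jp) (Jm := Jm) hφs hQ hy X) hw hz
  have hW := isCBasis_dSymm (J := Jp) hφ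
    (fun y hy X => dSymm_mem_Tminus (Jp := Jp) (Jm := Jm) hφs hQ hy X) hw hz'
  have h1 := hf.flow t ht (φ.symm w) k l _ _ hZ hW
  have p1 := (hGh.mono (D' := eigP Q w) le_top fun v hv => by
    rw [mem_eigP] at *; rw [mulI_clm, hv]).cdet_pos hz
  have p2 := (hGh.mono (D' := eigP (-Q) w) le_top fun v hv => by
    rw [mem_eigP] at *; rw [mulI_clm, hv]).cdet_pos hz'
  have p3 : 0 < hermDet Jp (φ.symm w) (fun X Y => hp (φ.symm w) X Y) (fun i => dSymm φ w (z i)) :=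
    (hhp (φ.symm w)).cdet_pos hZ
  have p4 : 0 < hermDet Jp (φ.symm w) (fun X Y => hm (φ.symm w) X Y) (fun i => dSymm φ w (z' i)) :=
    (hhm (φ.symm w)).cdet_pos hW
  have e1 := hermDet_dSymm hφ G hw z
  have e2 := hermDet_dSymm hφ G hw z'
  rw [metricOf_eq, ← hG] at h1
  rw [← e1] at p1 ⊢
  rw [← e2] at p2 ⊢
  rw [← hermDet_dSymm hφ hp hw z, ← hermDet_dSymm hφ hm hw z', ← Real.log_mul p1.ne' p4.ne',
    ← Real.log_mul p3.ne' p2.ne', ← Real.log_div (mul_pos p1 p4).ne' (mul_pos p3 p2).ne']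
  exact h1

theorem FlatMetric.contDiffOn_logDet {U V : Set (CE n)} {P : CE n → CE n →L[ℂ] CE n}
    {Ω : CE n → CE n [⋀^Fin 2]→L[ℝ] ℝ} {G : CE n → CE n →L[ℝ] CE n →L[ℝ] ℝ}
    (H : FlatMetric V P Ω) (hG : IsFlatMetricBil V Ω G) (hP : FlatGK U P) (hV : IsOpen V)
    (hVU : V ⊆ U) {w₀ : CE n} {k : ℕ} {e : Fin k → CE n}
    (hb : ∀ w ∈ V, IsCBasis (mulI n) (eigP P w) (fun a => frameMap P w₀ w (e a))) :
    ContDiffOn ℝ ∞ (logDet P G w₀ e) V := by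
  intro w hw
  have hp := ((H.isHermOn hG hw).mono (D' := eigP P w) le_top fun v hv => by
    rw [mem_eigP] at *; rw [mulI_clm, hv]).cdet_pos (hb w hw)
  refine ContDiffWithinAt.log (contDiffWithinAt_cdet (mulI n)
    (H.contDiffAt_G hV hG hw).contDiffWithinAt fun a => ?_) hp.ne'
  have h1 : DifferentiableOn ℂ (fun w => frameMap P w₀ w (e a)) V :=
    ((hP.differentiableOn_frameMap w₀).mono hVU).clm_apply (differentiableOn_const _)
  exact ((contDiffOn_infty_of_differentiableOn_complex hV h1) w hw).restrict_scalars ℝ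

/-- Near each point `ω^f_t = ω₀ + (δ₊δ₊ᶜ - δ₋δ₋ᶜ) F_t` for a local potential `F` whose time
derivative is the difference of the logarithms of the determinants of the induced metrics in
holomorphic frames. -/
theorem exists_local_potential (hGK : IsGeneralizedKahler g₀ Jp Jm ω₀ ωm)
    (hcomm : ∀ x : M, (Jp x).comp (Jm x) = (Jm x).comp (Jp x))
    (hhp : IsHermitianMetricOn Jp (Tplus Jp Jm) hp) (hhm : IsHermitianMetricOn Jp (Tminus Jp Jm) hm)
    (hf : IsScalarFlow Jp Jm hp hm ω₀ T f) (hφ : IsHoloChart Jp φ) {w₀ : CE n}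
    (hw₀ : w₀ ∈ φ.target) :
    ∃ (Q : CE n → CE n →L[ℂ] CE n) (V : Set (CE n)) (F L : ℝ → CE n → ℝ),
      FlatGK φ.target Q ∧ FlatMetric φ.target Q (pull φ ω₀) ∧ IsOpen V ∧ w₀ ∈ V ∧ V ⊆ φ.target ∧
      ContDiffOn ℝ ∞ (fun p : ℝ × CE n => F p.1 p.2) (timeInterval T ×ˢ V) ∧
      (∀ t ∈ timeInterval T, ∀ w ∈ V, pull φ (omegaF Jp Jm hp hm ω₀ f t) w
        = pull φ ω₀ w + fbox Q (F t) w) ∧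
      (∀ w ∈ V, F 0 w = 0) ∧
      (∀ t ∈ timeInterval T, ∀ w ∈ V, HasDerivWithinAt (fun s => F s w) (L t w) (timeInterval T) t) ∧
      ∀ t ∈ timeInterval T, FlatMetric V Q (pull φ (omegaF Jp Jm hp hm ω₀ f t)) ∧ ∀ w ∈ V,
        fpart11 (mulI n) (extDeriv (fun y => oneForm (nuForm n
          (pullBil φ (metricBil Jp (omegaF Jp Jm hp hm ω₀ f t))) y)) w) = -fbox Q (L t) w := by
  obtain ⟨Q, hGKQ, hQ, hflat⟩ := hGK.exists_flat hcomm hφ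
  have hφs := hφ.isSmoothChart
  have hJJ : ∀ (x : M) (v), Jp x (Jp x v) = -v := fun x => hGK.complex_p.J_J x
  have hst := fun x v => Tplus_stable (x := x) (v := v) hcomm
  have hst' := fun x v => Tminus_stable (x := x) (v := v) hcomm
  obtain ⟨V₁, k, e, hV₁, hwV₁, hVt₁, he, hbe, hpot⟩ := exists_chern_potential (J := Jp) hφ hGKQ
    (D := Tplus Jp Jm) (fun y hy X => dSymm_mem_Tplus hφs hQ hy X) hw₀
  obtain ⟨V₂, l, e', hV₂, hwV₂, hVt₂, he', hbe', hpot'⟩ := exists_chern_potential (J := Jp) hφ hGKQ.neg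
    (D := Tminus Jp Jm) (fun y hy X => dSymm_mem_Tminus hφs hQ hy X) hw₀
  obtain ⟨V₃, hV₃, hwV₃, hVt₃, hS⟩ := hGKQ.exists_frame_nhds hw₀
  set V := V₁ ∩ V₂ ∩ V₃ with hVdef
  have hV : IsOpen V := (hV₁.inter hV₂).inter hV₃
  have hV1 : V ⊆ V₁ := fun w hw => hw.1.1
  have hV2 : V ⊆ V₂ := fun w hw => hw.1.2
  have hV3 : V ⊆ V₃ := fun w hw => hw.2
  have hVt : V ⊆ φ.target := hV1.trans hVt₁
  have hhp' : ∀ x, IsHermOn (Jp x) (Tplus Jp Jm x) (hp x) := fun x =>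
    ⟨hJJ x, hst x, hhp.symm x, hhp.pos x, hhp.map_J x⟩
  have hhm' : ∀ x, IsHermOn (Jp x) (Tminus Jp Jm x) (hm x) := fun x =>
    ⟨hJJ x, hst' x, hhm.symm x, hhm.pos x, hhm.map_J x⟩
  obtain ⟨hA, hAc⟩ := hpot hp hhp' hV hV1 ((contDiffOn_pullBil hφs hhp.smooth).mono hVt)
  obtain ⟨hB, hBc⟩ := hpot' hm hhm' hV hV2 ((contDiffOn_pullBil hφs hhm.smooth).mono hVt)
  set a : CE n → ℝ := logDet Q (pullBil φ hp) w₀ e with ha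
  set b : CE n → ℝ := logDet (-Q) (pullBil φ hm) w₀ e' with hb
  set F : ℝ → CE n → ℝ := fun t y => f t (φ.symm y) + t * (a y + (-1) * b y) with hF
  set G := fun t => pullBil φ (metricBil Jp (omegaF Jp Jm hp hm ω₀ f t)) with hG
  have hab : ContDiffOn ℝ ∞ (fun y => a y + (-1) * b y) V := hA.add (contDiffOn_const.mul hB)
  have hfs := (hf.contDiffOn_chart hφs).mono (Set.prod_mono_right (s := timeInterval T) hVt)
  have hFs : ContDiffOn ℝ ∞ (fun p : ℝ × CE n => F p.1 p.2) (timeInterval T ×ˢ V) :=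
    hfs.add (contDiff_fst.contDiffOn.mul (hab.comp contDiff_snd.contDiffOn fun p hp => hp.2))
  have hloc : ∀ t ∈ timeInterval T, ∀ w ∈ V, pull φ (omegaF Jp Jm hp hm ω₀ f t) w
      = pull φ ω₀ w + fbox Q (F t) w := by
    intro t ht w hw
    have hn := hV.mem_nhds hw
    have h1 : ContDiffAt ℝ 2 (f t ∘ φ.symm) w :=
      ((contDiffOn_family_slice (F := fun t y => f t (φ.symm y)) hfs ht).contDiffAt hn).of_le
        two_le_infty
    have h2 := (hab.contDiffAt hn).of_le two_le_infty
    have h3 : fbox Q (F t) w = _ := fbox_add_mul h1 h2 t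
    have h4 : pull φ (backgroundP Jp Jm hp hm) w = -fbox Q (fun y => a y + (-1) * b y) w :=
      pull_backgroundP hφ hQ (hVt hw) ((hA.contDiffAt hn).of_le two_le_infty)
        ((hB.contDiffAt hn).of_le two_le_infty) (hAc w hw) (hBc w hw)
    rw [h3, ← pull_boxForm hφ hQ (hVt hw) h1, ← neg_eq_iff_eq_neg.2 h4]
    ext v
    simp only [pull, omegaF, ContinuousAlternatingMap.compContinuousLinearMap_apply,
      ContinuousAlternatingMap.add_apply, ContinuousAlternatingMap.sub_apply,
      ContinuousAlternatingMap.neg_apply, ContinuousAlternatingMap.smul_apply, smul_eq_mul]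
    ring
  have hfm : ∀ t ∈ timeInterval T, FlatMetric V Q (pull φ (omegaF Jp Jm hp hm ω₀ f t)) := by
    intro t ht
    refine hflat.add_fbox hGKQ hVt hV (contDiffOn_family_slice hFs ht) (hloc t ht)
      fun w hw X hX => ?_
    rw [← pullBil_metricBil hφ (hVt hw), pullBil_apply, metricBil_apply]
    refine hf.positive t ht _ _ fun h0 => hX ?_
    exact Function.LeftInverse.injective (dChart_dSymm hφs (hVt hw)) (h0.trans (map_zero _).symm)
  have hGe : ∀ t, IsFlatMetricBil V (pull φ (omegaF Jp Jm hp hm ω₀ f t)) (G t) := fun t =>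
    ⟨fun w hw X Y => pullBil_metricBil hφ (hVt hw) X Y⟩
  have hGh : ∀ t ∈ timeInterval T, ∀ w ∈ V, IsHermOn (mulI n) ⊤ (G t w) := fun t ht w hw =>
    (hfm t ht).isHermOn (hGe t) hw
  have hFd : ∀ t ∈ timeInterval T, ∀ w ∈ V, HasDerivWithinAt (fun s => F s w)
      (logDet Q (G t) w₀ e w - logDet (-Q) (G t) w₀ e' w) (timeInterval T) t := by
    intro t ht w hw
    have h1 := hf.hasDerivWithinAt_chart hφ hQ hhp' hhm' (hVt hw) (hbe w (hV1 hw))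
      (hbe' w (hV2 hw)) ht rfl (hGh t ht w hw)
    have h2 := h1.add ((hasDerivWithinAt_id t (timeInterval T)).mul_const (a w + (-1) * b w))
    refine h2.congr_deriv ?_
    simp only [ha, hb, logDet, hG]
    ring
  refine ⟨Q, V, F, fun t w => logDet Q (G t) w₀ e w - logDet (-Q) (G t) w₀ e' w, hGKQ, hflat, hV,
    ⟨⟨hwV₁, hwV₂⟩, hwV₃⟩, hVt, hFs, hloc, fun w hw => ?_, hFd, fun t ht => ⟨hfm t ht, fun w hw => ?_⟩⟩
  · simp [hF, hf.initial]
  · have hs1 := (hfm t ht).contDiffOn_logDet (hGe t) hGKQ hV hVt fun y hy => hbe y (hV1 hy)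
    have hs2 := (hfm t ht).neg.contDiffOn_logDet (hGe t) hGKQ.neg hV hVt fun y hy => hbe' y (hV2 hy)
    exact (hfm t ht).fpart11_nuForm ⟨hV, hGKQ.holo.mono hVt, fun y hy => hGKQ.sq y (hVt hy),
      fun y hy => hGKQ.tau_pos y (hVt hy), fun y hy => hGKQ.tau_neg y (hVt hy)⟩ (hGe t)
      ⟨⟨hwV₁, hwV₂⟩, hwV₃⟩ he he' hV subset_rfl (fun y hy => hS y (hV3 hy)) hs1 hs2 hw

end Local

end GenKahler

end

noncomputable section

namespace GenKahler

/-! ### The solution of pluriclosed flow given by a solution of the scalar flow -/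

section PartOne

set_option maxSynthPendingDepth 4 in
theorem ContDiffAt.extDeriv_comp {n : ℕ} {α : CE n → CE n [⋀^Fin 2]→L[ℝ] ℝ} {w : CE n}
    (h : ContDiffAt ℝ ∞ α w) (A : CE n →L[ℝ] CE n) :
    ContDiffAt ℝ ∞ (fun y => -(extDeriv α y).compContinuousLinearMap A) w := by
  have h1 : ContDiffAt ℝ ∞ (fderiv ℝ α) w := h.fderiv_right (m := ∞) (by simp)
  have h2 : ContDiffAt ℝ ∞ (extDeriv α) w := by
    have h3 := (ContinuousAlternatingMap.alternatizeUncurryFinCLM (n := 2) ℝ (CE n) ℝ).contDiff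
      (n := ∞)
    exact h3.contDiffAt.comp w h1
  exact contDiffAt_form_iff.2 fun v => (contDiffAt_form_iff.1 h2 (fun i => A (v i))).neg

variable {n : ℕ} {M : Type*} [TopologicalSpace M] [ChartedSpace (Model n) M]
  [IsManifold 𝓘(ℝ, Model n) ∞ M]
  {g₀ : Bundle.ContMDiffRiemannianMetric 𝓘(ℝ, Model n) ∞ (Model n) (fun x : M => TS n x)}
  {Jp Jm : EndField n M} {ω₀ ωm : Form n M 2} {hp hm : BilinField n M} {T : EReal}
  {f : ℝ → M → ℝ} {φ : OpenPartialHomeomorph M (CE n)}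

theorem pull_ddc {J : EndField n M} {α : Form n M 2} (hφ : IsHoloChart J φ) {w : CE n}
    (hw : w ∈ φ.target) (hα : ∀ᶠ y in 𝓝 w, ContDiffAt ℝ ∞ (pull φ α) y) :
    pull φ (extD (dcForm J α)) w
      = extDeriv (fun y => -(extDeriv (pull φ α) y).compContinuousLinearMap (mulI n)) w := by
  have h1 : pull φ (dcForm J α) =ᶠ[𝓝 w]
      fun y => -(extDeriv (pull φ α) y).compContinuousLinearMap (mulI n) := by
    filter_upwards [φ.open_target.mem_nhds hw, hα] with y hy hs
    exact pull_dcForm hφ α hy (hs.differentiableAt (by simp))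
  rw [pull_extD hφ.isSmoothChart hw, h1.extDeriv_eq]
  exact ((ContDiffAt.extDeriv_comp hα.self_of_nhds (mulI n)).differentiableAt
    (by simp)).congr_of_eventuallyEq h1

theorem form_apply_two (hφ : IsSmoothChart (n := n) φ) (α : Form n M 2) {x : M}
    (hx : x ∈ φ.source) (X Y : TS n x) :
    α x ![X, Y] = pull φ α (φ x) ![dChart φ x X, dChart φ x Y] := by
  have h := pull_apply_dChart hφ α hx
  rw [← h]
  exact form_comp_two _ _ X Y

theorem dChart_J {J : EndField n M} (hφ : IsHoloChart J φ) {x : M} (hx : x ∈ φ.source)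
    (X : TS n x) : dChart φ x (J x X) = mulI n (dChart φ x X) := hφ.map_J x hx X

theorem isPluriclosedFlow_omegaF (hGK : IsGeneralizedKahler g₀ Jp Jm ω₀ ωm)
    (hcomm : ∀ x : M, (Jp x).comp (Jm x) = (Jm x).comp (Jp x))
    (hhp : IsHermitianMetricOn Jp (Tplus Jp Jm) hp) (hhm : IsHermitianMetricOn Jp (Tminus Jp Jm) hm)
    (hT : 0 < T) (hf : IsScalarFlow Jp Jm hp hm ω₀ T f) :
    IsPluriclosedFlow Jp ω₀ T (omegaF Jp Jm hp hm ω₀ f) := by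
  have hUD := uniqueDiffOn_timeInterval hT
  have hcl := timeInterval_subset_closure hT
  have h0 : (0 : ℝ) ∈ timeInterval T := ⟨le_rfl, hT⟩
  have hsm : SmoothFamilyOn (timeInterval T) (omegaF Jp Jm hp hm ω₀ f) := by
    refine smoothFamilyOn_of_charts (E := CE n) fun x => ?_
    obtain ⟨φ, hx, hφ⟩ := hGK.complex_p x
    refine ⟨φ, hφ.isSmoothChart, hx, fun p hp' => ?_⟩
    obtain ⟨Q, V, F, L, hQ, hflat, hV, hpV, hVt, hF, hloc, -⟩ :=
      exists_local_potential hGK hcomm hhp hhm hf hφ hp'.2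
    have h1 : ContDiffOn ℝ ∞ (fun p : ℝ × CE n => pull φ (omegaF Jp Jm hp hm ω₀ f p.1) p.2)
        (timeInterval T ×ˢ V) :=
      (((hflat.smooth.mono hVt).comp contDiff_snd.contDiffOn fun p hp => hp.2).add
        (contDiffOn_fbox_family hQ hVt hUD hV hF)).congr fun p hp => hloc p.1 hp.1 p.2 hp.2
    refine (h1 p ⟨hp'.1, hpV⟩).mono_of_mem_nhdsWithin ?_
    filter_upwards [self_mem_nhdsWithin, mem_nhdsWithin_of_mem_nhds
      (continuous_snd.continuousAt.preimage_mem_nhds (hV.mem_nhds hpV))] with q h1 h2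
      using ⟨h1.1, h2⟩
  have hherm : ∀ t ∈ timeInterval T, IsHermitianForm Jp (omegaF Jp Jm hp hm ω₀ f t) := by
    intro t ht
    refine ⟨fun x X Y => ?_, hf.positive t ht⟩
    obtain ⟨φ, hx, hφ⟩ := hGK.complex_p x
    obtain ⟨Q, V, F, L, hQ, hflat, hV, hpV, hVt, hF, hloc, hF0, hFd, hfl⟩ :=
      exists_local_potential hGK hcomm hhp hhm hf hφ (φ.map_source hx)
    rw [form_apply_two hφ.isSmoothChart _ hx, form_apply_two hφ.isSmoothChart _ hx,
      dChart_J hφ hx, dChart_J hφ hx, (hfl t ht).1.inv_I _ hpV]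
  refine ⟨hsm, hherm, fun t ht => ?_, fun t ht x X Y => ?_, ?_⟩
  · funext x
    obtain ⟨φ, hx, hφ⟩ := hGK.complex_p x
    obtain ⟨Q, V, F, L, hQ, hflat, hV, hpV, hVt, hF, hloc, hF0, hFd, hfl⟩ :=
      exists_local_potential hGK hcomm hhp hhm hf hφ (φ.map_source hx)
    have hFt := contDiffOn_family_slice hF ht
    have hA : ∀ y ∈ V, ContDiffAt ℝ ∞ (pull φ ω₀) y := fun y hy =>
      hflat.smooth.contDiffAt (φ.open_target.mem_nhds (hVt hy))
    have hB : ∀ y ∈ V, ContDiffAt ℝ ∞ (fbox Q (F t)) y := fun y hy =>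
      contDiffAt_fbox hQ (hVt hy) (hFt.contDiffAt (hV.mem_nhds hy))
    have hn := hV.mem_nhds hpV
    refine form_eq_of_pull_eq hφ.isSmoothChart hx ?_
    have hC : ∀ y ∈ V, pull φ (omegaF Jp Jm hp hm ω₀ f t) =ᶠ[𝓝 y] pull φ ω₀ + fbox Q (F t) :=
      fun y hy => by filter_upwards [hV.mem_nhds hy] with z hz using hloc t ht z hz
    rw [pull_ddc hφ (φ.map_source hx) (by
      filter_upwards [hn] with y hy using ((hA y hy).add (hB y hy)).congr_of_eventuallyEq (hC y hy))]
    have h1 : (fun y => -(extDeriv (pull φ (omegaF Jp Jm hp hm ω₀ f t)) y).compContinuousLinearMap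
        (mulI n)) =ᶠ[𝓝 (φ x)] (fun y => -(extDeriv (pull φ ω₀) y).compContinuousLinearMap (mulI n))
        + fun y => -(extDeriv (fbox Q (F t)) y).compContinuousLinearMap (mulI n) := by
      filter_upwards [hn] with y hy
      rw [(hC y hy).extDeriv_eq, extDeriv_add ((hA y hy).differentiableAt (by simp))
        ((hB y hy).differentiableAt (by simp))]
      ext v
      simp only [ContinuousAlternatingMap.neg_apply, Pi.add_apply, ContinuousAlternatingMap.add_apply,
        ContinuousAlternatingMap.compContinuousLinearMap_apply]
      ring
    rw [h1.extDeriv_eq, extDeriv_add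
      ((ContDiffAt.extDeriv_comp (hA _ hpV) _).differentiableAt (by simp))
      ((ContDiffAt.extDeriv_comp (hB _ hpV) _).differentiableAt (by simp)),
      extDeriv_dc_fbox hQ (hVt hpV) (by
        filter_upwards [hn] with y hy using hFt.contDiffAt (hV.mem_nhds hy)),
      ← pull_ddc hφ (φ.map_source hx) (by filter_upwards [hn] with y hy using hA y hy),
      hGK.ddc_p, add_zero]
  · obtain ⟨φ, hx, hφ⟩ := hGK.complex_p x
    obtain ⟨Q, V, F, L, hQ, hflat, hV, hpV, hVt, hF, hloc, hF0, hFd, hfl⟩ :=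
      exists_local_potential hGK hcomm hhp hhm hf hφ (φ.map_source hx)
    have h1 := hasDerivWithinAt_fbox_family (P := Q) hUD hcl hV hF hFd ht hpV (dChart φ x X)
      (dChart φ x Y)
    rw [form_apply_two hφ.isSmoothChart _ hx, pull_pluriP hGK.complex_p hφ (hherm t ht)
      (hsm.isSmoothForm ht) (φ.map_source hx), (hfl t ht).2 _ hpV,
      ContinuousAlternatingMap.neg_apply, neg_neg]
    refine (h1.const_add (pull φ ω₀ (φ x) ![dChart φ x X, dChart φ x Y])).congr_of_mem
      (fun s hs => ?_) ht
    rw [form_apply_two hφ.isSmoothChart _ hx, hloc s hs _ hpV,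
      ContinuousAlternatingMap.add_apply]
  · funext x
    obtain ⟨φ, hx, hφ⟩ := hGK.complex_p x
    obtain ⟨Q, V, F, L, hQ, hflat, hV, hpV, hVt, hF, hloc, hF0, hFd, hfl⟩ :=
      exists_local_potential hGK hcomm hhp hhm hf hφ (φ.map_source hx)
    refine form_eq_of_pull_eq hφ.isSmoothChart hx ?_
    have h1 : F 0 =ᶠ[𝓝 (φ x)] fun y => 0 * F 0 y := by
      filter_upwards [hV.mem_nhds hpV] with y hy
      rw [hF0 y hy, mul_zero]
    have h2 : ContDiffAt ℝ 2 (F 0) (φ x) :=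
      ((contDiffOn_family_slice hF h0).contDiffAt (hV.mem_nhds hpV)).of_le two_le_infty
    rw [hloc 0 h0 _ hpV, fbox, fiddbar_congr h1, fiddbar_const_mul h2, twist_smul, zero_smul,
      add_zero]

end PartOne

end GenKahler

end

noncomputable section

namespace GenKahler

set_option maxSynthPendingDepth 6

/-! ### Orthonormal bases and the norm of bilinear forms -/

section Orthonormal

variable {E : Type*} [NormedAddCommGroup E] [NormedSpace ℝ E] [FiniteDimensional ℝ E]
  {G : E →L[ℝ] E →L[ℝ] ℝ} {ι : Type*} [Fintype ι]

theorem exists_orthonormal (hs : ∀ X Y, G X Y = G Y X) (hpos : ∀ v, v ≠ 0 → 0 < G v v) :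
    ∃ f : Module.Basis (Fin (Module.finrank ℝ E)) ℝ E, ∀ i j, G (f i) (f j) = if i = j then 1 else 0 := by
  let B : LinearMap.BilinForm ℝ E := (ContinuousLinearMap.coeLM ℝ).comp G.toLinearMap
  obtain ⟨v, hv⟩ := LinearMap.BilinForm.exists_orthogonal_basis (B := B) ⟨fun X Y => hs X Y⟩
  have hv' : ∀ i j, i ≠ j → G (v i) (v j) = 0 := fun i j hij => hv hij
  have hp : ∀ i, 0 < G (v i) (v i) := fun i => hpos _ (v.ne_zero i)
  have hr : ∀ i, (√(G (v i) (v i)))⁻¹ ≠ 0 := fun i => inv_ne_zero (Real.sqrt_pos.2 (hp i)).ne'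
  refine ⟨v.isUnitSMul fun i => (hr i).isUnit, fun i j => ?_⟩
  rw [Module.Basis.isUnitSMul_apply, Module.Basis.isUnitSMul_apply, map_smul, map_smul, smul_apply,
    smul_eq_mul, smul_eq_mul]
  split_ifs with h
  · subst h
    have := Real.mul_self_sqrt (hp i).le
    have h2 := (Real.sqrt_pos.2 (hp i)).ne'
    field_simp
    rw [sq, this]
  · rw [hv' i j h, mul_zero, mul_zero]

variable [DecidableEq ι] (f : Module.Basis ι ℝ E) (hf : ∀ i j, G (f i) (f j) = if i = j then 1 else 0)
include hf

theorem sum_orthonormal (v : E) : v = ∑ i, G v (f i) • f i := by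
  have h : ∀ i, G v (f i) = f.repr v i := fun i => by
    conv_lhs => rw [← f.sum_repr v]
    simp only [map_sum, map_smul, sum_apply, smul_apply, hf, smul_eq_mul]
    simp
  simp only [h]
  exact (f.sum_repr v).symm

theorem inverse_orthonormal (hpos : ∀ v, v ≠ 0 → 0 < G v v) (η : E →L[ℝ] ℝ) :
    G.inverse η = ∑ i, η (f i) • f i := by
  obtain ⟨e, he⟩ := exists_equiv_of_pos hpos
  have h := sum_orthonormal f hf (G.inverse η)
  rwa [self_apply_inverse e he] at h

theorem trG_orthonormal (hpos : ∀ v, v ≠ 0 → 0 < G v v) (B : E →L[ℝ] E →L[ℝ] ℝ) :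
    trG G B = ∑ i, B (f i) (f i) := by
  rw [trG_apply, trL_eq_sum f]
  refine Finset.sum_congr rfl fun i _ => ?_
  simp only [inverse_orthonormal f hf hpos]
  simp [Finsupp.single_apply]

end Orthonormal

section PairForm

variable {E : Type*} [NormedAddCommGroup E] [NormedSpace ℝ E] [FiniteDimensional ℝ E]

/-- The inner product on bilinear forms induced by a metric. -/
def pairForm (G : E →L[ℝ] E →L[ℝ] ℝ) :
    (E →L[ℝ] E →L[ℝ] ℝ) →L[ℝ] (E →L[ℝ] E →L[ℝ] ℝ) →L[ℝ] ℝ :=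
  (LinearMap.mk₂ ℝ (fun A B => trG G (A ∘L G.inverse ∘L B.flip))
    (fun A A' B => by rw [← map_add]; congr 1)
    (fun c A B => by rw [← map_smul]; congr 1)
    (fun A B B' => by rw [← map_add]; congr 1; ext X Y; simp)
    (fun c A B => by rw [← map_smul]; congr 1; ext X Y; simp)).toContinuousBilinearMap

theorem pairForm_apply (G A B : E →L[ℝ] E →L[ℝ] ℝ) :
    pairForm G A B = trG G (A ∘L G.inverse ∘L B.flip) := rfl

theorem pairForm_orthonormal {G : E →L[ℝ] E →L[ℝ] ℝ} {ι : Type*} [Fintype ι] [DecidableEq ι]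
    (f : Module.Basis ι ℝ E) (hf : ∀ i j, G (f i) (f j) = if i = j then 1 else 0)
    (hpos : ∀ v, v ≠ 0 → 0 < G v v) (A B : E →L[ℝ] E →L[ℝ] ℝ) :
    pairForm G A B = ∑ i, ∑ j, A (f j) (f i) * B (f j) (f i) := by
  rw [pairForm_apply, trG_orthonormal f hf hpos]
  refine Finset.sum_congr rfl fun i _ => ?_
  simp [inverse_orthonormal f hf hpos, mul_comm]

variable {G : E →L[ℝ] E →L[ℝ] ℝ}

theorem pairForm_symm (hs : ∀ X Y, G X Y = G Y X) (hpos : ∀ v, v ≠ 0 → 0 < G v v)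
    (A B : E →L[ℝ] E →L[ℝ] ℝ) : pairForm G A B = pairForm G B A := by
  obtain ⟨f, hf⟩ := exists_orthonormal hs hpos
  rw [pairForm_orthonormal f hf hpos, pairForm_orthonormal f hf hpos]
  simp only [mul_comm]

theorem pairForm_pos (hs : ∀ X Y, G X Y = G Y X) (hpos : ∀ v, v ≠ 0 → 0 < G v v)
    (A : E →L[ℝ] E →L[ℝ] ℝ) (hA : A ≠ 0) : 0 < pairForm G A A := by
  obtain ⟨f, hf⟩ := exists_orthonormal hs hpos
  rw [pairForm_orthonormal f hf hpos]
  have h0 : ∀ i j, 0 ≤ A (f j) (f i) * A (f j) (f i) := fun i j => mul_self_nonneg _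
  have h1 : 0 ≤ ∑ i, ∑ j, A (f j) (f i) * A (f j) (f i) :=
    Finset.sum_nonneg fun i _ => Finset.sum_nonneg fun j _ => h0 i j
  refine lt_of_le_of_ne h1 fun h => hA ?_
  have h2 : ∀ j i, A (f j) (f i) = 0 := fun j i => by
    have h3 := (Finset.sum_eq_zero_iff_of_nonneg
      (fun i _ => Finset.sum_nonneg fun j _ => h0 i j)).1 h.symm i (Finset.mem_univ _)
    exact mul_self_eq_zero.1
      ((Finset.sum_eq_zero_iff_of_nonneg fun j _ => h0 i j).1 h3 j (Finset.mem_univ _))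
  apply ContinuousLinearMap.coe_injective
  refine f.ext fun j => ?_
  apply ContinuousLinearMap.coe_injective
  exact f.ext fun i => h2 j i

theorem contDiffWithinAt_pairForm {D : Type*} [NormedAddCommGroup D] [NormedSpace ℝ D]
    {K : D → E →L[ℝ] E →L[ℝ] ℝ} {s : Set D} {x : D} {m : WithTop ℕ∞}
    (hK : ContDiffWithinAt ℝ m K s x) (hpos : ∀ v, v ≠ 0 → 0 < K x v v) :
    ContDiffWithinAt ℝ m (fun z => pairForm (K z)) s x := by
  obtain ⟨e, he⟩ := exists_equiv_of_pos hpos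
  have h1 := contDiffWithinAt_inverse hK e he
  refine contDiffWithinAt_clm fun A => contDiffWithinAt_clm fun B => ?_
  exact (trL E).contDiff.contDiffAt.comp_contDiffWithinAt x
    (h1.clm_comp (contDiffWithinAt_const.clm_comp (h1.clm_comp contDiffWithinAt_const)))

end PairForm

section Coercive

variable {V : Type*} [NormedAddCommGroup V] [NormedSpace ℝ V] [FiniteDimensional ℝ V]

theorem exists_coercive {b : V →L[ℝ] V →L[ℝ] ℝ} (hb : ∀ v, v ≠ 0 → 0 < b v v) :
    ∃ κ > 0, ∀ v, κ * ‖v‖ ^ 2 ≤ b v v := by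
  rcases subsingleton_or_nontrivial V with h | h
  · exact ⟨1, one_pos, fun v => by rw [Subsingleton.elim v 0]; simp⟩
  have hc : IsCompact (Metric.sphere (0 : V) 1) := by
    have := FiniteDimensional.proper_real V
    exact isCompact_sphere 0 1
  have hcont : Continuous fun v => b v v := b.continuous.clm_apply continuous_id
  obtain ⟨v₀, hv₀, hmin⟩ := hc.exists_isMinOn (NormedSpace.sphere_nonempty.2 zero_le_one)
    hcont.continuousOn
  have hv₀' : ‖v₀‖ = 1 := by simpa using hv₀
  refine ⟨b v₀ v₀, hb v₀ fun h => by simp [h] at hv₀', fun v => ?_⟩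
  rcases eq_or_ne v 0 with rfl | hv
  · simp
  have hn : 0 < ‖v‖ := norm_pos_iff.2 hv
  have h1 : b v₀ v₀ ≤ b (‖v‖⁻¹ • v) (‖v‖⁻¹ • v) := hmin (by simp [norm_smul, hn.ne'])
  rw [map_smul, map_smul, smul_apply, smul_eq_mul, smul_eq_mul] at h1
  calc b v₀ v₀ * ‖v‖ ^ 2 ≤ ‖v‖⁻¹ * (‖v‖⁻¹ * b v v) * ‖v‖ ^ 2 := by gcongr
    _ = b v v := by field_simp

theorem eventually_coercive {X : Type*} {l : Filter X} {b : X → V →L[ℝ] V →L[ℝ] ℝ}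
    {b₀ : V →L[ℝ] V →L[ℝ] ℝ} (h : Filter.Tendsto b l (𝓝 b₀)) (hb : ∀ v, v ≠ 0 → 0 < b₀ v v) :
    ∃ κ > 0, ∀ᶠ x in l, ∀ v, κ * ‖v‖ ^ 2 ≤ b x v v := by
  obtain ⟨κ, hκ, hb'⟩ := exists_coercive hb
  refine ⟨κ / 2, half_pos hκ, ?_⟩
  filter_upwards [Metric.tendsto_nhds.1 h (κ / 2) (half_pos hκ)] with x hx v
  rw [dist_eq_norm] at hx
  have h1 : ‖(b x - b₀) v v‖ ≤ κ / 2 * ‖v‖ ^ 2 := by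
    refine ((b x - b₀).le_opNorm₂ v v).trans ?_
    rw [mul_assoc, ← sq]
    gcongr
  have h2 := hb' v
  have h3 := (abs_le.1 h1).1
  simp only [sub_apply] at h3
  linarith

end Coercive

section Estimate

variable {E B : Type*} [NormedAddCommGroup E] [NormedSpace ℝ E] [NormedAddCommGroup B]
  [NormedSpace ℝ B] {ι : Type*} [Fintype ι]

/-- The algebraic part of the maximum principle for the squared norm of a solution of a
linear parabolic inequality. -/
theorem parabolic_estimate {κ K m : ℝ} (hκ : 0 < κ) (hK : 0 ≤ K) (hm : 0 ≤ m)
    {N : B →L[ℝ] B →L[ℝ] ℝ} {N₁ : E →L[ℝ] B →L[ℝ] B →L[ℝ] ℝ} {N₂ : E →L[ℝ] E →L[ℝ] B →L[ℝ] B →L[ℝ] ℝ}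
    (hN : ‖N‖ ≤ K) (hN₁ : ‖N₁‖ ≤ K) (hN₂ : ‖N₂‖ ≤ K) (hc : ∀ A, κ * ‖A‖ ^ 2 ≤ N A A)
    {U V : B} {D : E →L[ℝ] B} {D₂ : E →L[ℝ] E →L[ℝ] B} {f : ι → E} (hf : ∀ i, ‖f i‖ ≤ m)
    (hD : ‖D‖ ≤ m * ∑ i, ‖D (f i)‖)
    (hV : ‖V - (1 / 2 : ℝ) • ∑ i, D₂ (f i) (f i)‖ ≤ K * (‖U‖ + ‖D‖))
    (hmax : ∀ i, N₂ (f i) (f i) U U + 4 * N₁ (f i) U (D (f i)) + 2 * N (D (f i)) (D (f i))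
      + 2 * N U (D₂ (f i) (f i)) ≤ 0) :
    2 * N U V ≤ ((Fintype.card ι * (K * m ^ 2 / 2 + (2 * K * m + 2 * K ^ 2 * m) ^ 2 / (4 * κ))
      + 2 * K ^ 2) / κ) * N U U := by
  set u := ‖U‖ with hu
  set C := 2 * K * m + 2 * K ^ 2 * m with hC
  have hu0 : 0 ≤ u := norm_nonneg _
  set R := V - (1 / 2 : ℝ) • ∑ i, D₂ (f i) (f i) with hR
  have hVR : V = (1 / 2 : ℝ) • ∑ i, D₂ (f i) (f i) + R := by rw [hR]; abel
  have h1 : 2 * N U V = ∑ i, N U (D₂ (f i) (f i)) + 2 * N U R := by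
    rw [hVR, map_add, map_smul, map_sum, smul_eq_mul]
    ring
  have h2 : 2 * N U R ≤ 2 * K ^ 2 * u ^ 2 + ∑ i, 2 * K ^ 2 * m * u * ‖D (f i)‖ := by
    have h3 : N U R ≤ K * u * (K * (u + m * ∑ i, ‖D (f i)‖)) := by
      calc N U R ≤ ‖N U R‖ := Real.le_norm_self _
        _ ≤ ‖N‖ * ‖U‖ * ‖R‖ := N.le_opNorm₂ U R
        _ ≤ K * u * (K * (u + m * ∑ i, ‖D (f i)‖)) := by
          gcongr
          exact hV.trans (by gcongr)
    rw [← Finset.mul_sum]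
    nlinarith
  have h3 : ∀ i, N U (D₂ (f i) (f i)) ≤ K * m ^ 2 / 2 * u ^ 2 + 2 * K * m * u * ‖D (f i)‖
      - κ * ‖D (f i)‖ ^ 2 := by
    intro i
    have a1 : -N₂ (f i) (f i) U U ≤ K * m ^ 2 * u ^ 2 := by
      calc -N₂ (f i) (f i) U U ≤ ‖N₂ (f i) (f i) U U‖ := neg_le_abs _
        _ ≤ ‖N₂ (f i) (f i)‖ * ‖U‖ * ‖U‖ := (N₂ (f i) (f i)).le_opNorm₂ U U
        _ ≤ (‖N₂‖ * ‖f i‖ * ‖f i‖) * ‖U‖ * ‖U‖ := by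
          gcongr
          exact N₂.le_opNorm₂ _ _
        _ ≤ (K * m * m) * u * u := by gcongr <;> exact hf i
        _ = K * m ^ 2 * u ^ 2 := by ring
    have a2 : -N₁ (f i) U (D (f i)) ≤ K * m * u * ‖D (f i)‖ := by
      calc -N₁ (f i) U (D (f i)) ≤ ‖N₁ (f i) U (D (f i))‖ := neg_le_abs _
        _ ≤ ‖N₁ (f i)‖ * ‖U‖ * ‖D (f i)‖ := (N₁ (f i)).le_opNorm₂ _ _
        _ ≤ (‖N₁‖ * ‖f i‖) * ‖U‖ * ‖D (f i)‖ := by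
          gcongr
          exact N₁.le_opNorm _
        _ ≤ (K * m) * u * ‖D (f i)‖ := by gcongr; exact hf i
    have a3 := hc (D (f i))
    have a4 := hmax i
    linarith
  have h4 : ∀ i, N U (D₂ (f i) (f i)) + 2 * K ^ 2 * m * u * ‖D (f i)‖
      ≤ (K * m ^ 2 / 2 + C ^ 2 / (4 * κ)) * u ^ 2 := by
    intro i
    have a5 : C * u * ‖D (f i)‖ - κ * ‖D (f i)‖ ^ 2 ≤ C ^ 2 / (4 * κ) * u ^ 2 := by
      have a6 : C ^ 2 / (4 * κ) * u ^ 2 - (C * u * ‖D (f i)‖ - κ * ‖D (f i)‖ ^ 2)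
          = (C * u - 2 * κ * ‖D (f i)‖) ^ 2 / (4 * κ) := by
        field_simp
        ring
      have a7 : 0 ≤ (C * u - 2 * κ * ‖D (f i)‖) ^ 2 / (4 * κ) := by positivity
      linarith
    have a8 : C * u * ‖D (f i)‖ = 2 * K * m * u * ‖D (f i)‖ + 2 * K ^ 2 * m * u * ‖D (f i)‖ := by
      rw [hC]; ring
    have := h3 i
    linarith
  have h5 := Finset.sum_le_sum fun i (_ : i ∈ Finset.univ) => h4 i
  rw [Finset.sum_add_distrib, Finset.sum_const, Finset.card_univ, nsmul_eq_mul] at h5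
  have h6 : 2 * N U V ≤ (Fintype.card ι * (K * m ^ 2 / 2 + C ^ 2 / (4 * κ)) + 2 * K ^ 2) * u ^ 2 := by
    linarith
  refine h6.trans ?_
  rw [div_mul_eq_mul_div, le_div_iff₀ hκ, mul_assoc]
  refine mul_le_mul_of_nonneg_left ?_ (by positivity)
  rw [mul_comm]
  exact hc U

end Estimate

section SecondDerivative

theorem second_deriv_nonpos {c c' : ℝ → ℝ} {c'' : ℝ} (h1 : ∀ᶠ s in 𝓝 0, HasDerivAt c (c' s) s)
    (h2 : HasDerivAt c' c'' 0) (hmax : IsLocalMax c 0) : c'' ≤ 0 := by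
  by_contra h
  push Not at h
  have e1 : deriv c =ᶠ[𝓝 0] c' := by filter_upwards [h1] with s hs using hs.deriv
  have e2 : deriv (deriv c) 0 = c'' := by rw [e1.deriv_eq, h2.deriv]
  have h3 := isLocalMin_of_deriv_deriv_pos (f := c) (by rwa [e2]) hmax.deriv_eq_zero
    h1.self_of_nhds.continuousAt
  have h4 : c =ᶠ[𝓝 0] fun _ => c 0 := by
    filter_upwards [hmax, h3] with s a b using le_antisymm a b
  have h5 : deriv (deriv c) 0 = 0 := by
    rw [h4.deriv.deriv_eq]
    simp
  linarith

variable {E B : Type*} [NormedAddCommGroup E] [NormedSpace ℝ E] [NormedAddCommGroup B]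
  [NormedSpace ℝ B]

theorem second_deriv_pairing {N : E → B →L[ℝ] B →L[ℝ] ℝ} {U : E → B} {y : E}
    (hN : ContDiffAt ℝ 2 N y) (hU : ContDiffAt ℝ 2 U y) (hs : ∀ᶠ z in 𝓝 y, ∀ A C, N z A C = N z C A)
    (hmax : IsLocalMax (fun z => N z (U z) (U z)) y) (a : E) :
    fderiv ℝ (fderiv ℝ N) y a a (U y) (U y) + 4 * fderiv ℝ N y a (U y) (fderiv ℝ U y a)
      + 2 * N y (fderiv ℝ U y a) (fderiv ℝ U y a) + 2 * N y (U y) (fderiv ℝ (fderiv ℝ U) y a a) ≤ 0 := by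
  have hγ : ∀ s : ℝ, HasDerivAt (fun s : ℝ => y + s • a) a s := fun s => by
    simpa using ((hasDerivAt_id s).smul_const a).const_add y
  have hγ0 : y + (0 : ℝ) • a = y := by simp
  have hγc : Filter.Tendsto (fun s : ℝ => y + s • a) (𝓝 0) (𝓝 y) := by
    have := (hγ 0).continuousAt.tendsto
    rwa [hγ0] at this
  have hev : ∀ {X : Type _} [NormedAddCommGroup X] [NormedSpace ℝ X] {K : E → X},
      ContDiffAt ℝ 2 K y → (∀ᶠ s in 𝓝 (0 : ℝ), HasDerivAt (fun s : ℝ => K (y + s • a))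
        (fderiv ℝ K (y + s • a) a) s) ∧ HasDerivAt (fun s : ℝ => fderiv ℝ K (y + s • a) a)
        (fderiv ℝ (fderiv ℝ K) y a a) 0 := by
    intro X _ _ K hK
    constructor
    · filter_upwards [hγc.eventually (hK.eventually (by simp))] with s hs
      exact (hs.differentiableAt (by simp)).hasFDerivAt.comp_hasDerivAt s (hγ s)
    · have h1 := (differentiableAt_fderiv_of_contDiffAt hK).hasFDerivAt
      rw [← hγ0] at h1
      have h2 := h1.comp_hasDerivAt (0 : ℝ) (hγ 0)
      have h3 := h2.clm_apply (hasDerivAt_const (0 : ℝ) a)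
      simpa [hγ0] using h3
  obtain ⟨hN1, hN2⟩ := hev hN
  obtain ⟨hU1, hU2⟩ := hev hU
  have hU0 := hU1.self_of_nhds
  have hN0 := hN1.self_of_nhds
  refine second_deriv_nonpos (c := fun s : ℝ => N (y + s • a) (U (y + s • a)) (U (y + s • a)))
    (c' := fun s => fderiv ℝ N (y + s • a) a (U (y + s • a)) (U (y + s • a))
      + 2 * N (y + s • a) (U (y + s • a)) (fderiv ℝ U (y + s • a) a)) ?_ ?_ ?_
  · filter_upwards [hN1, hU1, hγc.eventually hs] with s h1 h2 h3
    refine ((h1.clm_apply h2).clm_apply h2).congr_deriv ?_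
    rw [add_apply, h3 (fderiv ℝ U (y + s • a) a)]
    ring
  · have h1 := ((hN2.clm_apply hU0).clm_apply hU0).add
      (((hN0.clm_apply hU0).clm_apply hU2).const_mul 2)
    refine h1.congr_deriv ?_
    simp only [hγ0, add_apply]
    have h3 : fderiv ℝ N y a (fderiv ℝ U y a) (U y) = fderiv ℝ N y a (U y) (fderiv ℝ U y a) := by
      have hNd := (hN.differentiableAt (by simp)).hasFDerivAt
      have e1 := (hNd.clm_apply (hasFDerivAt_const (fderiv ℝ U y a) y)).clm_apply
        (hasFDerivAt_const (U y) y)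
      have e2 := (hNd.clm_apply (hasFDerivAt_const (U y) y)).clm_apply
        (hasFDerivAt_const (fderiv ℝ U y a) y)
      have e3 := e1.unique (e2.congr_of_eventuallyEq (by
        filter_upwards [hs] with z hz using hz _ _))
      simpa using congrArg (fun S => S a) e3
    rw [h3]
    ring
  · have h1 : IsLocalMax ((fun z => N z (U z) (U z)) ∘ fun s : ℝ => y + s • a) 0 := by
      refine IsLocalMax.comp_continuous (b := (0 : ℝ)) ?_ (hγ 0).continuousAt
      rwa [hγ0]
    exact h1

end SecondDerivative

end GenKahler

end

noncomputable section

namespace GenKahler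

set_option maxSynthPendingDepth 6

/-! ### Pluriclosed flow as a parabolic equation for the metric -/

section Jets

variable {E : Type*} [NormedAddCommGroup E] [NormedSpace ℝ E] [FiniteDimensional ℝ E]

/-- The bilinear form `(a, b) ↦ B(a, b)(X, Y)`. -/
def evTwo (B : E →L[ℝ] E →L[ℝ] E →L[ℝ] E →L[ℝ] ℝ) (X Y : E) : E →L[ℝ] E →L[ℝ] ℝ :=
  (ContinuousLinearMap.compL ℝ E (E →L[ℝ] E →L[ℝ] ℝ) ℝ
    ((ContinuousLinearMap.apply ℝ ℝ Y).comp (ContinuousLinearMap.apply ℝ (E →L[ℝ] ℝ) X))).comp B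

@[simp] theorem evTwo_apply (B : E →L[ℝ] E →L[ℝ] E →L[ℝ] E →L[ℝ] ℝ) (X Y a b : E) :
    evTwo B X Y a b = B a b X Y := rfl

/-- The terms of first order in the derivative of the torsion one-form. -/
def quadR (g : E →L[ℝ] E →L[ℝ] ℝ) (p : E →L[ℝ] E →L[ℝ] E →L[ℝ] ℝ) (X Y : E) : ℝ :=
  1 / 4 * trL E (g.inverse ∘L p X ∘L g.inverse ∘L p Y)
    - trL E (g.inverse ∘L p X ∘L g.inverse ∘L p.flip Y)

theorem quadR_add_left (g : E →L[ℝ] E →L[ℝ] ℝ) (p : E →L[ℝ] E →L[ℝ] E →L[ℝ] ℝ) (X X' Y : E) :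
    quadR g p (X + X') Y = quadR g p X Y + quadR g p X' Y := by
  simp only [quadR, map_add, ContinuousLinearMap.add_comp, ContinuousLinearMap.comp_add]
  ring

theorem quadR_smul_left (g : E →L[ℝ] E →L[ℝ] ℝ) (p : E →L[ℝ] E →L[ℝ] E →L[ℝ] ℝ) (c : ℝ) (X Y : E) :
    quadR g p (c • X) Y = c * quadR g p X Y := by
  simp only [quadR, map_smul, ContinuousLinearMap.smul_comp, ContinuousLinearMap.comp_smul,
    smul_eq_mul]
  ring

theorem quadR_add_right (g : E →L[ℝ] E →L[ℝ] ℝ) (p : E →L[ℝ] E →L[ℝ] E →L[ℝ] ℝ) (X Y Y' : E) :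
    quadR g p X (Y + Y') = quadR g p X Y + quadR g p X Y' := by
  simp only [quadR, map_add, ContinuousLinearMap.comp_add]
  ring

theorem quadR_smul_right (g : E →L[ℝ] E →L[ℝ] ℝ) (p : E →L[ℝ] E →L[ℝ] E →L[ℝ] ℝ) (c : ℝ) (X Y : E) :
    quadR g p X (c • Y) = c * quadR g p X Y := by
  simp only [quadR, map_smul, ContinuousLinearMap.comp_smul, smul_eq_mul]
  ring

/-- The right-hand side of pluriclosed flow, as a function of the two-jet of the metric. -/
def flowH {n : ℕ} (g : CE n →L[ℝ] CE n →L[ℝ] ℝ) (p : CE n →L[ℝ] CE n →L[ℝ] CE n →L[ℝ] ℝ)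
    (B : CE n →L[ℝ] CE n →L[ℝ] CE n →L[ℝ] CE n →L[ℝ] ℝ) : CE n →L[ℝ] CE n →L[ℝ] ℝ :=
  (LinearMap.mk₂ ℝ (fun X Y => 1 / 2 * trG g (evTwo B X Y) + 1 / 2 * (quadR g p X Y + quadR g p Y X
      + quadR g p (mulI n X) (mulI n Y) + quadR g p (mulI n Y) (mulI n X)))
    (fun X X' Y => by
      have h : evTwo B (X + X') Y = evTwo B X Y + evTwo B X' Y := by ext a b; simp
      simp only [h, map_add, quadR_add_left, quadR_add_right]
      ring)
    (fun c X Y => by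
      have h : evTwo B (c • X) Y = c • evTwo B X Y := by ext a b; simp
      simp only [h, map_smul, quadR_smul_left, quadR_smul_right, smul_eq_mul]
      ring)
    (fun X Y Y' => by
      have h : evTwo B X (Y + Y') = evTwo B X Y + evTwo B X Y' := by ext a b; simp
      simp only [h, map_add, quadR_add_left, quadR_add_right]
      ring)
    (fun c X Y => by
      have h : evTwo B X (c • Y) = c • evTwo B X Y := by ext a b; simp
      simp only [h, map_smul, quadR_smul_left, quadR_smul_right, smul_eq_mul]
      ring)).toContinuousBilinearMap

theorem flowH_apply {n : ℕ} (g : CE n →L[ℝ] CE n →L[ℝ] ℝ)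
    (p : CE n →L[ℝ] CE n →L[ℝ] CE n →L[ℝ] ℝ)
    (B : CE n →L[ℝ] CE n →L[ℝ] CE n →L[ℝ] CE n →L[ℝ] ℝ) (X Y : CE n) :
    flowH g p B X Y = 1 / 2 * trG g (evTwo B X Y) + 1 / 2 * (quadR g p X Y + quadR g p Y X
      + quadR g p (mulI n X) (mulI n Y) + quadR g p (mulI n Y) (mulI n X)) := rfl

theorem contDiffAt_quadR {g : E →L[ℝ] E →L[ℝ] ℝ} (hg : ∀ v, v ≠ 0 → 0 < g v v)
    (p : E →L[ℝ] E →L[ℝ] E →L[ℝ] ℝ) (B : E →L[ℝ] E →L[ℝ] E →L[ℝ] E →L[ℝ] ℝ) (X Y : E) :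
    ContDiffAt ℝ 1 (fun j : (E →L[ℝ] E →L[ℝ] ℝ) × (E →L[ℝ] E →L[ℝ] E →L[ℝ] ℝ)
      × (E →L[ℝ] E →L[ℝ] E →L[ℝ] E →L[ℝ] ℝ) => quadR j.1 j.2.1 X Y) (g, p, B) := by
  obtain ⟨e, he⟩ := exists_equiv_of_pos hg
  have h1 : ContDiffAt ℝ 1 (fun j : (E →L[ℝ] E →L[ℝ] ℝ) × (E →L[ℝ] E →L[ℝ] E →L[ℝ] ℝ)
      × (E →L[ℝ] E →L[ℝ] E →L[ℝ] E →L[ℝ] ℝ) => j.1.inverse) (g, p, B) :=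
    contDiffWithinAt_univ.1 (contDiffWithinAt_inverse contDiffAt_fst.contDiffWithinAt e he)
  have h2 : ContDiffAt ℝ 1 (fun j : (E →L[ℝ] E →L[ℝ] ℝ) × (E →L[ℝ] E →L[ℝ] E →L[ℝ] ℝ)
      × (E →L[ℝ] E →L[ℝ] E →L[ℝ] E →L[ℝ] ℝ) => j.2.1) (g, p, B) :=
    contDiffAt_fst.comp _ contDiffAt_snd
  have h3 : ∀ Z : E, ContDiffAt ℝ 1 (fun j : (E →L[ℝ] E →L[ℝ] ℝ) × (E →L[ℝ] E →L[ℝ] E →L[ℝ] ℝ)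
      × (E →L[ℝ] E →L[ℝ] E →L[ℝ] E →L[ℝ] ℝ) => j.2.1 Z) (g, p, B) := fun Z =>
    h2.clm_apply contDiffAt_const
  have h4 : ContDiffAt ℝ 1 (fun j : (E →L[ℝ] E →L[ℝ] ℝ) × (E →L[ℝ] E →L[ℝ] E →L[ℝ] ℝ)
      × (E →L[ℝ] E →L[ℝ] E →L[ℝ] E →L[ℝ] ℝ) => j.2.1.flip Y) (g, p, B) :=
    contDiffAt_bil fun a b => ((h3 a).clm_apply contDiffAt_const).clm_apply contDiffAt_const
  have h5 := (h1.clm_comp ((h3 X).clm_comp (h1.clm_comp (h3 Y))))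
  have h6 := (h1.clm_comp ((h3 X).clm_comp (h1.clm_comp h4)))
  exact (contDiffAt_const.mul ((trL E).contDiff.contDiffAt.comp _ h5)).sub
    ((trL E).contDiff.contDiffAt.comp _ h6)

theorem contDiffAt_flowH {n : ℕ} {g : CE n →L[ℝ] CE n →L[ℝ] ℝ} (hg : ∀ v, v ≠ 0 → 0 < g v v)
    (p : CE n →L[ℝ] CE n →L[ℝ] CE n →L[ℝ] ℝ)
    (B : CE n →L[ℝ] CE n →L[ℝ] CE n →L[ℝ] CE n →L[ℝ] ℝ) :
    ContDiffAt ℝ 1 (fun j : (CE n →L[ℝ] CE n →L[ℝ] ℝ) × (CE n →L[ℝ] CE n →L[ℝ] CE n →L[ℝ] ℝ)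
      × (CE n →L[ℝ] CE n →L[ℝ] CE n →L[ℝ] CE n →L[ℝ] ℝ) => flowH j.1 j.2.1 j.2.2) (g, p, B) := by
  refine contDiffAt_bil fun X Y => ?_
  simp only [flowH_apply]
  have hq := fun X Y => contDiffAt_quadR hg p B X Y
  obtain ⟨e, he⟩ := exists_equiv_of_pos hg
  have h1 : ContDiffAt ℝ 1 (fun j : (CE n →L[ℝ] CE n →L[ℝ] ℝ) × (CE n →L[ℝ] CE n →L[ℝ] CE n →L[ℝ] ℝ)
      × (CE n →L[ℝ] CE n →L[ℝ] CE n →L[ℝ] CE n →L[ℝ] ℝ) => j.1.inverse) (g, p, B) :=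
    contDiffWithinAt_univ.1 (contDiffWithinAt_inverse contDiffAt_fst.contDiffWithinAt e he)
  have h2 : ContDiffAt ℝ 1 (fun j : (CE n →L[ℝ] CE n →L[ℝ] ℝ) × (CE n →L[ℝ] CE n →L[ℝ] CE n →L[ℝ] ℝ)
      × (CE n →L[ℝ] CE n →L[ℝ] CE n →L[ℝ] CE n →L[ℝ] ℝ) => evTwo j.2.2 X Y) (g, p, B) := by
    have h3 : ContDiffAt ℝ 1 (fun j : (CE n →L[ℝ] CE n →L[ℝ] ℝ)
        × (CE n →L[ℝ] CE n →L[ℝ] CE n →L[ℝ] ℝ)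
        × (CE n →L[ℝ] CE n →L[ℝ] CE n →L[ℝ] CE n →L[ℝ] ℝ) => j.2.2) (g, p, B) :=
      contDiffAt_snd.comp _ contDiffAt_snd
    exact contDiffAt_const.clm_comp h3
  exact (contDiffAt_const.mul ((trL (CE n)).contDiff.contDiffAt.comp _ (h1.clm_comp h2))).add
    (contDiffAt_const.mul ((((hq _ _).add (hq _ _)).add (hq _ _)).add (hq _ _)))

end Jets

section Parabolic

variable {E : Type*} [NormedAddCommGroup E] [NormedSpace ℝ E] [FiniteDimensional ℝ E]
  {F : Type*} [NormedAddCommGroup F] [NormedSpace ℝ F]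

theorem fderiv_trG {G c : F → E →L[ℝ] E →L[ℝ] ℝ} {w : F} (hG : DifferentiableAt ℝ G w)
    (hc : DifferentiableAt ℝ c w) (hpos : ∀ v, v ≠ 0 → 0 < G w v v) (X : F) :
    fderiv ℝ (fun y => trG (G y) (c y)) w X = trG (G w) (fderiv ℝ c w X)
      - trL E ((G w).inverse ∘L fderiv ℝ G w X ∘L (G w).inverse ∘L c w) := by
  obtain ⟨e, he⟩ := exists_equiv_of_pos hpos
  obtain ⟨hd, hi⟩ := hasFDerivAt_inverse hG e he
  have h1 := (trL E).hasFDerivAt.comp w (hd.hasFDerivAt.clm_comp hc.hasFDerivAt)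
  have h2 : HasFDerivAt (fun y => trG (G y) (c y)) _ w := h1
  rw [h2.fderiv, ContinuousLinearMap.comp_apply]
  simp only [add_apply, map_add, ContinuousLinearMap.comp_apply,
    ContinuousLinearMap.compL_apply, ContinuousLinearMap.flip_apply]
  have h3 : fderiv ℝ (fun z => (G z).inverse) w X ∘L c w
      = -((G w).inverse ∘L fderiv ℝ G w X ∘L (G w).inverse ∘L c w) := by
    ext1 v
    simp [hi]
  rw [h3, map_neg, trG_apply, sub_eq_add_neg]

variable {n : ℕ} {G : CE n → CE n →L[ℝ] CE n →L[ℝ] ℝ} {w : CE n}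

/-- The covariant derivative of the torsion one-form in coordinates. -/
def nuDeriv (G : CE n → CE n →L[ℝ] CE n →L[ℝ] ℝ) (w X Y : CE n) : ℝ :=
  fderiv ℝ (fun y => traceDflip G y Y - (1 / 4 : ℝ) * traceD G y Y) w X

theorem nuDeriv_eq (hG : ContDiffAt ℝ ∞ G w) (hpos : ∀ v, v ≠ 0 → 0 < G w v v) (X Y : CE n) :
    nuDeriv G w X Y = trG (G w) ((fderiv ℝ (fderiv ℝ G) w X).flip Y)
      - 1 / 4 * trG (G w) (fderiv ℝ (fderiv ℝ G) w X Y) + quadR (G w) (fderiv ℝ G w) X Y := by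
  have hGd := hG.differentiableAt (by simp)
  have hD : ContDiffAt ℝ ∞ (fderiv ℝ G) w := hG.fderiv_right (m := ∞) (by simp)
  have hDd := (hD.differentiableAt (by simp)).hasFDerivAt
  have h1 : HasFDerivAt (fun y => fderiv ℝ G y Y) _ w := hDd.clm_apply (hasFDerivAt_const Y w)
  have h2 : DifferentiableAt ℝ (fun y => (fderiv ℝ G y).flip Y) w := differentiableAt_bil fun a b =>
    ((hD.clm_apply contDiffAt_const).clm_apply contDiffAt_const).clm_apply contDiffAt_const
  have h2' : fderiv ℝ (fun y => (fderiv ℝ G y).flip Y) w X = (fderiv ℝ (fderiv ℝ G) w X).flip Y := by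
    ext a b
    have e1 := (h2.hasFDerivAt.clm_apply (hasFDerivAt_const a w)).clm_apply (hasFDerivAt_const b w)
    have e2 := ((hDd.clm_apply (hasFDerivAt_const a w)).clm_apply (hasFDerivAt_const Y w)).clm_apply
      (hasFDerivAt_const b w)
    simpa using congrArg (fun S => S X) (e1.unique e2)
  obtain ⟨a1, a2⟩ := contDiffAt_traceD hG hpos
  have a1' := (a1.differentiableAt (by simp)).clm_apply (differentiableAt_const Y)
  have a2' := (a2.differentiableAt (by simp)).clm_apply (differentiableAt_const Y)
  have e1 := fderiv_trG hGd h1.differentiableAt hpos X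
  have e2 := fderiv_trG hGd h2 hpos X
  rw [h1.fderiv] at e1
  rw [h2'] at e2
  rw [nuDeriv, fderiv_fun_sub a2' (a1'.const_mul _), fderiv_const_mul a1', sub_apply, smul_apply,
    smul_eq_mul]
  have e1' : fderiv ℝ (fun y => traceD G y Y) w X = _ := e1
  have e2' : fderiv ℝ (fun y => traceDflip G y Y) w X = _ := e2
  rw [e1', e2', quadR]
  simp only [add_apply, ContinuousLinearMap.comp_apply, ContinuousLinearMap.flip_apply, zero_apply,
    map_zero, zero_add]
  ring

theorem fpart11_nuForm_apply (hG : ContDiffAt ℝ ∞ G w) (hpos : ∀ v, v ≠ 0 → 0 < G w v v) (X : CE n) :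
    fpart11 (mulI n) (extDeriv (fun y => oneForm (nuForm n G y)) w) ![X, mulI n X]
      = -(nuDeriv G w X X + nuDeriv G w (mulI n X) (mulI n X)) := by
  obtain ⟨a1, a2⟩ := contDiffAt_traceD hG hpos
  have h1 : DifferentiableAt ℝ (nuForm n G) w := ((a2.differentiableAt (by simp)).sub
    ((a1.differentiableAt (by simp)).const_smul (1 / 4 : ℝ))).clm_comp (differentiableAt_const _)
  have h2 : ∀ X Y, fderiv ℝ (nuForm n G) w X Y = nuDeriv G w X (mulI n Y) := fun X Y => by
    have h3 := fderiv_clm_apply h1 (differentiableAt_const Y)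
    have h4 : fderiv ℝ (fun y => nuForm n G y Y) w X = nuDeriv G w X (mulI n Y) := rfl
    rw [← h4, h3]
    simp
  have h5 : ∀ Y X, nuDeriv G w Y (-X) = -nuDeriv G w Y X := fun Y X => by
    rw [nuDeriv, nuDeriv, ← neg_apply, ← fderiv_fun_neg]
    congr 2
    funext y
    rw [map_neg, map_neg]
    ring
  rw [fpart11_apply, extDeriv_oneForm_apply h1, extDeriv_oneForm_apply h1]
  simp only [h2, mulI_mulI, map_neg, neg_apply, h5]
  ring

/-- The pluriclosed condition in coordinates. -/
theorem pluriclosed_identity {Ω : CE n → CE n [⋀^Fin 2]→L[ℝ] ℝ} {V : Set (CE n)} (hV : IsOpen V)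
    (hw : w ∈ V) (hΩ : ContDiffOn ℝ ∞ Ω V) (hGs : ContDiffOn ℝ ∞ G V)
    (hG : ∀ y ∈ V, ∀ X Y, G y X Y = Ω y ![X, mulI n Y]) (hh : ∀ y ∈ V, IsHermOn (mulI n) ⊤ (G y))
    (hpc : extDeriv (fun y => -(extDeriv Ω y).compContinuousLinearMap (mulI n)) w = 0)
    (X e : CE n) (D : CE n →L[ℝ] CE n →L[ℝ] CE n →L[ℝ] CE n →L[ℝ] ℝ)
    (hD : D = fderiv ℝ (fderiv ℝ G) w) :
    D X X e e + D (mulI n X) (mulI n X) e e + D e e X X + D (mulI n e) (mulI n e) X X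
      = 2 * (D X e X e + D X (mulI n e) X (mulI n e) + D (mulI n X) e (mulI n X) e
        + D (mulI n X) (mulI n e) (mulI n X) (mulI n e)) := by
  have hn := hV.mem_nhds hw
  have hGd : ∀ y ∈ V, DifferentiableAt ℝ G y := fun y hy =>
    (hGs.contDiffAt (hV.mem_nhds hy)).differentiableAt (by simp)
  have hΩs : ∀ y ∈ V, ContDiffAt ℝ ∞ Ω y := fun y hy => hΩ.contDiffAt (hV.mem_nhds hy)
  have hΩe : ∀ y ∈ V, ∀ A B, Ω y ![A, B] = G y A (-mulI n B) := fun y hy A B => by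
    rw [hG y hy, map_neg, mulI_mulI, neg_neg]
  have h1 : ∀ y ∈ V, ∀ A B C, extDeriv Ω y ![A, B, C] = -fderiv ℝ G y A B (mulI n C)
      + fderiv ℝ G y B A (mulI n C) - fderiv ℝ G y C A (mulI n B) := by
    intro y hy A B C
    have h2 : ∀ A B C, fderiv ℝ (fun z => Ω z ![A, B]) y C = -fderiv ℝ G y C A (mulI n B) := by
      intro A B C
      have h3 : (fun z => Ω z ![A, B]) =ᶠ[𝓝 y] fun z => G z A (-mulI n B) := by
        filter_upwards [hV.mem_nhds hy] with z hz using hΩe z hz A B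
      rw [h3.fderiv_eq, (hasFDerivAt_bil_apply (hGd y hy) A (-mulI n B)).fderiv]
      simp only [ContinuousLinearMap.comp_apply, ContinuousLinearMap.apply_apply, map_neg, neg_apply]
    rw [extDeriv_two_apply ((hΩs y hy).differentiableAt (by simp)), h2, h2, h2]
    ring
  set β := fun y => -(extDeriv Ω y).compContinuousLinearMap (mulI n) with hβ
  have hβs : ContDiffAt ℝ ∞ β w := ContDiffAt.extDeriv_comp (hΩs w hw) _
  have hDG : DifferentiableAt ℝ (fderiv ℝ G) w :=
    ((hGs.contDiffAt hn).fderiv_right (m := ∞) (by simp)).differentiableAt (by simp)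
  have h4 : ∀ Z A B, HasFDerivAt (fun y => fderiv ℝ G y Z A B)
      (((ContinuousLinearMap.apply ℝ ℝ B).comp ((ContinuousLinearMap.apply ℝ (CE n →L[ℝ] ℝ) A).comp
        (ContinuousLinearMap.apply ℝ (CE n →L[ℝ] CE n →L[ℝ] ℝ) Z))).comp D) w := fun Z A B => by
    rw [hD]
    refine (((hDG.hasFDerivAt.clm_apply (hasFDerivAt_const Z w)).clm_apply
      (hasFDerivAt_const A w)).clm_apply (hasFDerivAt_const B w)).congr_fderiv ?_
    ext v
    simp
  have h5 : ∀ Z A B C, fderiv ℝ (fun y => β y ![A, B, C]) w Z = -D Z (mulI n A) (mulI n B) C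
      + D Z (mulI n B) (mulI n A) C - D Z (mulI n C) (mulI n A) B := by
    intro Z A B C
    have h6 : (fun y => β y ![A, B, C]) =ᶠ[𝓝 w] fun y => -fderiv ℝ G y (mulI n A) (mulI n B) C
        + fderiv ℝ G y (mulI n B) (mulI n A) C - fderiv ℝ G y (mulI n C) (mulI n A) B := by
      filter_upwards [hn] with y hy
      rw [hβ]
      simp only [ContinuousAlternatingMap.neg_apply]
      rw [form_comp_three, h1 y hy]
      simp only [mulI_mulI, map_neg]
      ring
    rw [h6.fderiv_eq]
    exact congrArg (fun S => S Z) (((h4 (mulI n A) (mulI n B) C).neg.add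
      (h4 (mulI n B) (mulI n A) C)).sub (h4 (mulI n C) (mulI n A) B)).fderiv
  have hsym : ∀ a b A B, D a b A B = D b a A B := fun a b A B => by
    rw [hD, fderiv_fderiv_symm ((hGs.contDiffAt hn).of_le two_le_infty)]
  have hJ : ∀ a b A B, D a b (mulI n A) B = -D a b A (mulI n B) := by
    intro a b A B
    have h7 : ∀ y ∈ V, ∀ Z, fderiv ℝ G y Z (mulI n A) B = -fderiv ℝ G y Z A (mulI n B) := by
      intro y hy Z
      have h8 : (fun z => G z (mulI n A) B) =ᶠ[𝓝 y] -fun z => G z A (mulI n B) := by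
        filter_upwards [hV.mem_nhds hy] with z hz using (hh z hz).J_left trivial trivial
      have h9 := (hasFDerivAt_bil_apply (hGd y hy) (mulI n A) B).unique
        ((hasFDerivAt_bil_apply (hGd y hy) A (mulI n B)).neg.congr_of_eventuallyEq h8)
      exact congrArg (fun S => S Z) h9
    have h8 : (fun z => fderiv ℝ G z b (mulI n A) B) =ᶠ[𝓝 w] -fun z => fderiv ℝ G z b A (mulI n B) := by
      filter_upwards [hn] with z hz using h7 z hz b
    exact congrArg (fun S => S a) ((h4 b (mulI n A) B).unique
      ((h4 b A (mulI n B)).neg.congr_of_eventuallyEq h8))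
  have h6 := extDeriv_three_apply (hβs.differentiableAt (by simp)) X (mulI n X) e (mulI n e)
  rw [hpc, h5, h5, h5, h5] at h6
  have h7 : (0 : CE n [⋀^Fin 4]→L[ℝ] ℝ) ![X, mulI n X, e, mulI n e] = 0 := rfl
  rw [h7] at h6
  simp only [mulI_mulI, map_neg, neg_apply, hJ, neg_neg] at h6 ⊢
  linear_combination -h6 + hsym e X X e - hsym e (mulI n X) X (mulI n e)
    + hsym (mulI n e) X X (mulI n e) + hsym (mulI n e) (mulI n X) X e

end Parabolic

end GenKahler

end

noncomputable section

namespace GenKahler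

set_option maxSynthPendingDepth 6

section Parabolic

theorem bilin_ext_diag {E : Type*} [NormedAddCommGroup E] [NormedSpace ℝ E]
    {A B : E →L[ℝ] E →L[ℝ] ℝ} (hA : ∀ X Y, A X Y = A Y X) (hB : ∀ X Y, B X Y = B Y X)
    (h : ∀ X, A X X = B X X) : A = B := by
  ext X Y
  have h1 := h (X + Y)
  simp only [map_add, add_apply] at h1
  linarith [h X, h Y, hA X Y, hB X Y]

variable {n : ℕ} {G : CE n → CE n →L[ℝ] CE n →L[ℝ] ℝ} {w : CE n}

/-- The linear isomorphism given by multiplication by `i`. -/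
def mulIEquiv (n : ℕ) : CE n ≃L[ℝ] CE n :=
  ContinuousLinearEquiv.equivOfInverse (mulI n) (-mulI n) (fun v => by rw [neg_apply, mulI_mulI, neg_neg])
    (fun v => by rw [neg_apply, map_neg, mulI_mulI, neg_neg])

theorem trG_mulI {g B B' : CE n →L[ℝ] CE n →L[ℝ] ℝ} (hg : IsHermOn (mulI n) ⊤ g)
    (hB : ∀ X Y, B' X Y = B (mulI n X) (mulI n Y)) : trG g B' = trG g B :=
  trG_bilinearComp (fun v hv => hg.pos v trivial hv) (mulIEquiv n)
    (fun X Y => (hg.map_J X trivial Y trivial).symm) hB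

theorem trG_second_order {g : CE n →L[ℝ] CE n →L[ℝ] ℝ} (hg : IsHermOn (mulI n) ⊤ g)
    {D : CE n →L[ℝ] CE n →L[ℝ] CE n →L[ℝ] CE n →L[ℝ] ℝ} {X : CE n}
    (h : ∀ e, D X X e e + D (mulI n X) (mulI n X) e e + D e e X X + D (mulI n e) (mulI n e) X X
      = 2 * (D X e X e + D X (mulI n e) X (mulI n e) + D (mulI n X) e (mulI n X) e
        + D (mulI n X) (mulI n e) (mulI n X) (mulI n e))) :
    trG g (D X X) + trG g (D (mulI n X) (mulI n X)) + 2 * trG g (evTwo D X X)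
      = 4 * (trG g ((D X).flip X) + trG g ((D (mulI n X)).flip (mulI n X))) := by
  obtain ⟨f, hf⟩ := exists_orthonormal (fun X Y => hg.symm X trivial Y trivial)
    (fun v hv => hg.pos v trivial hv)
  have tr := trG_orthonormal f hf (fun v hv => hg.pos v trivial hv)
  have tr' : ∀ B : CE n →L[ℝ] CE n →L[ℝ] ℝ, trG g B = ∑ i, B (mulI n (f i)) (mulI n (f i)) := by
    intro B
    rw [← trG_mulI (B' := B.bilinearComp (mulI n) (mulI n)) hg fun X Y => rfl, tr]
    rfl
  have hsum := Finset.sum_congr rfl fun i (_ : i ∈ Finset.univ) => h (f i)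
  simp only [← Finset.mul_sum, Finset.sum_add_distrib] at hsum
  have e1 := tr (evTwo D X X)
  have e2 := tr' (evTwo D X X)
  have e3 := tr ((D X).flip X)
  have e4 := tr' ((D X).flip X)
  have e5 := tr ((D (mulI n X)).flip (mulI n X))
  have e6 := tr' ((D (mulI n X)).flip (mulI n X))
  simp only [evTwo_apply, ContinuousLinearMap.flip_apply] at e1 e2 e3 e4 e5 e6
  rw [← tr, ← tr, ← e1, ← e2, ← e3, ← e4, ← e5, ← e6] at hsum
  linarith

/-- For a pluriclosed metric the second-order part of the flow is the Laplacian. -/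
theorem nuDeriv_eq_flowH {Ω : CE n → CE n [⋀^Fin 2]→L[ℝ] ℝ} {V : Set (CE n)} (hV : IsOpen V)
    (hw : w ∈ V) (hΩ : ContDiffOn ℝ ∞ Ω V) (hGs : ContDiffOn ℝ ∞ G V)
    (hG : ∀ y ∈ V, ∀ X Y, G y X Y = Ω y ![X, mulI n Y]) (hh : ∀ y ∈ V, IsHermOn (mulI n) ⊤ (G y))
    (hpc : extDeriv (fun y => -(extDeriv Ω y).compContinuousLinearMap (mulI n)) w = 0) (X : CE n) :
    nuDeriv G w X X + nuDeriv G w (mulI n X) (mulI n X)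
      = flowH (G w) (fderiv ℝ G w) (fderiv ℝ (fderiv ℝ G) w) X X := by
  have hg := hh w hw
  have hpos : ∀ v, v ≠ 0 → 0 < G w v v := fun v hv => hg.pos v trivial hv
  have hid := trG_second_order hg fun e => pluriclosed_identity hV hw hΩ hGs hG hh hpc X e _ rfl
  have hGw := hGs.contDiffAt (hV.mem_nhds hw)
  rw [nuDeriv_eq hGw hpos, nuDeriv_eq hGw hpos, flowH_apply]
  generalize fderiv ℝ (fderiv ℝ G) w = D at *
  linarith

end Parabolic

section Chart

variable {n : ℕ} {M : Type*} [TopologicalSpace M] [ChartedSpace (Model n) M]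
  [IsManifold 𝓘(ℝ, Model n) ∞ M] {J : EndField n M} {ω₀ : Form n M 2} {T : EReal}
  {ω₁ : ℝ → Form n M 2} {φ : OpenPartialHomeomorph M (CE n)}

/-- The metric of a family of Hermitian forms, in a chart. -/
def chartMetric (φ : OpenPartialHomeomorph M (CE n)) (J : EndField n M) (ω₁ : ℝ → Form n M 2)
    (t : ℝ) : CE n → CE n →L[ℝ] CE n →L[ℝ] ℝ := pullBil φ (metricBil J (ω₁ t))

theorem IsPluriclosedFlow.contDiffOn_chart (h : IsPluriclosedFlow J ω₀ T ω₁)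
    (hφ : IsHoloChart J φ) : ContDiffOn ℝ ∞ (fun p : ℝ × CE n => chartMetric φ J ω₁ p.1 p.2)
      (timeInterval T ×ˢ φ.target) :=
  contDiffOn_pullBil_metricBil hφ (h.smooth.contDiffOn_pull hφ.isSmoothChart)

theorem IsPluriclosedFlow.isHermOn (h : IsPluriclosedFlow J ω₀ T ω₁) (hφ : IsHoloChart J φ) {t : ℝ}
    (ht : t ∈ timeInterval T) {y : CE n} (hy : y ∈ φ.target) :
    IsHermOn (mulI n) ⊤ (chartMetric φ J ω₁ t y) := (h.hermitian t ht).isHermOn_pullBil hφ hy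

theorem flowH_symm (g : CE n →L[ℝ] CE n →L[ℝ] ℝ) (p : CE n →L[ℝ] CE n →L[ℝ] CE n →L[ℝ] ℝ)
    {B : CE n →L[ℝ] CE n →L[ℝ] CE n →L[ℝ] CE n →L[ℝ] ℝ} (hB : ∀ a b X Y, B a b X Y = B a b Y X)
    (X Y : CE n) : flowH g p B X Y = flowH g p B Y X := by
  have h : evTwo B X Y = evTwo B Y X := by ext a b; exact hB a b X Y
  rw [flowH_apply, flowH_apply, h]
  ring

theorem fderiv_fderiv_bilin_symm {V : Set (CE n)} (hV : IsOpen V)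
    {G : CE n → CE n →L[ℝ] CE n →L[ℝ] ℝ} (hGs : ContDiffOn ℝ ∞ G V)
    (hs : ∀ y ∈ V, ∀ X Y, G y X Y = G y Y X) {w : CE n} (hw : w ∈ V) (a b X Y : CE n) :
    fderiv ℝ (fderiv ℝ G) w a b X Y = fderiv ℝ (fderiv ℝ G) w a b Y X := by
  have h1 : ∀ y ∈ V, ∀ b, fderiv ℝ G y b X Y = fderiv ℝ G y b Y X := fun y hy b => by
    have hd := (hGs.contDiffAt (hV.mem_nhds hy)).differentiableAt (by simp)
    have e := (hasFDerivAt_bil_apply hd X Y).unique ((hasFDerivAt_bil_apply hd Y X).congr_of_eventuallyEq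
      (by filter_upwards [hV.mem_nhds hy] with z hz using hs z hz X Y))
    exact congrArg (fun S => S b) e
  have hd : DifferentiableAt ℝ (fderiv ℝ G) w :=
    ((hGs.contDiffAt (hV.mem_nhds hw)).fderiv_right (m := ∞) (by simp)).differentiableAt (by simp)
  have h2 := hd.hasFDerivAt.clm_apply (hasFDerivAt_const b w)
  have e := ((h2.clm_apply (hasFDerivAt_const X w)).clm_apply (hasFDerivAt_const Y w)).unique
    (((h2.clm_apply (hasFDerivAt_const Y w)).clm_apply (hasFDerivAt_const X w)).congr_of_eventuallyEq
      (by filter_upwards [hV.mem_nhds hw] with z hz using h1 z hz b))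
  simpa using congrArg (fun S => S a) e

theorem IsPluriclosedFlow.hasDerivWithinAt_chart (hT : 0 < T) (hJ : IsComplexStructure J)
    (h : IsPluriclosedFlow J ω₀ T ω₁) (hφ : IsHoloChart J φ) {t : ℝ} (ht : t ∈ timeInterval T)
    {y : CE n} (hy : y ∈ φ.target) :
    HasDerivWithinAt (fun s => chartMetric φ J ω₁ s y) (flowH (chartMetric φ J ω₁ t y)
      (fderiv ℝ (chartMetric φ J ω₁ t) y) (fderiv ℝ (fderiv ℝ (chartMetric φ J ω₁ t)) y))
      (timeInterval T) t := by
  have hUD := uniqueDiffOn_timeInterval hT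
  have hGs := h.contDiffOn_chart hφ
  have hG := contDiffOn_family_slice hGs ht
  have hV := φ.open_target
  have h1 := hasDerivWithinAt_family (p := (t, y)) hGs ⟨ht, hy⟩
  set A := fderivWithin ℝ (fun p : ℝ × CE n => chartMetric φ J ω₁ p.1 p.2)
    (timeInterval T ×ˢ φ.target) (t, y) (1, 0) with hA
  have hAd : ∀ X Y, HasDerivWithinAt (fun s => chartMetric φ J ω₁ s y X Y) (A X Y)
      (timeInterval T) t := fun X Y => by
    have h2 := (h1.clm_apply (hasDerivWithinAt_const t _ X)).clm_apply
      (hasDerivWithinAt_const t _ Y)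
    simpa using h2
  have hsm := h.smooth.isSmoothForm ht
  refine h1.congr_deriv (bilin_ext_diag (fun X Y => ?_) (flowH_symm _ _
    (fderiv_fderiv_bilin_symm hV hG (fun z hz X Y =>
      (h.isHermOn hφ ht hz).symm X trivial Y trivial) hy)) fun X => ?_)
  · refine (hUD t ht).eq_deriv _ (hAd X Y) ((hAd Y X).congr_of_mem (fun s hs => ?_) ht)
    exact (h.isHermOn hφ hs hy).symm X trivial Y trivial
  · have hh : ∀ z ∈ φ.target, IsHermOn (mulI n) ⊤ (chartMetric φ J ω₁ t z) := fun z hz =>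
      h.isHermOn hφ ht hz
    have hΩ : ContDiffOn ℝ ∞ (pull φ (ω₁ t)) φ.target := fun z hz =>
      (hsm.contDiffAt_pull hφ.isSmoothChart hz).contDiffWithinAt
    have hpc : extDeriv (fun z => -(extDeriv (pull φ (ω₁ t)) z).compContinuousLinearMap (mulI n)) y
        = 0 := by
      rw [← pull_ddc hφ hy (by
        filter_upwards [hV.mem_nhds hy] with z hz using hsm.contDiffAt_pull hφ.isSmoothChart hz),
        h.pluriclosed t ht]
      ext v
      rfl
    rw [← nuDeriv_eq_flowH hV hy hΩ hG (fun z hz X Y => pullBil_metricBil hφ hz X Y) hh hpc]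
    have h3 := fpart11_nuForm_apply (hG.contDiffAt (hV.mem_nhds hy))
      (fun v hv => (hh y hy).pos v trivial hv) X
    rw [← neg_eq_iff_eq_neg.2 h3]
    refine (hUD t ht).eq_deriv _ (hAd X X) ?_
    have h4 := pull_pluriP hJ hφ (h.hermitian t ht) hsm hy
    have h5 := h.flow t ht (φ.symm y) (dSymm φ y X) (dSymm φ y (mulI n X))
    have h6 : ∀ α : Form n M 2, α (φ.symm y) ![dSymm φ y X, dSymm φ y (mulI n X)]
        = pull φ α y ![X, mulI n X] := fun α => (form_comp_two _ _ _ _).symm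
    simp only [h6, h4] at h5
    refine h5.congr_of_mem (fun s hs => ?_) ht
    exact pullBil_metricBil hφ hy X X

end Chart

end GenKahler

end

noncomputable section

namespace GenKahler

set_option maxSynthPendingDepth 6

section LocalEstimate

theorem norm_le_of_orthonormal {E : Type*} [NormedAddCommGroup E] [NormedSpace ℝ E]
    [FiniteDimensional ℝ E] {g : E →L[ℝ] E →L[ℝ] ℝ} {ι : Type*} [Fintype ι] [DecidableEq ι] {κ K : ℝ}
    (hκ : 0 < κ) (hc : ∀ v, κ * ‖v‖ ^ 2 ≤ g v v) (hK : ‖g‖ ≤ K) (f : Module.Basis ι ℝ E)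
    (hf : ∀ i j, g (f i) (f j) = if i = j then 1 else 0) :
    (∀ i, ‖f i‖ ≤ (1 / κ + 1) * (K + 1)) ∧
      ∀ {F : Type*} [NormedAddCommGroup F] [NormedSpace ℝ F] (D : E →L[ℝ] F),
        ‖D‖ ≤ (1 / κ + 1) * (K + 1) * ∑ i, ‖D (f i)‖ := by
  have hκ' : 0 < 1 / κ := by positivity
  have hK0 : 0 ≤ K := (norm_nonneg g).trans hK
  have h1 : ∀ i, ‖f i‖ ≤ 1 / κ + 1 := fun i => by
    have h2 := hc (f i)
    rw [hf, if_pos rfl] at h2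
    have h3 : ‖f i‖ ^ 2 ≤ 1 / κ := by rw [le_div_iff₀ hκ]; linarith
    nlinarith [norm_nonneg (f i)]
  refine ⟨fun i => (h1 i).trans (le_mul_of_one_le_right (by positivity) (by linarith)), ?_⟩
  intro F _ _ D
  have hs : 0 ≤ ∑ i, ‖D (f i)‖ := Finset.sum_nonneg fun _ _ => norm_nonneg _
  refine D.opNorm_le_bound (by positivity) fun v => ?_
  have h2 : D v = ∑ i, g v (f i) • D (f i) := by
    conv_lhs => rw [sum_orthonormal f hf v]
    simp only [map_sum, map_smul]
  rw [h2, mul_assoc, mul_comm (∑ i, ‖D (f i)‖), ← mul_assoc, Finset.mul_sum]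
  refine (norm_sum_le _ _).trans (Finset.sum_le_sum fun i _ => ?_)
  rw [norm_smul]
  refine mul_le_mul_of_nonneg_right ?_ (norm_nonneg _)
  calc ‖g v (f i)‖ ≤ ‖g‖ * ‖v‖ * ‖f i‖ := g.le_opNorm₂ v (f i)
    _ ≤ K * ‖v‖ * (1 / κ + 1) := by gcongr; exact h1 i
    _ ≤ (1 / κ + 1) * (K + 1) * ‖v‖ := by nlinarith [mul_nonneg (add_pos hκ' one_pos).le (norm_nonneg v)]

theorem hasDerivWithinAt_pairing {B : Type*} [NormedAddCommGroup B] [NormedSpace ℝ B]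
    {N : B →L[ℝ] B →L[ℝ] ℝ} (hs : ∀ A C, N A C = N C A) {U : ℝ → B} {U' : B} {S : Set ℝ} {t : ℝ}
    (hU : HasDerivWithinAt U U' S t) :
    HasDerivWithinAt (fun s => N (U s) (U s)) (2 * N (U t) U') S t := by
  refine (((hasDerivWithinAt_const t S N).clm_apply hU).clm_apply hU).congr_deriv ?_
  rw [zero_apply, zero_add, hs U', two_mul]

theorem second_deriv_pairing_sub {E B : Type*} [NormedAddCommGroup E] [NormedSpace ℝ E]
    [NormedAddCommGroup B] [NormedSpace ℝ B] {N : E → B →L[ℝ] B →L[ℝ] ℝ} {H H' : E → B} {y : E}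
    (hN : ContDiffAt ℝ 2 N y) (hH : ContDiffAt ℝ 2 H y) (hH' : ContDiffAt ℝ 2 H' y)
    (hs : ∀ᶠ z in 𝓝 y, ∀ A C, N z A C = N z C A)
    (hmax : IsLocalMax (fun z => N z (H' z - H z) (H' z - H z)) y) (a : E) :
    fderiv ℝ (fderiv ℝ N) y a a (H' y - H y) (H' y - H y)
      + 4 * fderiv ℝ N y a (H' y - H y) ((fderiv ℝ H' y - fderiv ℝ H y) a)
      + 2 * N y ((fderiv ℝ H' y - fderiv ℝ H y) a) ((fderiv ℝ H' y - fderiv ℝ H y) a)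
      + 2 * N y (H' y - H y) ((fderiv ℝ (fderiv ℝ H') y - fderiv ℝ (fderiv ℝ H) y) a a) ≤ 0 := by
  have e1 : ∀ᶠ z in 𝓝 y, fderiv ℝ (fun z => H' z - H z) z = fderiv ℝ H' z - fderiv ℝ H z := by
    filter_upwards [hH.eventually (by simp), hH'.eventually (by simp)] with z hz hz'
    exact fderiv_fun_sub (hz'.differentiableAt (by simp)) (hz.differentiableAt (by simp))
  have e2 : fderiv ℝ (fderiv ℝ (fun z => H' z - H z)) y
      = fderiv ℝ (fderiv ℝ H') y - fderiv ℝ (fderiv ℝ H) y := by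
    rw [Filter.EventuallyEq.fderiv_eq e1]
    exact fderiv_fun_sub ((hH'.fderiv_right (m := 1) (by norm_num)).differentiableAt (by simp))
      ((hH.fderiv_right (m := 1) (by norm_num)).differentiableAt (by simp))
  rw [← e2, ← e1.self_of_nhds]
  exact second_deriv_pairing hN (hH'.sub hH) hs hmax a

variable {n : ℕ}

theorem flowH_sub {g : CE n →L[ℝ] CE n →L[ℝ] ℝ} {ι : Type*} [Fintype ι] [DecidableEq ι]
    (f : Module.Basis ι ℝ (CE n)) (hf : ∀ i j, g (f i) (f j) = if i = j then 1 else 0)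
    (hpos : ∀ v, v ≠ 0 → 0 < g v v) (p : CE n →L[ℝ] CE n →L[ℝ] CE n →L[ℝ] ℝ)
    (B B' : CE n →L[ℝ] CE n →L[ℝ] CE n →L[ℝ] CE n →L[ℝ] ℝ) :
    flowH g p B' - flowH g p B = (1 / 2 : ℝ) • ∑ i, (B' - B) (f i) (f i) := by
  ext X Y
  simp only [sub_apply, smul_apply, sum_apply, flowH_apply, trG_orthonormal f hf hpos, evTwo_apply,
    smul_eq_mul, Finset.sum_sub_distrib]
  ring

theorem flowH_lipschitz {g : CE n →L[ℝ] CE n →L[ℝ] ℝ} (hg : ∀ v, v ≠ 0 → 0 < g v v)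
    (p : CE n →L[ℝ] CE n →L[ℝ] CE n →L[ℝ] ℝ)
    (B : CE n →L[ℝ] CE n →L[ℝ] CE n →L[ℝ] CE n →L[ℝ] ℝ) :
    ∃ L : ℝ, 0 ≤ L ∧ ∃ s ∈ 𝓝 (g, p, B), ∀ g₁ p₁ g₂ p₂ b, (g₁, p₁, b) ∈ s → (g₂, p₂, b) ∈ s →
      ‖flowH g₁ p₁ b - flowH g₂ p₂ b‖ ≤ L * (‖g₁ - g₂‖ + ‖p₁ - p₂‖) := by
  obtain ⟨L, s, hs, hL⟩ := (contDiffAt_flowH hg p B).exists_lipschitzOnWith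
  refine ⟨L, L.2, s, hs, fun g₁ p₁ g₂ p₂ b h1 h2 => (hL.norm_sub_le h1 h2).trans ?_⟩
  refine mul_le_mul_of_nonneg_left ?_ L.2
  rw [Prod.mk_sub_mk, Prod.mk_sub_mk, sub_self, Prod.norm_mk, Prod.norm_mk, norm_zero]
  have h3 := norm_nonneg (g₁ - g₂)
  have h4 := norm_nonneg (p₁ - p₂)
  exact max_le (by linarith) (max_le (by linarith) (by linarith))

theorem flowH_parabolic_estimate {κ κN K₀ K : ℝ} (hκ : 0 < κ) (hκN : 0 < κN)
    {g g' : CE n →L[ℝ] CE n →L[ℝ] ℝ} {p p' : CE n →L[ℝ] CE n →L[ℝ] CE n →L[ℝ] ℝ}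
    {b b' : CE n →L[ℝ] CE n →L[ℝ] CE n →L[ℝ] CE n →L[ℝ] ℝ}
    {N : (CE n →L[ℝ] CE n →L[ℝ] ℝ) →L[ℝ] (CE n →L[ℝ] CE n →L[ℝ] ℝ) →L[ℝ] ℝ}
    {N₁ : CE n →L[ℝ] (CE n →L[ℝ] CE n →L[ℝ] ℝ) →L[ℝ] (CE n →L[ℝ] CE n →L[ℝ] ℝ) →L[ℝ] ℝ}
    {N₂ : CE n →L[ℝ] CE n →L[ℝ] (CE n →L[ℝ] CE n →L[ℝ] ℝ) →L[ℝ] (CE n →L[ℝ] CE n →L[ℝ] ℝ) →L[ℝ] ℝ}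
    (hs : ∀ X Y, g X Y = g Y X) (hpos : ∀ v, v ≠ 0 → 0 < g v v) (hc : ∀ v, κ * ‖v‖ ^ 2 ≤ g v v)
    (hcN : ∀ A, κN * ‖A‖ ^ 2 ≤ N A A) (hK₀ : ‖g‖ ≤ K₀) (hN : ‖N‖ ≤ K) (hN₁ : ‖N₁‖ ≤ K)
    (hN₂ : ‖N₂‖ ≤ K) (hL : ‖flowH g' p' b' - flowH g p b'‖ ≤ K * (‖g' - g‖ + ‖p' - p‖))
    (hmax : ∀ a, N₂ a a (g' - g) (g' - g) + 4 * N₁ a (g' - g) ((p' - p) a)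
      + 2 * N ((p' - p) a) ((p' - p) a) + 2 * N (g' - g) ((b' - b) a a) ≤ 0) {m : ℝ}
    (hm : m = (1 / κ + 1) * (K₀ + 1)) :
    2 * N (g' - g) (flowH g' p' b' - flowH g p b) ≤ ((Fintype.card (Fin (Module.finrank ℝ (CE n)))
      * (K * m ^ 2 / 2 + (2 * K * m + 2 * K ^ 2 * m) ^ 2 / (4 * κN)) + 2 * K ^ 2) / κN)
      * N (g' - g) (g' - g) := by
  have hK0 : 0 ≤ K := (norm_nonneg N).trans hN
  have hK1 : 0 ≤ K₀ := (norm_nonneg g).trans hK₀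
  obtain ⟨f, hf⟩ := exists_orthonormal hs hpos
  obtain ⟨hfm, hfD⟩ := norm_le_of_orthonormal hκ hc hK₀ f hf
  subst hm
  refine parabolic_estimate hκN hK0 (by positivity) hN hN₁ hN₂ hcN hfm (hfD (p' - p)) ?_
    fun i => hmax (f i)
  rwa [← flowH_sub f hf hpos p, sub_sub_sub_cancel_right]

theorem eventually_norm_le {X F : Type*} [NormedAddCommGroup F] {l : Filter X} {u : X → F} {a : F}
    (h : Filter.Tendsto u l (𝓝 a)) : ∃ K, 0 ≤ K ∧ ∀ᶠ x in l, ‖u x‖ ≤ K :=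
  ⟨‖a‖ + 1, by positivity, h.norm.eventually_le_const (lt_add_one _)⟩

theorem local_parabolic_estimate {S : Set ℝ} (hS : UniqueDiffOn ℝ S) {V : Set (CE n)}
    (hV : IsOpen V) {G G' : ℝ → CE n → CE n →L[ℝ] CE n →L[ℝ] ℝ}
    (hG : ContDiffOn ℝ ∞ (fun p : ℝ × CE n => G p.1 p.2) (S ×ˢ V))
    (hG' : ContDiffOn ℝ ∞ (fun p : ℝ × CE n => G' p.1 p.2) (S ×ˢ V))
    (hs : ∀ t ∈ S, ∀ y ∈ V, ∀ X Y, G t y X Y = G t y Y X)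
    (hpos : ∀ t ∈ S, ∀ y ∈ V, ∀ v, v ≠ 0 → 0 < G t y v v)
    (hd : ∀ t ∈ S, ∀ y ∈ V, HasDerivWithinAt (fun s => G s y)
      (flowH (G t y) (fderiv ℝ (G t) y) (fderiv ℝ (fderiv ℝ (G t)) y)) S t)
    (hd' : ∀ t ∈ S, ∀ y ∈ V, HasDerivWithinAt (fun s => G' s y)
      (flowH (G' t y) (fderiv ℝ (G' t) y) (fderiv ℝ (fderiv ℝ (G' t)) y)) S t)
    {N : CE n → (CE n →L[ℝ] CE n →L[ℝ] ℝ) →L[ℝ] (CE n →L[ℝ] CE n →L[ℝ] ℝ) →L[ℝ] ℝ}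
    (hN : ContDiffOn ℝ ∞ N V) (hNs : ∀ y ∈ V, ∀ A C, N y A C = N y C A)
    (hNpos : ∀ y ∈ V, ∀ A, A ≠ 0 → 0 < N y A A) {t₀ : ℝ} (ht₀ : t₀ ∈ S)
    (heq : ∀ y ∈ V, G' t₀ y = G t₀ y) {y₀ : CE n} (hy₀ : y₀ ∈ V) :
    ∃ C, ∀ᶠ p in 𝓝[S ×ˢ V] (t₀, y₀),
      IsLocalMax (fun z => N z (G' p.1 z - G p.1 z) (G' p.1 z - G p.1 z)) p.2 →
      ∃ W', HasDerivWithinAt (fun s => N p.2 (G' s p.2 - G s p.2) (G' s p.2 - G s p.2)) W' S p.1 ∧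
        W' ≤ C * N p.2 (G' p.1 p.2 - G p.1 p.2) (G' p.1 p.2 - G p.1 p.2) := by
  have hm₀ : (t₀, y₀) ∈ S ×ˢ V := ⟨ht₀, hy₀⟩
  have hD := contDiffOn_fderiv_family hS hV hG
  have hD' := contDiffOn_fderiv_family hS hV hG'
  have hDD' := contDiffOn_fderiv_family (F := fun t => fderiv ℝ (G' t)) hS hV hD'
  have e0 : G' t₀ =ᶠ[𝓝 y₀] G t₀ := by filter_upwards [hV.mem_nhds hy₀] with y hy using heq y hy
  have c : Filter.Tendsto (fun p : ℝ × CE n => G p.1 p.2) (𝓝[S ×ˢ V] (t₀, y₀)) (𝓝 (G t₀ y₀)) :=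
    (hG _ hm₀).continuousWithinAt.tendsto
  have cD : Filter.Tendsto (fun p : ℝ × CE n => fderiv ℝ (G p.1) p.2) (𝓝[S ×ˢ V] (t₀, y₀))
      (𝓝 (fderiv ℝ (G t₀) y₀)) := (hD _ hm₀).continuousWithinAt.tendsto
  have c' : Filter.Tendsto (fun p : ℝ × CE n => G' p.1 p.2) (𝓝[S ×ˢ V] (t₀, y₀))
      (𝓝 (G t₀ y₀)) := by
    rw [← heq y₀ hy₀]; exact (hG' _ hm₀).continuousWithinAt.tendsto
  have cD' : Filter.Tendsto (fun p : ℝ × CE n => fderiv ℝ (G' p.1) p.2) (𝓝[S ×ˢ V] (t₀, y₀))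
      (𝓝 (fderiv ℝ (G t₀) y₀)) := by
    rw [← e0.fderiv_eq]; exact (hD' _ hm₀).continuousWithinAt.tendsto
  have cDD' : Filter.Tendsto (fun p : ℝ × CE n => fderiv ℝ (fderiv ℝ (G' p.1)) p.2)
      (𝓝[S ×ˢ V] (t₀, y₀)) (𝓝 (fderiv ℝ (fderiv ℝ (G t₀)) y₀)) := by
    rw [← e0.fderiv.fderiv_eq]; exact (hDD' _ hm₀).continuousWithinAt.tendsto
  have hsnd : Filter.Tendsto (Prod.snd : ℝ × CE n → CE n) (𝓝[S ×ˢ V] (t₀, y₀)) (𝓝 y₀) :=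
    (continuous_snd.tendsto (t₀, y₀)).mono_left nhdsWithin_le_nhds
  have hNy := hN.contDiffAt (hV.mem_nhds hy₀)
  have hN1 : ContDiffAt ℝ ∞ (fderiv ℝ N) y₀ := hNy.fderiv_right (m := ∞) (by simp)
  have hN2 : ContDiffAt ℝ ∞ (fderiv ℝ (fderiv ℝ N)) y₀ := hN1.fderiv_right (m := ∞) (by simp)
  have n0 := hNy.continuousAt.tendsto.comp hsnd
  have n1 := hN1.continuousAt.tendsto.comp hsnd
  have n2 := hN2.continuousAt.tendsto.comp hsnd
  obtain ⟨κ, hκ, hκc⟩ := eventually_coercive c (hpos t₀ ht₀ y₀ hy₀)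
  obtain ⟨κN, hκN, hκNc⟩ := eventually_coercive n0 (hNpos y₀ hy₀)
  obtain ⟨L, hL, s, hs₀, hLs⟩ := flowH_lipschitz (hpos t₀ ht₀ y₀ hy₀) (fderiv ℝ (G t₀) y₀)
    (fderiv ℝ (fderiv ℝ (G t₀)) y₀)
  have m1 := (c'.prodMk_nhds (cD'.prodMk_nhds cDD')).eventually_mem hs₀
  have m2 := (c.prodMk_nhds (cD.prodMk_nhds cDD')).eventually_mem hs₀
  obtain ⟨K₀, k0, b0⟩ := eventually_norm_le c
  obtain ⟨K₁, k1, b1⟩ := eventually_norm_le n0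
  obtain ⟨K₂, k2, b2⟩ := eventually_norm_le n1
  obtain ⟨K₃, k3, b3⟩ := eventually_norm_le n2
  obtain ⟨m, hm⟩ : ∃ m, m = (1 / κ + 1) * (K₀ + 1) := ⟨_, rfl⟩
  obtain ⟨K, hK⟩ : ∃ K, K = K₁ + K₂ + K₃ + L := ⟨_, rfl⟩
  refine ⟨(Fintype.card (Fin (Module.finrank ℝ (CE n))) * (K * m ^ 2 / 2
    + (2 * K * m + 2 * K ^ 2 * m) ^ 2 / (4 * κN)) + 2 * K ^ 2) / κN, ?_⟩
  filter_upwards [self_mem_nhdsWithin, hκc, hκNc, m1, m2, b0, b1, b2, b3] with p hp hκc hκNc m1 m2 b0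
    b1 b2 b3 hmax
  obtain ⟨t, y⟩ := p
  obtain ⟨ht, hy⟩ := hp
  dsimp only at ht hy hκc hκNc m1 m2 b0 b1 b2 b3 hmax ⊢
  have hGt := contDiffOn_family_slice hG ht
  have hGt' := contDiffOn_family_slice hG' ht
  have hGy := hGt.contDiffAt (hV.mem_nhds hy)
  have hGy' := hGt'.contDiffAt (hV.mem_nhds hy)
  have hNe : ∀ᶠ z in 𝓝 y, ∀ A C, N z A C = N z C A := by
    filter_upwards [hV.mem_nhds hy] with z hz using hNs z hz
  have hm2 := second_deriv_pairing_sub ((hN.contDiffAt (hV.mem_nhds hy)).of_le two_le_infty)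
    (hGy.of_le two_le_infty) (hGy'.of_le two_le_infty) hNe hmax
  have hdU := (hd' t ht y hy).sub (hd t ht y hy)
  exact ⟨_, hasDerivWithinAt_pairing (hNs y hy) hdU, flowH_parabolic_estimate hκ hκN (hs t ht y hy)
    (hpos t ht y hy) hκc hκNc b0 (b1.trans (by linarith)) (b2.trans (by linarith))
    (b3.trans (by linarith)) ((hLs _ _ _ _ _ m1 m2).trans
      (mul_le_mul_of_nonneg_right (by linarith) (by positivity))) hm2 hm⟩

end LocalEstimate

end GenKahler

end

noncomputable section

namespace GenKahler

section MaximumPrinciple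

variable {X : Type*} [TopologicalSpace X] [CompactSpace X] {W : ℝ → X → ℝ}

theorem hasDerivWithinAt_nonneg_of_isMaxOn {u : ℝ → ℝ} {u' a b s : ℝ} (hs : s ∈ Set.Ioc a b)
    (hu : HasDerivWithinAt u u' (Set.Icc a b) s) (hmax : IsMaxOn u (Set.Icc a b) s) : 0 ≤ u' := by
  have h1 : a - s ∈ posTangentConeAt (Set.Icc a b) s :=
    sub_mem_posTangentConeAt_of_segment_subset ((convex_Icc a b).segment_subset ⟨hs.1.le, hs.2⟩
      ⟨le_rfl, hs.1.le.trans hs.2⟩)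
  have h2 := hmax.localize.hasFDerivWithinAt_nonpos hu.hasFDerivWithinAt h1
  simp only [ContinuousLinearMap.toSpanSingleton_apply, smul_eq_mul] at h2
  nlinarith [hs.1]

/-- The maximum principle for differential inequalities that hold at spatial maxima. -/
theorem nonpos_of_hasDerivWithinAt_le_at_max {a b C : ℝ}
    (hc : ContinuousOn (fun p : ℝ × X => W p.1 p.2) (Set.Icc a b ×ˢ Set.univ))
    (h0 : ∀ x, W a x ≤ 0)
    (hW : ∀ t ∈ Set.Ioc a b, ∀ x, IsLocalMax (W t) x → ∃ W',
      HasDerivWithinAt (fun s => W s x) W' (Set.Icc a b) t ∧ W' ≤ C * W t x) :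
    ∀ t ∈ Set.Icc a b, ∀ x, W t x ≤ 0 := by
  intro t ht x
  by_contra! hpos
  have hF : ContinuousOn (fun p : ℝ × X => Real.exp (-(C + 1) * p.1) * W p.1 p.2)
      (Set.Icc a b ×ˢ Set.univ) := (Continuous.continuousOn (by fun_prop)).mul hc
  obtain ⟨⟨s, z⟩, ⟨hs, -⟩, hmax⟩ := (isCompact_Icc.prod isCompact_univ).exists_isMaxOn
    ⟨(t, x), ht, Set.mem_univ x⟩ hF
  have hmax' : ∀ r ∈ Set.Icc a b, ∀ y,
      Real.exp (-(C + 1) * r) * W r y ≤ Real.exp (-(C + 1) * s) * W s z :=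
    fun r hr y => hmax (show (r, y) ∈ Set.Icc a b ×ˢ Set.univ from ⟨hr, trivial⟩)
  have hWz : 0 < W s z := (mul_pos_iff_of_pos_left (Real.exp_pos _)).1
    ((mul_pos (Real.exp_pos _) hpos).trans_le (hmax' t ht x))
  have hs' : s ∈ Set.Ioc a b := ⟨lt_of_le_of_ne hs.1 fun h => by
    rw [← h] at hWz; exact absurd (h0 z) hWz.not_ge, hs.2⟩
  obtain ⟨W', hW', hle⟩ := hW s hs' z (Filter.Eventually.of_forall fun y =>
    le_of_mul_le_mul_left (hmax' s hs y) (Real.exp_pos _))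
  have hE : HasDerivWithinAt (fun r => Real.exp (-(C + 1) * r))
      (Real.exp (-(C + 1) * s) * (-(C + 1) * 1)) (Set.Icc a b) s :=
    ((hasDerivWithinAt_id s _).const_mul _).exp
  have h1 := hasDerivWithinAt_nonneg_of_isMaxOn hs' (hE.mul hW') fun r hr => hmax' r hr z
  nlinarith [mul_pos (Real.exp_pos (-(C + 1) * s)) hWz,
    mul_le_mul_of_nonneg_left hle (Real.exp_pos (-(C + 1) * s)).le]

/-- Continuation in time: a nonnegative function that vanishes initially and satisfies a local
differential inequality at spatial maxima, near every time at which it vanishes, is zero. -/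
theorem eq_zero_of_local_parabolic {S : Set ℝ} (hS : Convex ℝ S) {a : ℝ} (ha : a ∈ S)
    (hc : ContinuousOn (fun p : ℝ × X => W p.1 p.2) (S ×ˢ Set.univ))
    (hnn : ∀ t ∈ S, ∀ x, 0 ≤ W t x) (h0 : ∀ x, W a x = 0)
    (hW : ∀ t₀ ∈ S, (∀ x, W t₀ x = 0) → ∀ x₀, ∃ C, ∀ᶠ p in 𝓝[S ×ˢ Set.univ] (t₀, x₀),
      IsLocalMax (W p.1) p.2 → ∃ W', HasDerivWithinAt (fun s => W s p.2) W' S p.1 ∧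
        W' ≤ C * W p.1 p.2) {b : ℝ} (hb : b ∈ S) (hab : a ≤ b) (x : X) : W b x = 0 := by
  have hsub : Set.Icc a b ⊆ S := hS.ordConnected.out ha hb
  have hcl : IsClosed ({t | W t = 0} ∩ Set.Icc a b) := by
    rw [Set.inter_comm]
    have h1 : ContinuousOn W (Set.Icc a b) := continuousOn_pi.2 fun x =>
      hc.comp (f := fun t => (t, x)) (Continuous.continuousOn (by fun_prop))
        fun t ht => ⟨hsub ht, trivial⟩
    exact h1.preimage_isClosed_of_isClosed isClosed_Icc (isClosed_singleton (x := (0 : X → ℝ)))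
  refine congrFun (hcl.Icc_subset_of_forall_mem_nhdsWithin (funext h0) ?_ ⟨hab, le_rfl⟩) x
  rintro t₀ ⟨hz, ht₀⟩
  have ht₀S := hsub ⟨ht₀.1, ht₀.2.le⟩
  obtain ⟨C, hC⟩ : ∃ C, ∀ᶠ t in 𝓝[S] t₀, ∀ x ∈ (Set.univ : Set X), IsLocalMax (W t) x →
      ∃ W', HasDerivWithinAt (fun s => W s x) W' S t ∧ W' ≤ C * W t x := by
    refine isCompact_univ.induction_on (p := fun s => ∃ C, ∀ᶠ t in 𝓝[S] t₀, ∀ x ∈ s,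
      IsLocalMax (W t) x → ∃ W', HasDerivWithinAt (fun s => W s x) W' S t ∧ W' ≤ C * W t x)
      ⟨0, by simp⟩ (fun s s' hss ⟨C, h⟩ => ⟨C, h.mono fun t ht x hx => ht x (hss hx)⟩) ?_ ?_
    · rintro s s' ⟨C, h⟩ ⟨C', h'⟩
      refine ⟨max C C', ?_⟩
      filter_upwards [h, h', self_mem_nhdsWithin] with t h h' ht x hx hm
      rcases hx with hx | hx
      · obtain ⟨W', hd, hle⟩ := h x hx hm
        exact ⟨W', hd, hle.trans (mul_le_mul_of_nonneg_right (le_max_left _ _) (hnn t ht x))⟩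
      · obtain ⟨W', hd, hle⟩ := h' x hx hm
        exact ⟨W', hd, hle.trans (mul_le_mul_of_nonneg_right (le_max_right _ _) (hnn t ht x))⟩
    · intro x₀ _
      obtain ⟨C, h⟩ := hW t₀ ht₀S (congrFun hz) x₀
      rw [nhdsWithin_prod_eq, Filter.eventually_prod_iff] at h
      obtain ⟨p, hp, q, hq, h⟩ := h
      exact ⟨{x | q x}, hq, C, hp.mono fun t ht x hx => h ht hx⟩
  obtain ⟨δ, hδ, hδC⟩ := Metric.mem_nhdsWithin_iff.1 hC
  set t₁ := min b (t₀ + δ / 2)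
  have ht₁ : t₀ < t₁ := lt_min ht₀.2 (by linarith)
  have hsub' : Set.Icc t₀ t₁ ⊆ S := fun t ht => hsub ⟨ht₀.1.trans ht.1, ht.2.trans (min_le_left _ _)⟩
  have key := nonpos_of_hasDerivWithinAt_le_at_max (C := C) (a := t₀) (b := t₁) (W := W)
    (hc.mono (Set.prod_mono hsub' subset_rfl)) (fun x => (congrFun hz x).le) fun t ht x hm => by
      have htI := Set.Ioc_subset_Icc_self ht
      have h1 : t ∈ Metric.ball t₀ δ := by
        rw [Metric.mem_ball, Real.dist_eq, abs_of_pos (sub_pos.2 ht.1)]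
        have := ht.2.trans (min_le_right _ _)
        linarith
      obtain ⟨W', hd, hle⟩ := hδC ⟨h1, hsub' htI⟩ x trivial hm
      exact ⟨W', hd.mono hsub', hle⟩
  filter_upwards [Ioc_mem_nhdsGT ht₁] with t ht
  have htI := Set.Ioc_subset_Icc_self ht
  exact funext fun x => le_antisymm (key t htI x) (hnn t (hsub' htI) x)

end MaximumPrinciple

end GenKahler

end

noncomputable section

namespace GenKahler

set_option maxSynthPendingDepth 6

section Uniqueness

theorem pairForm_bilinearComp {E F : Type*} [NormedAddCommGroup E] [NormedSpace ℝ E]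
    [FiniteDimensional ℝ E] [NormedAddCommGroup F] [NormedSpace ℝ F] [FiniteDimensional ℝ F]
    (e : E ≃L[ℝ] F) {G : F →L[ℝ] F →L[ℝ] ℝ} (hs : ∀ X Y, G X Y = G Y X)
    (hpos : ∀ v, v ≠ 0 → 0 < G v v) {G' A' : E →L[ℝ] E →L[ℝ] ℝ} {A : F →L[ℝ] F →L[ℝ] ℝ}
    (hG : ∀ X Y, G' X Y = G (e X) (e Y)) (hA : ∀ X Y, A' X Y = A (e X) (e Y)) :
    pairForm G' A' A' = pairForm G A A := by
  have hpos' : ∀ v, v ≠ 0 → 0 < G' v v := fun v hv => by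
    rw [hG]; exact hpos _ fun h => hv (e.map_eq_zero_iff.1 h)
  obtain ⟨f, hf⟩ := exists_orthonormal (G := G') (fun X Y => by rw [hG, hG, hs]) hpos'
  rw [pairForm_orthonormal f hf hpos', pairForm_orthonormal (f.map e.toLinearEquiv)
    (fun i j => by rw [← hf, hG]; rfl) hpos]
  simp only [hA]
  rfl

variable {n : ℕ} {M : Type*} [TopologicalSpace M] [ChartedSpace (Model n) M]
  [IsManifold 𝓘(ℝ, Model n) ∞ M] {J : EndField n M} {ω₀ : Form n M 2} {T : EReal}
  {ω₁ ω₂ : ℝ → Form n M 2} {φ : OpenPartialHomeomorph M (CE n)}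

theorem IsPluriclosedFlow.mono {T' : EReal} (h : IsPluriclosedFlow J ω₀ T ω₁) (hT : T' ≤ T) :
    IsPluriclosedFlow J ω₀ T' ω₁ := by
  have hsub : timeInterval T' ⊆ timeInterval T := fun t ht => ⟨ht.1, ht.2.trans_le hT⟩
  exact ⟨fun x => (h.smooth x).mono (Set.prod_mono hsub subset_rfl),
    fun t ht => h.hermitian t (hsub ht), fun t ht => h.pluriclosed t (hsub ht),
    fun t ht x X Y => (h.flow t (hsub ht) x X Y).mono hsub, h.initial⟩

/-- The difference of the metrics of two families of forms. -/
def metricDiff (J : EndField n M) (ω₁ ω₂ : ℝ → Form n M 2) (t : ℝ) (x : M) :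
    Model n →L[ℝ] Model n →L[ℝ] ℝ :=
  (show Model n →L[ℝ] Model n →L[ℝ] ℝ from metricBil J (ω₂ t) x)
    - (show Model n →L[ℝ] Model n →L[ℝ] ℝ from metricBil J (ω₁ t) x)

/-- The square of the norm, for a fixed metric, of the difference of two families of metrics. -/
def normDiff (J : EndField n M) (ω₀ : Form n M 2) (ω₁ ω₂ : ℝ → Form n M 2) (t : ℝ) (x : M) : ℝ :=
  pairForm (show Model n →L[ℝ] Model n →L[ℝ] ℝ from metricBil J ω₀ x) (metricDiff J ω₁ ω₂ t x)
    (metricDiff J ω₁ ω₂ t x)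

theorem normDiff_symm (hφ : IsHoloChart J φ) (hω : IsHermitianForm J ω₀) (t : ℝ) {y : CE n}
    (hy : y ∈ φ.target) : normDiff J ω₀ ω₁ ω₂ t (φ.symm y)
      = pairForm (pullBil φ (metricBil J ω₀) y)
        (chartMetric φ J ω₂ t y - chartMetric φ J ω₁ t y)
        (chartMetric φ J ω₂ t y - chartMetric φ J ω₁ t y) := by
  have h := hω.isHermOn (hφ.J_J (φ.map_target hy))
  exact (pairForm_bilinearComp (E := CE n) (F := Model n)
    (ContinuousLinearEquiv.equivOfInverse (show CE n →L[ℝ] Model n from dSymm φ y)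
      (show Model n →L[ℝ] CE n from dChart φ (φ.symm y)) (dChart_dSymm hφ.isSmoothChart hy)
      (dSymm_dChart hφ.isSmoothChart hy))
    (fun X Y => h.symm X trivial Y trivial) (fun v hv => h.pos v trivial hv)
    (fun X Y => rfl) fun X Y => rfl).symm

theorem eq_of_metricBil_eq (hJ : IsComplexStructure J) {α β : Form n M 2}
    (h : ∀ x, metricBil J α x = metricBil J β x) : α = β := by
  funext x
  have h1 : ∀ X Z : TS n x, metricOf J α x X Z = metricOf J β x X Z := fun X Z => by
    rw [← metricBil_apply, h x, metricBil_apply]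
  have h2 : ∀ X Y : TS n x, α x ![X, Y] = β x ![X, Y] := fun X Y => by
    simpa only [metricOf, map_neg, hJ.J_J, neg_neg] using h1 X (-(J x Y))
  exact two_form_ext (E := Model n) h2

theorem normDiff_nonneg (hJ : IsComplexStructure J) (hω : IsHermitianForm J ω₀) (t : ℝ) (x : M) :
    0 ≤ normDiff J ω₀ ω₁ ω₂ t x ∧
      (normDiff J ω₀ ω₁ ω₂ t x = 0 → metricBil J (ω₂ t) x = metricBil J (ω₁ t) x) := by
  have h := hω.isHermOn (hJ.J_J x)
  have h1 := pairForm_pos (E := Model n) (G := metricBil J ω₀ x) (fun X Y => h.symm X trivial Y trivial)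
    (fun v hv => h.pos v trivial hv) (metricDiff J ω₁ ω₂ t x)
  by_cases h0 : metricDiff J ω₁ ω₂ t x = 0
  · exact ⟨by rw [normDiff, h0, map_zero], fun _ => sub_eq_zero.1 h0⟩
  · exact ⟨(h1 h0).le, fun h2 => absurd h2 (h1 h0).ne'⟩

theorem tendsto_chart {S : Set ℝ} {t₀ : ℝ} {x₀ : M} (hx : x₀ ∈ φ.source) :
    Filter.Tendsto (fun p : ℝ × M => (p.1, φ p.2)) (𝓝[S ×ˢ Set.univ] (t₀, x₀))
      (𝓝[S ×ˢ φ.target] (t₀, φ x₀)) := by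
  rw [nhdsWithin_prod_eq, nhdsWithin_prod_eq, nhdsWithin_univ]
  exact Filter.tendsto_id.prodMap (tendsto_nhdsWithin_iff.2 ⟨φ.continuousAt hx, by
    filter_upwards [φ.open_source.mem_nhds hx] with _ hy using φ.map_source hy⟩)

theorem contDiffOn_pairForm_chart (hφ : IsHoloChart J φ) (hω : IsHermitianForm J ω₀)
    (hsm : IsSmoothForm ω₀) :
    ContDiffOn ℝ ∞ (fun y => pairForm (pullBil φ (metricBil J ω₀) y)) φ.target := fun _ hy =>
  contDiffWithinAt_pairForm (hsm.contDiffAt_pullBil hφ hy).contDiffWithinAt fun v hv =>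
    (hω.isHermOn_pullBil hφ hy).pos v trivial hv

theorem continuousOn_normDiff (hJ : IsComplexStructure J) (hω : IsHermitianForm J ω₀)
    (hsm : IsSmoothForm ω₀) (h₁ : IsPluriclosedFlow J ω₀ T ω₁) (h₂ : IsPluriclosedFlow J ω₀ T ω₂) :
    ContinuousOn (fun p : ℝ × M => normDiff J ω₀ ω₁ ω₂ p.1 p.2) (timeInterval T ×ˢ Set.univ) := by
  rintro ⟨t, x⟩ ⟨ht, -⟩
  obtain ⟨φ, hx, hφ⟩ := hJ x
  have hN := (contDiffOn_pairForm_chart hφ hω hsm).continuousOn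
  have hU := ((h₂.contDiffOn_chart hφ).continuousOn.sub (h₁.contDiffOn_chart hφ).continuousOn)
  have hw := ((hN.comp (s := timeInterval T ×ˢ φ.target) continuous_snd.continuousOn
    fun p hp => hp.2).clm_apply hU).clm_apply hU
  have hm : (t, φ x) ∈ timeInterval T ×ˢ φ.target := ⟨ht, φ.map_source hx⟩
  have h1 := (hw _ hm).tendsto.comp (tendsto_chart (S := timeInterval T) (t₀ := t) hx)
  refine Filter.Tendsto.congr' ?_ (h1.trans (le_of_eq (congrArg 𝓝 ?_)))
  · have h2 : ∀ᶠ p : ℝ × M in 𝓝[timeInterval T ×ˢ Set.univ] (t, x), p.2 ∈ φ.source :=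
      (continuous_snd.tendsto (t, x)).mono_left nhdsWithin_le_nhds |>.eventually
        (φ.open_source.mem_nhds hx)
    filter_upwards [h2] with p hp
    have h3 := normDiff_symm (ω₁ := ω₁) (ω₂ := ω₂) hφ hω p.1 (φ.map_source hp)
    rw [φ.left_inv hp] at h3
    exact h3.symm
  · have h3 := normDiff_symm (ω₁ := ω₁) (ω₂ := ω₂) hφ hω t (φ.map_source hx)
    rw [φ.left_inv hx] at h3
    exact h3.symm

theorem normDiff_parabolic (hT : 0 < T) (hJ : IsComplexStructure J) (hω : IsHermitianForm J ω₀)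
    (hsm : IsSmoothForm ω₀) (h₁ : IsPluriclosedFlow J ω₀ T ω₁) (h₂ : IsPluriclosedFlow J ω₀ T ω₂)
    {t₀ : ℝ} (ht₀ : t₀ ∈ timeInterval T) (h0 : ∀ x, normDiff J ω₀ ω₁ ω₂ t₀ x = 0) (x₀ : M) :
    ∃ C, ∀ᶠ p in 𝓝[timeInterval T ×ˢ Set.univ] (t₀, x₀),
      IsLocalMax (normDiff J ω₀ ω₁ ω₂ p.1) p.2 → ∃ W',
        HasDerivWithinAt (fun s => normDiff J ω₀ ω₁ ω₂ s p.2) W' (timeInterval T) p.1 ∧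
          W' ≤ C * normDiff J ω₀ ω₁ ω₂ p.1 p.2 := by
  obtain ⟨φ, hx, hφ⟩ := hJ x₀
  have hherm : ∀ y ∈ φ.target, IsHermOn (mulI n) ⊤ (pullBil φ (metricBil J ω₀) y) := fun y hy =>
    hω.isHermOn_pullBil hφ hy
  obtain ⟨C, hC⟩ := local_parabolic_estimate (uniqueDiffOn_timeInterval hT) φ.open_target
    (h₁.contDiffOn_chart hφ) (h₂.contDiffOn_chart hφ)
    (fun t ht y hy X Y => (h₁.isHermOn hφ ht hy).symm X trivial Y trivial)
    (fun t ht y hy v hv => (h₁.isHermOn hφ ht hy).pos v trivial hv)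
    (fun t ht y hy => h₁.hasDerivWithinAt_chart hT hJ hφ ht hy)
    (fun t ht y hy => h₂.hasDerivWithinAt_chart hT hJ hφ ht hy)
    (contDiffOn_pairForm_chart hφ hω hsm)
    (fun y hy => pairForm_symm (fun X Y => (hherm y hy).symm X trivial Y trivial)
      fun v hv => (hherm y hy).pos v trivial hv)
    (fun y hy => pairForm_pos (fun X Y => (hherm y hy).symm X trivial Y trivial)
      fun v hv => (hherm y hy).pos v trivial hv) ht₀
    (fun y hy => by
      have h3 := (normDiff_nonneg hJ hω t₀ (φ.symm y)).2 (h0 _)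
      ext X Y
      exact congrArg (fun b => b (dSymm φ y X) (dSymm φ y Y)) h3)
    (φ.map_source hx)
  refine ⟨C, ?_⟩
  have h2 : ∀ᶠ p : ℝ × M in 𝓝[timeInterval T ×ˢ Set.univ] (t₀, x₀), p.2 ∈ φ.source :=
    (continuous_snd.tendsto (t₀, x₀)).mono_left nhdsWithin_le_nhds |>.eventually
      (φ.open_source.mem_nhds hx)
  filter_upwards [(tendsto_chart hx).eventually hC, h2] with p hp hps hmax
  have hpt := φ.map_source hps
  have e := fun s => normDiff_symm (ω₁ := ω₁) (ω₂ := ω₂) hφ hω s hpt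
  simp only [φ.left_inv hps] at e
  simp only [e]
  refine hp ?_
  have h4 : Filter.Tendsto φ.symm (𝓝 (φ p.2)) (𝓝 p.2) := by
    have := φ.continuousAt_symm hpt
    rwa [ContinuousAt, φ.left_inv hps] at this
  filter_upwards [h4.eventually hmax, φ.open_target.mem_nhds hpt] with z hz hzt
  rw [e, normDiff_symm hφ hω p.1 hzt] at hz
  exact hz

theorem IsPluriclosedFlow.unique [CompactSpace M] (hT : 0 < T) (hJ : IsComplexStructure J)
    (h₁ : IsPluriclosedFlow J ω₀ T ω₁) (h₂ : IsPluriclosedFlow J ω₀ T ω₂) {t : ℝ}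
    (ht : t ∈ timeInterval T) : ω₂ t = ω₁ t := by
  have h0 : (0 : ℝ) ∈ timeInterval T := ⟨le_rfl, by exact_mod_cast hT⟩
  have hω : IsHermitianForm J ω₀ := h₁.initial ▸ h₁.hermitian 0 h0
  have hsm : IsSmoothForm ω₀ := h₁.initial ▸ h₁.smooth.isSmoothForm h0
  refine eq_of_metricBil_eq hJ fun x => (normDiff_nonneg hJ hω t x).2 ?_
  refine eq_zero_of_local_parabolic (timeInterval_convex T) h0
    (continuousOn_normDiff hJ hω hsm h₁ h₂) (fun s _ x => (normDiff_nonneg hJ hω s x).1) (fun x => ?_)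
    (fun t₀ ht₀ hz x₀ => normDiff_parabolic hT hJ hω hsm h₁ h₂ ht₀ hz x₀) ht ht.1 x
  rw [normDiff, metricDiff, h₁.initial, h₂.initial, sub_self, map_zero]

end Uniqueness

end GenKahler

end

noncomputable section

theorem mainTheorem12 {n : ℕ} {M : Type*} [TopologicalSpace M] [T2Space M] [CompactSpace M]
    [ChartedSpace (GenKahler.Model n) M] [IsManifold 𝓘(ℝ, GenKahler.Model n) ∞ M]
    (g₀ : Bundle.ContMDiffRiemannianMetric 𝓘(ℝ, GenKahler.Model n) ∞ (GenKahler.Model n)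
      (fun x : M => GenKahler.TS n x))
    (Jp Jm : GenKahler.EndField n M) (ω₀ ωm : GenKahler.Form n M 2)
    (hGK : GenKahler.IsGeneralizedKahler g₀ Jp Jm ω₀ ωm)
    (hcomm : ∀ x : M, (Jp x).comp (Jm x) = (Jm x).comp (Jp x))
    (hp hm : GenKahler.BilinField n M)
    (hhp : GenKahler.IsHermitianMetricOn Jp (GenKahler.Tplus Jp Jm) hp)
    (hhm : GenKahler.IsHermitianMetricOn Jp (GenKahler.Tminus Jp Jm) hm)
    (T : EReal) (hT : 0 < T) (f : ℝ → M → ℝ)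
    (hf : GenKahler.IsScalarFlow Jp Jm hp hm ω₀ T f) :
    GenKahler.IsPluriclosedFlow Jp ω₀ T (GenKahler.omegaF Jp Jm hp hm ω₀ f) ∧
      ∀ (T' : EReal) (ω₁ : ℝ → GenKahler.Form n M 2), 0 < T' →
        GenKahler.IsPluriclosedFlow Jp ω₀ T' ω₁ →
        ∀ t ∈ GenKahler.timeInterval T ∩ GenKahler.timeInterval T',
          ω₁ t = GenKahler.omegaF Jp Jm hp hm ω₀ f t := by
  have h := GenKahler.isPluriclosedFlow_omegaF hGK hcomm hhp hhm hT hf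
  refine ⟨h, fun T' ω₁ hT' h' t ht => ?_⟩
  exact GenKahler.IsPluriclosedFlow.unique (lt_min hT hT') hGK.complex_p
    (h.mono (min_le_left T T')) (h'.mono (min_le_right T T'))
    ⟨ht.1.1, lt_min ht.1.2 ht.2.2⟩

end
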